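/- Let $k$ be a field of characteristic $0$, $\mathbf t=(t_i)$ a finite family of parameters, $A=k[[\mathbf t]]$, and $F\supseteq A$ a field. Let $v_n\in F^{\times}$ ($n\ge1$) be such that $v_n^{-1}\in A$. Put $K_0=k[z^{\pm1},w^{\pm1},(z-w)^{\pm1}]$, $K=K_0[[\mathbf t]]$ and $$f(x)=\exp\Big(-\sum_{n\ge1}\frac{v_n^{-1}}{n}x^n\Big)\in A[[x]],\qquad \sigma(z,w)=z\, i_{\mathbf t}f(w/z),$$ where $i_{\mathbf t}$ denotes expansion in powers of $\mathbf t$; assume that this is a well-defined invertible element of $K$ (every $\mathbf t$-coefficient of $\sigma$ is the element of $K_0$ whose expansion in powers of $w/z$ is the corresponding coefficient of $z f(w/z)$). Let $V_0=\mathrm{Sym}(D^{(n)}\alpha : n\ge 1)\otimes k[\mathbf Z\alpha]=k[h^{(0)},h^{(1)},\dots]\otimes k[\mathbf Z\alpha]$, $h^{(n)}=D^{(n)}h$, $h=D\alpha=(De^{\alpha})e^{-\alpha}$, $D^{(n)}=D^n/n!$, with its derivation $D$ and its Hopf algebra structure for which $e^{m\alpha}$ is grouplike and $h^{(n)}$ is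 primitive, and let $V=V_0[[\mathbf t]]$. There is a unique bicharacter $r:V_0\otimes V_0\to K$ with $r(e^\alpha\otimes e^\alpha)=\sigma$, $r(Da\otimes b)=\partial_z r(a\otimes b)$ and $r(a\otimes Db)=\partial_w r(a\otimes b)$. Its values have no pole at $w=0$, and we set, for $a,b\in V_0$ (and extend $k[[\mathbf t]]$-linearly), $$Y(a,z)b=\sum (e^{zD}a')\,b'\,r(a''\otimes b'')(z,0),\qquad R(z,w)(a\otimes b)=\sum a'\otimes b'\,(r^{t}*r^{-1})(a''\otimes b''),$$ where $r^t(a\otimes b)(z,w)=r(b\otimes a)(w,z)$, $r^{-1}(a\otimes b)=r(Sa\otimes b)$ and $*$ is convolution. For $a,b\in V_0$ the series $Y(a,z)b$ has a pole of finite order at $z=0$. On the other hand let $\Lambda_F=F[p_1,p_2,\dots]$ be the ring of symmetric functions with $\langle p_\lambda,p_\mu\rangle_v=\delta_{\lambda\mu}z_\lambda v_\lambda$ ($v_\lambda=\prod_i v_{\lambda_i}$), let $p_n^{\perp}$ be the adjoint of multiplication by $p_n$ (it exists and is unique), and let $h_n=v_n^{-1}p_n^{\perp}$, $h_{-n}=v_n^{-1}p_n$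 ($n\ge1$), $h_0=\partial_\alpha$ act on $\Lambda_F\otimes F[\mathbf Z\alpha]$. Then $[h_m,h_n]=m\,v_{|m|}^{-1}\delta_{m+n,0}$. Put $$\Psi(z)=\exp\Big(\sum_{n\ge1}\frac{h_{-n}}{n}z^n\Big)\exp\Big(-\sum_{n\ge1}\frac{h_n}{n}z^{-n}\Big)e^{\alpha}z^{\partial_\alpha},$$ each of whose coefficients, applied to a vector, is a finite sum. The module $A\otimes_k V_0$ embeds in $V$ and, by $h^{(n-1)}\mapsto v_n^{-1}p_n$, $e^{\alpha}\mapsto e^{\alpha}$, in $\Lambda_F\otimes F[\mathbf Z\alpha]$. 1. Under this identification, on all vectors of $V_0$, the coefficients of $Y(D\alpha,z)=\sum_n h_nz^{-n-1}$ are the operators $h_n$, and $$Y(e^{\alpha},z)=\Psi(z).$$ 2. $(V,\,|0\rangle=1,\,D,\,Y,\,R)$ is an $H_D$-quantum vertex algebra over $k[[\mathbf t]]$: $R$ satisfies the Yang–Baxter equation, the shift conditions $[D\otimes1,R]=-\partial_zR$, $[1\otimes D,R]=-\partial_wR$ and unitarity $\tau R(w,z)\tau=R(z,w)^{-1}$;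 $Y(Da,z)=\partial_zY(a,z)$, $Y(|0\rangle,z)=\mathrm{Id}$, $Y(a,z)|0\rangle$ has no pole at $z=0$ and takes the value $a$ there; and for $a,b\in V$ and every $M$ there is $N$ such that for all $c\in V$ $$(z-w)^NY(a,z)Y(b,w)c\equiv(w-z)^N\,Y(w)(1\otimes Y(z))\big(R(w,z)(b\otimes a)\otimes c\big)$$ modulo $(\mathbf t)^M$, where elements of $K$ in the right-hand side are expanded in the region $|w|>|z|$. 3. This covers the Hall–Littlewood case ($\mathbf t=t$, $v_n=\frac1{1-t^n}$) and the Macdonald case ($\mathbf t=(t,q)$, $v_n=\frac{1-q^n}{1-t^n}$): in both, $v_n^{-1}\in k[[\mathbf t]]$ and $\sigma$ is a well-defined invertible element of $K$; moreover in both cases, for $a,b\in V_0$, the exponent $N$ in the locality axiom can be chosen independently of $M$, so that the identity holds exactly. -/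

import Mathlib

open scoped TensorProduct LaurentPolynomial

noncomputable section

namespace HDQVA

/-! ## Parameter-adic modules

For a `k`-vector space `X`, the topologically free `k[[t]]`-module `X[[t]]` (`t` a family of
parameters indexed by a finite type `τ`) is `MvPowerSeries τ X`.  A `k[[t]]`-linear map
`X[[t]] → Y[[t]]` is determined by its restriction to `X`, which is an arbitrary `k`-linear map
`X → Y[[t]]`; we represent such maps by these restrictions, and `tExt` recovers the map. -/

section Param

variable {k : Type*} [CommRing k] {τ : Type*}
variable {X Y Z : Type*} [AddCommMonoid X] [Module k X] [AddCommMonoid Y] [Module k Y]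
  [AddCommMonoid Z] [Module k Z]

/-- The coefficient of the monomial `t ^ d`. -/
def tCoeff (k : Type*) [CommRing k] {τ X : Type*} [AddCommMonoid X] [Module k X]
    (d : τ →₀ ℕ) : MvPowerSeries τ X →ₗ[k] X where
  toFun x := x d
  map_add' _ _ := rfl
  map_smul' _ _ := rfl

open Classical in
/-- The inclusion of `X` in `X[[t]]` as constant series. -/
def tC (k τ : Type*) [CommRing k] (X : Type*) [AddCommMonoid X] [Module k X] :
    X →ₗ[k] MvPowerSeries τ X where
  toFun x := fun d => if d = 0 then x else 0
  map_add' x y := by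
    funext d
    change (if d = 0 then x + y else 0) = (if d = 0 then x else 0) + (if d = 0 then y else 0)
    split_ifs <;> simp
  map_smul' c x := by
    funext d
    change (if d = 0 then c • x else 0) = c • (if d = 0 then x else 0)
    split_ifs <;> simp

/-- Application of a `k`-linear map to all coefficients. -/
def tMap (τ : Type*) (f : X →ₗ[k] Y) : MvPowerSeries τ X →ₗ[k] MvPowerSeries τ Y where
  toFun x := fun d => f (x d)
  map_add' x y := by funext d; exact map_add f _ _
  map_smul' c x := by funext d; exact map_smul f _ _

open Classical in
/-- The `k[[t]]`-linear extension `X[[t]] → Y[[t]]` of a `k`-linear map `X → Y[[t]]`. -/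
def tExt (φ : X →ₗ[k] MvPowerSeries τ Y) : MvPowerSeries τ X →ₗ[k] MvPowerSeries τ Y where
  toFun x := fun d => ∑ p ∈ Finset.HasAntidiagonal.antidiagonal d, φ (x p.1) p.2
  map_add' x y := by
    funext d
    change _ = (∑ p ∈ Finset.HasAntidiagonal.antidiagonal d, φ (x p.1) p.2) +
      ∑ p ∈ Finset.HasAntidiagonal.antidiagonal d, φ (y p.1) p.2
    rw [← Finset.sum_add_distrib]
    refine Finset.sum_congr rfl fun p _ => ?_
    exact congrFun (map_add φ (x p.1) (y p.1)) p.2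
  map_smul' c x := by
    funext d
    change _ = c • ∑ p ∈ Finset.HasAntidiagonal.antidiagonal d, φ (x p.1) p.2
    rw [Finset.smul_sum]
    refine Finset.sum_congr rfl fun p _ => ?_
    exact congrFun (map_smul φ c (x p.1)) p.2

/-- The canonical map `X[[t]] ⊗ Y → (X ⊗ Y)[[t]]`. -/
def strength (k τ X Y : Type*) [CommRing k] [AddCommMonoid X] [Module k X]
    [AddCommMonoid Y] [Module k Y] :
    MvPowerSeries τ X ⊗[k] Y →ₗ[k] MvPowerSeries τ (X ⊗[k] Y) :=
  TensorProduct.lift (LinearMap.mk₂ k (fun s y => tMap τ ((TensorProduct.mk k X Y).flip y) s)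
    (fun s s' y => map_add _ s s')
    (fun c s y => map_smul _ c s)
    (fun s y y' => by funext d; exact TensorProduct.tmul_add _ _ _)
    (fun c s y => by funext d; exact TensorProduct.tmul_smul _ _ _))

end Param

/-! ## The rings `K` of coefficients -/

/-- The multiplicative set generated by the `z_i` and the `z_i - z_j`, `i ≠ j`. -/
def kSet (k ι : Type*) [Field k] : Submonoid (MvPolynomial ι k) :=
  Submonoid.closure (Set.range MvPolynomial.X ∪
    {p | ∃ i j : ι, i ≠ j ∧ p = MvPolynomial.X i - MvPolynomial.X j})

/-- `KRing k ι = k[z_i^{±1}, (z_i - z_j)^{±1}]`.  The algebra `K` of the two variables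
`z = z_0`, `w = z_1` is `MvPowerSeries τ (KRing k (Fin 2))`. -/
def KRing (k ι : Type*) [Field k] : Type _ := Localization (kSet k ι)

section KRing

/-- The coefficientwise algebra structure on formal Laurent series over an algebra. -/
instance (priority := 2000) hahnAlgebra {R A : Type*} [CommSemiring R] [Semiring A]
    [Algebra R A] : Algebra R (HahnSeries ℤ A) := HahnSeries.instAlgebra

variable {k : Type*} [Field k] {ι κ : Type*}

instance : CommRing (KRing k ι) := inferInstanceAs (CommRing (Localization (kSet k ι)))

instance : Algebra k (KRing k ι) := inferInstanceAs (Algebra k (Localization (kSet k ι)))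

instance : Algebra (MvPolynomial ι k) (KRing k ι) :=
  inferInstanceAs (Algebra (MvPolynomial ι k) (Localization (kSet k ι)))

instance : IsScalarTower k (MvPolynomial ι k) (KRing k ι) :=
  inferInstanceAs (IsScalarTower k (MvPolynomial ι k) (Localization (kSet k ι)))

instance : IsLocalization (kSet k ι) (KRing k ι) :=
  inferInstanceAs (IsLocalization (kSet k ι) (Localization (kSet k ι)))

/-- The variable `z_i`. -/
def KRing.var (k : Type*) [Field k] {ι : Type*} (i : ι) : KRing k ι :=
  algebraMap (MvPolynomial ι k) (KRing k ι) (MvPolynomial.X i)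

theorem KRing.isUnit_aeval {B : Type*} [CommRing B] [Algebra k B] (x : ι → B)
    (hx : ∀ i, IsUnit (x i)) (hd : ∀ i j, i ≠ j → IsUnit (x i - x j)) (y : kSet k ι) :
    IsUnit (MvPolynomial.aeval x (y : MvPolynomial ι k)) := by
  obtain ⟨y, hy⟩ := y
  refine Submonoid.closure_induction (motive := fun y _ => IsUnit (MvPolynomial.aeval x y))
    ?_ ?_ ?_ hy
  · rintro p (⟨i, rfl⟩ | ⟨i, j, hij, rfl⟩)
    · simpa using hx i
    · simpa using hd i j hij
  · simp
  · intro p q _ _ hp hq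
    rw [map_mul]
    exact hp.mul hq

/-- The `k`-algebra homomorphism out of `KRing k ι` sending `z_i` to `x i`. -/
def KRing.lift {B : Type*} [CommRing B] [Algebra k B] (x : ι → B)
    (hx : ∀ i, IsUnit (x i)) (hd : ∀ i j, i ≠ j → IsUnit (x i - x j)) : KRing k ι →ₐ[k] B :=
  IsLocalization.liftAlgHom (M := kSet k ι) (f := MvPolynomial.aeval x)
    (KRing.isUnit_aeval x hx hd)

theorem KRing.isUnit_var (i : ι) : IsUnit (KRing.var k i) :=
  IsLocalization.map_units (M := kSet k ι) (KRing k ι)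
    ⟨_, Submonoid.subset_closure (Or.inl ⟨i, rfl⟩)⟩

theorem KRing.isUnit_var_sub {i j : ι} (h : i ≠ j) :
    IsUnit (KRing.var k i - KRing.var k j) := by
  have := IsLocalization.map_units (M := kSet k ι) (KRing k ι)
    ⟨_, Submonoid.subset_closure (Or.inr ⟨i, j, h, rfl⟩)⟩
  simpa [KRing.var] using this

/-- Renaming of the variables along an injective map, `z_i ↦ z_{e i}`. -/
def KRing.rename (e : ι ↪ κ) : KRing k ι →ₐ[k] KRing k κ :=
  KRing.lift (fun i => KRing.var k (e i)) (fun i => KRing.isUnit_var (e i))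
    (fun _ _ hij => KRing.isUnit_var_sub (e.injective.ne hij))

open Classical in
/-- The homomorphism `p ↦ p + ε ∂p/∂z_i` to the dual numbers. -/
def KRing.toDual (k : Type*) [Field k] {ι : Type*} (i : ι) :
    KRing k ι →ₐ[k] TrivSqZeroExt (KRing k ι) (KRing k ι) :=
  KRing.lift
    (fun j => TrivSqZeroExt.inl (KRing.var k j) +
      (if j = i then TrivSqZeroExt.inr (1 : KRing k ι) else 0))
    (fun j => by
      rw [TrivSqZeroExt.isUnit_iff_isUnit_fst]
      have h := KRing.isUnit_var (k := k) j
      split_ifs <;> simpa using h)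
    (fun j l hjl => by
      rw [TrivSqZeroExt.isUnit_iff_isUnit_fst]
      have h := KRing.isUnit_var_sub (k := k) hjl
      split_ifs <;> simpa using h)

/-- The partial derivative `∂/∂z_i` on `KRing k ι`. -/
def KRing.partialD (k : Type*) [Field k] {ι : Type*} (i : ι) : KRing k ι →ₗ[k] KRing k ι :=
  (TrivSqZeroExt.sndHom (KRing k ι) (KRing k ι)).restrictScalars k ∘ₗ
    (KRing.toDual k i).toLinearMap

/-- `i_{x₁,x₂}`: the expansion of a function of two variables `x₁ = z_0`, `x₂ = z_1` in the region
`|x₁| > |x₂|`, as an element of `k((x₁))((x₂))`. -/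
def expand (k : Type*) [Field k] : KRing k (Fin 2) →ₐ[k] LaurentSeries (LaurentSeries k) :=
  KRing.lift
    ![HahnSeries.single 0 (HahnSeries.single 1 1), HahnSeries.single 1 1]
    (fun i => by
      fin_cases i <;> simp)
    (fun i j hij => by
      have h : (HahnSeries.single 0 (HahnSeries.single 1 1) : LaurentSeries (LaurentSeries k)) -
          HahnSeries.single 1 1 ≠ 0 := by
        intro h
        have h1 := congrArg (fun s => HahnSeries.coeff s 0) h
        simp at h1
      fin_cases i <;> fin_cases j
      · exact absurd rfl hij
      · simpa using h
      · rw [← neg_ne_zero, neg_sub] at h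
        simpa using h
      · exact absurd rfl hij)

/-- Interchange of the two variables. -/
def swapK (k : Type*) [Field k] : KRing k (Fin 2) →ₐ[k] KRing k (Fin 2) :=
  KRing.rename (Equiv.swap (0 : Fin 2) 1).toEmbedding

end KRing

/-! ## Operators with coefficients in an algebra of functions

`X → (𝒦 ⊗ Y)[[t]]` stands for a linear map `X → X ⊗ 𝒦[[t]]` and its `𝒦[[t]]`-linear extension. -/

section Kleisli

variable {k : Type*} [CommRing k] {τ : Type*} {𝒦 𝒦' : Type*} [CommRing 𝒦] [Algebra k 𝒦]
  [CommRing 𝒦'] [Algebra k 𝒦']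
variable {X Y Z : Type*} [AddCommMonoid X] [Module k X] [AddCommMonoid Y] [Module k Y]
  [AddCommMonoid Z] [Module k Z]

/-- The `𝒦[[t]]`-linear extension of `X → (𝒦 ⊗ Y)[[t]]`. -/
def kExt (φ : X →ₗ[k] MvPowerSeries τ (𝒦 ⊗[k] Y)) :
    MvPowerSeries τ (𝒦 ⊗[k] X) →ₗ[k] MvPowerSeries τ (𝒦 ⊗[k] Y) :=
  tExt (TensorProduct.lift (LinearMap.mk₂ k
    (fun a x => tMap τ (LinearMap.rTensor Y (LinearMap.mulLeft k a)) (φ x))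
    (fun a b x => by
      funext d
      change LinearMap.rTensor Y (LinearMap.mulLeft k (a + b)) (φ x d) =
        LinearMap.rTensor Y (LinearMap.mulLeft k a) (φ x d) +
          LinearMap.rTensor Y (LinearMap.mulLeft k b) (φ x d)
      rw [← LinearMap.add_apply, ← LinearMap.rTensor_add]
      congr 2
      ext
      simp [add_mul])
    (fun c a x => by
      funext d
      change LinearMap.rTensor Y (LinearMap.mulLeft k (c • a)) (φ x d) =
        c • LinearMap.rTensor Y (LinearMap.mulLeft k a) (φ x d)
      rw [← LinearMap.smul_apply, ← LinearMap.rTensor_smul]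
      congr 2
      ext
      simp)
    (fun a x y => by rw [map_add, map_add])
    (fun c a x => by rw [map_smul, map_smul])))

/-- Composition of two such operators. -/
def kComp (ψ : Y →ₗ[k] MvPowerSeries τ (𝒦 ⊗[k] Z)) (φ : X →ₗ[k] MvPowerSeries τ (𝒦 ⊗[k] Y)) :
    X →ₗ[k] MvPowerSeries τ (𝒦 ⊗[k] Z) :=
  kExt ψ ∘ₗ φ

/-- An operator without dependence on the variables, viewed as an operator over `𝒦`. -/
def toK (𝒦 : Type*) [CommRing 𝒦] [Algebra k 𝒦] (φ : X →ₗ[k] MvPowerSeries τ Y) :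
    X →ₗ[k] MvPowerSeries τ (𝒦 ⊗[k] Y) :=
  tMap τ (TensorProduct.mk k 𝒦 Y 1) ∘ₗ φ

/-- The identity operator. -/
def kId (k τ 𝒦 X : Type*) [CommRing k] [CommRing 𝒦] [Algebra k 𝒦] [AddCommMonoid X] [Module k X] :
    X →ₗ[k] MvPowerSeries τ (𝒦 ⊗[k] X) :=
  toK 𝒦 (tC k τ X)

/-- Change of coefficients along a linear map `𝒦 → 𝒦'` (a change of variables or a derivative). -/
def kMap (f : 𝒦 →ₗ[k] 𝒦') (φ : X →ₗ[k] MvPowerSeries τ (𝒦 ⊗[k] Y)) :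
    X →ₗ[k] MvPowerSeries τ (𝒦' ⊗[k] Y) :=
  tMap τ (LinearMap.rTensor Y f) ∘ₗ φ

/-- `φ ⊗ 1`. -/
def tensorId (Z : Type*) [AddCommMonoid Z] [Module k Z]
    (φ : X →ₗ[k] MvPowerSeries τ (𝒦 ⊗[k] Y)) :
    X ⊗[k] Z →ₗ[k] MvPowerSeries τ (𝒦 ⊗[k] (Y ⊗[k] Z)) :=
  tMap τ (TensorProduct.assoc k 𝒦 Y Z).toLinearMap ∘ₗ strength k τ (𝒦 ⊗[k] Y) Z ∘ₗ
    LinearMap.rTensor Z φ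

/-- `e φ e⁻¹`. -/
def conj (e : X ≃ₗ[k] Y) (φ : X →ₗ[k] MvPowerSeries τ (𝒦 ⊗[k] X)) :
    Y →ₗ[k] MvPowerSeries τ (𝒦 ⊗[k] Y) :=
  tMap τ (LinearMap.lTensor 𝒦 e.toLinearMap) ∘ₗ φ ∘ₗ e.symm.toLinearMap

end Kleisli

/-! ## `H_D`-quantum vertex algebras -/

section HahnAction

variable {k : Type*} [CommRing k] {A B C : Type*} [AddCommMonoid A] [Module k A]
  [AddCommMonoid B] [Module k B] [AddCommMonoid C] [Module k C]

theorem finite_support_mul (β : A →ₗ[k] B →ₗ[k] C) (x : HahnSeries ℤ A) (y : HahnSeries ℤ B)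
    (n : ℤ) : (Function.support fun i => β (x.coeff i) (y.coeff (n - i))).Finite := by
  refine (Set.finite_Icc x.order (n - y.order)).subset fun i hi => ?_
  rw [Function.mem_support] at hi
  constructor
  · by_contra h
    exact hi (by rw [HahnSeries.coeff_eq_zero_of_lt_order (not_le.mp h)]; simp)
  · by_contra h
    exact hi (by
      rw [HahnSeries.coeff_eq_zero_of_lt_order (x := y) (i := n - i) (by linarith)]; simp)

/-- The multiplication `A((x)) × B((x)) → C((x))` induced by a bilinear map `A × B → C`;
all sums are finite by `finite_support_mul`. -/
def seriesMul (β : A →ₗ[k] B →ₗ[k] C) :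
    HahnSeries ℤ A →ₗ[k] HahnSeries ℤ B →ₗ[k] HahnSeries ℤ C :=
  LinearMap.mk₂ k
    (fun x y => HahnSeries.ofSuppBddBelow
      (fun n => ∑ᶠ i : ℤ, β (x.coeff i) (y.coeff (n - i)))
      (by
        refine ⟨x.order + y.order, fun n hn => ?_⟩
        by_contra h
        refine hn (finsum_eq_zero_of_forall_eq_zero fun i => ?_)
        by_cases hi : i < x.order
        · rw [HahnSeries.coeff_eq_zero_of_lt_order hi]; simp
        · rw [HahnSeries.coeff_eq_zero_of_lt_order (x := y) (i := n - i) (by linarith)]; simp))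
    (fun x x' y => by
      ext n
      change (∑ᶠ i : ℤ, β (x.coeff i + x'.coeff i) (y.coeff (n - i))) =
        (∑ᶠ i : ℤ, β (x.coeff i) (y.coeff (n - i))) + ∑ᶠ i : ℤ, β (x'.coeff i) (y.coeff (n - i))
      rw [← finsum_add_distrib (finite_support_mul β x y n) (finite_support_mul β x' y n)]
      simp)
    (fun c x y => by
      ext n
      change (∑ᶠ i : ℤ, β (c • x.coeff i) (y.coeff (n - i))) =
        c • ∑ᶠ i : ℤ, β (x.coeff i) (y.coeff (n - i))
      rw [smul_finsum' c (finite_support_mul β x y n)]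
      simp)
    (fun x y y' => by
      ext n
      change (∑ᶠ i : ℤ, β (x.coeff i) (y.coeff (n - i) + y'.coeff (n - i))) =
        (∑ᶠ i : ℤ, β (x.coeff i) (y.coeff (n - i))) + ∑ᶠ i : ℤ, β (x.coeff i) (y'.coeff (n - i))
      rw [← finsum_add_distrib (finite_support_mul β x y n) (finite_support_mul β x y' n)]
      simp)
    (fun c x y => by
      ext n
      change (∑ᶠ i : ℤ, β (x.coeff i) (c • y.coeff (n - i))) =
        c • ∑ᶠ i : ℤ, β (x.coeff i) (y.coeff (n - i))
      rw [smul_finsum' c (finite_support_mul β x y n)]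
      simp)

end HahnAction

section QVA

variable {k : Type*} [Field k] {τ : Type*} {X Y V : Type*} [AddCommMonoid X] [Module k X]
  [AddCommMonoid Y] [Module k Y] [AddCommGroup V] [Module k V]

/-- Application of a linear map to all coefficients of a formal Laurent series. -/
def hMap (f : X →ₗ[k] Y) : HahnSeries ℤ X →ₗ[k] HahnSeries ℤ Y where
  toFun x := x.map f
  map_add' x y := by ext n; exact map_add f _ _
  map_smul' c x := by ext n; exact map_smul f _ _

/-- The coefficient of `z ^ n` in an element of `V((z))`, for `V = X[[t]]`. -/
def zCoeff {τ X : Type*} [Zero X] (n : ℤ) (x : MvPowerSeries τ (HahnSeries ℤ X)) :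
    MvPowerSeries τ X :=
  fun d => (x d).coeff n

/-- For `φ : X → Y[[t]]`, the induced map `X((z)) → Y((z))[[t]]`. -/
def hLift (φ : X →ₗ[k] MvPowerSeries τ Y) :
    HahnSeries ℤ X →ₗ[k] MvPowerSeries τ (HahnSeries ℤ Y) where
  toFun F := fun d => hMap (tCoeff k d ∘ₗ φ) F
  map_add' F G := by funext d; exact map_add _ F G
  map_smul' c F := by funext d; exact map_smul _ c F

theorem hLift_add (φ ψ : X →ₗ[k] MvPowerSeries τ Y) : hLift (φ + ψ) = hLift φ + hLift ψ := rfl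

theorem hLift_smul (c : k) (φ : X →ₗ[k] MvPowerSeries τ Y) : hLift (c • φ) = c • hLift φ := rfl

theorem tExt_add (φ ψ : X →ₗ[k] MvPowerSeries τ Y) : tExt (φ + ψ) = tExt φ + tExt ψ := by
  ext x
  funext d
  exact Finset.sum_add_distrib

open Classical in
theorem tExt_smul (c : k) (φ : X →ₗ[k] MvPowerSeries τ Y) : tExt (c • φ) = c • tExt φ := by
  ext x
  funext d
  exact Finset.sum_congr rfl (fun p _ => rfl) |>.trans
    (Finset.smul_sum (f := fun p : (τ →₀ ℕ) × (τ →₀ ℕ) => φ (x p.1) p.2) (r := c)).symm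

/-- For a state-field correspondence `Y` and `c ∈ V`, the map
`a ⊗ b ↦ Y(a, x₁) Y(b, x₂) c ∈ V((x₁))((x₂))`. -/
def prodFields (Y : V →ₗ[k] V →ₗ[k] MvPowerSeries τ (HahnSeries ℤ V)) (c : V) :
    V ⊗[k] V →ₗ[k] MvPowerSeries τ (HahnSeries ℤ (HahnSeries ℤ V)) :=
  TensorProduct.lift (LinearMap.mk₂ k
    (fun a b => tExt (hLift (Y a)) (Y b c))
    (fun a a' b => by rw [map_add, hLift_add, tExt_add]; rfl)
    (fun r a b => by rw [map_smul, hLift_smul, tExt_smul]; rfl)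
    (fun a b b' => by rw [map_add, LinearMap.add_apply, map_add])
    (fun r a b => by rw [map_smul, LinearMap.smul_apply, map_smul]))

/-- For `c ∈ V`, the map `V ⊗ V ⊗ K → V((x₁))((x₂))[[t]]`,
`a ⊗ b ⊗ κ(x₁, x₂) ↦ κ(x₁, x₂) Y(a, x₁) Y(b, x₂) c`, extended linearly over `k[[t]]`; here `κ` is
expanded in the region `|x₁| > |x₂|`, the region of the product of the two fields.  Applied to
`R(w, z)(b ⊗ a)` it gives the series `Y(w)(1 ⊗ Y(z))(R(w, z)(b ⊗ a) ⊗ c)`. -/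
def prodFieldsK (Y : V →ₗ[k] V →ₗ[k] MvPowerSeries τ (HahnSeries ℤ V)) (c : V) :
    MvPowerSeries τ (KRing k (Fin 2) ⊗[k] (V ⊗[k] V)) →ₗ[k]
      MvPowerSeries τ (HahnSeries ℤ (HahnSeries ℤ V)) :=
  tExt (TensorProduct.lift (LinearMap.mk₂ k
    (fun κ x => tMap τ (seriesMul (seriesMul (LinearMap.lsmul k V)) (expand k κ))
      (prodFields Y c x))
    (fun κ κ' x => by rw [map_add, map_add]; rfl)
    (fun r κ x => by
      have h : expand k (r • κ) = r • expand k κ := map_smul (expand k) r κ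
      rw [h, map_smul]; rfl)
    (fun κ x x' => by rw [map_add, map_add])
    (fun r κ x => by rw [map_smul, map_smul])))

/-- The identity `(z-w)^N Y(a,z) Y(b,w) c = (w-z)^N Y(w)(1 ⊗ Y(z))(R(w,z)(b ⊗ a) ⊗ c)`
for the coefficients of `t ^ d`, as formal series in `z^{±1}, w^{±1}`.
The left side lies in `V((z))((w))` and the right side in `V((w))((z))`. -/
def LocalAt (Y : V →ₗ[k] V →ₗ[k] MvPowerSeries τ (HahnSeries ℤ V))
    (R : V ⊗[k] V →ₗ[k] MvPowerSeries τ (KRing k (Fin 2) ⊗[k] (V ⊗[k] V)))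
    (a b c : V) (N : ℕ) (d : τ →₀ ℕ) : Prop :=
  ∀ m n : ℤ,
    ((seriesMul (seriesMul (LinearMap.lsmul k V))
        (expand k ((KRing.var k 0 - KRing.var k 1) ^ N))
        (tCoeff k d (prodFields Y c (a ⊗ₜ b)))).coeff n).coeff m =
    ((seriesMul (seriesMul (LinearMap.lsmul k V))
        (expand k ((KRing.var k 0 - KRing.var k 1) ^ N))
        (tCoeff k d (prodFieldsK Y c (R (b ⊗ₜ a))))).coeff m).coeff n

/-- The embedding `(z_0, z_1) ↦ (z_i, z_j)` of the variables. -/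
def pairEmb (i j : Fin 3) (h : i ≠ j) : Fin 2 ↪ Fin 3 where
  toFun := ![i, j]
  inj' a b hab := by
    fin_cases a <;> fin_cases b <;> simp_all

/-- `R_{12}(z_1, z_2)` on `V ⊗ V ⊗ V`. -/
def R12 (R : V ⊗[k] V →ₗ[k] MvPowerSeries τ (KRing k (Fin 2) ⊗[k] (V ⊗[k] V))) :
    (V ⊗[k] V) ⊗[k] V →ₗ[k] MvPowerSeries τ (KRing k (Fin 3) ⊗[k] ((V ⊗[k] V) ⊗[k] V)) :=
  tensorId V (kMap (KRing.rename (pairEmb 0 1 (by decide))).toLinearMap R)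

/-- `R_{13}(z_1, z_3)` on `V ⊗ V ⊗ V`. -/
def R13 (R : V ⊗[k] V →ₗ[k] MvPowerSeries τ (KRing k (Fin 2) ⊗[k] (V ⊗[k] V))) :
    (V ⊗[k] V) ⊗[k] V →ₗ[k] MvPowerSeries τ (KRing k (Fin 3) ⊗[k] ((V ⊗[k] V) ⊗[k] V)) :=
  conj (TensorProduct.rightComm k V V V)
    (tensorId V (kMap (KRing.rename (pairEmb 0 2 (by decide))).toLinearMap R))

/-- `R_{23}(z_2, z_3)` on `V ⊗ V ⊗ V`. -/
def R23 (R : V ⊗[k] V →ₗ[k] MvPowerSeries τ (KRing k (Fin 2) ⊗[k] (V ⊗[k] V))) :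
    (V ⊗[k] V) ⊗[k] V →ₗ[k] MvPowerSeries τ (KRing k (Fin 3) ⊗[k] ((V ⊗[k] V) ⊗[k] V)) :=
  conj ((TensorProduct.comm k (V ⊗[k] V) V).trans (TensorProduct.assoc k V V V).symm)
    (tensorId V (kMap (KRing.rename (pairEmb 1 2 (by decide))).toLinearMap R))

/-- `H_D`-quantum vertex algebras over `k[[t]]`.  The space of states is the topologically free
module `V[[t]]`.  The state-field correspondence, the operator `D` and the braiding are
`k[[t]]`-linear, hence given by their restrictions to `V`, and the axioms, all of them
`k[[t]]`-(multi)linear, are stated for vectors of `V`.  Here `Y(a, z) b` lies in `V((z))[[t]]`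
(that is, `a_{(n)} b` tends to `0` in the topology of `V[[t]]` as `n → ∞`), and the
locality axiom is, as usual for topologically free modules, required modulo every power of the
maximal ideal of `k[[t]]`. -/
structure IsHDQuantumVertexAlgebra
    (vac : MvPowerSeries τ V) (D : V →ₗ[k] MvPowerSeries τ V)
    (Y : V →ₗ[k] V →ₗ[k] MvPowerSeries τ (HahnSeries ℤ V))
    (R : V ⊗[k] V →ₗ[k] MvPowerSeries τ (KRing k (Fin 2) ⊗[k] (V ⊗[k] V))) : Prop where
  yang_baxter : kComp (kComp (R12 R) (R13 R)) (R23 R) = kComp (kComp (R23 R) (R13 R)) (R12 R)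
  shift_left :
    kComp (tensorId V (toK (KRing k (Fin 2)) D)) R -
      kComp R (tensorId V (toK (KRing k (Fin 2)) D)) = - kMap (KRing.partialD k 0) R
  shift_right :
    kComp (conj (TensorProduct.comm k V V) (tensorId V (toK (KRing k (Fin 2)) D))) R -
      kComp R (conj (TensorProduct.comm k V V) (tensorId V (toK (KRing k (Fin 2)) D))) =
        - kMap (KRing.partialD k 1) R
  unitarity_left :
    kComp (conj (TensorProduct.comm k V V) (kMap (swapK k).toLinearMap R)) R =
      kId k τ (KRing k (Fin 2)) (V ⊗[k] V)
  unitarity_right :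
    kComp R (conj (TensorProduct.comm k V V) (kMap (swapK k).toLinearMap R)) =
      kId k τ (KRing k (Fin 2)) (V ⊗[k] V)
  translation : ∀ (a b : V) (d : τ →₀ ℕ) (n : ℤ),
    (tCoeff k d (tExt (Y.flip b) (D a))).coeff n =
      ((n + 1 : ℤ) : k) • (tCoeff k d (Y a b)).coeff (n + 1)
  vacuum : ∀ b : V, tExt (Y.flip b) vac = tC k τ _ (HahnSeries.single 0 b)
  creation : ∀ (a : V) (d : τ →₀ ℕ),
    (∀ n : ℤ, n < 0 → (tCoeff k d (tExt (Y a) vac)).coeff n = 0) ∧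
      (tCoeff k d (tExt (Y a) vac)).coeff 0 = tCoeff k d (tC k τ V a)
  locality : ∀ (a b : V) (M : ℕ), ∃ N : ℕ, ∀ (c : V) (d : τ →₀ ℕ), d.degree < M →
    LocalAt Y R a b c N d

/-- The locality axiom with an exponent `N` that works for all powers of the parameters at once. -/
def StronglyLocal (Y : V →ₗ[k] V →ₗ[k] MvPowerSeries τ (HahnSeries ℤ V))
    (R : V ⊗[k] V →ₗ[k] MvPowerSeries τ (KRing k (Fin 2) ⊗[k] (V ⊗[k] V))) : Prop :=
  ∀ a b : V, ∃ N : ℕ, ∀ (c : V) (d : τ →₀ ℕ), LocalAt Y R a b c N d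

end QVA

/-! ## The rank-one lattice: the Hopf algebra `V = Sym(D^{(n)} α) ⊗ k[ℤα]` -/

section Lattice

/-- `k[h^{(n)}, n ≥ 0] ⊗ k[ℤα]`, where `h^{(n)} = D^{(n)} h`, `h = D α = (D e^α) e^{-α}`. -/
def LatticeV (k : Type*) [Field k] : Type _ := MvPolynomial ℕ k ⊗[k] k[T;T⁻¹]

instance (k : Type*) [Field k] : CommRing (LatticeV k) :=
  inferInstanceAs (CommRing (MvPolynomial ℕ k ⊗[k] k[T;T⁻¹]))

instance (k : Type*) [Field k] : Algebra k (LatticeV k) :=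
  inferInstanceAs (Algebra k (MvPolynomial ℕ k ⊗[k] k[T;T⁻¹]))

/-- The identity map from the tensor product to `V`. -/
def LatticeV.of (k : Type*) [Field k] : MvPolynomial ℕ k ⊗[k] k[T;T⁻¹] ≃ₐ[k] LatticeV k :=
  AlgEquiv.refl

/-- The generator `h^{(n)} = D^n h / n!`. -/
def hGen (k : Type*) [Field k] (n : ℕ) : LatticeV k := LatticeV.of k (MvPolynomial.X n ⊗ₜ 1)

/-- The generator `e^{mα}`. -/
def eGen (k : Type*) [Field k] (m : ℤ) : LatticeV k :=
  LatticeV.of k (1 ⊗ₜ LaurentPolynomial.T m)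

variable (k : Type*) [Field k]

theorem eGen_zero : eGen k 0 = 1 := rfl

theorem eGen_add (m n : ℤ) : eGen k (m + n) = eGen k m * eGen k n := by
  rw [eGen, eGen, eGen, ← map_mul, Algebra.TensorProduct.tmul_mul_tmul, one_mul,
    LaurentPolynomial.T_add]

/-- The algebra homomorphism out of `V` with prescribed values on the generators. -/
def latticeLift {B : Type*} [CommSemiring B] [Algebra k B] (x : ℕ → B) (y : Multiplicative ℤ →* B) :
    LatticeV k →ₐ[k] B :=
  (Algebra.TensorProduct.productMap (MvPolynomial.aeval x) (AddMonoidAlgebra.lift k B ℤ y)).comp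
    (LatticeV.of k).symm.toAlgHom

/-- The coproduct: `h^{(n)}` is primitive and `e^{mα}` is grouplike. -/
def comul : LatticeV k →ₐ[k] LatticeV k ⊗[k] LatticeV k :=
  latticeLift k (fun n => hGen k n ⊗ₜ 1 + 1 ⊗ₜ hGen k n)
    { toFun := fun m => eGen k m.toAdd ⊗ₜ[k] eGen k m.toAdd
      map_one' := rfl
      map_mul' := fun m n => by
        rw [toAdd_mul, eGen_add, Algebra.TensorProduct.tmul_mul_tmul] }

/-- The counit. -/
def counit : LatticeV k →ₐ[k] k := latticeLift k (fun _ => 0) 1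

/-- The antipode: `S(h^{(n)}) = -h^{(n)}`, `S(e^{mα}) = e^{-mα}`. -/
def antipode : LatticeV k →ₐ[k] LatticeV k :=
  latticeLift k (fun n => - hGen k n)
    { toFun := fun m => eGen k (-m.toAdd)
      map_one' := rfl
      map_mul' := fun m n => by rw [toAdd_mul, neg_add, eGen_add] }

/-- `∂_α` on the group algebra: `e^{mα} ↦ m e^{mα}`. -/
def chargeL (S : Type*) [CommRing S] : S[T;T⁻¹] →ₗ[S] S[T;T⁻¹] :=
  Finsupp.lsum S (fun m : ℤ => (m : S) • AddMonoidAlgebra.lsingle m) ∘ₗ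
    (AddMonoidAlgebra.coeffLinearEquiv S).toLinearMap

/-- The projection of the group algebra to the span of `e^{sα}`. -/
def projL (S : Type*) [CommRing S] (s : ℤ) : S[T;T⁻¹] →ₗ[S] S[T;T⁻¹] :=
  AddMonoidAlgebra.lsingle s ∘ₗ Finsupp.lapply s ∘ₗ
    (AddMonoidAlgebra.coeffLinearEquiv S).toLinearMap

/-- The infinitesimal translation `D`, the derivation of `V` with `D h^{(n)} = (n+1) h^{(n+1)}`
and `D e^{mα} = m h e^{mα}`. -/
def latticeD : LatticeV k →ₗ[k] LatticeV k :=
  (LatticeV.of k).toLinearMap ∘ₗ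
    (LinearMap.rTensor _ (MvPolynomial.mkDerivation k
      (fun n : ℕ => ((n : k) + 1) • (MvPolynomial.X (n + 1) : MvPolynomial ℕ k)) :
        MvPolynomial ℕ k →ₗ[k] MvPolynomial ℕ k) +
    LinearMap.mulLeft k ((MvPolynomial.X 0 : MvPolynomial ℕ k) ⊗ₜ[k] (1 : k[T;T⁻¹])) ∘ₗ
      LinearMap.lTensor _ (chargeL k)) ∘ₗ
    (LatticeV.of k).symm.toLinearMap

/-- The coproduct `a ⊗ b ↦ (a' ⊗ b') ⊗ (a'' ⊗ b'')` of `V ⊗ V`. -/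
def comul₂ : LatticeV k ⊗[k] LatticeV k →ₗ[k]
    (LatticeV k ⊗[k] LatticeV k) ⊗[k] (LatticeV k ⊗[k] LatticeV k) :=
  (TensorProduct.tensorTensorTensorComm k _ _ _ _).toLinearMap ∘ₗ
    TensorProduct.map (comul k).toLinearMap (comul k).toLinearMap

variable {k} {τ : Type*}

/-- `r` is the `H_D`-bicharacter on `V` with values in `K = k[z^{±1}, w^{±1}, (z-w)^{±1}][[t]]`
that satisfies `r(e^α ⊗ e^α) = σ`. -/
structure IsBicharacter (σ : MvPowerSeries τ (KRing k (Fin 2)))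
    (r : LatticeV k ⊗[k] LatticeV k →ₗ[k] MvPowerSeries τ (KRing k (Fin 2))) : Prop where
  one_left : ∀ a, r (1 ⊗ₜ a) = algebraMap k _ (counit k a)
  one_right : ∀ a, r (a ⊗ₜ 1) = algebraMap k _ (counit k a)
  mul_left : ∀ a b c, r ((a * b) ⊗ₜ c) = LinearMap.mul' k _
    (TensorProduct.map (r ∘ₗ TensorProduct.mk k _ _ a) (r ∘ₗ TensorProduct.mk k _ _ b) (comul k c))
  mul_right : ∀ a b c, r (a ⊗ₜ (b * c)) = LinearMap.mul' k _
    (TensorProduct.map (r ∘ₗ (TensorProduct.mk k _ _).flip b)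
      (r ∘ₗ (TensorProduct.mk k _ _).flip c) (comul k a))
  deriv_left : ∀ a b, r (latticeD k a ⊗ₜ b) = tMap τ (KRing.partialD k 0) (r (a ⊗ₜ b))
  deriv_right : ∀ a b, r (a ⊗ₜ latticeD k b) = tMap τ (KRing.partialD k 1) (r (a ⊗ₜ b))
  lattice : r (eGen k 1 ⊗ₜ eGen k 1) = σ

/-- The convolution product `(r * s)(a ⊗ b) = r(a' ⊗ b') s(a'' ⊗ b'')`. -/
def conv (r s : LatticeV k ⊗[k] LatticeV k →ₗ[k] MvPowerSeries τ (KRing k (Fin 2))) :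
    LatticeV k ⊗[k] LatticeV k →ₗ[k] MvPowerSeries τ (KRing k (Fin 2)) :=
  LinearMap.mul' k _ ∘ₗ TensorProduct.map r s ∘ₗ comul₂ k

/-- The transpose `r^t(a ⊗ b)(z, w) = r(b ⊗ a)(w, z)`. -/
def transpose (r : LatticeV k ⊗[k] LatticeV k →ₗ[k] MvPowerSeries τ (KRing k (Fin 2))) :
    LatticeV k ⊗[k] LatticeV k →ₗ[k] MvPowerSeries τ (KRing k (Fin 2)) :=
  tMap τ (swapK k).toLinearMap ∘ₗ r ∘ₗ (TensorProduct.comm k _ _).toLinearMap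

/-- The inverse `r⁻¹(a ⊗ b) = r(S a ⊗ b)`. -/
def bicharInv (r : LatticeV k ⊗[k] LatticeV k →ₗ[k] MvPowerSeries τ (KRing k (Fin 2))) :
    LatticeV k ⊗[k] LatticeV k →ₗ[k] MvPowerSeries τ (KRing k (Fin 2)) :=
  r ∘ₗ LinearMap.rTensor _ (antipode k).toLinearMap

/-- The braiding `R(a ⊗ b) = Σ a' ⊗ b' (r^t * r⁻¹)(a'' ⊗ b'')`. -/
def bicharR (r : LatticeV k ⊗[k] LatticeV k →ₗ[k] MvPowerSeries τ (KRing k (Fin 2))) :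
    LatticeV k ⊗[k] LatticeV k →ₗ[k]
      MvPowerSeries τ (KRing k (Fin 2) ⊗[k] (LatticeV k ⊗[k] LatticeV k)) :=
  strength k τ (KRing k (Fin 2)) (LatticeV k ⊗[k] LatticeV k) ∘ₗ
    (TensorProduct.comm k _ _).toLinearMap ∘ₗ
    LinearMap.lTensor _ (conv (transpose r) (bicharInv r)) ∘ₗ comul₂ k

/-- `e^{zD} a = Σ_n D^n a z^n / n!`. -/
def expD (k : Type*) [Field k] : LatticeV k →ₗ[k] HahnSeries ℤ (LatticeV k) where
  toFun a := HahnSeries.ofSuppBddBelow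
    (fun n => if 0 ≤ n then (n.toNat.factorial : k)⁻¹ • (latticeD k ^ n.toNat) a else 0)
    ⟨0, fun n hn => by
      by_contra h
      exact Function.mem_support.mp hn (if_neg h)⟩
  map_add' a b := by
    ext n
    change (if 0 ≤ n then (n.toNat.factorial : k)⁻¹ • (latticeD k ^ n.toNat) (a + b) else 0) =
      (if 0 ≤ n then (n.toNat.factorial : k)⁻¹ • (latticeD k ^ n.toNat) a else 0) +
      (if 0 ≤ n then (n.toNat.factorial : k)⁻¹ • (latticeD k ^ n.toNat) b else 0)
    split_ifs
    · rw [map_add, smul_add]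
    · rw [add_zero]
  map_smul' c a := by
    ext n
    change (if 0 ≤ n then (n.toNat.factorial : k)⁻¹ • (latticeD k ^ n.toNat) (c • a) else 0) =
      c • (if 0 ≤ n then (n.toNat.factorial : k)⁻¹ • (latticeD k ^ n.toNat) a else 0)
    split_ifs
    · rw [map_smul, smul_comm]
    · rw [smul_zero]

/-- The map `a ⊗ b ↦ (e^{zD} a) b`. -/
def expDMul (k : Type*) [Field k] :
    LatticeV k ⊗[k] LatticeV k →ₗ[k] HahnSeries ℤ (LatticeV k) :=
  TensorProduct.lift (LinearMap.mk₂ k (fun a b => hMap (LinearMap.mulRight k b) (expD k a))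
    (fun a a' b => by rw [map_add, map_add])
    (fun c a b => by rw [map_smul, map_smul])
    (fun a b b' => by ext n; exact mul_add _ _ _)
    (fun c a b => by ext n; exact mul_smul_comm _ _ _))

/-- The value `κ(z, 0)`: the constant term of the expansion of `κ(z, w)` in powers of `w`
(it is used for functions without a pole at `w = 0` only). -/
def evalW (k : Type*) [Field k] : KRing k (Fin 2) →ₗ[k] HahnSeries ℤ k where
  toFun κ := (expand k κ).coeff 0
  map_add' κ κ' := by rw [map_add]; rfl
  map_smul' c κ := by
    have h : expand k (c • κ) = c • expand k κ := map_smul (expand k) c κ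
    rw [h]; rfl

/-- The field `Y(a, z) b = Σ (e^{zD} a') b' r(a'' ⊗ b'')(z, 0)`. -/
def bicharY (r : LatticeV k ⊗[k] LatticeV k →ₗ[k] MvPowerSeries τ (KRing k (Fin 2))) :
    LatticeV k →ₗ[k] LatticeV k →ₗ[k] MvPowerSeries τ (HahnSeries ℤ (LatticeV k)) :=
  TensorProduct.curry (TensorProduct.lift (LinearMap.mk₂ k
      (fun x y => tMap τ
        ((seriesMul (LinearMap.lsmul k (LatticeV k))).flip (expDMul k x) ∘ₗ evalW k) (r y))
      (fun x x' y => by rw [map_add, map_add]; rfl)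
      (fun c x y => by rw [map_smul, map_smul]; rfl)
      (fun x y y' => by rw [map_add, map_add])
      (fun c x y => by rw [map_smul, map_smul])) ∘ₗ
    comul₂ k)

end Lattice

/-! ## The deformed Heisenberg algebra and the vertex operator `Ψ` -/

section Heisenberg

/-- `exp G = Σ_j G^j / j!` for a formal power series `G` without constant term over a
(not necessarily commutative) `S`-algebra, `S` a field of characteristic zero. -/
def expSeries (S : Type*) [Field S] {A : Type*} [Ring A] [Algebra S A] (G : PowerSeries A) :
    PowerSeries A :=
  PowerSeries.mk fun n =>
    ∑ j ∈ Finset.range (n + 1), (j.factorial : S)⁻¹ • PowerSeries.coeff n (G ^ j)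

variable {F : Type*} [Field F]

/-- `Λ_F = F[p_1, p_2, …]`, the ring of symmetric functions over a field of characteristic zero,
in terms of the power sums `p_n = X n`. -/
abbrev SymFun (F : Type*) [Field F] : Type _ := MvPolynomial ℕ+ F

/-- `Λ_F ⊗ F[ℤα]`. -/
abbrev SymFunLattice (F : Type*) [Field F] : Type _ := SymFun F ⊗[F] F[T;T⁻¹]

/-- The scalar product `⟨p_λ, p_μ⟩_v = δ_{λμ} z_λ v_λ`.  The partition `λ` is given by its
multiplicities `m_n(λ)`, so that `z_λ = ∏ n^{m_n} m_n!` and `v_λ = ∏ v_n^{m_n}`. -/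
def scalarProduct (v : ℕ+ → F) (f g : SymFun F) : F :=
  ∑ l ∈ f.support, f.coeff l * g.coeff l *
    l.prod fun n m => ((n : ℕ) : F) ^ m * (m.factorial : F) * v n ^ m

/-- `T = p_n^⊥`, the adjoint of the multiplication by `p_n`. -/
def IsPerp (v : ℕ+ → F) (n : ℕ+) (T : Module.End F (SymFun F)) : Prop :=
  ∀ f g, scalarProduct v (T f) g = scalarProduct v f (MvPolynomial.X n * g)

/-- The generators of the deformed Heisenberg algebra on `Λ_F ⊗ F[ℤα]`:
`h_n = v_n⁻¹ p_n^⊥` and `h_{-n} = v_n⁻¹ p_n` for `n > 0`, and `h_0 = ∂_α`. -/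
def heis (v : ℕ+ → F) (pPerp : ℕ+ → Module.End F (SymFun F)) :
    ℤ → Module.End F (SymFunLattice F)
  | .ofNat 0 => LinearMap.lTensor _ (chargeL F)
  | .ofNat (n + 1) => (v n.succPNat)⁻¹ • LinearMap.rTensor _ (pPerp n.succPNat)
  | .negSucc n => (v n.succPNat)⁻¹ •
      LinearMap.rTensor _ (LinearMap.mulLeft F (MvPolynomial.X n.succPNat : SymFun F))

/-- `exp (Σ_{n ≥ 1} h_{-n} z^n / n)`, a power series in `z`. -/
def expMinus (v : ℕ+ → F) (pPerp : ℕ+ → Module.End F (SymFun F)) :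
    PowerSeries (Module.End F (SymFunLattice F)) :=
  expSeries F (PowerSeries.mk fun n => if n = 0 then 0 else (n : F)⁻¹ • heis v pPerp (-(n : ℤ)))

/-- `exp (- Σ_{n ≥ 1} h_n z^{-n} / n)`, a power series in `z⁻¹`. -/
def expPlus (v : ℕ+ → F) (pPerp : ℕ+ → Module.End F (SymFun F)) :
    PowerSeries (Module.End F (SymFunLattice F)) :=
  expSeries F (PowerSeries.mk fun n => if n = 0 then 0 else -((n : F)⁻¹ • heis v pPerp n))

/-- The contribution to `Ψ(z) x` of the coefficient of `z^i` in the first exponential, of `z^{-j}`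
in the second one, and of the component of `x` of charge `s`, on which `e^α z^{∂_α}` acts as
`z^s e^α`. -/
def psiTerm (v : ℕ+ → F) (pPerp : ℕ+ → Module.End F (SymFun F)) (x : SymFunLattice F)
    (q : ℕ × ℕ × ℤ) : SymFunLattice F :=
  PowerSeries.coeff q.1 (expMinus v pPerp) (PowerSeries.coeff q.2.1 (expPlus v pPerp)
    ((1 ⊗ₜ LaurentPolynomial.T 1) * LinearMap.lTensor _ (projL F q.2.2) x))

/-- The coefficient of `z^m` in `Ψ(z) x`, where
`Ψ(z) = exp (Σ_{n ≥ 1} h_{-n} z^n / n) exp (- Σ_{n ≥ 1} h_n z^{-n} / n) e^α z^{∂_α}`. -/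
def psiCoeff (v : ℕ+ → F) (pPerp : ℕ+ → Module.End F (SymFun F)) (m : ℤ)
    (x : SymFunLattice F) : SymFunLattice F :=
  ∑ᶠ (q : ℕ × ℕ × ℤ) (_ : (q.1 : ℤ) - (q.2.1 : ℤ) + q.2.2 = m), psiTerm v pPerp x q

end Heisenberg

/-! ## The bicharacter of the family `(v_n)` and the comparison of the two spaces -/

section Comparison

variable {k : Type*} [Field k] {τ : Type*} {F : Type*} [Field F] [Algebra k F]
  [Algebra (MvPowerSeries τ k) F] [IsScalarTower k (MvPowerSeries τ k) F]

/-- `f(x) = exp (- Σ_{n ≥ 1} v_n⁻¹ x^n / n)`, with `c n = v_n⁻¹` expanded in powers of `t`. -/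
def fSeries (c : ℕ+ → MvPowerSeries τ k) : PowerSeries (MvPowerSeries τ k) :=
  expSeries k (PowerSeries.mk fun n =>
    if h : 0 < n then -((n : k)⁻¹ • c ⟨n, h⟩) else 0)

/-- The data entering the construction: `v_n ∈ F^×`, the expansion `c n` of `v_n⁻¹` in powers of
the parameters `t`, and `σ(z, w) = z i_t f(w / z)`, an invertible element of
`K = k[z^{±1}, w^{±1}, (z-w)^{±1}][[t]]`.  The identity for `σ` says that every coefficient of `σ`
with respect to `t` is the function of `z, w` whose power series expansion in `w / z` is the
corresponding coefficient of `z f(w / z)`. -/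
structure IsSigma (v : ℕ+ → F) (c : ℕ+ → MvPowerSeries τ k)
    (σ : MvPowerSeries τ (KRing k (Fin 2))) : Prop where
  v_ne_zero : ∀ n, v n ≠ 0
  v_inv : ∀ n, (v n)⁻¹ = algebraMap (MvPowerSeries τ k) F (c n)
  expansion : ∀ (d : τ →₀ ℕ) (m n : ℤ),
    ((expand k (tCoeff k d σ)).coeff n).coeff m =
      if 0 ≤ n ∧ m = 1 - n then
        MvPowerSeries.coeff d (PowerSeries.coeff n.toNat (fSeries c)) else 0
  isUnit : IsUnit σ

/-- The algebra homomorphism `V → Λ_F ⊗ F[ℤα]`, `h^{(n-1)} ↦ v_n⁻¹ p_n`, `e^α ↦ e^α`. -/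
def toSymFun (k : Type*) [Field k] [Algebra k F] (v : ℕ+ → F) :
    LatticeV k →ₐ[k] SymFunLattice F :=
  latticeLift k (fun n => ((v n.succPNat)⁻¹ • MvPolynomial.X n.succPNat) ⊗ₜ 1)
    { toFun := fun m => 1 ⊗ₜ LaurentPolynomial.T m.toAdd
      map_one' := rfl
      map_mul' := fun m n => by
        rw [toAdd_mul, LaurentPolynomial.T_add, Algebra.TensorProduct.tmul_mul_tmul, one_mul] }

/-- The `k[[t]]`-linear extension `k[[t]] ⊗ V → Λ_F ⊗ F[ℤα]` of `toSymFun`. -/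
def integralToSymFun (k τ : Type*) [Field k] [Algebra k F] [Algebra (MvPowerSeries τ k) F]
    [IsScalarTower k (MvPowerSeries τ k) F] (v : ℕ+ → F) :
    MvPowerSeries τ k ⊗[k] LatticeV k →ₐ[k] SymFunLattice F :=
  Algebra.TensorProduct.productMap
    (((Algebra.ofId F (SymFunLattice F)).restrictScalars k).comp
      (IsScalarTower.toAlgHom k (MvPowerSeries τ k) F)) (toSymFun k v)

/-- The canonical map from `k[[t]] ⊗ V` to its completion `V[[t]]`. -/
def integralToCompletion (k τ : Type*) [Field k] :
    MvPowerSeries τ k ⊗[k] LatticeV k →ₗ[k] MvPowerSeries τ (LatticeV k) :=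
  tMap τ (TensorProduct.lid k (LatticeV k)).toLinearMap ∘ₗ strength k τ k (LatticeV k)

/-- `x ∈ V[[t]]` and `y ∈ Λ_F ⊗ F[ℤα]` come from the same element of their common subspace
`k[[t]] ⊗ V`. -/
def Corresponds (v : ℕ+ → F) (x : MvPowerSeries τ (LatticeV k)) (y : SymFunLattice F) : Prop :=
  ∃ u : MvPowerSeries τ k ⊗[k] LatticeV k,
    integralToCompletion k τ u = x ∧ integralToSymFun k τ v u = y

end Comparison

end HDQVA

end

open HDQVA

/-!
# The quantum vertex algebra of the rank-one lattice and its vertex operators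

Write `V` for the lattice algebra and `K` for the ring of values of the bicharacter.  Functionals on
`V` or `V ⊗ V` with values in a commutative algebra form a commutative algebra under convolution,
since `V` is cocommutative.  In this language everything constructed from the bicharacter `r`
becomes a product.

*The bicharacter.*  In characteristic zero `V` is generated by `e^{±α}` as an algebra with
derivation (`subalgebra_eq_top_of_latticeD`), so that `r` is determined by `σ = r(e^α ⊗ e^α)`
(`IsBicharacter.unique`).  For the existence, `r` is defined on generators by the logarithmic
derivatives of `σ`, as an algebra homomorphism from `V` to the convolution algebra of functionals on
`V` (`exists_isBicharacter`).  By the same generation argument all values of `r` lie in any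
subalgebra of `K` that is closed under `∂_z` and `∂_w` and contains `σ` and `σ⁻¹`
(`IsBicharacter.mem`).  This gives the bounds for the poles of `r` at `w = 0` and at `z = 0`
(`IsSigma.bicharacter_mem`), and in the examples at `z = w`.

*The braiding.*  `R` is the "diagonal" operator `x ↦ Σ χ(x'') x'` of the functional
`χ = r^t * r⁻¹`.  Diagonal operators compose by convolution of their functionals (`kComp_diagOp`).
Hence they commute, which is the Yang-Baxter equation; unitarity says `χ^t * χ = 1`; and the shift
conditions hold because `D` is a coderivation that acts on `χ` by `∂_z` and `∂_w`.

*Locality.*  Put `X(a, z) b = Σ b' r(a ⊗ b'')(z, 0)`, so that `Y(a, z) = Σ (e^{zD} a') X(a'', z)`.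
Taylor expansion at `w = 0` identifies `X(a, z) e^{wD} b` with `Σ (e^{wD} b') r(a ⊗ b'')(z, w)`,
expanded in the region `|z| > |w|`.  Therefore `Y(a, z) Y(b, w) c` is the convolution product of a
part that is symmetric under the interchange of `(a, z)` and `(b, w)` with the expansion of `r`
(`IsBicharacter.prodFields_eq`).  The product in the opposite order, applied to the braided tensor,
is the convolution product of the same symmetric part with the expansion of `r^t`, since
`χ * r = r^t` (`IsBicharacter.prodFieldsK_eq`).  Thus locality says that after multiplication by a
power of `z - w` the two expansions of `r` agree.  Elements of `K` without a pole at `z = w` have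
this property (`noDiagonalPole`), and every pole has finite order; the exponent is uniform modulo
any power of the parameters, as only finitely many coefficients are involved.

*The vertex operator.*  The Taylor coefficients of `e^{zD} e^α` satisfy the recursion of the
exponential series `exp (Σ h^{(n-1)} z^n / n)`; this identifies the creation parts of `Y(e^α, z)`
and `Ψ(z)`.  Together with the analogous recursion for `f` it determines the values of
`r(e^α ⊗ ·)` and `r(h ⊗ ·)` at `w = 0`.  The annihilation part `X(e^α, z)` is multiplicative, and so
is the annihilation part of `Ψ(z)`, which is the substitution `p_n ↦ p_n - z^{-n}`,
`e^{mα} ↦ z^m e^{mα}`.  They agree on generators, hence everywhere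
(`IsSigma.corresponds_psiCoeff`).  In the same way `X(h, z)` and the `h_n` with `n ≥ 0` are
derivations that agree on generators (`IsSigma.corresponds_heis`).

*The examples.*  If `v_n⁻¹ - 1` has order at least `n` in the parameters, then
`f(x) = (1 - x) g(x)`, where the coefficients of `g` and of `g⁻¹` with respect to the parameters are
polynomials in `x`.  Hence `σ = (z - w) g(w / z)` is an invertible element of `K`, and the poles of
`σ` and `σ⁻¹` at `z = w` have order at most one (`exists_isSigma`).  Both families satisfy this
hypothesis.
-/

noncomputable section
namespace HDQVA

/-! ### The Hopf algebra structure of the lattice algebra -/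

section LatticeHopf

variable {k : Type*} [Field k]

@[simp]
theorem latticeLift_hGen {B : Type*} [CommSemiring B] [Algebra k B] (x : ℕ → B)
    (y : Multiplicative ℤ →* B) (n : ℕ) : latticeLift k x y (hGen k n) = x n := by
  change Algebra.TensorProduct.productMap _ _ (MvPolynomial.X n ⊗ₜ 1) = _
  simp

@[simp]
theorem latticeLift_eGen {B : Type*} [CommSemiring B] [Algebra k B] (x : ℕ → B)
    (y : Multiplicative ℤ →* B) (m : ℤ) :
    latticeLift k x y (eGen k m) = y (Multiplicative.ofAdd m) := by
  change Algebra.TensorProduct.productMap _ _ (1 ⊗ₜ LaurentPolynomial.T m) = _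
  rw [Algebra.TensorProduct.productMap_apply_tmul, map_one, one_mul]
  exact (AddMonoidAlgebra.lift_single _ _ _).trans (one_smul _ _)

/-- The `h^{(n)}` and the `e^{mα}` generate the lattice algebra. -/
theorem adjoin_generators :
    Algebra.adjoin k (Set.range (hGen k) ∪ Set.range (eGen k)) = ⊤ := by
  rw [eq_top_iff]
  rintro x -
  obtain ⟨x, rfl⟩ := (LatticeV.of k).surjective x
  induction x with
  | zero => rw [map_zero]; exact zero_mem _
  | add x y hx hy => rw [map_add]; exact add_mem hx hy
  | tmul p q =>
    have h : LatticeV.of k (p ⊗ₜ q) = LatticeV.of k (p ⊗ₜ 1) * LatticeV.of k (1 ⊗ₜ q) := by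
      rw [← map_mul, Algebra.TensorProduct.tmul_mul_tmul, one_mul, mul_one]
    rw [h]
    refine mul_mem ?_ ?_
    · let f : MvPolynomial ℕ k →ₐ[k] LatticeV k :=
        (LatticeV.of k).toAlgHom.comp Algebra.TensorProduct.includeLeft
      change f p ∈ _
      rw [MvPolynomial.aeval_unique f]
      refine MvPolynomial.induction_on (motive := fun p => MvPolynomial.aeval _ p ∈ _) p ?_ ?_ ?_
      · intro a
        rw [MvPolynomial.aeval_C]
        exact Subalgebra.algebraMap_mem _ _
      · intro p q hp hq
        rw [map_add]; exact add_mem hp hq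
      · intro p n hp
        rw [map_mul, MvPolynomial.aeval_X]
        exact mul_mem hp (Algebra.subset_adjoin (Or.inl ⟨n, rfl⟩))
    · clear h
      induction q using LaurentPolynomial.induction_on' with
      | add p q hp hq => rw [TensorProduct.tmul_add, map_add]; exact add_mem hp hq
      | C_mul_T n a =>
        rw [← LaurentPolynomial.smul_eq_C_mul, TensorProduct.tmul_smul, map_smul]
        exact Subalgebra.smul_mem _ (Algebra.subset_adjoin (Or.inr ⟨n, rfl⟩ : eGen k n ∈ _)) _

theorem subalgebra_eq_top {S : Subalgebra k (LatticeV k)} (hh : ∀ n, hGen k n ∈ S)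
    (he : ∀ m, eGen k m ∈ S) : S = ⊤ := by
  rw [eq_top_iff, ← adjoin_generators, Algebra.adjoin_le_iff]
  rintro _ (⟨n, rfl⟩ | ⟨m, rfl⟩)
  exacts [hh n, he m]

/-- Induction over the generators of the lattice algebra. -/
theorem lattice_induction {p : LatticeV k → Prop} (hh : ∀ n, p (hGen k n))
    (he : ∀ m, p (eGen k m)) (algebraMap : ∀ c, p (algebraMap k _ c))
    (add : ∀ a b, p a → p b → p (a + b)) (mul : ∀ a b, p a → p b → p (a * b)) (a : LatticeV k) :
    p a := by
  have h : a ∈ Algebra.adjoin k (Set.range (hGen k) ∪ Set.range (eGen k)) := by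
    rw [adjoin_generators]; trivial
  induction h using Algebra.adjoin_induction with
  | mem x hx =>
    obtain ⟨n, rfl⟩ | ⟨m, rfl⟩ := hx
    exacts [hh n, he m]
  | algebraMap c => exact algebraMap c
  | add x y _ _ hx hy => exact add x y hx hy
  | mul x y _ _ hx hy => exact mul x y hx hy

theorem lattice_algHom_ext {B : Type*} [Semiring B] [Algebra k B] {f g : LatticeV k →ₐ[k] B}
    (hh : ∀ n, f (hGen k n) = g (hGen k n)) (he : ∀ m, f (eGen k m) = g (eGen k m)) : f = g := by
  have h : AlgHom.equalizer f g = ⊤ := subalgebra_eq_top hh he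
  ext a
  have : a ∈ AlgHom.equalizer f g := by rw [h]; trivial
  exact this

theorem chargeL_T (S : Type*) [CommRing S] (m : ℤ) :
    chargeL S (LaurentPolynomial.T m) = (m : S) • LaurentPolynomial.T m := by
  change (Finsupp.lsum S (fun m : ℤ => (m : S) • AddMonoidAlgebra.lsingle m))
    (Finsupp.single m (1 : S)) = _
  rw [Finsupp.lsum_single]
  rfl

theorem chargeL_mul (S : Type*) [CommRing S] (f g : S[T;T⁻¹]) :
    chargeL S (f * g) = chargeL S f * g + f * chargeL S g := by
  induction f using LaurentPolynomial.induction_on' with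
  | add p q hp hq => simp only [add_mul, map_add, hp, hq]; ring
  | C_mul_T n a =>
    induction g using LaurentPolynomial.induction_on' with
    | add p q hp hq => simp only [mul_add, map_add, hp, hq]; ring
    | C_mul_T m b =>
      simp only [← LaurentPolynomial.smul_eq_C_mul, smul_mul_smul_comm, map_smul,
        ← LaurentPolynomial.T_add, chargeL_T, Int.cast_add]
      rw [LaurentPolynomial.T_add, add_smul, smul_add, smul_mul_assoc, mul_smul_comm]

theorem latticeD_of_tmul (p : MvPolynomial ℕ k) (q : k[T;T⁻¹]) :
    latticeD k (LatticeV.of k (p ⊗ₜ q)) =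
      LatticeV.of k (MvPolynomial.mkDerivation k
        (fun n : ℕ => ((n : k) + 1) • (MvPolynomial.X (n + 1) : MvPolynomial ℕ k)) p ⊗ₜ q) +
      LatticeV.of k ((MvPolynomial.X 0 * p) ⊗ₜ chargeL k q) := by
  rw [← map_add]
  refine Eq.trans (b := LatticeV.of k (MvPolynomial.mkDerivation k
    (fun n : ℕ => ((n : k) + 1) • (MvPolynomial.X (n + 1) : MvPolynomial ℕ k)) p ⊗ₜ[k] q +
      (MvPolynomial.X 0 ⊗ₜ[k] 1) * (p ⊗ₜ[k] chargeL k q))) rfl ?_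
  rw [Algebra.TensorProduct.tmul_mul_tmul, one_mul]

/-- The infinitesimal translation is a derivation of the lattice algebra. -/
theorem latticeD_mul (a b : LatticeV k) :
    latticeD k (a * b) = latticeD k a * b + a * latticeD k b := by
  obtain ⟨a, rfl⟩ := (LatticeV.of k).surjective a
  obtain ⟨b, rfl⟩ := (LatticeV.of k).surjective b
  induction a with
  | zero => simp
  | add x y hx hy => simp only [map_add, add_mul, hx, hy]; ring
  | tmul p q =>
    induction b with
    | zero => simp
    | add x y hx hy => simp only [map_add, mul_add, hx, hy]; ring
    | tmul p' q' =>
      rw [← map_mul, Algebra.TensorProduct.tmul_mul_tmul]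
      simp only [latticeD_of_tmul, add_mul, mul_add, ← map_mul,
        Algebra.TensorProduct.tmul_mul_tmul, Derivation.leibniz, chargeL_mul,
        TensorProduct.add_tmul, TensorProduct.tmul_add, map_add, smul_eq_mul]
      rw [mul_comm p' (MvPolynomial.mkDerivation _ _ p), mul_left_comm p, ← mul_assoc _ p p']
      ring

@[simp]
theorem latticeD_hGen (n : ℕ) : latticeD k (hGen k n) = ((n : k) + 1) • hGen k (n + 1) := by
  rw [hGen, latticeD_of_tmul, MvPolynomial.mkDerivation_X, ← LaurentPolynomial.T_zero, chargeL_T]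
  simp [hGen, ← TensorProduct.smul_tmul', -TensorProduct.tmul_smul]

@[simp]
theorem latticeD_eGen (m : ℤ) : latticeD k (eGen k m) = (m : k) • (hGen k 0 * eGen k m) := by
  rw [eGen, latticeD_of_tmul, chargeL_T, hGen, ← map_mul, Algebra.TensorProduct.tmul_mul_tmul]
  simp

@[simp]
theorem latticeD_one : latticeD k 1 = 0 := by
  rw [← eGen_zero, latticeD_eGen]; simp

@[simp]
theorem latticeD_algebraMap (c : k) : latticeD k (algebraMap k _ c) = 0 := by
  rw [Algebra.algebraMap_eq_smul_one, map_smul, latticeD_one, smul_zero]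

@[simp]
theorem comul_hGen (n : ℕ) : comul k (hGen k n) = hGen k n ⊗ₜ 1 + 1 ⊗ₜ hGen k n :=
  latticeLift_hGen _ _ _

@[simp]
theorem comul_eGen (m : ℤ) : comul k (eGen k m) = eGen k m ⊗ₜ eGen k m :=
  latticeLift_eGen _ _ _

@[simp]
theorem counit_hGen (n : ℕ) : counit k (hGen k n) = 0 :=
  latticeLift_hGen _ _ _

@[simp]
theorem counit_eGen (m : ℤ) : counit k (eGen k m) = 1 :=
  latticeLift_eGen _ _ _

@[simp]
theorem antipode_hGen (n : ℕ) : antipode k (hGen k n) = - hGen k n :=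
  latticeLift_hGen _ _ _

@[simp]
theorem antipode_eGen (m : ℤ) : antipode k (eGen k m) = eGen k (-m) :=
  latticeLift_eGen _ _ _

/-- The coalgebra axioms are identities between algebra homomorphisms, hence are checked on
generators. -/
instance : Bialgebra k (LatticeV k) :=
  Bialgebra.ofAlgHom (comul k) (counit k)
    (lattice_algHom_ext
      (fun n => by
        simp [TensorProduct.add_tmul, TensorProduct.tmul_add, Algebra.TensorProduct.one_def,
          add_assoc])
      (fun m => by simp))
    (lattice_algHom_ext
      (fun n => by simp)
      (fun m => by simp))
    (lattice_algHom_ext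
      (fun n => by simp)
      (fun m => by simp))

theorem comul_eq (a : LatticeV k) : CoalgebraStruct.comul (R := k) a = comul k a := rfl

theorem counit_eq (a : LatticeV k) : CoalgebraStruct.counit (R := k) a = counit k a := rfl

/-- The lattice algebra is cocommutative, so that functionals on it with values in a commutative
algebra form a commutative algebra under convolution. -/
instance : Coalgebra.IsCocomm k (LatticeV k) where
  comm_comp_comul := by
    have h : (Algebra.TensorProduct.comm k (LatticeV k) (LatticeV k)).toAlgHom.comp (comul k) =
        comul k :=
      lattice_algHom_ext (fun n => by simp [add_comm]) (fun m => by simp)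
    exact congrArg AlgHom.toLinearMap h

/-- The antipode is the convolution inverse of the identity. -/
theorem mul_antipode (a : LatticeV k) :
    LinearMap.mul' k _ (LinearMap.rTensor _ (antipode k).toLinearMap (comul k a)) =
      algebraMap k _ (counit k a) := by
  have h : ((Algebra.TensorProduct.productMap (antipode k) (AlgHom.id k _)).comp (comul k)) =
      (Algebra.ofId k _).comp (counit k) :=
    lattice_algHom_ext (fun n => by simp) (fun m => by simp [← eGen_add, eGen_zero])
  refine Eq.trans ?_ (DFunLike.congr_fun h a)
  exact LinearMap.congr_fun (f := LinearMap.mul' k _ ∘ₗ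
    LinearMap.rTensor _ (antipode k).toLinearMap)
    (g := (Algebra.TensorProduct.productMap (antipode k) (AlgHom.id k _)).toLinearMap)
    (by ext; simp) _

/-- The infinitesimal translation is a coderivation. -/
theorem comul_latticeD (a : LatticeV k) :
    comul k (latticeD k a) = LinearMap.rTensor _ (latticeD k) (comul k a) +
      LinearMap.lTensor _ (latticeD k) (comul k a) := by
  have hr : ∀ x y : LatticeV k ⊗[k] LatticeV k, LinearMap.rTensor _ (latticeD k) (x * y) =
      LinearMap.rTensor _ (latticeD k) x * y + x * LinearMap.rTensor _ (latticeD k) y := by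
    intro x y
    induction x with
    | zero => simp
    | add x x' hx hy => simp only [map_add, add_mul, hx, hy]; abel
    | tmul p q =>
      induction y with
      | zero => simp
      | add x y hx hy => simp only [map_add, mul_add, hx, hy]; abel
      | tmul p' q' => simp [latticeD_mul, TensorProduct.add_tmul]
  have hl : ∀ x y : LatticeV k ⊗[k] LatticeV k, LinearMap.lTensor _ (latticeD k) (x * y) =
      LinearMap.lTensor _ (latticeD k) x * y + x * LinearMap.lTensor _ (latticeD k) y := by
    intro x y
    induction x with
    | zero => simp
    | add x x' hx hy => simp only [map_add, add_mul, hx, hy]; abel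
    | tmul p q =>
      induction y with
      | zero => simp
      | add x y hx hy => simp only [map_add, mul_add, hx, hy]; abel
      | tmul p' q' => simp [latticeD_mul, TensorProduct.tmul_add]
  induction a using lattice_induction with
  | hh n => simp [TensorProduct.smul_tmul']
  | he m => simp [TensorProduct.smul_tmul', add_mul, smul_add]
  | algebraMap c => simp [Algebra.TensorProduct.algebraMap_apply]
  | add a b ha hb => simp only [map_add, ha, hb]; abel
  | mul a b ha hb =>
    rw [latticeD_mul, map_add, map_mul, map_mul, map_mul, ha, hb, hr, hl]
    ring

theorem counit_latticeD (a : LatticeV k) : counit k (latticeD k a) = 0 := by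
  induction a using lattice_induction with
  | hh n => simp
  | he m => simp
  | algebraMap c => simp
  | add a b ha hb => rw [map_add, map_add, ha, hb, add_zero]
  | mul a b ha hb => rw [latticeD_mul, map_add, map_mul, map_mul, ha, hb]; ring

/-- In characteristic zero the lattice algebra is generated, as an algebra with derivation, by
`e^α` and its inverse. -/
theorem subalgebra_eq_top_of_latticeD [CharZero k] {S : Subalgebra k (LatticeV k)}
    (he : eGen k 1 ∈ S) (he' : eGen k (-1) ∈ S) (hD : ∀ a ∈ S, latticeD k a ∈ S) : S = ⊤ := by
  refine subalgebra_eq_top (fun n => ?_) (fun m => ?_)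
  · induction n with
    | zero =>
      have h := mul_mem (hD _ he) he'
      rwa [latticeD_eGen, smul_mul_assoc, mul_assoc, ← eGen_add, add_neg_cancel, eGen_zero,
        mul_one, Int.cast_one, one_smul] at h
    | succ n ih =>
      have h := S.smul_mem (hD _ ih) ((n : k) + 1)⁻¹
      rwa [latticeD_hGen, smul_smul, inv_mul_cancel₀ (Nat.cast_add_one_ne_zero n),
        one_smul] at h
  · induction m with
    | zero => rw [eGen_zero]; exact one_mem _
    | succ n ih => rw [eGen_add]; exact mul_mem ih he
    | pred n ih => rw [sub_eq_add_neg, eGen_add]; exact mul_mem ih he'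

end LatticeHopf

/-! ### Formal Laurent series and parameter-adic series over commutative algebras -/

section Series

variable {k : Type*} [CommRing k] {A B C : Type*} [AddCommMonoid A] [Module k A]
  [AddCommMonoid B] [Module k B] [AddCommMonoid C] [Module k C]

theorem coeff_seriesMul (β : A →ₗ[k] B →ₗ[k] C) (x : HahnSeries ℤ A) (y : HahnSeries ℤ B)
    (n : ℤ) : (seriesMul β x y).coeff n = ∑ᶠ i : ℤ, β (x.coeff i) (y.coeff (n - i)) := rfl

end Series

section SeriesAlgebra

variable {k : Type*} [Field k] {A B : Type*} [CommRing A] [Algebra k A] [CommRing B] [Algebra k B]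

/-- The product of Laurent series as a sum over all integers, in the form used by `seriesMul`. -/
theorem coeff_mul_eq_finsum (x y : HahnSeries ℤ A) (n : ℤ) :
    (x * y).coeff n = ∑ᶠ i : ℤ, x.coeff i * y.coeff (n - i) := by
  rw [HahnSeries.coeff_mul]
  symm
  rw [finsum_eq_sum_of_support_subset (s := (Finset.antidiagonal x.isPWO_support
    y.isPWO_support n).image Prod.fst)]
  · rw [Finset.sum_image]
    · refine Finset.sum_congr rfl fun p hp => ?_
      rw [Finset.mem_antidiagonal] at hp
      rw [← hp.2.2, add_sub_cancel_left]
    · intro p hp q hq h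
      rw [Finset.mem_coe, Finset.mem_antidiagonal] at hp hq
      exact Prod.ext h (by have := hp.2.2; have := hq.2.2; omega)
  · intro i hi
    rw [Function.mem_support] at hi
    rw [Finset.mem_coe, Finset.mem_image]
    refine ⟨(i, n - i), ?_, rfl⟩
    rw [Finset.mem_antidiagonal]
    refine ⟨?_, ?_, by simp⟩
    · exact fun h => hi (by simp [h])
    · exact fun h => hi (by simp [h])

theorem coeff_mul_eq_sum (x y : HahnSeries ℤ A) (n : ℤ) {s : Finset ℤ}
    (hs : ∀ i, x.coeff i ≠ 0 → y.coeff (n - i) ≠ 0 → i ∈ s) :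
    (x * y).coeff n = ∑ i ∈ s, x.coeff i * y.coeff (n - i) := by
  rw [coeff_mul_eq_finsum]
  exact finsum_eq_sum_of_support_subset _ fun i hi =>
    Finset.mem_coe.mpr (hs i (left_ne_zero_of_mul hi) (right_ne_zero_of_mul hi))

@[simp]
theorem coeff_hMap {X Y : Type*} [AddCommMonoid X] [Module k X] [AddCommMonoid Y] [Module k Y]
    (f : X →ₗ[k] Y) (x : HahnSeries ℤ X) (n : ℤ) : (hMap f x).coeff n = f (x.coeff n) := rfl

/-- Application of an algebra homomorphism to all coefficients of a Laurent series. -/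
def hMapAlg (f : A →ₐ[k] B) : HahnSeries ℤ A →ₐ[k] HahnSeries ℤ B :=
  AlgHom.ofLinearMap (hMap f.toLinearMap)
    (by ext n; simp [HahnSeries.coeff_one, apply_ite f])
    (fun x y => HahnSeries.map_mul (f : A →ₙ+* B))

@[simp]
theorem coeff_hMapAlg (f : A →ₐ[k] B) (x : HahnSeries ℤ A) (n : ℤ) :
    (hMapAlg f x).coeff n = f (x.coeff n) := rfl

theorem hMapAlg_single (f : A →ₐ[k] B) (n : ℤ) (a : A) :
    hMapAlg f (HahnSeries.single n a) = HahnSeries.single n (f a) := by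
  classical
  ext m
  rw [coeff_hMapAlg, HahnSeries.coeff_single, HahnSeries.coeff_single, apply_ite f, map_zero]

/-- The inclusion `A → A((x))` of the constants. -/
def hC (k A : Type*) [Field k] [CommRing A] [Algebra k A] : A →ₐ[k] HahnSeries ℤ A :=
  AlgHom.ofLinearMap
    { toFun := HahnSeries.C
      map_add' := map_add _
      map_smul' := fun c a => by ext n; by_cases h : n = 0 <;> simp [HahnSeries.C, h] }
    (map_one HahnSeries.C) (map_mul HahnSeries.C)

theorem hC_apply (a : A) : hC k A a = HahnSeries.single 0 a := rfl

/-- Multiplication of an `A`-valued series by a scalar series is the product in the ring of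
`A`-valued series. -/
theorem seriesMul_lsmul (x : HahnSeries ℤ k) (y : HahnSeries ℤ A) :
    seriesMul (LinearMap.lsmul k A) x y = hMapAlg (Algebra.ofId k A) x * y := by
  ext n
  rw [coeff_mul_eq_finsum, coeff_seriesMul]
  refine finsum_congr fun i => ?_
  exact Algebra.smul_def _ _

/-- The analogue of `seriesMul_lsmul` for double series. -/
theorem seriesMul_seriesMul_lsmul (x : HahnSeries ℤ (HahnSeries ℤ k))
    (y : HahnSeries ℤ (HahnSeries ℤ A)) :
    seriesMul (seriesMul (LinearMap.lsmul k A)) x y =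
      hMapAlg (hMapAlg (Algebra.ofId k A)) x * y := by
  ext n : 2
  rw [coeff_mul_eq_finsum, coeff_seriesMul]
  exact finsum_congr fun i => seriesMul_lsmul _ _

variable {τ : Type*}

theorem tC_eq_C (a : A) : tC k τ A a = MvPowerSeries.C a := by
  classical
  ext d
  rw [MvPowerSeries.coeff_C]
  change (if d = 0 then a else 0) = _
  congr

/-- The inclusion `A → A[[t]]` of the constants. -/
def tCAlg (k τ A : Type*) [Field k] [CommRing A] [Algebra k A] : A →ₐ[k] MvPowerSeries τ A :=
  AlgHom.ofLinearMap (tC k τ A) (by rw [tC_eq_C, map_one])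
    (fun a b => by rw [tC_eq_C, tC_eq_C, tC_eq_C, map_mul])

theorem tCAlg_apply (a : A) : tCAlg k τ A a = tC k τ A a := rfl

/-- Application of an algebra homomorphism to all coefficients of a parameter-adic series. -/
def tMapAlg (τ : Type*) (f : A →ₐ[k] B) : MvPowerSeries τ A →ₐ[k] MvPowerSeries τ B :=
  MvPowerSeries.mapAlgHom f

section
variable {X Y Z : Type*} [AddCommMonoid X] [Module k X] [AddCommMonoid Y] [Module k Y]
  [AddCommMonoid Z] [Module k Z]

@[simp]
theorem tMap_apply (f : X →ₗ[k] Y) (x : MvPowerSeries τ X) (d : τ →₀ ℕ) :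
    tMap τ f x d = f (x d) := rfl

open Classical in
theorem tC_apply (x : X) (d : τ →₀ ℕ) : tC k τ X x d = if d = 0 then x else 0 := rfl

theorem tMap_tC (f : X →ₗ[k] Y) (x : X) : tMap τ f (tC k τ X x) = tC k τ Y (f x) := by
  funext d
  rw [tMap_apply, tC_apply, tC_apply]
  split_ifs <;> simp

open Classical in
theorem tExt_apply (φ : X →ₗ[k] MvPowerSeries τ Y) (x : MvPowerSeries τ X) (d : τ →₀ ℕ) :
    tExt φ x d = ∑ p ∈ Finset.HasAntidiagonal.antidiagonal d, φ (x p.1) p.2 := rfl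

theorem tExt_tC (φ : X →ₗ[k] MvPowerSeries τ Y) (x : X) : tExt φ (tC k τ X x) = φ x := by
  classical
  funext d
  rw [tExt_apply]
  rw [Finset.sum_eq_single (0, d)]
  · rw [tC_apply, if_pos rfl]
  · rintro ⟨p, q⟩ h h'
    rw [Finset.HasAntidiagonal.mem_antidiagonal] at h
    rw [tC_apply, if_neg, map_zero]; · rfl
    rintro rfl
    exact h' (Prod.ext rfl (by simpa using h))
  · intro h
    simp at h

end

theorem mul_apply_antidiagonal (x y : MvPowerSeries τ A) (d : τ →₀ ℕ) :
    letI := Classical.decEq τ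
    (x * y) d = ∑ p ∈ Finset.HasAntidiagonal.antidiagonal d, x p.1 * y p.2 := by
  classical
  have := MvPowerSeries.coeff_mul (n := d) (φ := x) (ψ := y)
  simp only [MvPowerSeries.coeff_apply] at this
  convert this

theorem C_mul_apply (a : A) (x : MvPowerSeries τ A) (d : τ →₀ ℕ) :
    (tC k τ A a * x) d = a * x d := by
  rw [tC_eq_C]; exact MvPowerSeries.coeff_C_mul _ _ _

end SeriesAlgebra

/-! ### Extension of maps to series -/

section SeriesExtension

variable {k : Type*} [Field k] {τ : Type*} {A B : Type*} [CommRing A] [Algebra k A] [CommRing B]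
  [Algebra k B] {X : Type*} [AddCommMonoid X] [Module k X]

theorem seriesSum_apply {Y ι : Type*} [AddCommMonoid Y] (s : Finset ι) (f : ι → MvPowerSeries τ Y)
    (d : τ →₀ ℕ) : (∑ i ∈ s, f i) d = ∑ i ∈ s, f i d :=
  Finset.sum_apply d s f

theorem hLift_apply {Y : Type*} [AddCommMonoid Y] [Module k Y] (φ : X →ₗ[k] MvPowerSeries τ Y)
    (F : HahnSeries ℤ X) (d : τ →₀ ℕ) (n : ℤ) : (hLift φ F d).coeff n = φ (F.coeff n) d := rfl

theorem tExt_hLift_const_mul (u : B) (ψ : X →ₗ[k] MvPowerSeries τ B)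
    (F : MvPowerSeries τ (HahnSeries ℤ X)) :
    tExt (hLift (LinearMap.mulLeft k (tC k τ B u) ∘ₗ ψ)) F =
      tC k τ _ (hC k B u) * tExt (hLift ψ) F := by
  funext d
  rw [C_mul_apply, tExt_apply, tExt_apply, Finset.mul_sum]
  refine Finset.sum_congr rfl fun p _ => ?_
  ext n
  rw [hC_apply, HahnSeries.coeff_single_zero_mul, hLift_apply, hLift_apply]
  exact C_mul_apply _ _ _

theorem tExt_hLift_sum {Y ι : Type*} [AddCommGroup Y] [Module k Y] (s : Finset ι)
    (φ : ι → X →ₗ[k] MvPowerSeries τ Y) (F : MvPowerSeries τ (HahnSeries ℤ X)) :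
    tExt (hLift (∑ i ∈ s, φ i)) F = ∑ i ∈ s, tExt (hLift (φ i)) F := by
  classical
  induction s using Finset.induction_on with
  | empty =>
    funext d
    rw [Finset.sum_empty, Finset.sum_empty, tExt_apply]
    refine Finset.sum_eq_zero fun p _ => ?_
    ext n
    rfl
  | insert i s hi ih =>
    rw [Finset.sum_insert hi, Finset.sum_insert hi, hLift_add, tExt_add, LinearMap.add_apply, ih]

/-- A Leibniz rule for `φ` on products, `φ (x y) = Σ φ'_i(x) φ''_i(y)`, extends to Laurent
series. -/
theorem hLift_mul {ι : Type*} (s : Finset ι) (φ : A →ₗ[k] MvPowerSeries τ B)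
    (φ' φ'' : ι → A →ₗ[k] MvPowerSeries τ B)
    (h : ∀ x y, φ (x * y) = ∑ i ∈ s, φ' i x * φ'' i y) (F G : HahnSeries ℤ A) :
    hLift φ (F * G) = ∑ i ∈ s, hLift (φ' i) F * hLift (φ'' i) G := by
  classical
  funext d
  ext n
  rw [hLift_apply, coeff_mul_eq_sum F G n (s := Finset.Icc F.order (n - G.order))]
  · rw [seriesSum_apply, HahnSeries.coeff_sum, map_sum, seriesSum_apply]
    simp only [h, seriesSum_apply]
    rw [Finset.sum_comm]
    refine Finset.sum_congr rfl fun i _ => ?_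
    simp only [mul_apply_antidiagonal]
    rw [HahnSeries.coeff_sum, Finset.sum_comm]
    refine Finset.sum_congr rfl fun p _ => ?_
    rw [coeff_mul_eq_sum _ _ n (s := Finset.Icc F.order (n - G.order))]
    · rfl
    · intro j h1 h2
      rw [hLift_apply] at h1 h2
      rw [Finset.mem_Icc]
      constructor
      · by_contra hj
        rw [HahnSeries.coeff_eq_zero_of_lt_order (not_le.mp hj), map_zero] at h1
        exact h1 rfl
      · by_contra hj
        rw [HahnSeries.coeff_eq_zero_of_lt_order (x := G) (i := n - j) (by linarith),
          map_zero] at h2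
        exact h2 rfl
  · intro j h1 h2
    rw [Finset.mem_Icc]
    constructor
    · by_contra hj
      exact h1 (HahnSeries.coeff_eq_zero_of_lt_order (not_le.mp hj))
    · by_contra hj
      exact h2 (HahnSeries.coeff_eq_zero_of_lt_order (by linarith))

/-- Exchange of the first two parts of a decomposition of `d` into three parts. -/
theorem sum_antidiagonal_rotate {M : Type*} [AddCommMonoid M] {N : Type*} [AddCommMonoid N]
    [Finset.HasAntidiagonal N] (f : N → N → N → M) (d : N) :
    ∑ p ∈ Finset.HasAntidiagonal.antidiagonal d,
      ∑ q ∈ Finset.HasAntidiagonal.antidiagonal p.2, f q.1 p.1 q.2 =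
    ∑ p ∈ Finset.HasAntidiagonal.antidiagonal d,
      ∑ q ∈ Finset.HasAntidiagonal.antidiagonal p.2, f p.1 q.1 q.2 := by
  rw [Finset.sum_sigma', Finset.sum_sigma']
  refine Finset.sum_nbij' (fun x => ⟨(x.2.1, x.1.1 + x.2.2), (x.1.1, x.2.2)⟩)
    (fun x => ⟨(x.2.1, x.1.1 + x.2.2), (x.1.1, x.2.2)⟩) ?_ ?_ ?_ ?_ ?_
  · rintro ⟨⟨a, b⟩, ⟨c, e⟩⟩ h
    simp only [Finset.mem_sigma, Finset.HasAntidiagonal.mem_antidiagonal] at h ⊢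
    exact ⟨by rw [← h.1, ← h.2, add_left_comm], trivial⟩
  · rintro ⟨⟨a, b⟩, ⟨c, e⟩⟩ h
    simp only [Finset.mem_sigma, Finset.HasAntidiagonal.mem_antidiagonal] at h ⊢
    exact ⟨by rw [← h.1, ← h.2, add_left_comm], trivial⟩
  · rintro ⟨⟨a, b⟩, ⟨c, e⟩⟩ h
    simp only [Finset.mem_sigma, Finset.HasAntidiagonal.mem_antidiagonal] at h
    simp [← h.2]
  · rintro ⟨⟨a, b⟩, ⟨c, e⟩⟩ h
    simp only [Finset.mem_sigma, Finset.HasAntidiagonal.mem_antidiagonal] at h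
    simp [← h.2]
  · rintro ⟨⟨a, b⟩, ⟨c, e⟩⟩ _
    rfl

/-- The Leibniz rule of `hLift_mul` for the extension of `φ` to parameter-adic series, when one
factor does not involve the parameters. -/
theorem tExt_hLift_tC_mul {ι : Type*} (s : Finset ι) (φ : A →ₗ[k] MvPowerSeries τ B)
    (φ' φ'' : ι → A →ₗ[k] MvPowerSeries τ B)
    (h : ∀ x y, φ (x * y) = ∑ i ∈ s, φ' i x * φ'' i y) (F : HahnSeries ℤ A)
    (G : MvPowerSeries τ (HahnSeries ℤ A)) :
    tExt (hLift φ) (tC k τ _ F * G) =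
      ∑ i ∈ s, hLift (φ' i) F * tExt (hLift (φ'' i)) G := by
  classical
  funext d
  rw [tExt_apply, seriesSum_apply]
  simp only [C_mul_apply, hLift_mul s φ φ' φ'' h, seriesSum_apply]
  rw [Finset.sum_comm]
  refine Finset.sum_congr rfl fun i _ => ?_
  simp only [mul_apply_antidiagonal, tExt_apply, Finset.mul_sum]
  convert sum_antidiagonal_rotate (fun a b c => hLift (φ' i) F a * hLift (φ'' i) (G b) c) d

/-- The extension of `φ` is linear over scalar series. -/
theorem tExt_hLift_scalar_mul (φ : A →ₗ[k] MvPowerSeries τ B)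
    (s : MvPowerSeries τ (HahnSeries ℤ k)) (c : A) :
    tExt (hLift φ) (tC k τ _ (hC k A c) * tMapAlg τ (hMapAlg (Algebra.ofId k A)) s) =
      tMapAlg τ (hC k B) (φ c) * tMapAlg τ (hMapAlg (Algebra.ofId k B)) s := by
  classical
  funext d
  rw [mul_comm (tMapAlg τ (hC k B) (φ c)), mul_apply_antidiagonal, tExt_apply]
  convert Finset.sum_congr rfl fun p _ => ?_
  ext n
  rw [hLift_apply, C_mul_apply, hC_apply, HahnSeries.coeff_single_zero_mul,
    mul_comm (_ : HahnSeries ℤ B)]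
  change _ = (HahnSeries.single 0 (φ c p.2) * hMapAlg (Algebra.ofId k B) (s p.1)).coeff n
  rw [HahnSeries.coeff_single_zero_mul]
  change φ (c * algebraMap k A ((s p.1).coeff n)) p.2 =
    φ c p.2 * algebraMap k B ((s p.1).coeff n)
  rw [mul_comm, ← Algebra.smul_def, map_smul, mul_comm, ← Algebra.smul_def]
  rfl

end SeriesExtension

/-! ### Diagonal operators on cocommutative coalgebras -/

section Diagonal

open Coalgebra (IsCocomm)
open WithConv

variable {k : Type*} [Field k] {τ : Type*} {𝒦 𝒦' : Type*} [CommRing 𝒦] [Algebra k 𝒦]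
  [CommRing 𝒦'] [Algebra k 𝒦']
variable {C C' Z : Type*} [AddCommGroup C] [Module k C] [Coalgebra k C]
  [AddCommGroup C'] [Module k C'] [Coalgebra k C'] [AddCommGroup Z] [Module k Z]

/-- The canonical map `X ⊗ 𝒦[[t]] → (𝒦 ⊗ X)[[t]]`. -/
def costrength (k τ 𝒦 X : Type*) [Field k] [CommRing 𝒦] [Algebra k 𝒦] [AddCommGroup X]
    [Module k X] : X ⊗[k] MvPowerSeries τ 𝒦 →ₗ[k] MvPowerSeries τ (𝒦 ⊗[k] X) :=
  strength k τ 𝒦 X ∘ₗ (TensorProduct.comm k _ _).toLinearMap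

theorem costrength_tmul (x : Z) (s : MvPowerSeries τ 𝒦) (d : τ →₀ ℕ) :
    costrength k τ 𝒦 Z (x ⊗ₜ s) d = s d ⊗ₜ x := rfl

/-- The operator `x ↦ Σ χ(x'') x'` defined by a functional `χ` on a coalgebra. -/
def diagOp (χ : C →ₗ[k] MvPowerSeries τ 𝒦) : C →ₗ[k] MvPowerSeries τ (𝒦 ⊗[k] C) :=
  costrength k τ 𝒦 C ∘ₗ LinearMap.lTensor C χ ∘ₗ CoalgebraStruct.comul

/-- The `𝒦`-linear extension of an operator, computed on `X ⊗ 𝒦[[t]]`. -/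
theorem kExt_costrength {X : Type*} [AddCommGroup X] [Module k X]
    (φ : X →ₗ[k] MvPowerSeries τ (𝒦 ⊗[k] Z)) (y : X)
    (s : MvPowerSeries τ 𝒦) (w : Z ⊗[k] MvPowerSeries τ 𝒦) (h : φ y = costrength k τ 𝒦 Z w) :
    kExt φ (costrength k τ 𝒦 X (y ⊗ₜ s)) =
      costrength k τ 𝒦 Z (LinearMap.lTensor Z (LinearMap.mulLeft k s) w) := by
  classical
  have h1 : kExt φ (costrength k τ 𝒦 X (y ⊗ₜ s)) = fun d =>
      ∑ p ∈ Finset.HasAntidiagonal.antidiagonal d,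
        LinearMap.rTensor Z (LinearMap.mulLeft k (s p.1)) (costrength k τ 𝒦 Z w p.2) := by
    funext d
    rw [← h, kExt, tExt_apply]
    convert rfl
    rfl
  rw [h1]
  clear h1 h
  induction w with
  | zero =>
    funext d
    simp only [map_zero]
    exact Finset.sum_eq_zero fun p _ => map_zero _
  | add u v hu hv =>
    rw [map_add, map_add, map_add, ← hu, ← hv]
    funext d
    refine Eq.trans ?_ Finset.sum_add_distrib
    exact Finset.sum_congr rfl fun p _ => map_add _ _ _
  | tmul z u =>
    funext d
    rw [LinearMap.lTensor_tmul, costrength_tmul, LinearMap.mulLeft_apply, mul_apply_antidiagonal,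
      TensorProduct.sum_tmul]
    convert rfl
    rfl

/-- The composition of diagonal operators is the diagonal operator of the convolution product. -/
theorem kComp_diagOp (χ ψ : C →ₗ[k] MvPowerSeries τ 𝒦) :
    kComp (diagOp χ) (diagOp ψ) = diagOp (toConv χ * toConv ψ).ofConv := by
  let G : C ⊗[k] MvPowerSeries τ 𝒦 →ₗ[k] C ⊗[k] MvPowerSeries τ 𝒦 :=
    LinearMap.lTensor C (LinearMap.mul' k _) ∘ₗ (TensorProduct.assoc k _ _ _).toLinearMap ∘ₗ
      LinearMap.rTensor _ (LinearMap.lTensor C χ ∘ₗ CoalgebraStruct.comul)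
  have hG : kExt (diagOp χ) ∘ₗ costrength k τ 𝒦 C = costrength k τ 𝒦 C ∘ₗ G := by
    refine TensorProduct.ext' fun y s => ?_
    rw [LinearMap.comp_apply, kExt_costrength (diagOp χ) y s
      (LinearMap.lTensor C χ (CoalgebraStruct.comul y)) rfl, LinearMap.comp_apply]
    congr 1
    simp only [G, LinearMap.comp_apply, LinearMap.rTensor_tmul, LinearEquiv.coe_coe]
    induction LinearMap.lTensor C χ (CoalgebraStruct.comul (R := k) y) with
    | zero => simp
    | add u v hu hv => simp only [map_add, TensorProduct.add_tmul, hu, hv]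
    | tmul z u => simp [mul_comm]
  ext x : 1
  refine (LinearMap.congr_fun hG _).trans ?_
  change costrength k τ 𝒦 C _ = costrength k τ 𝒦 C _
  congr 1
  -- `G` maps `Σ y' ⊗ ψ(y'')` to `Σ y' ⊗ χ(y'') ψ(y''')`
  have h3 : ∀ v : C ⊗[k] C, G (LinearMap.lTensor C ψ v) =
      LinearMap.lTensor C (LinearMap.mul' k _ ∘ₗ TensorProduct.map χ ψ)
        (TensorProduct.assoc k _ _ _ (LinearMap.rTensor C CoalgebraStruct.comul v)) := by
    intro v
    induction v with
    | zero => simp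
    | add u v hu hv => simp only [map_add, hu, hv]
    | tmul y y' =>
      simp only [G, LinearMap.comp_apply, LinearMap.rTensor_tmul, LinearEquiv.coe_coe,
        LinearMap.lTensor_tmul]
      induction CoalgebraStruct.comul (R := k) y with
      | zero => simp
      | add u v hu hv => simp only [map_add, TensorProduct.add_tmul, hu, hv]
      | tmul z u => simp
  refine (h3 _).trans ?_
  rw [Coalgebra.coassoc_apply, ← LinearMap.comp_apply (LinearMap.lTensor C _),
    ← LinearMap.lTensor_comp]
  rfl

/-- Over a cocommutative coalgebra convolution, hence the composition of diagonal operators, is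
commutative. -/
theorem diagOp_comm [IsCocomm k C] (χ ψ : C →ₗ[k] MvPowerSeries τ 𝒦) :
    kComp (diagOp χ) (diagOp ψ) = kComp (diagOp ψ) (diagOp χ) := by
  rw [kComp_diagOp, kComp_diagOp, mul_comm]

theorem costrength_one (x : Z) :
    costrength k τ 𝒦 Z (x ⊗ₜ 1) = kId k τ 𝒦 Z x := by
  classical
  funext d
  rw [costrength_tmul]
  have h : (1 : MvPowerSeries τ 𝒦) d = if d = 0 then 1 else 0 := MvPowerSeries.coeff_one d
  rw [h]
  change _ = (1 : 𝒦) ⊗ₜ[k] (if d = 0 then x else 0)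
  split_ifs <;> simp

theorem diagOp_one : diagOp (1 : WithConv (C →ₗ[k] MvPowerSeries τ 𝒦)).ofConv =
    kId k τ 𝒦 C := by
  ext x : 1
  rw [← costrength_one]
  refine congrArg (costrength k τ 𝒦 C) ?_
  rw [LinearMap.convOne_def]
  change LinearMap.lTensor C (_ ∘ₗ _) _ = _
  rw [LinearMap.lTensor_comp, LinearMap.comp_apply, Coalgebra.lTensor_counit_comul]
  simp

theorem kMap_diagOp (f : 𝒦 →ₗ[k] 𝒦') (χ : C →ₗ[k] MvPowerSeries τ 𝒦) :
    kMap f (diagOp χ) = diagOp (tMap τ f ∘ₗ χ) := by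
  have h : tMap τ (LinearMap.rTensor C f) ∘ₗ costrength k τ 𝒦 C =
      costrength k τ 𝒦' C ∘ₗ LinearMap.lTensor C (tMap τ f) :=
    TensorProduct.ext' fun y s => rfl
  ext x : 1
  refine (LinearMap.congr_fun h _).trans ?_
  rw [diagOp, LinearMap.lTensor_comp]
  rfl

/-- The action of a diagonal operator on the first tensor factor is diagonal, with the functional
extended by the counit. -/
theorem tensorId_diagOp (χ : C →ₗ[k] MvPowerSeries τ 𝒦) :
    tensorId C' (diagOp χ) = diagOp (χ ∘ₗ (TensorProduct.rid k C).toLinearMap ∘ₗ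
      LinearMap.lTensor C CoalgebraStruct.counit) := by
  refine TensorProduct.ext' fun x z => ?_
  change tMap τ (TensorProduct.assoc k 𝒦 C C').toLinearMap (strength k τ (𝒦 ⊗[k] C) C'
    (costrength k τ 𝒦 C (LinearMap.lTensor C χ (CoalgebraStruct.comul x)) ⊗ₜ z)) =
    costrength k τ 𝒦 (C ⊗[k] C') (LinearMap.lTensor (C ⊗[k] C') _
      (TensorProduct.tensorTensorTensorComm k C C C' C'
        (CoalgebraStruct.comul x ⊗ₜ CoalgebraStruct.comul z)))
  have hz := Coalgebra.lTensor_counit_comul (R := k) z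
  induction CoalgebraStruct.comul (R := k) x with
  | zero => simp
  | add u v hu hv => simp only [map_add, TensorProduct.add_tmul, hu, hv]
  | tmul y y' =>
    have h : ∀ v : C' ⊗[k] C', LinearMap.lTensor (C ⊗[k] C')
        (χ ∘ₗ (TensorProduct.rid k C).toLinearMap ∘ₗ LinearMap.lTensor C CoalgebraStruct.counit)
        (TensorProduct.tensorTensorTensorComm k C C C' C' ((y ⊗ₜ y') ⊗ₜ v)) =
        (y ⊗ₜ TensorProduct.rid k C' (LinearMap.lTensor C' CoalgebraStruct.counit v)) ⊗ₜ χ y' := by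
      intro v
      induction v with
      | zero => simp
      | add u v hu hv =>
        simp only [map_add, TensorProduct.tmul_add, TensorProduct.add_tmul, hu, hv]
      | tmul z z' => simp [TensorProduct.smul_tmul]
    rw [h, hz]
    funext d
    rw [TensorProduct.rid_tmul, one_smul]
    rfl

/-- Transport of a diagonal operator along an isomorphism of coalgebras. -/
theorem conj_diagOp (e : C ≃ₗ[k] C')
    (he : ∀ x, CoalgebraStruct.comul (R := k) (e x) =
      TensorProduct.map e.toLinearMap e.toLinearMap (CoalgebraStruct.comul x))
    (χ : C →ₗ[k] MvPowerSeries τ 𝒦) :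
    conj e (diagOp χ) = diagOp (χ ∘ₗ e.symm.toLinearMap) := by
  ext y : 1
  obtain ⟨x, rfl⟩ := e.surjective y
  have h : tMap τ (LinearMap.lTensor 𝒦 e.toLinearMap) ∘ₗ costrength k τ 𝒦 C =
      costrength k τ 𝒦 C' ∘ₗ LinearMap.rTensor _ e.toLinearMap :=
    TensorProduct.ext' fun y s => rfl
  change tMap τ (LinearMap.lTensor 𝒦 e.toLinearMap) (costrength k τ 𝒦 C
    (LinearMap.lTensor C χ (CoalgebraStruct.comul (e.symm (e x))))) =
    costrength k τ 𝒦 C' (LinearMap.lTensor C' _ (CoalgebraStruct.comul (e x)))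
  rw [e.symm_apply_apply, he]
  refine (LinearMap.congr_fun h _).trans ?_
  rw [LinearMap.comp_apply]
  congr 1
  induction CoalgebraStruct.comul (R := k) x with
  | zero => simp
  | add u v hu hv => simp only [map_add, hu, hv]
  | tmul y y' => simp

theorem toK_eq_costrength {X : Type*} [AddCommGroup X] [Module k X] (f : X →ₗ[k] Z) (x : X) :
    toK 𝒦 (tC k τ Z ∘ₗ f) x = costrength k τ 𝒦 Z (f x ⊗ₜ 1) :=
  (costrength_one (f x)).symm

/-- A coderivation `𝔇` acts on a diagonal operator through its functional. -/
theorem commutator_diagOp (𝔇 : C →ₗ[k] C)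
    (h𝔇 : ∀ x, CoalgebraStruct.comul (R := k) (𝔇 x) =
      LinearMap.rTensor C 𝔇 (CoalgebraStruct.comul x) +
        LinearMap.lTensor C 𝔇 (CoalgebraStruct.comul x))
    (ρ : C →ₗ[k] MvPowerSeries τ 𝒦) :
    kComp (toK 𝒦 (tC k τ C ∘ₗ 𝔇)) (diagOp ρ) - kComp (diagOp ρ) (toK 𝒦 (tC k τ C ∘ₗ 𝔇)) =
      - diagOp (ρ ∘ₗ 𝔇) := by
  have h1 : kExt (toK 𝒦 (tC k τ C ∘ₗ 𝔇)) ∘ₗ costrength k τ 𝒦 C =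
      costrength k τ 𝒦 C ∘ₗ LinearMap.rTensor _ 𝔇 := by
    refine TensorProduct.ext' fun y s => ?_
    rw [LinearMap.comp_apply, kExt_costrength _ _ _ _ (toK_eq_costrength 𝔇 y)]
    simp
  have h2 : kComp (diagOp ρ) (toK 𝒦 (tC k τ C ∘ₗ 𝔇)) = diagOp ρ ∘ₗ 𝔇 := by
    ext x : 1
    rw [kComp, LinearMap.comp_apply, toK_eq_costrength, kExt_costrength (diagOp ρ) _ _
      (LinearMap.lTensor C ρ (CoalgebraStruct.comul (𝔇 x))) rfl,
      LinearMap.mulLeft_one, LinearMap.lTensor_id]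
    rfl
  rw [h2]
  ext x : 1
  rw [LinearMap.sub_apply, LinearMap.neg_apply]
  have h3 : kComp (toK 𝒦 (tC k τ C ∘ₗ 𝔇)) (diagOp ρ) x = costrength k τ 𝒦 C
      (LinearMap.rTensor _ 𝔇 (LinearMap.lTensor C ρ (CoalgebraStruct.comul x))) :=
    LinearMap.congr_fun h1 _
  rw [h3]
  change _ - costrength k τ 𝒦 C (LinearMap.lTensor C ρ (CoalgebraStruct.comul (𝔇 x))) =
    - costrength k τ 𝒦 C (LinearMap.lTensor C (ρ ∘ₗ 𝔇) (CoalgebraStruct.comul x))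
  rw [h𝔇, map_add, map_add, LinearMap.lTensor_comp, ← LinearMap.comp_apply (LinearMap.rTensor _ 𝔇),
    LinearMap.rTensor_comp_lTensor, ← LinearMap.comp_apply _ (LinearMap.rTensor C 𝔇),
    LinearMap.lTensor_comp_rTensor, LinearMap.comp_apply]
  abel

theorem tensorId_toK {X : Type*} [AddCommGroup X] [Module k X] (f : X →ₗ[k] X) :
    tensorId Z (toK 𝒦 (tC k τ X ∘ₗ f)) = toK 𝒦 (tC k τ (X ⊗[k] Z) ∘ₗ LinearMap.rTensor Z f) := by
  refine TensorProduct.ext' fun x z => ?_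
  rw [toK_eq_costrength]
  change tMap τ (TensorProduct.assoc k 𝒦 X Z).toLinearMap (strength k τ (𝒦 ⊗[k] X) Z
    (toK 𝒦 (tC k τ X ∘ₗ f) x ⊗ₜ z)) = _
  rw [toK_eq_costrength]
  rfl

theorem conj_toK {X Y : Type*} [AddCommGroup X] [Module k X] [AddCommGroup Y] [Module k Y]
    (e : X ≃ₗ[k] Y) (f : X →ₗ[k] X) :
    conj e (toK 𝒦 (tC k τ X ∘ₗ f)) =
      toK 𝒦 (tC k τ Y ∘ₗ e.toLinearMap ∘ₗ f ∘ₗ e.symm.toLinearMap) := by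
  ext y : 1
  rw [toK_eq_costrength]
  change tMap τ (LinearMap.lTensor 𝒦 e.toLinearMap)
    (toK 𝒦 (tC k τ X ∘ₗ f) (e.symm y)) = _
  rw [toK_eq_costrength]
  rfl

end Diagonal

/-! ### Derivations and expansions of the coefficient ring -/

section KRingStructure

variable {k : Type*} [Field k] {ι : Type*}

/-- The ring of coefficients is generated by the variables and the inverses of the variables and of
their differences. -/
theorem KRing.subalgebra_eq_top {S : Subalgebra k (KRing k ι)} (hv : ∀ i, KRing.var k i ∈ S)
    (hi : ∀ i u, KRing.var k i * u = 1 → u ∈ S)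
    (hd : ∀ i j u, i ≠ j → (KRing.var k i - KRing.var k j) * u = 1 → u ∈ S) : S = ⊤ := by
  have hp : ∀ p : MvPolynomial ι k, algebraMap _ (KRing k ι) p ∈ S := by
    intro p
    induction p using MvPolynomial.induction_on with
    | C a =>
      rw [← MvPolynomial.algebraMap_eq, ← IsScalarTower.algebraMap_apply]
      exact S.algebraMap_mem a
    | add p q hp hq => rw [map_add]; exact add_mem hp hq
    | mul_X p i hp => rw [map_mul]; exact mul_mem hp (hv i)
  have hs : ∀ s ∈ kSet k ι, ∃ u ∈ S, algebraMap _ (KRing k ι) s * u = 1 := by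
    intro s hs
    induction hs using Submonoid.closure_induction with
    | mem s hs =>
      obtain ⟨i, rfl⟩ | ⟨i, j, hij, rfl⟩ := hs
      · obtain ⟨u, hu⟩ := (KRing.isUnit_var (k := k) i).exists_right_inv
        exact ⟨u, hi i u hu, hu⟩
      · obtain ⟨u, hu⟩ := (KRing.isUnit_var_sub (k := k) hij).exists_right_inv
        exact ⟨u, hd i j u hij hu, by rw [map_sub]; exact hu⟩
    | one => exact ⟨1, one_mem _, by simp⟩
    | mul p q _ _ h1 h2 =>
      obtain ⟨u, hu, hu'⟩ := h1
      obtain ⟨v, hv, hv'⟩ := h2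
      exact ⟨u * v, mul_mem hu hv, by rw [map_mul, mul_mul_mul_comm, hu', hv', one_mul]⟩
  rw [eq_top_iff]
  rintro x -
  obtain ⟨p, s, rfl⟩ := IsLocalization.exists_mk'_eq (kSet k ι) x
  obtain ⟨u, hu, hu'⟩ := hs s s.2
  have h : IsLocalization.mk' (KRing k ι) p s = algebraMap _ _ p * u := by
    rw [IsLocalization.mk'_eq_iff_eq_mul, mul_right_comm, mul_assoc, hu', mul_one]
  rw [h]
  exact mul_mem (hp p) hu

theorem KRing.algHom_ext {B : Type*} [CommRing B] [Algebra k B] {f g : KRing k ι →ₐ[k] B}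
    (h : ∀ i, f (KRing.var k i) = g (KRing.var k i)) : f = g := by
  have hu : ∀ x u : KRing k ι, f x = g x → x * u = 1 → f u = g u := by
    intro x u hx hxu
    have h1 : f x * f u = 1 := by rw [← map_mul, hxu, map_one]
    have h2 : g x * g u = 1 := by rw [← map_mul, hxu, map_one]
    calc f u = (g x * g u) * f u := by rw [h2, one_mul]
      _ = g u * (f x * f u) := by rw [hx]; ring
      _ = g u := by rw [h1, mul_one]
  have hS : AlgHom.equalizer f g = ⊤ := KRing.subalgebra_eq_top h
    (fun i u => hu _ u (h i)) (fun i j u _ => hu _ u (by rw [map_sub, map_sub, h, h]))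
  ext x
  have : x ∈ AlgHom.equalizer f g := by rw [hS]; trivial
  exact this

@[simp]
theorem KRing.lift_var {B : Type*} [CommRing B] [Algebra k B] (x : ι → B)
    (hx : ∀ i, IsUnit (x i)) (hd : ∀ i j, i ≠ j → IsUnit (x i - x j)) (i : ι) :
    KRing.lift x hx hd (KRing.var k i) = x i := by
  refine (IsLocalization.lift_eq _ _).trans ?_
  exact MvPolynomial.aeval_X _ _

theorem KRing.fst_toDual (i : ι) (x : KRing k ι) : (KRing.toDual k i x).fst = x := by
  have h : (TrivSqZeroExt.fstHom k (KRing k ι) (KRing k ι)).comp (KRing.toDual k i) =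
      AlgHom.id k _ := by
    refine KRing.algHom_ext fun j => ?_
    rw [AlgHom.comp_apply, KRing.toDual, KRing.lift_var]
    split_ifs <;> simp
  exact DFunLike.congr_fun h x

theorem KRing.partialD_mul (i : ι) (x y : KRing k ι) :
    KRing.partialD k i (x * y) = x * KRing.partialD k i y + KRing.partialD k i x * y := by
  change (KRing.toDual k i (x * y)).snd = _
  rw [map_mul, TrivSqZeroExt.snd_mul, KRing.fst_toDual, KRing.fst_toDual]
  simp only [smul_eq_mul, MulOpposite.smul_eq_mul_unop, MulOpposite.unop_op]
  rfl

open Classical in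
theorem KRing.partialD_var (i j : ι) :
    KRing.partialD k i (KRing.var k j) = if j = i then 1 else 0 := by
  change (KRing.toDual k i _).snd = _
  rw [KRing.toDual, KRing.lift_var]
  split_ifs <;> simp

@[simp]
theorem KRing.partialD_algebraMap (i : ι) (c : k) :
    KRing.partialD k i (algebraMap k _ c) = 0 := by
  change (KRing.toDual k i _).snd = 0
  rw [AlgHom.commutes]
  rfl

/-- Two maps that satisfy the Leibniz rule along an algebra homomorphism agree if they agree on
the variables. -/
theorem KRing.leibniz_ext {B : Type*} [CommRing B] [Algebra k B] (f : KRing k ι →ₐ[k] B)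
    {δ δ' : KRing k ι →ₗ[k] B} (hδ : ∀ x y, δ (x * y) = f x * δ y + δ x * f y)
    (hδ' : ∀ x y, δ' (x * y) = f x * δ' y + δ' x * f y)
    (h : ∀ i, δ (KRing.var k i) = δ' (KRing.var k i)) : δ = δ' := by
  -- the Leibniz rule for `x u = 1` determines the value on the inverse `u`
  have h1 : ∀ x u : KRing k ι, δ x = δ' x → x * u = 1 → δ u = δ' u := by
    intro x u hx hxu
    have hone : δ 1 = δ' 1 := by
      have e := hδ 1 1
      have e' := hδ' 1 1
      simp only [mul_one, map_one, one_mul] at e e'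
      rw [left_eq_add.mp e, left_eq_add.mp e']
    have e := hδ x u
    have e' := hδ' x u
    rw [hxu] at e e'
    have hf : f x * f u = 1 := by rw [← map_mul, hxu, map_one]
    have e2 : f x * δ u = f x * δ' u := by
      rw [hone, e', hx] at e
      exact (add_right_cancel e).symm
    calc δ u = (f x * f u) * δ u := by rw [hf, one_mul]
      _ = f u * (f x * δ u) := by ring
      _ = (f x * f u) * δ' u := by rw [e2]; ring
      _ = δ' u := by rw [hf, one_mul]
  have hone : ∀ c, δ (algebraMap k _ c) = δ' (algebraMap k _ c) := by
    intro c
    have e := hδ 1 1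
    have e' := hδ' 1 1
    simp only [mul_one, map_one, one_mul] at e e'
    rw [Algebra.algebraMap_eq_smul_one, map_smul, map_smul, left_eq_add.mp e, left_eq_add.mp e']
  let S : Subalgebra k (KRing k ι) :=
    { carrier := {x | δ x = δ' x}
      mul_mem' := fun {x y} hx hy => by
        rw [Set.mem_ofPred_eq] at *
        rw [hδ, hδ', hx, hy]
      add_mem' := fun {x y} hx hy => by
        rw [Set.mem_ofPred_eq] at *
        rw [map_add, map_add, hx, hy]
      algebraMap_mem' := hone }
  have hS : S = ⊤ := KRing.subalgebra_eq_top h (fun i u => h1 _ u (h i))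
    (fun i j u _ => h1 _ u (by rw [map_sub, map_sub, h, h]))
  ext x
  have : x ∈ S := by rw [hS]; trivial
  exact this

theorem KRing.partialD_comm (i j : ι) (x : KRing k ι) :
    KRing.partialD k i (KRing.partialD k j x) = KRing.partialD k j (KRing.partialD k i x) := by
  have h : KRing.partialD k i ∘ₗ KRing.partialD k j - KRing.partialD k j ∘ₗ KRing.partialD k i =
      0 := by
    refine KRing.leibniz_ext (AlgHom.id k _) (fun x y => ?_) (fun x y => by simp) (fun l => ?_)
    · simp only [LinearMap.sub_apply, LinearMap.comp_apply, KRing.partialD_mul, map_add,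
        AlgHom.coe_id, id_eq]
      ring
    · classical
      have h0 : ∀ i, KRing.partialD k i (1 : KRing k ι) = 0 := fun i => by
        rw [← map_one (algebraMap k _), KRing.partialD_algebraMap]
      simp only [LinearMap.sub_apply, LinearMap.comp_apply, KRing.partialD_var]
      split_ifs <;> simp [h0]
  exact sub_eq_zero.mp (LinearMap.congr_fun h x)

@[simp]
theorem swapK_var_zero : swapK k (KRing.var k 0) = KRing.var k 1 := by
  rw [swapK, KRing.rename, KRing.lift_var]; rfl

@[simp]
theorem swapK_var_one : swapK k (KRing.var k 1) = KRing.var k 0 := by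
  rw [swapK, KRing.rename, KRing.lift_var]; rfl

theorem swapK_comp_swapK : (swapK k).comp (swapK k) = AlgHom.id k _ := by
  refine KRing.algHom_ext fun i => ?_
  fin_cases i <;> simp

@[simp]
theorem swapK_swapK (x : KRing k (Fin 2)) : swapK k (swapK k x) = x :=
  DFunLike.congr_fun swapK_comp_swapK x

theorem swapK_partialD_one (x : KRing k (Fin 2)) :
    swapK k (KRing.partialD k 1 x) = KRing.partialD k 0 (swapK k x) := by
  have h : (swapK k).toLinearMap ∘ₗ KRing.partialD k 1 =
      KRing.partialD k 0 ∘ₗ (swapK k).toLinearMap := by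
    refine KRing.leibniz_ext (swapK k) (fun x y => ?_) (fun x y => ?_) (fun i => ?_)
    · simp [KRing.partialD_mul]
    · simp [KRing.partialD_mul]
    · fin_cases i <;> simp [KRing.partialD_var]
  exact LinearMap.congr_fun h x

theorem swapK_partialD_zero (x : KRing k (Fin 2)) :
    swapK k (KRing.partialD k 0 x) = KRing.partialD k 1 (swapK k x) := by
  rw [← swapK_swapK x, ← swapK_partialD_one, swapK_swapK, swapK_swapK]

end KRingStructure

section Expansion

variable {k : Type*} [Field k] {A : Type*} [CommRing A] [Algebra k A]

@[simp]
theorem expand_var_zero :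
    expand k (KRing.var k 0) = HahnSeries.single 0 (HahnSeries.single 1 1) := by
  rw [expand, KRing.lift_var]; rfl

@[simp]
theorem expand_var_one : expand k (KRing.var k 1) = HahnSeries.single 1 1 := by
  rw [expand, KRing.lift_var]; rfl

/-- The derivative of a formal Laurent series. -/
def hDeriv (k : Type*) [Field k] (A : Type*) [AddCommGroup A] [Module k A] :
    HahnSeries ℤ A →ₗ[k] HahnSeries ℤ A where
  toFun x := HahnSeries.ofSuppBddBelow (fun n => ((n + 1 : ℤ) : k) • x.coeff (n + 1))
    ⟨x.order - 1, fun n hn => by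
      by_contra h
      refine hn ?_
      change _ • _ = _
      rw [HahnSeries.coeff_eq_zero_of_lt_order (by linarith), smul_zero]⟩
  map_add' x y := by ext n; exact smul_add _ _ _
  map_smul' c x := by ext n; exact smul_comm _ _ _

@[simp]
theorem coeff_hDeriv {A : Type*} [AddCommGroup A] [Module k A] (x : HahnSeries ℤ A) (n : ℤ) :
    (hDeriv k A x).coeff n = ((n + 1 : ℤ) : k) • x.coeff (n + 1) := rfl

theorem hDeriv_mul (x y : HahnSeries ℤ A) :
    hDeriv k A (x * y) = x * hDeriv k A y + hDeriv k A x * y := by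
  ext n
  have hx : ∀ i, x.coeff i ≠ 0 → x.order ≤ i := fun i h => by
    by_contra hi
    exact h (HahnSeries.coeff_eq_zero_of_lt_order (not_le.mp hi))
  have hy : ∀ i, y.coeff i ≠ 0 → y.order ≤ i := fun i h => by
    by_contra hi
    exact h (HahnSeries.coeff_eq_zero_of_lt_order (not_le.mp hi))
  have h2 : (hDeriv k A x * y).coeff n = ∑ i ∈ Finset.Icc x.order (n + 1 - y.order),
      (i : k) • (x.coeff i * y.coeff (n + 1 - i)) := by
    rw [coeff_mul_eq_sum _ _ n (s := (Finset.Icc x.order (n + 1 - y.order)).map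
      (Equiv.subRight (1 : ℤ)).toEmbedding), Finset.sum_map]
    · refine Finset.sum_congr rfl fun i _ => ?_
      simp only [Equiv.toEmbedding_apply, Equiv.subRight_apply, coeff_hDeriv, sub_add_cancel]
      rw [smul_mul_assoc, show n - (i - 1) = n + 1 - i by ring]
    · intro i h1 h2
      rw [coeff_hDeriv] at h1
      have h1 := hx _ (right_ne_zero_of_smul h1)
      have h2 := hy _ h2
      simp only [Finset.mem_map_equiv, Finset.mem_Icc]
      change x.order ≤ i + 1 ∧ i + 1 ≤ _
      omega
  rw [HahnSeries.coeff_add, h2, coeff_hDeriv,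
    coeff_mul_eq_sum x y (n + 1) (s := Finset.Icc x.order (n + 1 - y.order)),
    coeff_mul_eq_sum x _ n (s := Finset.Icc x.order (n + 1 - y.order)), Finset.smul_sum,
    ← Finset.sum_add_distrib]
  · refine Finset.sum_congr rfl fun i _ => ?_
    rw [coeff_hDeriv, mul_smul_comm, show n - i + 1 = n + 1 - i by ring, ← add_smul,
      ← Int.cast_add, sub_add_cancel]
  · intro i h1 h2
    rw [coeff_hDeriv] at h2
    have h1 := hx _ h1
    have h2 := hy _ (right_ne_zero_of_smul h2)
    rw [Finset.mem_Icc]; omega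
  · intro i h1 h2
    have h1 := hx _ h1
    have h2 := hy _ h2
    rw [Finset.mem_Icc]; omega

theorem hDeriv_single (n : ℤ) (a : A) :
    hDeriv k A (HahnSeries.single n a) = HahnSeries.single (n - 1) ((n : k) • a) := by
  classical
  ext m
  rw [coeff_hDeriv, HahnSeries.coeff_single, HahnSeries.coeff_single]
  by_cases h : m = n - 1
  · subst h; simp
  · rw [if_neg h, if_neg (by omega), smul_zero]

/-- The expansion in the region `|z| > |w|` intertwines `∂_z` with the derivative of the
coefficients, which are series in the inner variable `z`. -/
theorem expand_partialD_zero (x : KRing k (Fin 2)) :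
    expand k (KRing.partialD k 0 x) = hMap (hDeriv k k) (expand k x) := by
  have h : (expand k).toLinearMap ∘ₗ KRing.partialD k 0 =
      hMap (hDeriv k k) ∘ₗ (expand k).toLinearMap := by
    refine KRing.leibniz_ext (expand k) (fun x y => ?_) (fun x y => ?_) (fun i => ?_)
    · simp [KRing.partialD_mul]
    · simp only [LinearMap.comp_apply, AlgHom.toLinearMap_apply, map_mul]
      ext1; funext n
      rw [coeff_hMap, HahnSeries.coeff_add, coeff_mul_eq_finsum, coeff_mul_eq_finsum,
        coeff_mul_eq_finsum, ← finsum_add_distrib]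
      · rw [← LinearMap.toAddMonoidHom_coe, AddMonoidHom.map_finsum]
        · exact finsum_congr fun i => hDeriv_mul _ _
        · exact finite_support_mul (LinearMap.mul k _) _ _ n
      · exact finite_support_mul (LinearMap.mul k _) _ _ n
      · exact finite_support_mul (LinearMap.mul k _) _ _ n
    · classical
      fin_cases i
      · simp only [LinearMap.comp_apply, AlgHom.toLinearMap_apply, KRing.partialD_var,
          Fin.zero_eta, if_true, map_one, expand_var_zero]
        ext1; funext n
        rw [coeff_hMap, HahnSeries.coeff_single, apply_ite (hDeriv k k), hDeriv_single, map_zero,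
          HahnSeries.coeff_one]
        simp
      · simp only [LinearMap.comp_apply, AlgHom.toLinearMap_apply, KRing.partialD_var,
          Fin.mk_one, expand_var_one]
        ext1; funext n
        rw [coeff_hMap, HahnSeries.coeff_single, apply_ite (hDeriv k k)]
        rw [← HahnSeries.single_zero_one, hDeriv_single]
        simp
  exact LinearMap.congr_fun h x

/-- The expansion in the region `|z| > |w|` intertwines `∂_w` with the derivative in the outer
variable `w`. -/
theorem expand_partialD_one (x : KRing k (Fin 2)) :
    expand k (KRing.partialD k 1 x) = hDeriv k _ (expand k x) := by
  have h : (expand k).toLinearMap ∘ₗ KRing.partialD k 1 =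
      hDeriv k _ ∘ₗ (expand k).toLinearMap := by
    refine KRing.leibniz_ext (expand k) (fun x y => ?_) (fun x y => ?_) (fun i => ?_)
    · simp [KRing.partialD_mul]
    · simp [hDeriv_mul]
    · classical
      fin_cases i
      · simp only [LinearMap.comp_apply, AlgHom.toLinearMap_apply, KRing.partialD_var,
          Fin.zero_eta, expand_var_zero, hDeriv_single]
        simp
      · simp only [LinearMap.comp_apply, AlgHom.toLinearMap_apply, KRing.partialD_var,
          Fin.mk_one, expand_var_one, hDeriv_single]
        simp
  exact LinearMap.congr_fun h x

end Expansion

/-! ### Comparison of expansions in two regions -/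

section TransposedPairs

variable {k : Type*} [Field k] {A B : Type*} [CommRing A] [Algebra k A] [CommRing B] [Algebra k B]

theorem order_le_of_coeff_ne_zero {A : Type*} [Zero A] {x : HahnSeries ℤ A} {i : ℤ}
    (h : x.coeff i ≠ 0) : x.order ≤ i := by
  by_contra hi
  exact h (HahnSeries.coeff_eq_zero_of_lt_order (not_le.mp hi))

/-- The pairs `(x, y)`, `x ∈ A((z))((w))` and `y ∈ A((w))((z))`, with the same coefficients. Such
series are Laurent series in both variables, so that these pairs form an algebra. -/
def transposedPairs (k A : Type*) [Field k] [CommRing A] [Algebra k A] :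
    Subalgebra k (HahnSeries ℤ (HahnSeries ℤ A) × HahnSeries ℤ (HahnSeries ℤ A)) where
  carrier := {p | ∀ m n : ℤ, (p.1.coeff n).coeff m = (p.2.coeff m).coeff n}
  mul_mem' := by
    rintro ⟨x, y⟩ ⟨x', y'⟩ h h'
    simp only [Set.mem_ofPred_eq] at h h' ⊢
    intro m n
    simp only [Prod.fst_mul, Prod.snd_mul]
    rw [coeff_mul_eq_sum x x' n (s := Finset.Icc x.order (n - x'.order)),
      coeff_mul_eq_sum y y' m (s := Finset.Icc y.order (m - y'.order)),
      HahnSeries.coeff_sum, HahnSeries.coeff_sum]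
    · have e1 : ∀ i, (x.coeff i * x'.coeff (n - i)).coeff m =
          ∑ j ∈ Finset.Icc y.order (m - y'.order),
            (x.coeff i).coeff j * (x'.coeff (n - i)).coeff (m - j) := by
        intro i
        refine coeff_mul_eq_sum _ _ _ fun j h1 h2 => ?_
        rw [h] at h1
        rw [h'] at h2
        have h3 := order_le_of_coeff_ne_zero (x := y) (i := j) (fun e => h1 (by rw [e]; rfl))
        have h4 := order_le_of_coeff_ne_zero (x := y') (i := m - j) (fun e => h2 (by rw [e]; rfl))
        rw [Finset.mem_Icc]; omega
      have e2 : ∀ j, (y.coeff j * y'.coeff (m - j)).coeff n =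
          ∑ i ∈ Finset.Icc x.order (n - x'.order),
            (y.coeff j).coeff i * (y'.coeff (m - j)).coeff (n - i) := by
        intro j
        refine coeff_mul_eq_sum _ _ _ fun i h1 h2 => ?_
        rw [← h] at h1
        rw [← h'] at h2
        have h3 := order_le_of_coeff_ne_zero (x := x) (i := i) (fun e => h1 (by rw [e]; rfl))
        have h4 := order_le_of_coeff_ne_zero (x := x') (i := n - i) (fun e => h2 (by rw [e]; rfl))
        rw [Finset.mem_Icc]; omega
      -- both coefficients are the same double sum, which is finite by the bounds for the orders in
      -- both variables
      simp only [e1, e2]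
      rw [Finset.sum_comm]
      simp only [h, h']
    · intro j h1 h2
      have h3 := order_le_of_coeff_ne_zero h1
      have h4 := order_le_of_coeff_ne_zero h2
      rw [Finset.mem_Icc]; omega
    · intro j h1 h2
      have h3 := order_le_of_coeff_ne_zero h1
      have h4 := order_le_of_coeff_ne_zero h2
      rw [Finset.mem_Icc]; omega
  add_mem' := by
    rintro ⟨x, y⟩ ⟨x', y'⟩ h h'
    simp only [Set.mem_ofPred_eq] at h h' ⊢
    intro m n
    simp [h, h']
  algebraMap_mem' := by
    intro c m n
    change ((HahnSeries.single 0 (HahnSeries.single 0 (algebraMap k A c)) :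
      HahnSeries ℤ (HahnSeries ℤ A)).coeff n).coeff m =
      ((HahnSeries.single 0 (HahnSeries.single 0 (algebraMap k A c)) :
      HahnSeries ℤ (HahnSeries ℤ A)).coeff m).coeff n
    simp only [HahnSeries.coeff_single]
    split_ifs <;> simp_all

theorem mem_transposedPairs {p : HahnSeries ℤ (HahnSeries ℤ A) × HahnSeries ℤ (HahnSeries ℤ A)} :
    p ∈ transposedPairs k A ↔ ∀ m n : ℤ, (p.1.coeff n).coeff m = (p.2.coeff m).coeff n := Iff.rfl

/-- A series in the inner variable, paired with the same series in the outer variable. -/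
theorem const_mem_transposedPairs (x : HahnSeries ℤ A) :
    (hC k _ x, hMapAlg (hC k A) x) ∈ transposedPairs k A := by
  intro m n
  change ((HahnSeries.single 0 x : HahnSeries ℤ (HahnSeries ℤ A)).coeff n).coeff m =
    (HahnSeries.single 0 (x.coeff m)).coeff n
  rw [HahnSeries.coeff_single, HahnSeries.coeff_single]
  split_ifs <;> simp

theorem swap_mem_transposedPairs
    {p : HahnSeries ℤ (HahnSeries ℤ A) × HahnSeries ℤ (HahnSeries ℤ A)}
    (hp : p ∈ transposedPairs k A) : (p.2, p.1) ∈ transposedPairs k A :=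
  fun m n => (hp n m).symm

/-- The expansions of a function of two variables in the two regions. -/
def expandPair (k : Type*) [Field k] : KRing k (Fin 2) →ₐ[k]
    LaurentSeries (LaurentSeries k) × LaurentSeries (LaurentSeries k) :=
  (expand k).prod ((expand k).comp (swapK k))

/-- The functions with the same expansion in both regions: those without a pole at `z = w`. -/
def noDiagonalPole (k : Type*) [Field k] : Subalgebra k (KRing k (Fin 2)) :=
  (transposedPairs k k).comap (expandPair k)

theorem mem_noDiagonalPole {x : KRing k (Fin 2)} : x ∈ noDiagonalPole k ↔ ∀ m n : ℤ,
    ((expand k x).coeff n).coeff m = ((expand k (swapK k x)).coeff m).coeff n := Iff.rfl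

theorem expandPair_var_zero : expandPair k (KRing.var k 0) =
    (hC k (HahnSeries ℤ k) (HahnSeries.single 1 1),
      hMapAlg (hC k k) (HahnSeries.single 1 1)) := by
  rw [hMapAlg_single, map_one (hC k k)]
  exact Prod.ext (expand_var_zero (k := k))
    ((congrArg (expand k) (swapK_var_zero (k := k))).trans (expand_var_one (k := k)))

theorem var_zero_mem_noDiagonalPole : KRing.var k 0 ∈ noDiagonalPole k := by
  change expandPair k _ ∈ transposedPairs k k
  rw [expandPair_var_zero]
  exact const_mem_transposedPairs _

theorem swapK_mem_noDiagonalPole {x : KRing k (Fin 2)} (hx : x ∈ noDiagonalPole k) :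
    swapK k x ∈ noDiagonalPole k := by
  rw [mem_noDiagonalPole] at hx ⊢
  intro m n
  rw [swapK_swapK, hx]

/-- The inverse of `z` has the same expansion in both regions, unlike that of `z - w`. -/
theorem inv_var_zero_mem_noDiagonalPole {u : KRing k (Fin 2)} (hu : KRing.var k 0 * u = 1) :
    u ∈ noDiagonalPole k := by
  have h2 : expandPair k (KRing.var k 0) * (hC k (HahnSeries ℤ k) (HahnSeries.single (-1) 1),
      hMapAlg (hC k k) (HahnSeries.single (-1) 1)) = 1 := by
    rw [expandPair_var_zero]
    refine Prod.ext ?_ ?_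
    · change hC k (HahnSeries ℤ k) _ * hC k _ _ = 1
      rw [← map_mul, HahnSeries.single_mul_single, add_neg_cancel, mul_one]
      exact map_one (hC k (HahnSeries ℤ k))
    · change hMapAlg (hC k k) _ * hMapAlg _ _ = 1
      rw [← map_mul, HahnSeries.single_mul_single, add_neg_cancel, mul_one]
      exact map_one (hMapAlg (hC k k))
  have h4 : expandPair k (KRing.var k 0) * expandPair k u = 1 := by rw [← map_mul, hu, map_one]
  change expandPair k u ∈ transposedPairs k k
  rw [inv_unique h4 h2]
  exact const_mem_transposedPairs _

theorem var_one_mem_noDiagonalPole : KRing.var k 1 ∈ noDiagonalPole k := by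
  rw [← swapK_var_zero]
  exact swapK_mem_noDiagonalPole var_zero_mem_noDiagonalPole

theorem inv_var_one_mem_noDiagonalPole {u : KRing k (Fin 2)} (hu : KRing.var k 1 * u = 1) :
    u ∈ noDiagonalPole k := by
  rw [← swapK_swapK u]
  refine swapK_mem_noDiagonalPole (inv_var_zero_mem_noDiagonalPole ?_)
  rw [← swapK_var_one, ← map_mul, hu, map_one]

/-- Every element of the coefficient ring has a pole of finite order at `z = w`. -/
theorem exists_pow_mul_mem_noDiagonalPole (x : KRing k (Fin 2)) :
    ∃ N : ℕ, ∀ N' ≥ N, (KRing.var k 0 - KRing.var k 1) ^ N' * x ∈ noDiagonalPole k := by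
  have hz := var_zero_mem_noDiagonalPole (k := k)
  have hw := var_one_mem_noDiagonalPole (k := k)
  have hzw := sub_mem hz hw
  let S : Subalgebra k (KRing k (Fin 2)) :=
    { carrier := {x | ∃ N : ℕ, ∀ N' ≥ N,
        (KRing.var k 0 - KRing.var k 1) ^ N' * x ∈ noDiagonalPole k}
      mul_mem' := by
        rintro x y ⟨N, hN⟩ ⟨M, hM⟩
        refine ⟨N + M, fun N' hN' => ?_⟩
        have h : N' = N + (N' - N) := by omega
        rw [h, pow_add, mul_mul_mul_comm]
        exact mul_mem (hN N le_rfl) (hM _ (by omega))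
      add_mem' := by
        rintro x y ⟨N, hN⟩ ⟨M, hM⟩
        refine ⟨max N M, fun N' hN' => ?_⟩
        rw [mul_add]
        exact add_mem (hN _ (le_of_max_le_left hN')) (hM _ (le_of_max_le_right hN'))
      algebraMap_mem' := fun c =>
        ⟨0, fun N' _ => mul_mem (pow_mem hzw _) (Subalgebra.algebraMap_mem _ _)⟩ }
  have hle : ∀ x ∈ noDiagonalPole k, x ∈ S := fun x hx =>
    ⟨0, fun N' _ => mul_mem (pow_mem hzw _) hx⟩
  have hS : S = ⊤ := by
    refine KRing.subalgebra_eq_top (fun i => ?_) (fun i u hu => ?_) (fun i j u hij hu => ?_)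
    · fin_cases i
      exacts [hle _ hz, hle _ hw]
    · fin_cases i
      exacts [hle _ (inv_var_zero_mem_noDiagonalPole hu), hle _ (inv_var_one_mem_noDiagonalPole hu)]
    · refine ⟨1, fun N' hN' => ?_⟩
      obtain ⟨n, rfl⟩ : ∃ n, N' = n + 1 := ⟨N' - 1, by omega⟩
      have : (KRing.var k 0 - KRing.var k 1) * u ∈ noDiagonalPole k := by
        fin_cases i <;> fin_cases j
        · exact absurd rfl hij
        · refine (congrArg (· ∈ noDiagonalPole k) hu).mpr (one_mem _)
        · rw [← neg_sub, neg_mul]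
          exact neg_mem ((congrArg (· ∈ noDiagonalPole k) hu).mpr (one_mem _))
        · exact absurd rfl hij
      rw [pow_succ, mul_assoc]
      exact mul_mem (pow_mem hzw _) this
  have : x ∈ S := by rw [hS]; trivial
  exact this

end TransposedPairs

section TransposedSeries

variable {k : Type*} [Field k] {τ : Type*} {A B : Type*} [CommRing A] [Algebra k A] [CommRing B]
  [Algebra k B]

end TransposedSeries

/-! ### The braiding of a bicharacter -/

section TensorCoalgebra

variable {k : Type*} [Field k] {C D E : Type*} [AddCommGroup C] [Module k C] [Coalgebra k C]
  [AddCommGroup D] [Module k D] [Coalgebra k D] [AddCommGroup E] [Module k E] [Coalgebra k E]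

theorem comul_tmul (x : C) (y : D) : CoalgebraStruct.comul (R := k) (x ⊗ₜ[k] y) =
    TensorProduct.tensorTensorTensorComm k C C D D
      (CoalgebraStruct.comul x ⊗ₜ CoalgebraStruct.comul y) := rfl

theorem comul_comm (x : C ⊗[k] D) :
    CoalgebraStruct.comul (R := k) (TensorProduct.comm k C D x) =
      TensorProduct.map (TensorProduct.comm k C D).toLinearMap
        (TensorProduct.comm k C D).toLinearMap (CoalgebraStruct.comul x) := by
  induction x with
  | zero => simp only [map_zero]
  | add u v hu hv => simp only [map_add, hu, hv]
  | tmul x y =>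
    rw [TensorProduct.comm_tmul, comul_tmul, comul_tmul]
    induction CoalgebraStruct.comul (R := k) x with
    | zero => simp
    | add u v hu hv => simp only [map_add, TensorProduct.add_tmul, TensorProduct.tmul_add, hu, hv]
    | tmul x x' =>
      induction CoalgebraStruct.comul (R := k) y with
      | zero => simp
      | add u v hu hv =>
        simp only [map_add, TensorProduct.add_tmul, TensorProduct.tmul_add, hu, hv]
      | tmul y y' => simp

/-- The associativity constraint is a homomorphism of coalgebras. -/
theorem comul_assoc_symm (x : C ⊗[k] (D ⊗[k] E)) :
    CoalgebraStruct.comul (R := k) ((TensorProduct.assoc k C D E).symm x) =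
      TensorProduct.map (TensorProduct.assoc k C D E).symm.toLinearMap
        (TensorProduct.assoc k C D E).symm.toLinearMap (CoalgebraStruct.comul x) := by
  have h := (CoalgHomClass.map_comp_comul_apply
    (Coalgebra.TensorProduct.assoc k k C D E).symm x).symm
  exact h

theorem comul_rightComm (x : (C ⊗[k] D) ⊗[k] E) :
    CoalgebraStruct.comul (R := k) (TensorProduct.rightComm k C D E x) =
      TensorProduct.map (TensorProduct.rightComm k C D E).toLinearMap
        (TensorProduct.rightComm k C D E).toLinearMap (CoalgebraStruct.comul x) := by
  induction x with
  | zero => simp only [map_zero]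
  | add u v hu hv => simp only [map_add, hu, hv]
  | tmul u z =>
    induction u with
    | zero => simp only [TensorProduct.zero_tmul, map_zero]
    | add u v hu hv => simp only [map_add, TensorProduct.add_tmul, hu, hv]
    | tmul x y =>
      rw [TensorProduct.rightComm_tmul]
      simp only [comul_tmul]
      induction CoalgebraStruct.comul (R := k) x with
      | zero => simp
      | add u v hu hv => simp only [map_add, TensorProduct.add_tmul, hu, hv]
      | tmul x x' =>
        induction CoalgebraStruct.comul (R := k) y with
        | zero => simp
        | add u v hu hv =>
          simp only [map_add, TensorProduct.add_tmul, TensorProduct.tmul_add, hu, hv]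
        | tmul y y' =>
          induction CoalgebraStruct.comul (R := k) z with
          | zero => simp
          | add u v hu hv =>
            simp only [map_add, TensorProduct.add_tmul, TensorProduct.tmul_add, hu, hv]
          | tmul y y' => simp

/-- A coderivation of `C`, acting on the first factor, is a coderivation of `C ⊗ D`. -/
theorem comul_rTensor_coderivation {δ : C →ₗ[k] C}
    (hδ : ∀ x, CoalgebraStruct.comul (R := k) (δ x) =
      LinearMap.rTensor C δ (CoalgebraStruct.comul x) +
        LinearMap.lTensor C δ (CoalgebraStruct.comul x)) (x : C ⊗[k] D) :
    CoalgebraStruct.comul (R := k) (LinearMap.rTensor D δ x) =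
      LinearMap.rTensor _ (LinearMap.rTensor D δ) (CoalgebraStruct.comul x) +
        LinearMap.lTensor _ (LinearMap.rTensor D δ) (CoalgebraStruct.comul x) := by
  induction x with
  | zero => simp only [map_zero, add_zero]
  | add u v hu hv => simp only [map_add, hu, hv]; abel
  | tmul x y =>
    rw [LinearMap.rTensor_tmul, comul_tmul, comul_tmul, hδ]
    induction CoalgebraStruct.comul (R := k) x with
    | zero => simp
    | add u v hu hv =>
      simp only [map_add, TensorProduct.add_tmul] at hu hv ⊢
      have huv := congrArg₂ (· + ·) hu hv
      convert huv using 1 <;> abel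
    | tmul x x' =>
      induction CoalgebraStruct.comul (R := k) y with
      | zero => simp
      | add u v hu hv =>
        simp only [map_add, TensorProduct.add_tmul, TensorProduct.tmul_add] at hu hv ⊢
        have huv := congrArg₂ (· + ·) hu hv
        convert huv using 1
        abel
      | tmul y y' => simp [TensorProduct.add_tmul]

end TensorCoalgebra

section Conv

open WithConv

variable {k : Type*} [Field k] {C : Type*} [AddCommGroup C] [Module k C] [Coalgebra k C]
  {A B : Type*} [CommRing A] [Algebra k A] [CommRing B] [Algebra k B]

/-- Functionals compatible with a coderivation and a derivation are closed under convolution. -/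
theorem conv_coderivation {𝔇 : C →ₗ[k] C} {δ : A →ₗ[k] A}
    (h𝔇 : ∀ x, CoalgebraStruct.comul (R := k) (𝔇 x) =
      LinearMap.rTensor C 𝔇 (CoalgebraStruct.comul x) +
        LinearMap.lTensor C 𝔇 (CoalgebraStruct.comul x))
    (hδ : ∀ x y, δ (x * y) = x * δ y + δ x * y) {f g : WithConv (C →ₗ[k] A)}
    (hf : ∀ x, f (𝔇 x) = δ (f x)) (hg : ∀ x, g (𝔇 x) = δ (g x)) (x : C) :
    (f * g) (𝔇 x) = δ ((f * g) x) := by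
  rw [LinearMap.convMul_apply, LinearMap.convMul_apply, h𝔇]
  induction CoalgebraStruct.comul (R := k) x with
  | zero => simp
  | add u v hu hv =>
    simp only [map_add] at hu hv ⊢
    rw [← hu, ← hv]; abel
  | tmul y y' =>
    simp only [map_add, LinearMap.rTensor_tmul, LinearMap.lTensor_tmul, TensorProduct.map_tmul,
      LinearMap.mul'_apply]
    have h1 := hf y
    have h2 := hg y'
    change f.ofConv (𝔇 y) = δ (f.ofConv y) at h1
    change g.ofConv (𝔇 y') = δ (g.ofConv y') at h2
    rw [hδ, h1, h2, add_comm]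

theorem mul'_map_mem (S : Subalgebra k A) {X Y : Type*} [AddCommGroup X] [Module k X]
    [AddCommGroup Y] [Module k Y] {f : X →ₗ[k] A} {g : Y →ₗ[k] A} (hf : ∀ x, f x ∈ S)
    (hg : ∀ x, g x ∈ S) (x : X ⊗[k] Y) : LinearMap.mul' k A (TensorProduct.map f g x) ∈ S := by
  induction x with
  | zero => simp
  | add u v hu hv => rw [map_add, map_add]; exact add_mem hu hv
  | tmul y y' => exact mul_mem (hf y) (hg y')

theorem tMap_leibniz {τ : Type*} {δ : A →ₗ[k] A} (hδ : ∀ x y, δ (x * y) = x * δ y + δ x * y)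
    (x y : MvPowerSeries τ A) :
    tMap τ δ (x * y) = x * tMap τ δ y + tMap τ δ x * y := by
  funext d
  change δ ((x * y) d) = (x * tMap τ δ y) d + (tMap τ δ x * y) d
  rw [mul_apply_antidiagonal, mul_apply_antidiagonal, mul_apply_antidiagonal, map_sum,
    ← Finset.sum_add_distrib]
  exact Finset.sum_congr rfl fun p _ => hδ _ _

end Conv

section Braiding

open WithConv

variable {k : Type*} [Field k] {τ : Type*} {σ : MvPowerSeries τ (KRing k (Fin 2))}
  {r : LatticeV k ⊗[k] LatticeV k →ₗ[k] MvPowerSeries τ (KRing k (Fin 2))}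

theorem conv_eq (r s : LatticeV k ⊗[k] LatticeV k →ₗ[k] MvPowerSeries τ (KRing k (Fin 2))) :
    conv r s = (toConv r * toConv s).ofConv := rfl

theorem transpose_apply (a b : LatticeV k) :
    transpose r (a ⊗ₜ b) = tMap τ (swapK k).toLinearMap (r (b ⊗ₜ a)) := rfl

theorem transpose_transpose : transpose (transpose r) = r := by
  refine TensorProduct.ext' fun a b => ?_
  rw [transpose_apply, transpose_apply]
  funext d
  exact swapK_swapK _

theorem transpose_conv
    (r s : LatticeV k ⊗[k] LatticeV k →ₗ[k] MvPowerSeries τ (KRing k (Fin 2))) :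
    toConv (transpose (conv r s)) = toConv (transpose r) * toConv (transpose s) := by
  refine WithConv.ofConv_injective (LinearMap.ext fun x => ?_)
  change tMapAlg τ (swapK k) (LinearMap.mul' k _ (TensorProduct.map r s
    (CoalgebraStruct.comul (R := k) (TensorProduct.comm k _ _ x)))) =
    LinearMap.mul' k _ (TensorProduct.map (transpose r) (transpose s)
      (CoalgebraStruct.comul (R := k) x))
  rw [comul_comm]
  induction CoalgebraStruct.comul (R := k) x with
  | zero => simp
  | add u v hu hv => simp only [map_add, hu, hv]
  | tmul y y' =>
    simp only [TensorProduct.map_tmul, LinearMap.mul'_apply, map_mul]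
    rfl

theorem transpose_one :
    transpose (1 : WithConv (LatticeV k ⊗[k] LatticeV k →ₗ[k]
      MvPowerSeries τ (KRing k (Fin 2)))).ofConv =
      (1 : WithConv (LatticeV k ⊗[k] LatticeV k →ₗ[k]
        MvPowerSeries τ (KRing k (Fin 2)))).ofConv := by
  refine TensorProduct.ext' fun a b => ?_
  change tMapAlg τ (swapK k) (algebraMap k _ (counit k a • counit k b)) =
    algebraMap k _ (counit k b • counit k a)
  rw [AlgHom.commutes, smul_eq_mul, smul_eq_mul, mul_comm]

/-- The multiplicativity of a bicharacter in the first argument, on arbitrary tensors. -/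
theorem IsBicharacter.mul_left' (hr : IsBicharacter σ r) (x : LatticeV k ⊗[k] LatticeV k)
    (b : LatticeV k) : r (LinearMap.mul' k _ x ⊗ₜ b) =
      LinearMap.mul' k _ (TensorProduct.map r r
        (TensorProduct.tensorTensorTensorComm k _ _ _ _ (x ⊗ₜ comul k b))) := by
  induction x with
  | zero => simp
  | add u v hu hv => simp only [map_add, TensorProduct.add_tmul, hu, hv]
  | tmul a a' =>
    rw [LinearMap.mul'_apply, hr.mul_left]
    induction comul k b with
    | zero => simp
    | add u v hu hv => simp only [map_add, TensorProduct.tmul_add, hu, hv]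
    | tmul b b' => rfl

/-- The functional `r(S a ⊗ b)` is the convolution inverse of `r`. -/
theorem IsBicharacter.bicharInv_mul (hr : IsBicharacter σ r) :
    toConv (bicharInv r) * toConv r = 1 := by
  refine WithConv.ofConv_injective (TensorProduct.ext' fun a b => ?_)
  change LinearMap.mul' k _ (TensorProduct.map (bicharInv r) r
    (TensorProduct.tensorTensorTensorComm k _ _ _ _ (comul k a ⊗ₜ comul k b))) =
    algebraMap k _ (counit k b • counit k a)
  have h := hr.mul_left' (LinearMap.rTensor _ (antipode k).toLinearMap (comul k a)) b
  rw [mul_antipode, Algebra.algebraMap_eq_smul_one, ← TensorProduct.smul_tmul', map_smul,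
    hr.one_left] at h
  rw [smul_eq_mul, mul_comm, map_mul, ← Algebra.smul_def, h]
  congr 1
  induction comul k a with
  | zero => simp
  | add u v hu hv => simp only [map_add, TensorProduct.add_tmul, hu, hv]
  | tmul a a' =>
    induction comul k b with
    | zero => simp
    | add u v hu hv => simp only [map_add, TensorProduct.tmul_add, hu, hv]
    | tmul b b' => rfl

/-- The functional of the braiding: `r^t * r⁻¹`. -/
def braidingFunctional
    (r : LatticeV k ⊗[k] LatticeV k →ₗ[k] MvPowerSeries τ (KRing k (Fin 2))) :
    LatticeV k ⊗[k] LatticeV k →ₗ[k] MvPowerSeries τ (KRing k (Fin 2)) :=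
  conv (transpose r) (bicharInv r)

theorem bicharR_eq : bicharR r = diagOp (braidingFunctional r) := rfl

theorem IsBicharacter.braiding_mul (hr : IsBicharacter σ r) :
    toConv (braidingFunctional r) * toConv r = toConv (transpose r) := by
  rw [braidingFunctional, conv_eq, toConv_ofConv, mul_assoc, hr.bicharInv_mul, mul_one]

/-- Unitarity at the level of functionals: `χ^t * χ = 1` for `χ = r^t * r⁻¹`. -/
theorem IsBicharacter.transpose_braiding_mul (hr : IsBicharacter σ r) :
    toConv (transpose (braidingFunctional r)) * toConv (braidingFunctional r) = 1 := by
  have h : toConv (transpose (bicharInv r)) * toConv (transpose r) = 1 := by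
    rw [← transpose_conv, conv_eq, hr.bicharInv_mul, transpose_one]
  have h' := hr.bicharInv_mul
  rw [braidingFunctional, transpose_conv, transpose_transpose, conv_eq, toConv_ofConv]
  simp only [toConv_ofConv]
  calc _ = (toConv (transpose (bicharInv r)) * toConv (transpose r)) *
        (toConv (bicharInv r) * toConv r) := by ring
    _ = 1 := by rw [h, h', one_mul]

theorem antipode_latticeD (a : LatticeV k) :
    antipode k (latticeD k a) = latticeD k (antipode k a) := by
  induction a using lattice_induction with
  | hh n => simp
  | he m => simp
  | algebraMap c => simp
  | add a b ha hb => simp only [map_add, ha, hb]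
  | mul a b ha hb => simp only [latticeD_mul, map_add, map_mul, ha, hb]

theorem comul_latticeD' (a : LatticeV k) : CoalgebraStruct.comul (R := k) (latticeD k a) =
    LinearMap.rTensor _ (latticeD k) (CoalgebraStruct.comul a) +
      LinearMap.lTensor _ (latticeD k) (CoalgebraStruct.comul a) := comul_latticeD a

theorem IsBicharacter.braiding_latticeD_left (hr : IsBicharacter σ r)
    (x : LatticeV k ⊗[k] LatticeV k) :
    braidingFunctional r (LinearMap.rTensor _ (latticeD k) x) =
      tMap τ (KRing.partialD k 0) (braidingFunctional r x) := by
  refine conv_coderivation (f := toConv (transpose r)) (g := toConv (bicharInv r))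
    (comul_rTensor_coderivation comul_latticeD') (tMap_leibniz (KRing.partialD_mul 0)) ?_ ?_ x
  · refine LinearMap.congr_fun (f := transpose r ∘ₗ LinearMap.rTensor _ (latticeD k))
      (g := tMap τ (KRing.partialD k 0) ∘ₗ transpose r) (TensorProduct.ext' fun a b => ?_)
    rw [LinearMap.comp_apply, LinearMap.comp_apply, LinearMap.rTensor_tmul, transpose_apply,
      transpose_apply, hr.deriv_right]
    funext d
    exact swapK_partialD_one _
  · refine LinearMap.congr_fun (f := bicharInv r ∘ₗ LinearMap.rTensor _ (latticeD k))
      (g := tMap τ (KRing.partialD k 0) ∘ₗ bicharInv r) (TensorProduct.ext' fun a b => ?_)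
    change r (antipode k (latticeD k a) ⊗ₜ b) =
      tMap τ (KRing.partialD k 0) (r (antipode k a ⊗ₜ b))
    rw [antipode_latticeD, hr.deriv_left]

theorem comul_lTensor_latticeD (x : LatticeV k ⊗[k] LatticeV k) :
    CoalgebraStruct.comul (R := k) (LinearMap.lTensor _ (latticeD k) x) =
      LinearMap.rTensor _ (LinearMap.lTensor _ (latticeD k)) (CoalgebraStruct.comul x) +
        LinearMap.lTensor _ (LinearMap.lTensor _ (latticeD k)) (CoalgebraStruct.comul x) := by
  have h : LinearMap.lTensor (LatticeV k) (latticeD k) =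
      (TensorProduct.comm k _ _).toLinearMap ∘ₗ LinearMap.rTensor _ (latticeD k) ∘ₗ
        (TensorProduct.comm k _ _).toLinearMap := by
    ext; rfl
  rw [h, LinearMap.comp_apply, LinearMap.comp_apply]
  simp only [LinearEquiv.coe_coe]
  rw [comul_comm, comul_rTensor_coderivation comul_latticeD', comul_comm]
  induction CoalgebraStruct.comul (R := k) x with
  | zero => simp
  | add u v hu hv =>
    simp only [map_add] at hu hv ⊢
    have huv := congrArg₂ (· + ·) hu hv
    convert huv using 1 <;> abel
  | tmul y y' =>
    rw [← h]
    induction y with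
    | zero => simp
    | add u v hu hv =>
      simp only [map_add, TensorProduct.add_tmul] at hu hv ⊢
      have huv := congrArg₂ (· + ·) hu hv
      convert huv using 1 <;> abel
    | tmul y1 y2 =>
      induction y' with
      | zero => simp
      | add u v hu hv =>
        simp only [map_add, TensorProduct.tmul_add] at hu hv ⊢
        have huv := congrArg₂ (· + ·) hu hv
        convert huv using 1 <;> abel
      | tmul y y' => simp

theorem IsBicharacter.braiding_latticeD_right (hr : IsBicharacter σ r)
    (x : LatticeV k ⊗[k] LatticeV k) :
    braidingFunctional r (LinearMap.lTensor _ (latticeD k) x) =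
      tMap τ (KRing.partialD k 1) (braidingFunctional r x) := by
  refine conv_coderivation (f := toConv (transpose r)) (g := toConv (bicharInv r))
    comul_lTensor_latticeD (tMap_leibniz (KRing.partialD_mul 1)) ?_ ?_ x
  · refine LinearMap.congr_fun (f := transpose r ∘ₗ LinearMap.lTensor _ (latticeD k))
      (g := tMap τ (KRing.partialD k 1) ∘ₗ transpose r) (TensorProduct.ext' fun a b => ?_)
    rw [LinearMap.comp_apply, LinearMap.comp_apply, LinearMap.lTensor_tmul, transpose_apply,
      transpose_apply, hr.deriv_left]
    funext d
    exact swapK_partialD_zero _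
  · refine LinearMap.congr_fun (f := bicharInv r ∘ₗ LinearMap.lTensor _ (latticeD k))
      (g := tMap τ (KRing.partialD k 1) ∘ₗ bicharInv r) (TensorProduct.ext' fun a b => ?_)
    change r (antipode k a ⊗ₜ latticeD k b) =
      tMap τ (KRing.partialD k 1) (r (antipode k a ⊗ₜ b))
    rw [hr.deriv_right]

/-- Three diagonal operators can be composed in either order. -/
theorem kComp_diagOp_reverse {C 𝒦 : Type*} [AddCommGroup C] [Module k C] [Coalgebra k C]
    [Coalgebra.IsCocomm k C] [CommRing 𝒦] [Algebra k 𝒦] (χ ψ ω : C →ₗ[k] MvPowerSeries τ 𝒦) :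
    kComp (kComp (diagOp χ) (diagOp ψ)) (diagOp ω) =
      kComp (kComp (diagOp ω) (diagOp ψ)) (diagOp χ) := by
  rw [kComp_diagOp, kComp_diagOp, kComp_diagOp, kComp_diagOp]
  simp only [toConv_ofConv]
  congr 2
  ring

/-- All three factors of the Yang-Baxter equation are diagonal operators on `V ⊗ V ⊗ V`, and
diagonal operators commute. -/
theorem bicharR_yang_baxter :
    kComp (kComp (R12 (bicharR r)) (R13 (bicharR r))) (R23 (bicharR r)) =
      kComp (kComp (R23 (bicharR r)) (R13 (bicharR r))) (R12 (bicharR r)) := by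
  rw [R12, R13, R23, bicharR_eq, kMap_diagOp, kMap_diagOp, kMap_diagOp, tensorId_diagOp,
    tensorId_diagOp, tensorId_diagOp,
    conj_diagOp (TensorProduct.rightComm k (LatticeV k) (LatticeV k) (LatticeV k))
      (fun x => comul_rightComm x),
    conj_diagOp ((TensorProduct.comm k (LatticeV k ⊗[k] LatticeV k) (LatticeV k)).trans
      (TensorProduct.assoc k (LatticeV k) (LatticeV k) (LatticeV k)).symm) (fun x => by
      rw [LinearEquiv.trans_apply, comul_assoc_symm, comul_comm, ← LinearMap.comp_apply,
        ← TensorProduct.map_comp]; rfl)]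
  exact kComp_diagOp_reverse (k := k) (C := (LatticeV k ⊗[k] LatticeV k) ⊗[k] LatticeV k)
    (𝒦 := KRing k (Fin 3)) _ _ _

/-- The operator `τ R(w, z) τ` is diagonal, with the transposed functional. -/
theorem conj_comm_bicharR :
    conj (TensorProduct.comm k _ _) (kMap (swapK k).toLinearMap (bicharR r)) =
      diagOp (transpose (braidingFunctional r)) := by
  rw [bicharR_eq, kMap_diagOp, conj_diagOp _ comul_comm]
  rfl

theorem IsBicharacter.unitarity_left (hr : IsBicharacter σ r) :
    kComp (conj (TensorProduct.comm k _ _) (kMap (swapK k).toLinearMap (bicharR r))) (bicharR r) =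
      kId k τ (KRing k (Fin 2)) (LatticeV k ⊗[k] LatticeV k) := by
  rw [conj_comm_bicharR, bicharR_eq, kComp_diagOp, hr.transpose_braiding_mul, diagOp_one]

theorem IsBicharacter.unitarity_right (hr : IsBicharacter σ r) :
    kComp (bicharR r) (conj (TensorProduct.comm k _ _) (kMap (swapK k).toLinearMap (bicharR r))) =
      kId k τ (KRing k (Fin 2)) (LatticeV k ⊗[k] LatticeV k) := by
  rw [conj_comm_bicharR, bicharR_eq, diagOp_comm, kComp_diagOp, hr.transpose_braiding_mul,
    diagOp_one]

theorem IsBicharacter.shift_left (hr : IsBicharacter σ r) :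
    kComp (tensorId (LatticeV k) (toK (KRing k (Fin 2)) (tC k τ (LatticeV k) ∘ₗ latticeD k)))
        (bicharR r) -
      kComp (bicharR r)
        (tensorId (LatticeV k) (toK (KRing k (Fin 2)) (tC k τ (LatticeV k) ∘ₗ latticeD k))) =
      - kMap (KRing.partialD k 0) (bicharR r) := by
  rw [tensorId_toK, bicharR_eq, commutator_diagOp _ (comul_rTensor_coderivation comul_latticeD'),
    kMap_diagOp]
  refine congrArg _ (congrArg _ (LinearMap.ext fun x => ?_))
  exact hr.braiding_latticeD_left x

theorem IsBicharacter.shift_right (hr : IsBicharacter σ r) :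
    kComp (conj (TensorProduct.comm k _ _) (tensorId (LatticeV k)
        (toK (KRing k (Fin 2)) (tC k τ (LatticeV k) ∘ₗ latticeD k)))) (bicharR r) -
      kComp (bicharR r) (conj (TensorProduct.comm k _ _) (tensorId (LatticeV k)
        (toK (KRing k (Fin 2)) (tC k τ (LatticeV k) ∘ₗ latticeD k)))) =
      - kMap (KRing.partialD k 1) (bicharR r) := by
  have h : (TensorProduct.comm k (LatticeV k) (LatticeV k)).toLinearMap ∘ₗ
      LinearMap.rTensor _ (latticeD k) ∘ₗ (TensorProduct.comm k _ _).symm.toLinearMap =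
        LinearMap.lTensor (LatticeV k) (latticeD k) := by
    ext; rfl
  rw [tensorId_toK, conj_toK, h, bicharR_eq, commutator_diagOp _ comul_lTensor_latticeD,
    kMap_diagOp]
  refine congrArg _ (congrArg _ (LinearMap.ext fun x => ?_))
  exact hr.braiding_latticeD_right x

end Braiding

/-! ### Existence and uniqueness of the bicharacter -/

section Derivations

variable {k : Type*} [Field k] {A : Type*} [CommRing A] [Algebra k A]

theorem leibniz_one {δ : A →ₗ[k] A} (hδ : ∀ x y, δ (x * y) = x * δ y + δ x * y) : δ 1 = 0 := by
  have h := hδ 1 1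
  rw [mul_one, one_mul, mul_one] at h
  exact left_eq_add.mp h

theorem leibniz_algebraMap {δ : A →ₗ[k] A} (hδ : ∀ x y, δ (x * y) = x * δ y + δ x * y) (c : k) :
    δ (algebraMap k A c) = 0 := by
  rw [Algebra.algebraMap_eq_smul_one, map_smul, leibniz_one hδ, smul_zero]

/-- The logarithmic derivative `u⁻¹ δ(u)` of a unit, a homomorphism. -/
def logDeriv {δ : A →ₗ[k] A} (hδ : ∀ x y, δ (x * y) = x * δ y + δ x * y) :
    Aˣ →* Multiplicative A where
  toFun u := Multiplicative.ofAdd ((↑u⁻¹ : A) * δ u)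
  map_one' := by simp [leibniz_one hδ]
  map_mul' u v := by
    rw [← ofAdd_add]
    refine congrArg _ ?_
    rw [Units.val_mul, hδ, mul_inv, Units.val_mul]
    linear_combination (↑v⁻¹ * δ ↑v) * Units.inv_mul u + (↑u⁻¹ * δ ↑u) * Units.inv_mul v

theorem leibniz_zpow {δ : A →ₗ[k] A} (hδ : ∀ x y, δ (x * y) = x * δ y + δ x * y) (u : Aˣ) (n : ℤ) :
    δ ((u ^ n : Aˣ) : A) = (n : k) • ((u ^ n : Aˣ) * ((↑u⁻¹ : A) * δ u)) := by
  have h := map_zpow (logDeriv hδ) u n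
  rw [logDeriv, MonoidHom.coe_mk, OneHom.coe_mk, ← ofAdd_zsmul] at h
  have h := congrArg Multiplicative.toAdd h
  rw [toAdd_ofAdd, toAdd_ofAdd] at h
  rw [Units.inv_mul_eq_iff_eq_mul] at h
  rw [h, mul_smul_comm, Int.cast_smul_eq_zsmul]

/-- The mixed logarithmic derivative `δ(u⁻¹ δ'(u))` is symmetric in the commuting derivations `δ`
and `δ'`. -/
theorem leibniz_inv_mul_comm {δ δ' : A →ₗ[k] A} (hδ : ∀ x y, δ (x * y) = x * δ y + δ x * y)
    (hδ' : ∀ x y, δ' (x * y) = x * δ' y + δ' x * y) (hc : ∀ x, δ (δ' x) = δ' (δ x)) (u : Aˣ) :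
    δ (↑u⁻¹ * δ' u) = δ' (↑u⁻¹ * δ u) := by
  have h1 := leibniz_zpow hδ u (-1)
  have h2 := leibniz_zpow hδ' u (-1)
  rw [zpow_neg_one] at h1 h2
  rw [hδ, hδ', h1, h2, hc]
  simp only [smul_mul_assoc]
  ring_nf

/-- The divided power `δ^n / n!`. -/
def dividedPow {X : Type*} [AddCommGroup X] [Module k X] (δ : X →ₗ[k] X) (n : ℕ) : X →ₗ[k] X :=
  (n.factorial : k)⁻¹ • δ ^ n

section
variable {X : Type*} [AddCommGroup X] [Module k X]

@[simp]
theorem dividedPow_zero (δ : X →ₗ[k] X) (x : X) : dividedPow δ 0 x = x := by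
  simp [dividedPow]

theorem apply_dividedPow [CharZero k] (δ : X →ₗ[k] X) (n : ℕ) (x : X) :
    δ (dividedPow δ n x) = ((n : k) + 1) • dividedPow δ (n + 1) x := by
  rw [dividedPow, dividedPow, LinearMap.smul_apply, LinearMap.smul_apply, map_smul, smul_smul,
    pow_succ', Module.End.mul_apply, Nat.factorial_succ, Nat.cast_mul, mul_inv, ← mul_assoc,
    Nat.cast_add_one, mul_inv_cancel₀ (Nat.cast_add_one_ne_zero n), one_mul]

theorem dividedPow_comm {δ δ' : X →ₗ[k] X} (hc : ∀ x, δ (δ' x) = δ' (δ x)) (n : ℕ) (x : X) :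
    δ (dividedPow δ' n x) = dividedPow δ' n (δ x) := by
  have h : Commute δ δ' := LinearMap.ext hc
  rw [dividedPow, LinearMap.smul_apply, LinearMap.smul_apply, map_smul]
  exact congrArg _ (LinearMap.congr_fun (h.pow_right n) x)

end

/-- Two maps on the lattice algebra that satisfy the Leibniz rule along an algebra homomorphism
agree if they agree on the generators. -/
theorem lattice_leibniz_ext (f : LatticeV k →ₐ[k] A) {δ δ' : LatticeV k →ₗ[k] A}
    (hδ : ∀ x y, δ (x * y) = f x * δ y + δ x * f y)
    (hδ' : ∀ x y, δ' (x * y) = f x * δ' y + δ' x * f y)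
    (hh : ∀ n, δ (hGen k n) = δ' (hGen k n)) (he : ∀ m, δ (eGen k m) = δ' (eGen k m)) :
    δ = δ' := by
  refine LinearMap.ext fun a => ?_
  induction a using lattice_induction with
  | hh n => exact hh n
  | he m => exact he m
  | algebraMap c =>
    rw [Algebra.algebraMap_eq_smul_one, map_smul, map_smul]
    exact congrArg _ (he 0)
  | add a b ha hb => rw [map_add, map_add, ha, hb]
  | mul a b ha hb => rw [hδ, hδ', ha, hb]

end Derivations

section Functionals

open WithConv

variable {k : Type*} [Field k] {A : Type*} [CommRing A] [Algebra k A]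

/-- The counit with values in an algebra. -/
abbrev counitTo (A : Type*) [CommRing A] [Algebra k A] : LatticeV k →ₐ[k] A :=
  (Algebra.ofId k A).comp (counit k)

/-- The algebra homomorphism to the dual numbers over `A` that deforms the counit. -/
def primitiveLift (x : ℕ → A) (y : A) : LatticeV k →ₐ[k] TrivSqZeroExt A A :=
  latticeLift k (fun i => TrivSqZeroExt.inr (x i))
    { toFun := fun m => TrivSqZeroExt.inl 1 + TrivSqZeroExt.inr ((m.toAdd : k) • y)
      map_one' := by simp
      map_mul' := fun m n => by
        rw [toAdd_mul, Int.cast_add, add_smul, TrivSqZeroExt.inr_add]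
        simp only [mul_add, add_mul, TrivSqZeroExt.inr_mul_inr, TrivSqZeroExt.inl_one, one_mul,
          mul_one]
        abel }

/-- The functional on the lattice algebra that is a derivation along the counit and has the values
`x i` on `h^{(i)}` and `m y` on `e^{mα}`. -/
def primitiveFunctional (x : ℕ → A) (y : A) : LatticeV k →ₗ[k] A :=
  (TrivSqZeroExt.sndHom A A).restrictScalars k ∘ₗ (primitiveLift x y).toLinearMap

@[simp]
theorem primitiveFunctional_hGen (x : ℕ → A) (y : A) (i : ℕ) :
    primitiveFunctional x y (hGen k i) = x i := by
  change (primitiveLift x y (hGen k i)).snd = _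
  rw [primitiveLift, latticeLift_hGen, TrivSqZeroExt.snd_inr]

@[simp]
theorem primitiveFunctional_eGen (x : ℕ → A) (y : A) (m : ℤ) :
    primitiveFunctional x y (eGen k m) = (m : k) • y := by
  change (primitiveLift x y (eGen k m)).snd = _
  rw [primitiveLift, latticeLift_eGen]
  simp

theorem primitiveFunctional_mul (x : ℕ → A) (y : A) (a b : LatticeV k) :
    primitiveFunctional x y (a * b) = counitTo A a * primitiveFunctional x y b +
      primitiveFunctional x y a * counitTo A b := by
  have h : (TrivSqZeroExt.fstHom k A A).comp (primitiveLift x y) = counitTo A := by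
    refine lattice_algHom_ext (fun n => ?_) (fun m => ?_)
    · rw [AlgHom.comp_apply, AlgHom.comp_apply, primitiveLift, latticeLift_hGen, counit_hGen,
        map_zero]
      rfl
    · rw [AlgHom.comp_apply, AlgHom.comp_apply, primitiveLift, latticeLift_eGen, counit_eGen,
        map_one]
      simp
  have h' : ∀ a, (primitiveLift x y a).fst = counitTo A a := fun a => DFunLike.congr_fun h a
  change (primitiveLift x y (a * b)).snd = _
  rw [map_mul, TrivSqZeroExt.snd_mul, h', h']
  simp only [smul_eq_mul, MulOpposite.smul_eq_mul_unop, MulOpposite.unop_op]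
  rfl

/-- The algebra homomorphism with the values `x i` on `h^{(i)}` and `u^m` on `e^{mα}`. -/
def grouplikeFunctional (x : ℕ → A) (u : Aˣ) : LatticeV k →ₐ[k] A :=
  latticeLift k x
    { toFun := fun m => ((u ^ m.toAdd : Aˣ) : A)
      map_one' := by simp
      map_mul' := fun m n => by rw [toAdd_mul, zpow_add, Units.val_mul] }

@[simp]
theorem grouplikeFunctional_hGen (x : ℕ → A) (u : Aˣ) (i : ℕ) :
    grouplikeFunctional x u (hGen k i) = x i := latticeLift_hGen _ _ _

@[simp]
theorem grouplikeFunctional_eGen (x : ℕ → A) (u : Aˣ) (m : ℤ) :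
    grouplikeFunctional x u (eGen k m) = ((u ^ m : Aˣ) : A) := latticeLift_eGen _ _ _

/-- The convolution product of algebra homomorphisms is an algebra homomorphism. -/
theorem toConv_algHom_mul (f g : LatticeV k →ₐ[k] A) :
    toConv f.toLinearMap * toConv g.toLinearMap =
      toConv ((Algebra.TensorProduct.productMap f g).comp (comul k)).toLinearMap := by
  refine WithConv.ofConv_injective (LinearMap.ext fun a => ?_)
  refine LinearMap.congr_fun (f := LinearMap.mul' k A ∘ₗ TensorProduct.map f.toLinearMap
    g.toLinearMap) (g := (Algebra.TensorProduct.productMap f g).toLinearMap) ?_ _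
  refine TensorProduct.ext' fun a b => ?_
  simp

variable {δ₀ δ₁ : A →ₗ[k] A} (h₀ : ∀ x y, δ₀ (x * y) = x * δ₀ y + δ₀ x * y)
  (h₁ : ∀ x y, δ₁ (x * y) = x * δ₁ y + δ₁ x * y) (hc : ∀ x, δ₀ (δ₁ x) = δ₁ (δ₀ x)) (u : Aˣ)

/-- The functional `r(h^{(n)} ⊗ ·)` of the bicharacter `r` with `r(e^α ⊗ e^α) = u`. -/
def bicharH (δ₀ δ₁ : A →ₗ[k] A) (u : Aˣ) (n : ℕ) : LatticeV k →ₗ[k] A :=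
  primitiveFunctional
    (fun i => dividedPow δ₀ n (dividedPow δ₁ i (δ₁ (↑u⁻¹ * δ₀ u))))
    (dividedPow δ₀ n (↑u⁻¹ * δ₀ u))

/-- The functional `r(e^{mα} ⊗ ·)` of the bicharacter `r` with `r(e^α ⊗ e^α) = u`. -/
def bicharE (δ₁ : A →ₗ[k] A) (u : Aˣ) (m : ℤ) : LatticeV k →ₐ[k] A :=
  grouplikeFunctional (fun i => (m : k) • dividedPow δ₁ i (↑u⁻¹ * δ₁ u)) (u ^ m)

/-- The functionals `r(e^{mα} ⊗ ·)` depend multiplicatively on `m`, as `bicharHom` requires. -/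
theorem bicharE_mul (m n : ℤ) : toConv (bicharE δ₁ u (m + n)).toLinearMap =
    toConv (bicharE δ₁ u m).toLinearMap * toConv (bicharE δ₁ u n).toLinearMap := by
  rw [toConv_algHom_mul]
  refine congrArg (fun f : LatticeV k →ₐ[k] A => toConv f.toLinearMap) ?_
  refine lattice_algHom_ext (fun i => ?_) (fun i => ?_)
  · rw [AlgHom.comp_apply, comul_hGen, map_add]
    simp [bicharE, add_smul]
  · rw [AlgHom.comp_apply, comul_eGen]
    simp [bicharE, zpow_add, mul_zpow]

/-- The bicharacter with `r(e^α ⊗ e^α) = u`, as a homomorphism to the convolution algebra. -/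
def bicharHom (δ₀ δ₁ : A →ₗ[k] A) (u : Aˣ) : LatticeV k →ₐ[k] WithConv (LatticeV k →ₗ[k] A) :=
  latticeLift k (fun n => toConv (bicharH δ₀ δ₁ u n))
    { toFun := fun m => toConv (bicharE δ₁ u m.toAdd).toLinearMap
      map_one' := by
        refine WithConv.ofConv_injective (LinearMap.ext fun a => ?_)
        have h : bicharE δ₁ u 0 = counitTo A :=
          lattice_algHom_ext (fun n => by simp [bicharE]) (fun m => by simp [bicharE])
        exact DFunLike.congr_fun h a
      map_mul' := fun m n => bicharE_mul u m.toAdd n.toAdd }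

theorem bicharHom_hGen (n : ℕ) : bicharHom δ₀ δ₁ u (hGen k n) = toConv (bicharH δ₀ δ₁ u n) :=
  latticeLift_hGen _ _ _

theorem bicharHom_eGen (m : ℤ) :
    bicharHom δ₀ δ₁ u (eGen k m) = toConv (bicharE δ₁ u m).toLinearMap :=
  latticeLift_eGen _ _ _

theorem bicharHom_one_right (a : LatticeV k) : (bicharHom δ₀ δ₁ u a) 1 = counitTo A a := by
  induction a using lattice_induction with
  | hh n =>
    rw [bicharHom_hGen, ← eGen_zero]
    change bicharH δ₀ δ₁ u n _ = _
    simp [bicharH]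
  | he m =>
    rw [bicharHom_eGen]
    rw [AlgHom.comp_apply, counit_eGen]
    exact (map_one (bicharE δ₁ u m)).trans (map_one _).symm
  | algebraMap c =>
    rw [AlgHom.commutes, AlgHom.commutes, LinearMap.convAlgebraMap_apply, counit_eq, map_one,
      map_one, Algebra.algebraMap_eq_smul_one]
  | add a b ha hb =>
    rw [map_add, map_add, ← ha, ← hb]; rfl
  | mul a b ha hb =>
    rw [map_mul, map_mul, ← ha, ← hb, LinearMap.convMul_apply, comul_eq, map_one,
      Algebra.TensorProduct.one_def]
    rfl

/-- The homomorphism `a ⊗ a' ↦ (b ⊗ b' ↦ f(a)(b) f(a')(b'))` to the convolution algebra. -/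
def externalConv (f : LatticeV k →ₐ[k] WithConv (LatticeV k →ₗ[k] A)) :
    LatticeV k ⊗[k] LatticeV k →ₐ[k] WithConv (LatticeV k ⊗[k] LatticeV k →ₗ[k] A) :=
  Algebra.TensorProduct.algHomOfLinearMapTensorProduct
    (TensorProduct.lift (LinearMap.mk₂ k
      (fun a a' => toConv (LinearMap.mul' k A ∘ₗ TensorProduct.map (f a).ofConv (f a').ofConv))
      (fun a b c => by
        rw [map_add, ofConv_add, TensorProduct.map_add_left, LinearMap.comp_add]; rfl)
      (fun c a b => by
        rw [map_smul, ofConv_smul, TensorProduct.map_smul_left, LinearMap.comp_smul]; rfl)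
      (fun a b c => by
        rw [map_add, ofConv_add, TensorProduct.map_add_right, LinearMap.comp_add]; rfl)
      (fun c a b => by
        rw [map_smul, ofConv_smul, TensorProduct.map_smul_right, LinearMap.comp_smul]; rfl)))
    (fun a a' b b' => by
      simp only [TensorProduct.lift.tmul, LinearMap.mk₂_apply, map_mul]
      refine (congrArg (fun g => toConv (LinearMap.mul' k A ∘ₗ ofConv g))
        TensorProduct.map_convMul_map.symm).trans ?_
      refine WithConv.ofConv_injective ?_
      exact LinearMap.algHom_comp_convMul_distrib (Algebra.TensorProduct.lmul' k (S := A)) _ _)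
    (by
      simp only [TensorProduct.lift.tmul, LinearMap.mk₂_apply, map_one]
      refine WithConv.ofConv_injective (TensorProduct.ext' fun a b => ?_)
      change algebraMap k A (counit k a) * algebraMap k A (counit k b) =
        algebraMap k A (counit k b • counit k a)
      rw [smul_eq_mul, map_mul, mul_comm])

theorem externalConv_tmul (f : LatticeV k →ₐ[k] WithConv (LatticeV k →ₗ[k] A))
    (a a' b b' : LatticeV k) :
    externalConv f (a ⊗ₜ a') (b ⊗ₜ b') = f a b * f a' b' := rfl

/-- Multiplicativity in the second argument.  Both sides are algebra homomorphisms in `a`, so it is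
enough to consider generators: for `a = h^{(n)}` it says that `r(a ⊗ ·)` is a derivation along the
counit, and for `a = e^{mα}` that it is an algebra homomorphism. -/
theorem bicharHom_mul_right (a b c : LatticeV k) :
    bicharHom δ₀ δ₁ u a (b * c) = externalConv (bicharHom δ₀ δ₁ u) (comul k a) (b ⊗ₜ c) := by
  -- `a ↦ r(a ⊗ · ·)` is multiplicative, since multiplication is a homomorphism of coalgebras
  let P : LatticeV k →ₐ[k] WithConv (LatticeV k ⊗[k] LatticeV k →ₗ[k] A) :=
    AlgHom.ofLinearMap
      { toFun := fun a => toConv ((bicharHom δ₀ δ₁ u a).ofConv ∘ₗ LinearMap.mul' k _)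
        map_add' := fun a b => by rw [map_add]; rfl
        map_smul' := fun c a => by rw [map_smul]; rfl }
      (by
        refine WithConv.ofConv_injective (TensorProduct.ext' fun a b => ?_)
        change (bicharHom δ₀ δ₁ u 1) (a * b) = algebraMap k A (counit k b • counit k a)
        rw [map_one, smul_eq_mul, mul_comm, ← map_mul]
        rfl)
      (fun a b => by
        refine WithConv.ofConv_injective ?_
        change (bicharHom δ₀ δ₁ u (a * b)).ofConv ∘ₗ LinearMap.mul' k _ = _
        rw [map_mul]
        exact LinearMap.convMul_comp_coalgHom_distrib _ _ (Bialgebra.mulCoalgHom k (LatticeV k)))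
  have h : P = (externalConv (bicharHom δ₀ δ₁ u)).comp (comul k) := by
    refine lattice_algHom_ext (fun n => ?_) (fun m => ?_)
    · refine WithConv.ofConv_injective (TensorProduct.ext' fun b c => ?_)
      change bicharHom δ₀ δ₁ u (hGen k n) (b * c) =
        externalConv (bicharHom δ₀ δ₁ u) (comul k (hGen k n)) (b ⊗ₜ c)
      rw [comul_hGen, map_add]
      change _ = bicharHom δ₀ δ₁ u (hGen k n) b * bicharHom δ₀ δ₁ u 1 c +
        bicharHom δ₀ δ₁ u 1 b * bicharHom δ₀ δ₁ u (hGen k n) c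
      rw [bicharHom_hGen, map_one]
      change bicharH δ₀ δ₁ u n (b * c) = bicharH δ₀ δ₁ u n b * counitTo A c +
        counitTo A b * bicharH δ₀ δ₁ u n c
      rw [bicharH, primitiveFunctional_mul, add_comm]
    · refine WithConv.ofConv_injective (TensorProduct.ext' fun b c => ?_)
      change bicharHom δ₀ δ₁ u (eGen k m) (b * c) =
        externalConv (bicharHom δ₀ δ₁ u) (comul k (eGen k m)) (b ⊗ₜ c)
      rw [comul_eGen, externalConv_tmul, bicharHom_eGen]
      exact map_mul (bicharE δ₁ u m) b c
  exact DFunLike.congr_fun (congrArg WithConv.ofConv (DFunLike.congr_fun h a)) (b ⊗ₜ c)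

include h₁ in
/-- Compatibility with the derivation in the second argument: the condition is stable under
convolution, hence can be checked for generators `a`, and then for generators `b`. -/
theorem bicharHom_latticeD_right [CharZero k] (hc : ∀ x, δ₀ (δ₁ x) = δ₁ (δ₀ x))
    (a b : LatticeV k) :
    bicharHom δ₀ δ₁ u a (latticeD k b) = δ₁ (bicharHom δ₀ δ₁ u a b) := by
  induction a using lattice_induction generalizing b with
  | hh n =>
    rw [bicharHom_hGen]
    change bicharH δ₀ δ₁ u n (latticeD k b) = δ₁ (bicharH δ₀ δ₁ u n b)
    refine LinearMap.congr_fun (f := bicharH δ₀ δ₁ u n ∘ₗ latticeD k)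
      (g := δ₁ ∘ₗ bicharH δ₀ δ₁ u n) (lattice_leibniz_ext (counitTo A) ?_ ?_ ?_ ?_) b
    · intro x y
      have h : ∀ x, counitTo A (latticeD k x) = 0 := fun x => by
        rw [AlgHom.comp_apply, counit_latticeD, map_zero]
      simp only [LinearMap.comp_apply, latticeD_mul, map_add, bicharH, primitiveFunctional_mul, h]
      ring
    · intro x y
      have h : ∀ x, δ₁ (counitTo A x) = 0 := fun x => leibniz_algebraMap h₁ _
      simp only [LinearMap.comp_apply, map_add, bicharH, primitiveFunctional_mul, h₁, h]
      ring
    · intro i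
      rw [LinearMap.comp_apply, LinearMap.comp_apply, latticeD_hGen, map_smul, bicharH,
        primitiveFunctional_hGen, primitiveFunctional_hGen,
        dividedPow_comm (fun x => (hc x).symm), apply_dividedPow, map_smul]
    · intro m
      rw [LinearMap.comp_apply, LinearMap.comp_apply, latticeD_eGen, map_smul, bicharH,
        primitiveFunctional_mul, primitiveFunctional_hGen, primitiveFunctional_eGen, map_smul,
        dividedPow_comm (fun x => (hc x).symm)]
      simp
  | he m =>
    rw [bicharHom_eGen]
    change bicharE δ₁ u m (latticeD k b) = δ₁ (bicharE δ₁ u m b)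
    refine LinearMap.congr_fun (f := (bicharE δ₁ u m).toLinearMap ∘ₗ latticeD k)
      (g := δ₁ ∘ₗ (bicharE δ₁ u m).toLinearMap) (lattice_leibniz_ext (bicharE δ₁ u m) ?_ ?_ ?_ ?_) b
    · intro x y
      simp only [LinearMap.comp_apply, latticeD_mul, map_add, AlgHom.toLinearMap_apply, map_mul]
      ring
    · intro x y
      simp only [LinearMap.comp_apply, AlgHom.toLinearMap_apply, map_mul, h₁]
    · intro i
      rw [LinearMap.comp_apply, LinearMap.comp_apply, latticeD_hGen, map_smul,
        AlgHom.toLinearMap_apply, AlgHom.toLinearMap_apply, bicharE, grouplikeFunctional_hGen,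
        grouplikeFunctional_hGen, map_smul, apply_dividedPow, smul_comm]
    · intro n
      rw [LinearMap.comp_apply, LinearMap.comp_apply, latticeD_eGen, map_smul,
        AlgHom.toLinearMap_apply, AlgHom.toLinearMap_apply, map_mul, bicharE,
        grouplikeFunctional_hGen, grouplikeFunctional_eGen, ← zpow_mul, leibniz_zpow h₁,
        dividedPow_zero, smul_mul_assoc, smul_smul, Int.cast_mul, mul_comm (n : k),
        mul_comm ((u ^ (m * n) : Aˣ) : A)]
  | algebraMap c =>
    rw [AlgHom.commutes, LinearMap.convAlgebraMap_apply, LinearMap.convAlgebraMap_apply, counit_eq,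
      counit_eq, counit_latticeD, map_smul, leibniz_algebraMap h₁, map_zero]
  | add a a' ha ha' =>
    rw [map_add]
    change bicharHom δ₀ δ₁ u a (latticeD k b) + bicharHom δ₀ δ₁ u a' (latticeD k b) =
      δ₁ (bicharHom δ₀ δ₁ u a b + bicharHom δ₀ δ₁ u a' b)
    rw [ha, ha', map_add]
  | mul a a' ha ha' =>
    rw [map_mul]
    exact conv_coderivation comul_latticeD' h₁ ha ha' b

include h₀ h₁ hc in
/-- Compatibility with the derivation in the first argument. -/
theorem bicharHom_latticeD_left [CharZero k] (a b : LatticeV k) :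
    bicharHom δ₀ δ₁ u (latticeD k a) b = δ₀ (bicharHom δ₀ δ₁ u a b) := by
  induction a using lattice_induction generalizing b with
  | hh n =>
    rw [latticeD_hGen, map_smul, bicharHom_hGen, bicharHom_hGen]
    change ((n : k) + 1) • bicharH δ₀ δ₁ u (n + 1) b = δ₀ (bicharH δ₀ δ₁ u n b)
    refine LinearMap.congr_fun (f := ((n : k) + 1) • bicharH δ₀ δ₁ u (n + 1))
      (g := δ₀ ∘ₗ bicharH δ₀ δ₁ u n) (lattice_leibniz_ext (counitTo A) ?_ ?_ ?_ ?_) b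
    · intro x y
      simp only [LinearMap.smul_apply, bicharH, primitiveFunctional_mul, smul_add,
        smul_mul_assoc, mul_smul_comm]
    · intro x y
      have h : ∀ x, δ₀ (counitTo A x) = 0 := fun x => leibniz_algebraMap h₀ _
      simp only [LinearMap.comp_apply, map_add, bicharH, primitiveFunctional_mul, h₀, h]
      ring
    · intro i
      rw [LinearMap.comp_apply, LinearMap.smul_apply, bicharH, bicharH, primitiveFunctional_hGen,
        primitiveFunctional_hGen, apply_dividedPow]
    · intro m
      rw [LinearMap.comp_apply, LinearMap.smul_apply, bicharH, bicharH, primitiveFunctional_eGen,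
        primitiveFunctional_eGen, map_smul, apply_dividedPow, smul_comm]
  | he m =>
    rw [latticeD_eGen, map_smul, map_mul, bicharHom_eGen, bicharHom_hGen]
    change (m : k) • (toConv (bicharH δ₀ δ₁ u 0) * toConv (bicharE δ₁ u m).toLinearMap).ofConv b =
      δ₀ (bicharE δ₁ u m b)
    refine LinearMap.congr_fun (f := (m : k) • (toConv (bicharH δ₀ δ₁ u 0) *
        toConv (bicharE δ₁ u m).toLinearMap).ofConv)
      (g := δ₀ ∘ₗ (bicharE δ₁ u m).toLinearMap) (lattice_leibniz_ext (bicharE δ₁ u m) ?_ ?_ ?_ ?_) b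
    · intro x y
      -- the convolution product of `r(h ⊗ ·)`, a derivation along the counit, and the homomorphism
      -- `r(e^{mα} ⊗ ·)` is a derivation along the latter
      have h : ∀ v w : LatticeV k ⊗[k] LatticeV k,
          LinearMap.mul' k A (TensorProduct.map (bicharH δ₀ δ₁ u 0)
            (bicharE δ₁ u m).toLinearMap (v * w)) =
          (Algebra.TensorProduct.productMap (counitTo A) (bicharE δ₁ u m)) v *
            LinearMap.mul' k A (TensorProduct.map (bicharH δ₀ δ₁ u 0)
              (bicharE δ₁ u m).toLinearMap w) +
          LinearMap.mul' k A (TensorProduct.map (bicharH δ₀ δ₁ u 0)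
            (bicharE δ₁ u m).toLinearMap v) *
              (Algebra.TensorProduct.productMap (counitTo A) (bicharE δ₁ u m)) w := by
        intro v w
        induction v with
        | zero => simp
        | add v v' hv hv' => simp only [add_mul, map_add, hv, hv']; ring
        | tmul a a' =>
          induction w with
          | zero => simp
          | add v v' hv hv' => simp only [mul_add, map_add, hv, hv']; ring
          | tmul b b' =>
            simp only [Algebra.TensorProduct.tmul_mul_tmul, TensorProduct.map_tmul,
              LinearMap.mul'_apply, AlgHom.toLinearMap_apply, map_mul, bicharH,
              primitiveFunctional_mul, Algebra.TensorProduct.productMap_apply_tmul]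
            ring
      have h' : (Algebra.TensorProduct.productMap (counitTo A) (bicharE δ₁ u m)).comp (comul k) =
          bicharE δ₁ u m := by
        refine lattice_algHom_ext (fun i => ?_) (fun i => ?_) <;> simp
      have h'' : ∀ x, (Algebra.TensorProduct.productMap (counitTo A) (bicharE δ₁ u m))
          (comul k x) = bicharE δ₁ u m x := fun x => DFunLike.congr_fun h' x
      simp only [LinearMap.smul_apply, LinearMap.convMul_apply, comul_eq, map_mul, h, h'', smul_add,
        smul_mul_assoc, mul_smul_comm]
    · intro x y
      simp only [LinearMap.comp_apply, AlgHom.toLinearMap_apply, map_mul, h₀]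
    · intro i
      simp only [LinearMap.smul_apply, LinearMap.comp_apply, LinearMap.convMul_apply, comul_eq,
        comul_hGen, map_add, TensorProduct.map_tmul, LinearMap.mul'_apply,
        AlgHom.toLinearMap_apply, map_one, mul_one]
      have h1 : bicharH δ₀ δ₁ u 0 1 = 0 := by rw [← eGen_zero]; simp [bicharH]
      rw [h1, zero_mul, add_zero, bicharH, primitiveFunctional_hGen, bicharE,
        grouplikeFunctional_hGen, map_smul, dividedPow_zero, dividedPow_comm hc,
        leibniz_inv_mul_comm h₀ h₁ hc]
    · intro n
      simp only [LinearMap.smul_apply, LinearMap.comp_apply, LinearMap.convMul_apply, comul_eq,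
        comul_eGen, TensorProduct.map_tmul, LinearMap.mul'_apply,
        AlgHom.toLinearMap_apply]
      rw [bicharH, primitiveFunctional_eGen, bicharE, grouplikeFunctional_eGen, ← zpow_mul,
        leibniz_zpow h₀, dividedPow_zero, smul_mul_assoc, smul_smul, Int.cast_mul,
        mul_comm ((u ^ (m * n) : Aˣ) : A)]
  | algebraMap c =>
    rw [latticeD_algebraMap, map_zero, AlgHom.commutes, LinearMap.convAlgebraMap_apply, map_smul,
      leibniz_algebraMap h₀, smul_zero]
    rfl
  | add a a' ha ha' =>
    rw [map_add, map_add, map_add]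
    change bicharHom δ₀ δ₁ u (latticeD k a) b + bicharHom δ₀ δ₁ u (latticeD k a') b =
      δ₀ (bicharHom δ₀ δ₁ u a b + bicharHom δ₀ δ₁ u a' b)
    rw [ha, ha', map_add]
  | mul a a' ha ha' =>
    rw [latticeD_mul, map_add, map_mul, map_mul, map_mul]
    change LinearMap.mul' k A (TensorProduct.map _ _ (comul k b)) +
      LinearMap.mul' k A (TensorProduct.map _ _ (comul k b)) =
        δ₀ (LinearMap.mul' k A (TensorProduct.map _ _ (comul k b)))
    induction comul k b with
    | zero => simp
    | add v w hv hw =>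
      simp only [map_add, ← hv, ← hw]; abel
    | tmul v w =>
      simp only [TensorProduct.map_tmul, LinearMap.mul'_apply]
      rw [ha, ha', h₀]; ring

end Functionals

section Bicharacters

open WithConv

variable {k : Type*} [Field k] {τ : Type*} {σ σ' : MvPowerSeries τ (KRing k (Fin 2))}
  {r r' : LatticeV k ⊗[k] LatticeV k →ₗ[k] MvPowerSeries τ (KRing k (Fin 2))}

/-- Every invertible `σ` is the value `r(e^α ⊗ e^α)` of a bicharacter. -/
theorem exists_isBicharacter [CharZero k] (hσ : IsUnit σ) :
    ∃ r : LatticeV k ⊗[k] LatticeV k →ₗ[k] MvPowerSeries τ (KRing k (Fin 2)),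
      IsBicharacter σ r := by
  obtain ⟨u, rfl⟩ := hσ
  have h₀ := tMap_leibniz (τ := τ) (KRing.partialD_mul (k := k) (0 : Fin 2))
  have h₁ := tMap_leibniz (τ := τ) (KRing.partialD_mul (k := k) (1 : Fin 2))
  have hc : ∀ x, tMap τ (KRing.partialD k (0 : Fin 2)) (tMap τ (KRing.partialD k 1) x) =
      tMap τ (KRing.partialD k 1) (tMap τ (KRing.partialD k 0) x) := fun x => by
    funext d
    exact KRing.partialD_comm _ _ _
  let Φ := bicharHom (tMap τ (KRing.partialD k (0 : Fin 2))) (tMap τ (KRing.partialD k 1)) u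
  refine ⟨TensorProduct.lift ((WithConv.linearEquiv k _).toLinearMap ∘ₗ Φ.toLinearMap), ?_⟩
  constructor
  · intro a
    change (Φ 1) a = _
    rw [map_one]
    rfl
  · intro a
    exact bicharHom_one_right u a
  · intro a b c
    change (Φ (a * b)) c = _
    rw [map_mul]
    rfl
  · intro a b c
    refine (bicharHom_mul_right u a b c).trans ?_
    induction comul k a with
    | zero => rw [map_zero, map_zero]; rfl
    | add v w hv hw => rw [map_add, map_add, map_add, ← hv, ← hw]; rfl
    | tmul v w => rfl
  · intro a b
    exact bicharHom_latticeD_left h₀ h₁ hc u a b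
  · intro a b
    exact bicharHom_latticeD_right h₁ u hc a b
  · change Φ (eGen k 1) (eGen k 1) = _
    rw [bicharHom_eGen]
    change bicharE _ u 1 (eGen k 1) = _
    rw [bicharE, grouplikeFunctional_eGen, zpow_one, zpow_one]

theorem IsBicharacter.mul_left_grouplike (hr : IsBicharacter σ r) (a b : LatticeV k) (m : ℤ) :
    r ((a * b) ⊗ₜ eGen k m) = r (a ⊗ₜ eGen k m) * r (b ⊗ₜ eGen k m) := by
  rw [hr.mul_left, comul_eGen]; rfl

theorem IsBicharacter.mul_right_grouplike (hr : IsBicharacter σ r) (a b : LatticeV k) (m : ℤ) :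
    r (eGen k m ⊗ₜ (a * b)) = r (eGen k m ⊗ₜ a) * r (eGen k m ⊗ₜ b) := by
  rw [hr.mul_right, comul_eGen]; rfl

theorem IsBicharacter.eGen_neg_left (hr : IsBicharacter σ r) :
    r (eGen k (-1) ⊗ₜ eGen k 1) * σ = 1 := by
  rw [← hr.lattice, ← hr.mul_left_grouplike, ← eGen_add, neg_add_cancel, eGen_zero, hr.one_left,
    counit_eGen, map_one]

theorem IsBicharacter.eGen_neg_right (hr : IsBicharacter σ r) :
    r (eGen k 1 ⊗ₜ eGen k (-1)) * σ = 1 := by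
  rw [← hr.lattice, ← hr.mul_right_grouplike, ← eGen_add, neg_add_cancel, eGen_zero, hr.one_right,
    counit_eGen, map_one]

theorem IsBicharacter.eGen_neg_neg (hr : IsBicharacter σ r) :
    r (eGen k (-1) ⊗ₜ eGen k (-1)) = σ := by
  have h : r (eGen k (-1) ⊗ₜ eGen k (-1)) * r (eGen k 1 ⊗ₜ eGen k (-1)) = 1 := by
    rw [← hr.mul_left_grouplike, ← eGen_add, neg_add_cancel, eGen_zero, hr.one_left,
      counit_eGen, map_one]
  calc _ = r (eGen k (-1) ⊗ₜ eGen k (-1)) * (r (eGen k 1 ⊗ₜ eGen k (-1)) * σ) := by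
        rw [hr.eGen_neg_right, mul_one]
    _ = σ := by rw [← mul_assoc, h, one_mul]

/-- The values of a bimultiplicative functional that intertwines derivations lie in every
subalgebra that is closed under these derivations and contains the values on `e^{±α} ⊗ e^{±α}`:
the lattice algebra is generated by `e^{±α}` as an algebra with derivation. -/
theorem bimultiplicative_mem [CharZero k] {A : Type*} [CommRing A] [Algebra k A]
    {ρ : LatticeV k ⊗[k] LatticeV k →ₗ[k] A} {δ₀ δ₁ : A →ₗ[k] A}
    (one_left : ∀ a, ρ (1 ⊗ₜ a) = algebraMap k A (counit k a))
    (one_right : ∀ a, ρ (a ⊗ₜ 1) = algebraMap k A (counit k a))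
    (mul_left : ∀ a b m, ρ ((a * b) ⊗ₜ eGen k m) = ρ (a ⊗ₜ eGen k m) * ρ (b ⊗ₜ eGen k m))
    (mul_right : ∀ a b c, ρ (a ⊗ₜ (b * c)) = LinearMap.mul' k _
      (TensorProduct.map (ρ ∘ₗ (TensorProduct.mk k _ _).flip b)
        (ρ ∘ₗ (TensorProduct.mk k _ _).flip c) (comul k a)))
    (deriv_left : ∀ a b, ρ (latticeD k a ⊗ₜ b) = δ₀ (ρ (a ⊗ₜ b)))
    (deriv_right : ∀ a b, ρ (a ⊗ₜ latticeD k b) = δ₁ (ρ (a ⊗ₜ b)))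
    (S : Subalgebra k A) (h₀ : ∀ x ∈ S, δ₀ x ∈ S) (h₁ : ∀ x ∈ S, δ₁ x ∈ S)
    (h : ∀ m n : ℤ, m = 1 ∨ m = -1 → n = 1 ∨ n = -1 → ρ (eGen k m ⊗ₜ eGen k n) ∈ S)
    (a b : LatticeV k) : ρ (a ⊗ₜ b) ∈ S := by
  -- first for a fixed second argument `e^{±α}`, where `ρ` is multiplicative in the first argument
  have key : ∀ m : ℤ, m = 1 ∨ m = -1 → ∀ a, ρ (a ⊗ₜ eGen k m) ∈ S := by
    intro m hm a
    let T : Subalgebra k (LatticeV k) :=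
      { carrier := {a | ρ (a ⊗ₜ eGen k m) ∈ S}
        mul_mem' := fun {a b} ha hb => by
          rw [Set.mem_ofPred_eq] at ha hb ⊢
          rw [mul_left]
          exact mul_mem ha hb
        add_mem' := fun {a b} ha hb => by
          rw [Set.mem_ofPred_eq] at ha hb ⊢
          rw [TensorProduct.add_tmul, map_add]
          exact add_mem ha hb
        algebraMap_mem' := fun c => by
          rw [Set.mem_ofPred_eq, Algebra.algebraMap_eq_smul_one, ← TensorProduct.smul_tmul',
            map_smul, one_left]
          exact S.smul_mem (S.algebraMap_mem _) c }
    have hT : T = ⊤ := subalgebra_eq_top_of_latticeD (h 1 m (Or.inl rfl) hm)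
      (h (-1) m (Or.inr rfl) hm) (fun a ha => by
        change ρ _ ∈ S
        rw [deriv_left]
        exact h₀ _ ha)
    have : a ∈ T := by rw [hT]; trivial
    exact this
  let T : Subalgebra k (LatticeV k) :=
    { carrier := {b | ∀ a, ρ (a ⊗ₜ b) ∈ S}
      mul_mem' := fun {b c} hb hc a => by
        rw [Set.mem_ofPred_eq] at hb hc
        rw [mul_right]
        exact mul'_map_mem S (fun x => hb x) (fun x => hc x) _
      add_mem' := fun {b c} hb hc a => by
        rw [TensorProduct.tmul_add, map_add]
        exact add_mem (hb a) (hc a)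
      algebraMap_mem' := fun c a => by
        rw [Algebra.algebraMap_eq_smul_one, TensorProduct.tmul_smul, map_smul, one_right]
        exact S.smul_mem (S.algebraMap_mem _) c }
  have hT : T = ⊤ := by
    refine subalgebra_eq_top_of_latticeD (key 1 (Or.inl rfl)) (key (-1) (Or.inr rfl))
      (fun b hb a => ?_)
    rw [deriv_right]
    exact h₁ _ (hb a)
  have : b ∈ T := by rw [hT]; trivial
  exact this a

theorem IsBicharacter.eGen_mem (hr : IsBicharacter σ r)
    {S : Subalgebra k (MvPowerSeries τ (KRing k (Fin 2)))}
    (hσ : σ ∈ S) {s : MvPowerSeries τ (KRing k (Fin 2))} (hs : s ∈ S) (hsσ : s * σ = 1)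
    (m n : ℤ) (hm : m = 1 ∨ m = -1) (hn : n = 1 ∨ n = -1) :
    r (eGen k m ⊗ₜ eGen k n) ∈ S := by
  have h : ∀ t, t * σ = 1 → t = s := fun t ht => by
    calc t = t * (s * σ) := by rw [hsσ, mul_one]
      _ = (t * σ) * s := by ring
      _ = s := by rw [ht, one_mul]
  rcases hm with rfl | rfl <;> rcases hn with rfl | rfl
  · rwa [hr.lattice]
  · rwa [h _ hr.eGen_neg_right]
  · rwa [h _ hr.eGen_neg_left]
  · rwa [hr.eGen_neg_neg]

/-- The values of a bicharacter lie in every subalgebra that is closed under `∂_z` and `∂_w` and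
contains `σ` and `σ⁻¹`. -/
theorem IsBicharacter.mem [CharZero k] (hr : IsBicharacter σ r)
    (S : Subalgebra k (MvPowerSeries τ (KRing k (Fin 2))))
    (hS : ∀ (i : Fin 2), ∀ x ∈ S, tMap τ (KRing.partialD k i) x ∈ S)
    (hσ : σ ∈ S) {s : MvPowerSeries τ (KRing k (Fin 2))} (hs : s ∈ S) (hsσ : s * σ = 1)
    (a b : LatticeV k) : r (a ⊗ₜ b) ∈ S :=
  bimultiplicative_mem hr.one_left hr.one_right hr.mul_left_grouplike hr.mul_right hr.deriv_left
    hr.deriv_right S (hS 0) (hS 1) (hr.eGen_mem hσ hs hsσ) a b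

theorem mul'_map_prod {A X Y : Type*} [CommRing A] [Algebra k A] [AddCommGroup X] [Module k X]
    [AddCommGroup Y] [Module k Y] (f f' : X →ₗ[k] A) (g g' : Y →ₗ[k] A) (x : X ⊗[k] Y) :
    LinearMap.mul' k (A × A) (TensorProduct.map (f.prod f') (g.prod g') x) =
      (LinearMap.mul' k A (TensorProduct.map f g x),
        LinearMap.mul' k A (TensorProduct.map f' g' x)) := by
  induction x with
  | zero => simp only [map_zero]; rfl
  | add u v hu hv => simp only [map_add, hu, hv]; rfl
  | tmul y z => rfl

/-- Bimultiplicative functionals that intertwine derivations agree if they agree on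
`e^{±α} ⊗ e^{±α}`. -/
theorem bimultiplicative_ext [CharZero k] {A : Type*} [CommRing A] [Algebra k A]
    {ρ ρ' : LatticeV k ⊗[k] LatticeV k →ₗ[k] A} {δ₀ δ₁ : A →ₗ[k] A}
    (one_left : ∀ a, ρ (1 ⊗ₜ a) = algebraMap k A (counit k a))
    (one_left' : ∀ a, ρ' (1 ⊗ₜ a) = algebraMap k A (counit k a))
    (one_right : ∀ a, ρ (a ⊗ₜ 1) = algebraMap k A (counit k a))
    (one_right' : ∀ a, ρ' (a ⊗ₜ 1) = algebraMap k A (counit k a))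
    (mul_left : ∀ a b m, ρ ((a * b) ⊗ₜ eGen k m) = ρ (a ⊗ₜ eGen k m) * ρ (b ⊗ₜ eGen k m))
    (mul_left' : ∀ a b m, ρ' ((a * b) ⊗ₜ eGen k m) = ρ' (a ⊗ₜ eGen k m) * ρ' (b ⊗ₜ eGen k m))
    (mul_right : ∀ a b c, ρ (a ⊗ₜ (b * c)) = LinearMap.mul' k _
      (TensorProduct.map (ρ ∘ₗ (TensorProduct.mk k _ _).flip b)
        (ρ ∘ₗ (TensorProduct.mk k _ _).flip c) (comul k a)))
    (mul_right' : ∀ a b c, ρ' (a ⊗ₜ (b * c)) = LinearMap.mul' k _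
      (TensorProduct.map (ρ' ∘ₗ (TensorProduct.mk k _ _).flip b)
        (ρ' ∘ₗ (TensorProduct.mk k _ _).flip c) (comul k a)))
    (deriv_left : ∀ a b, ρ (latticeD k a ⊗ₜ b) = δ₀ (ρ (a ⊗ₜ b)))
    (deriv_left' : ∀ a b, ρ' (latticeD k a ⊗ₜ b) = δ₀ (ρ' (a ⊗ₜ b)))
    (deriv_right : ∀ a b, ρ (a ⊗ₜ latticeD k b) = δ₁ (ρ (a ⊗ₜ b)))
    (deriv_right' : ∀ a b, ρ' (a ⊗ₜ latticeD k b) = δ₁ (ρ' (a ⊗ₜ b)))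
    (h : ∀ m n : ℤ, m = 1 ∨ m = -1 → n = 1 ∨ n = -1 →
      ρ (eGen k m ⊗ₜ eGen k n) = ρ' (eGen k m ⊗ₜ eGen k n)) : ρ = ρ' := by
  have hmul : ∀ a b c, (ρ.prod ρ') (a ⊗ₜ (b * c)) = LinearMap.mul' k _
      (TensorProduct.map ((ρ.prod ρ') ∘ₗ (TensorProduct.mk k _ _).flip b)
        ((ρ.prod ρ') ∘ₗ (TensorProduct.mk k _ _).flip c) (comul k a)) := by
    intro a b c
    refine Eq.trans ?_ (mul'_map_prod (ρ ∘ₗ (TensorProduct.mk k _ _).flip b)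
      (ρ' ∘ₗ (TensorProduct.mk k _ _).flip b) (ρ ∘ₗ (TensorProduct.mk k _ _).flip c)
      (ρ' ∘ₗ (TensorProduct.mk k _ _).flip c) (comul k a)).symm
    exact Prod.ext (mul_right a b c) (mul_right' a b c)
  -- `bimultiplicative_mem` for the pair `(ρ, ρ')` with values in `A × A` and the diagonal
  have key : ∀ a b, (ρ.prod ρ') (a ⊗ₜ b) ∈
      AlgHom.equalizer (AlgHom.fst k A A) (AlgHom.snd k A A) :=
    bimultiplicative_mem (ρ := ρ.prod ρ') (δ₀ := δ₀.prodMap δ₀) (δ₁ := δ₁.prodMap δ₁)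
      (fun a => Prod.ext (one_left a) (one_left' a))
      (fun a => Prod.ext (one_right a) (one_right' a))
      (fun a b m => Prod.ext (mul_left a b m) (mul_left' a b m)) hmul
      (fun a b => Prod.ext (deriv_left a b) (deriv_left' a b))
      (fun a b => Prod.ext (deriv_right a b) (deriv_right' a b))
      (AlgHom.equalizer (AlgHom.fst k A A) (AlgHom.snd k A A))
      (fun _ hx => congrArg δ₀ hx) (fun _ hx => congrArg δ₁ hx) h
  exact TensorProduct.ext' fun a b => key a b

/-- A bicharacter is determined by `σ = r(e^α ⊗ e^α)`. -/
theorem IsBicharacter.unique [CharZero k] (hr : IsBicharacter σ r) (hr' : IsBicharacter σ r') :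
    r = r' := by
  have hs : ∀ s t, s * σ = 1 → t * σ = 1 → s = t := fun s t hs ht => by
    calc s = s * (t * σ) := by rw [ht, mul_one]
      _ = (s * σ) * t := by ring
      _ = t := by rw [hs, one_mul]
  refine bimultiplicative_ext hr.one_left hr'.one_left hr.one_right hr'.one_right
    hr.mul_left_grouplike hr'.mul_left_grouplike hr.mul_right hr'.mul_right
    hr.deriv_left hr'.deriv_left hr.deriv_right hr'.deriv_right fun m n hm hn => ?_
  rcases hm with rfl | rfl <;> rcases hn with rfl | rfl
  · rw [hr.lattice, hr'.lattice]
  · exact hs _ _ hr.eGen_neg_right hr'.eGen_neg_right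
  · exact hs _ _ hr.eGen_neg_left hr'.eGen_neg_left
  · rw [hr.eGen_neg_neg, hr'.eGen_neg_neg]

end Bicharacters

/-! ### Poles of the bicharacter at `w = 0` and at `z = 0` -/

section BoundedSeries

variable {k : Type*} [Field k] {τ : Type*}

/-- The series `x ∈ k((z))((w))[[t]]` without a pole at `w = 0` such that the total degrees of the
monomials `z^m w^n` of all coefficients are bounded below. -/
def boundedSeries (k τ : Type*) [Field k] :
    Subalgebra k (MvPowerSeries τ (HahnSeries ℤ (HahnSeries ℤ k))) where
  carrier := {x | ∃ e : ℤ, ∀ d n m, ((x d).coeff n).coeff m ≠ 0 → 0 ≤ n ∧ e ≤ m + n}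
  mul_mem' := by
    rintro x y ⟨e, he⟩ ⟨e', he'⟩
    refine ⟨e + e', fun d n m h => ?_⟩
    rw [mul_apply_antidiagonal, HahnSeries.coeff_sum, HahnSeries.coeff_sum] at h
    obtain ⟨p, -, hp⟩ := Finset.exists_ne_zero_of_sum_ne_zero h
    rw [coeff_mul_eq_finsum] at hp
    have hfin : (Function.support fun i : ℤ =>
        (x p.1).coeff i * (y p.2).coeff (n - i)).Finite :=
      finite_support_mul (LinearMap.mul k _) (x p.1) (y p.2) n
    rw [finsum_eq_sum_of_support_subset (s := hfin.toFinset) _ (by simp),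
      HahnSeries.coeff_sum] at hp
    obtain ⟨i, -, hi⟩ := Finset.exists_ne_zero_of_sum_ne_zero hp
    rw [coeff_mul_eq_finsum] at hi
    obtain ⟨j, hj⟩ : ∃ j,
        ((x p.1).coeff i).coeff j * ((y p.2).coeff (n - i)).coeff (m - j) ≠ 0 := by
      by_contra! hcon
      exact hi (finsum_eq_zero_of_forall_eq_zero hcon)
    have h1 := he _ _ _ (left_ne_zero_of_mul hj)
    have h2 := he' _ _ _ (right_ne_zero_of_mul hj)
    omega
  add_mem' := by
    rintro x y ⟨e, he⟩ ⟨e', he'⟩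
    refine ⟨min e e', fun d n m h => ?_⟩
    by_cases hx : ((x d).coeff n).coeff m = 0
    · have hy : ((y d).coeff n).coeff m ≠ 0 := by
        intro hy
        refine h ?_
        change ((x d).coeff n).coeff m + ((y d).coeff n).coeff m = 0
        rw [hx, hy, add_zero]
      have := he' _ _ _ hy
      omega
    · have := he _ _ _ hx
      omega
  algebraMap_mem' := fun c => by
    classical
    refine ⟨0, fun d n m h => ?_⟩
    change (HahnSeries.coeff (MvPowerSeries.coeff d (algebraMap k
      (MvPowerSeries τ (HahnSeries ℤ (HahnSeries ℤ k))) c)) n).coeff m ≠ 0 at h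
    rw [IsScalarTower.algebraMap_apply k (HahnSeries ℤ (HahnSeries ℤ k))
      (MvPowerSeries τ (HahnSeries ℤ (HahnSeries ℤ k))), MvPowerSeries.algebraMap_apply,
      MvPowerSeries.coeff_C] at h
    split_ifs at h
    · change ((HahnSeries.single 0 (HahnSeries.single 0 c) :
        HahnSeries ℤ (HahnSeries ℤ k)).coeff n).coeff m ≠ 0 at h
      rw [HahnSeries.coeff_single] at h
      split_ifs at h with hn
      · rw [HahnSeries.coeff_single] at h
        split_ifs at h with hm
        · omega
        · exact absurd rfl h
      · exact absurd rfl h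
    · exact absurd rfl h

theorem tMap_hDeriv_mem_boundedSeries {x : MvPowerSeries τ (HahnSeries ℤ (HahnSeries ℤ k))}
    (hx : x ∈ boundedSeries k τ) : tMap τ (hDeriv k _) x ∈ boundedSeries k τ := by
  obtain ⟨e, he⟩ := hx
  refine ⟨e - 1, fun d n m h => ?_⟩
  rw [tMap_apply, coeff_hDeriv] at h
  change (((n + 1 : ℤ) : k)) • ((x d).coeff (n + 1)).coeff m ≠ 0 at h
  have h1 := he _ _ _ (right_ne_zero_of_smul h)
  have h2 : n + 1 ≠ 0 := fun h0 => left_ne_zero_of_smul h (by rw [h0, Int.cast_zero])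
  omega

theorem tMap_hMap_hDeriv_mem_boundedSeries
    {x : MvPowerSeries τ (HahnSeries ℤ (HahnSeries ℤ k))}
    (hx : x ∈ boundedSeries k τ) : tMap τ (hMap (hDeriv k k)) x ∈ boundedSeries k τ := by
  obtain ⟨e, he⟩ := hx
  refine ⟨e - 1, fun d n m h => ?_⟩
  rw [tMap_apply, coeff_hMap, coeff_hDeriv] at h
  have h1 := he _ _ _ (right_ne_zero_of_smul h)
  omega

/-- The coefficient of `t^d` in `F(w / z)`, as a power series in `w`. -/
def ratioCoeff (F : PowerSeries (MvPowerSeries τ k)) (d : τ →₀ ℕ) :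
    PowerSeries (HahnSeries ℤ k) :=
  PowerSeries.mk fun n =>
    HahnSeries.single (-(n : ℤ)) (MvPowerSeries.coeff d (PowerSeries.coeff n F))

/-- The series `F(w / z) ∈ k((z))((w))[[t]]` for `F ∈ k[[t]][[x]]`. -/
def ratioSeries (F : PowerSeries (MvPowerSeries τ k)) :
    MvPowerSeries τ (HahnSeries ℤ (HahnSeries ℤ k)) :=
  fun d => HahnSeries.ofPowerSeries ℤ (HahnSeries ℤ k) (ratioCoeff F d)

theorem coeff_ofPowerSeries_of_neg {A : Type*} [Semiring A] (x : PowerSeries A) {n : ℤ}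
    (hn : n < 0) : (HahnSeries.ofPowerSeries ℤ A x).coeff n = 0 := by
  rw [HahnSeries.ofPowerSeries_apply]
  refine HahnSeries.embDomain_of_notMem_range ?_
  rintro ⟨m, hm⟩
  have : (m : ℤ) = n := hm
  omega

theorem coeff_ratioSeries (F : PowerSeries (MvPowerSeries τ k)) (d : τ →₀ ℕ) (n m : ℤ) :
    ((ratioSeries F d).coeff n).coeff m = if 0 ≤ n ∧ m = -n then
      MvPowerSeries.coeff d (PowerSeries.coeff n.toNat F) else 0 := by
  classical
  rw [ratioSeries]
  by_cases hn : 0 ≤ n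
  · lift n to ℕ using hn
    rw [HahnSeries.ofPowerSeries_apply_coeff, ratioCoeff, PowerSeries.coeff_mk,
      HahnSeries.coeff_single]
    simp
  · rw [coeff_ofPowerSeries_of_neg _ (not_le.mp hn), if_neg (fun h => hn h.1)]
    rfl

/-- The substitution `x = w / z` is multiplicative. -/
theorem ratioSeries_mul (F G : PowerSeries (MvPowerSeries τ k)) :
    ratioSeries (F * G) = ratioSeries F * ratioSeries G := by
  classical
  funext d
  rw [mul_apply_antidiagonal]
  have h : ratioCoeff (F * G) d = ∑ p ∈ Finset.HasAntidiagonal.antidiagonal d,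
      ratioCoeff F p.1 * ratioCoeff G p.2 := by
    refine PowerSeries.ext fun n => ?_
    rw [map_sum, ratioCoeff, PowerSeries.coeff_mk, PowerSeries.coeff_mul, map_sum]
    simp only [PowerSeries.coeff_mul, ratioCoeff, PowerSeries.coeff_mk,
      HahnSeries.single_mul_single]
    rw [Finset.sum_comm]
    refine (map_sum (HahnSeries.single.addMonoidHom (R := k) (-(n : ℤ))) _ _).trans ?_
    refine Finset.sum_congr rfl fun q hq => ?_
    rw [MvPowerSeries.coeff_mul]
    refine (map_sum (HahnSeries.single.addMonoidHom (R := k) (-(n : ℤ))) _ _).trans ?_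
    have h : -(q.1 : ℤ) + -(q.2 : ℤ) = -(n : ℤ) := by
      have := Finset.HasAntidiagonal.mem_antidiagonal.mp hq
      omega
    rw [h]
    rfl
  rw [ratioSeries, h, map_sum]
  convert Finset.sum_congr rfl fun (p : (τ →₀ ℕ) × (τ →₀ ℕ)) _ =>
    map_mul (HahnSeries.ofPowerSeries ℤ (HahnSeries ℤ k)) (ratioCoeff F p.1)
      (ratioCoeff G p.2) <;> rfl

theorem ratioSeries_one : ratioSeries (1 : PowerSeries (MvPowerSeries τ k)) = 1 := by
  classical
  funext d
  ext n m
  rw [coeff_ratioSeries]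
  have h : (1 : MvPowerSeries τ (HahnSeries ℤ (HahnSeries ℤ k))) d = if d = 0 then 1 else 0 :=
    MvPowerSeries.coeff_one d
  rw [h, PowerSeries.coeff_one]
  by_cases hn : n = 0
  · subst hn
    by_cases hd : d = 0
    · subst hd; simp [HahnSeries.coeff_one]
    · simp [hd, MvPowerSeries.coeff_one]
  · by_cases hd : d = 0
    · have : 0 ≤ n → n.toNat ≠ 0 := by omega
      subst hd
      simp only [HahnSeries.coeff_one, if_neg hn, if_true, HahnSeries.coeff_zero]
      split_ifs with h1 h2
      · exact absurd h2 (this h1.1)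
      · simp
      · rfl
    · simp [hd, MvPowerSeries.coeff_one, apply_ite]

theorem ratioSeries_mem_boundedSeries (F : PowerSeries (MvPowerSeries τ k)) :
    ratioSeries F ∈ boundedSeries k τ := by
  refine ⟨0, fun d n m h => ?_⟩
  rw [coeff_ratioSeries] at h
  split_ifs at h with h1
  · omega
  · exact absurd rfl h

theorem tC_hC_single_mem_boundedSeries (j : ℤ) :
    tC k τ _ (hC k (HahnSeries ℤ k) (HahnSeries.single j 1)) ∈ boundedSeries k τ := by
  classical
  refine ⟨j, fun d n m h => ?_⟩
  rw [tC_apply] at h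
  split_ifs at h
  · rw [hC_apply, HahnSeries.coeff_single] at h
    split_ifs at h with hn
    · rw [HahnSeries.coeff_single] at h
      split_ifs at h with hm
      · omega
      · exact absurd rfl h
    · exact absurd rfl h
  · exact absurd rfl h

end BoundedSeries

section Regularity

variable {k : Type*} [Field k] {τ : Type*} {F : Type*} [Field F]
  [Algebra (MvPowerSeries τ k) F]
  {v : ℕ+ → F} {c : ℕ+ → MvPowerSeries τ k} {σ : MvPowerSeries τ (KRing k (Fin 2))}
  {r : LatticeV k ⊗[k] LatticeV k →ₗ[k] MvPowerSeries τ (KRing k (Fin 2))}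

theorem isUnit_fSeries (c : ℕ+ → MvPowerSeries τ k) : IsUnit (fSeries c) := by
  rw [PowerSeries.isUnit_iff_constantCoeff, ← PowerSeries.coeff_zero_eq_constantCoeff_apply]
  have h : PowerSeries.coeff 0 (fSeries c) = 1 := by
    rw [fSeries, expSeries, PowerSeries.coeff_mk]
    simp
  rw [h]
  exact isUnit_one

/-- The defining property of `σ`, as an equality `σ = z f(w / z)` of series. -/
theorem IsSigma.expand_eq (hσ : IsSigma v c σ) : tMapAlg τ (expand k) σ =
    tC k τ _ (hC k (HahnSeries ℤ k) (HahnSeries.single 1 1)) * ratioSeries (fSeries c) := by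
  funext d
  ext n m
  rw [C_mul_apply, hC_apply, HahnSeries.coeff_single_zero_mul]
  have h : m = (m - 1) + 1 := by ring
  rw [h, HahnSeries.coeff_single_mul_add, one_mul, coeff_ratioSeries]
  refine (hσ.expansion d _ _).trans ?_
  refine if_congr ?_ rfl rfl
  omega

/-- The values of the bicharacter have no pole at `w = 0`, and their poles at `z = 0` are bounded,
uniformly in the powers of the parameters. -/
theorem IsSigma.bicharacter_mem [CharZero k] (hσ : IsSigma v c σ) (hr : IsBicharacter σ r)
    (a b : LatticeV k) :
    tMapAlg τ (expand k) (r (a ⊗ₜ b)) ∈ boundedSeries k τ := by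
  obtain ⟨s, hs⟩ := hσ.isUnit.exists_left_inv
  obtain ⟨g, hg⟩ := (isUnit_fSeries c).exists_left_inv
  refine hr.mem ((boundedSeries k τ).comap (tMapAlg τ (expand k))) ?_ ?_ (s := s) ?_ hs a b
  · intro i x hx
    fin_cases i
    · have h : tMapAlg τ (expand k) (tMap τ (KRing.partialD k 0) x) =
          tMap τ (hMap (hDeriv k k)) (tMapAlg τ (expand k) x) := by
        funext d
        exact expand_partialD_zero _
      change tMapAlg τ (expand k) (tMap τ (KRing.partialD k 0) x) ∈ boundedSeries k τ
      rw [h]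
      exact tMap_hMap_hDeriv_mem_boundedSeries hx
    · have h : tMapAlg τ (expand k) (tMap τ (KRing.partialD k 1) x) =
          tMap τ (hDeriv k _) (tMapAlg τ (expand k) x) := by
        funext d
        exact expand_partialD_one _
      change tMapAlg τ (expand k) (tMap τ (KRing.partialD k 1) x) ∈ boundedSeries k τ
      rw [h]
      exact tMap_hDeriv_mem_boundedSeries hx
  · change tMapAlg τ (expand k) σ ∈ boundedSeries k τ
    rw [hσ.expand_eq]
    exact mul_mem (tC_hC_single_mem_boundedSeries 1) (ratioSeries_mem_boundedSeries _)
  · change tMapAlg τ (expand k) s ∈ boundedSeries k τ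
    -- the inverse of `σ = z f(w / z)` has the expansion `z⁻¹ f⁻¹(w / z)`
    have h1 : tMapAlg τ (expand k) s * (tC k τ _ (hC k (HahnSeries ℤ k) (HahnSeries.single 1 1)) *
        ratioSeries (fSeries c)) = 1 := by
      rw [← hσ.expand_eq, ← map_mul, hs, map_one]
    have h2 : tC k τ _ (hC k (HahnSeries ℤ k) (HahnSeries.single 1 1)) *
        tC k τ _ (hC k (HahnSeries ℤ k) (HahnSeries.single (-1) 1)) = 1 := by
      rw [← tCAlg_apply, ← tCAlg_apply, ← map_mul, ← map_mul, HahnSeries.single_mul_single]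
      simp only [add_neg_cancel, mul_one]
      exact (congrArg _ (map_one (hC k (HahnSeries ℤ k)))).trans (map_one _)
    have h3 : ratioSeries g * ratioSeries (fSeries c) = 1 := by
      rw [← ratioSeries_mul, hg, ratioSeries_one]
    have h4 : tMapAlg τ (expand k) s =
        tC k τ _ (hC k (HahnSeries ℤ k) (HahnSeries.single (-1) 1)) * ratioSeries g := by
      calc _ = tMapAlg τ (expand k) s * ((tC k τ _ (hC k (HahnSeries ℤ k) (HahnSeries.single 1 1)) *
            tC k τ _ (hC k (HahnSeries ℤ k) (HahnSeries.single (-1) 1))) *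
              (ratioSeries g * ratioSeries (fSeries c))) := by rw [h2, h3, one_mul, mul_one]
        _ = (tMapAlg τ (expand k) s * (tC k τ _ (hC k (HahnSeries ℤ k) (HahnSeries.single 1 1)) *
              ratioSeries (fSeries c))) *
              (tC k τ _ (hC k (HahnSeries ℤ k) (HahnSeries.single (-1) 1)) * ratioSeries g) := by
            ring
        _ = _ := by rw [h1, one_mul]
    rw [h4]
    exact mul_mem (tC_hC_single_mem_boundedSeries (-1)) (ratioSeries_mem_boundedSeries _)

end Regularity

/-! ### Divided powers of the infinitesimal translation -/

section DividedPowers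

variable {k : Type*} [Field k] [CharZero k] {X Y : Type*} [AddCommGroup X] [Module k X]
  [AddCommGroup Y] [Module k Y]

theorem dividedPow_add {δ δ' : X →ₗ[k] X} (h : Commute δ δ') (n : ℕ) (x : X) :
    dividedPow (δ + δ') n x =
      ∑ p ∈ Finset.HasAntidiagonal.antidiagonal n, dividedPow δ p.1 (dividedPow δ' p.2 x) := by
  rw [dividedPow, h.add_pow', Finset.smul_sum, LinearMap.sum_apply]
  refine Finset.sum_congr rfl fun p hp => ?_
  replace hp := Finset.HasAntidiagonal.mem_antidiagonal.mp hp
  rw [dividedPow, dividedPow, LinearMap.smul_apply, LinearMap.smul_apply, LinearMap.smul_apply,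
    LinearMap.smul_apply, map_smul, smul_smul, Module.End.mul_apply, ← Nat.cast_smul_eq_nsmul k,
    smul_smul]
  congr 1
  have h1 := Nat.add_choose_mul_factorial_mul_factorial p.1 p.2
  rw [hp] at h1
  have h2 : ((p.1.factorial : ℕ) : k) ≠ 0 := Nat.cast_ne_zero.mpr (Nat.factorial_ne_zero _)
  have h3 : ((p.2.factorial : ℕ) : k) ≠ 0 := Nat.cast_ne_zero.mpr (Nat.factorial_ne_zero _)
  have h4 : ((n.factorial : ℕ) : k) ≠ 0 := Nat.cast_ne_zero.mpr (Nat.factorial_ne_zero _)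
  field_simp
  rw [← h1, Nat.choose_symm_of_eq_add hp.symm]
  push_cast
  ring

omit [CharZero k] in
theorem map_dividedPow {f : X →ₗ[k] Y} {δ : X →ₗ[k] X} {δ' : Y →ₗ[k] Y}
    (h : ∀ x, f (δ x) = δ' (f x)) (n : ℕ) (x : X) :
    f (dividedPow δ n x) = dividedPow δ' n (f x) := by
  rw [dividedPow, dividedPow, LinearMap.smul_apply, LinearMap.smul_apply, map_smul]
  congr 1
  induction n generalizing x with
  | zero => rfl
  | succ n ih => rw [pow_succ, pow_succ, Module.End.mul_apply, Module.End.mul_apply, ih, h]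

omit [CharZero k] in
theorem dividedPow_rTensor (δ : X →ₗ[k] X) (n : ℕ) :
    dividedPow (LinearMap.rTensor Y δ) n = LinearMap.rTensor Y (dividedPow δ n) := by
  rw [dividedPow, dividedPow, LinearMap.rTensor_smul, LinearMap.rTensor_pow]

omit [CharZero k] in
theorem dividedPow_lTensor (δ : X →ₗ[k] X) (n : ℕ) :
    dividedPow (LinearMap.lTensor Y δ) n = LinearMap.lTensor Y (dividedPow δ n) := by
  rw [dividedPow, dividedPow, LinearMap.lTensor_smul, LinearMap.lTensor_pow]

theorem dividedPow_tensor (δ : X →ₗ[k] X) (δ' : Y →ₗ[k] Y) (n : ℕ) (x : X ⊗[k] Y) :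
    dividedPow (LinearMap.rTensor Y δ + LinearMap.lTensor X δ') n x =
      ∑ p ∈ Finset.HasAntidiagonal.antidiagonal n,
        TensorProduct.map (dividedPow δ p.1) (dividedPow δ' p.2) x := by
  have h : Commute (LinearMap.rTensor Y δ) (LinearMap.lTensor X δ') := by
    refine TensorProduct.ext' fun a b => ?_
    rfl
  rw [dividedPow_add h]
  refine Finset.sum_congr rfl fun p _ => ?_
  rw [dividedPow_rTensor, dividedPow_lTensor]
  exact LinearMap.congr_fun (LinearMap.rTensor_comp_lTensor _ _ _) x

/-- The divided powers of `D` are compatible with the coproduct, since `D` is a coderivation. -/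
theorem comul_dividedPow (n : ℕ) (a : LatticeV k) :
    comul k (dividedPow (latticeD k) n a) = ∑ p ∈ Finset.HasAntidiagonal.antidiagonal n,
      TensorProduct.map (dividedPow (latticeD k) p.1) (dividedPow (latticeD k) p.2)
        (comul k a) := by
  rw [← dividedPow_tensor]
  exact map_dividedPow (f := (comul k).toLinearMap) comul_latticeD n a

theorem dividedPow_mul (n : ℕ) (a b : LatticeV k) :
    dividedPow (latticeD k) n (a * b) = ∑ p ∈ Finset.HasAntidiagonal.antidiagonal n,
      dividedPow (latticeD k) p.1 a * dividedPow (latticeD k) p.2 b := by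
  have h := map_dividedPow (f := LinearMap.mul' k (LatticeV k))
    (δ := LinearMap.rTensor _ (latticeD k) + LinearMap.lTensor _ (latticeD k))
    (δ' := latticeD k) (fun x => by
      induction x with
      | zero => simp
      | add x y hx hy => rw [map_add, map_add, hx, hy, map_add, map_add]
      | tmul x y =>
        rw [LinearMap.mul'_apply, latticeD_mul, LinearMap.add_apply, map_add]; rfl) n (a ⊗ₜ b)
  rw [dividedPow_tensor, map_sum] at h
  exact h.symm

omit [CharZero k] in
theorem expD_eq (a : LatticeV k) : expD k a = HahnSeries.ofPowerSeries ℤ (LatticeV k)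
    (PowerSeries.mk fun n => dividedPow (latticeD k) n a) := by
  ext n
  change (if 0 ≤ n then (n.toNat.factorial : k)⁻¹ • (latticeD k ^ n.toNat) a else 0) = _
  split_ifs with hn
  · lift n to ℕ using hn
    rw [HahnSeries.ofPowerSeries_apply_coeff, PowerSeries.coeff_mk]
    rfl
  · rw [coeff_ofPowerSeries_of_neg _ (not_le.mp hn)]

omit [CharZero k] in
theorem coeff_expD (a : LatticeV k) (n : ℕ) :
    (expD k a).coeff n = dividedPow (latticeD k) n a := rfl

omit [CharZero k] in
theorem coeff_expD_of_neg (a : LatticeV k) {n : ℤ} (hn : n < 0) : (expD k a).coeff n = 0 :=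
  if_neg (not_le.mpr hn)

omit [CharZero k] in
theorem coeff_zero_hDeriv_pow {A : Type*} [AddCommGroup A] [Module k A] (n : ℕ)
    (x : HahnSeries ℤ A) :
    ((hDeriv k A ^ n) x).coeff 0 = (n.factorial : k) • x.coeff n := by
  induction n generalizing x with
  | zero => simp
  | succ n ih =>
    rw [pow_succ, Module.End.mul_apply, ih, coeff_hDeriv, smul_smul, Nat.factorial_succ]
    push_cast
    rw [mul_comm]

/-- Taylor's formula. -/
theorem coeff_zero_dividedPow_hDeriv {A : Type*} [AddCommGroup A] [Module k A] (n : ℕ)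
    (x : HahnSeries ℤ A) : (dividedPow (hDeriv k A) n x).coeff 0 = x.coeff n := by
  have h : ((n.factorial : ℕ) : k) ≠ 0 := Nat.cast_ne_zero.mpr (Nat.factorial_ne_zero _)
  rw [dividedPow, LinearMap.smul_apply]
  change (n.factorial : k)⁻¹ • ((hDeriv k A ^ n) x).coeff 0 = _
  rw [coeff_zero_hDeriv_pow, smul_smul, inv_mul_cancel₀ h, one_smul]

omit [CharZero k] in
theorem coeff_zero_mul {A : Type*} [CommRing A] [Algebra k A] {x y : HahnSeries ℤ A}
    (hx : ∀ n < 0, x.coeff n = 0) (hy : ∀ n < 0, y.coeff n = 0) :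
    (x * y).coeff 0 = x.coeff 0 * y.coeff 0 := by
  rw [coeff_mul_eq_sum x y 0 (s := {0})]
  · simp
  · intro i h1 h2
    rw [Finset.mem_singleton]
    by_contra h
    rcases lt_or_gt_of_ne h with h | h
    · exact h1 (hx i h)
    · exact h2 (hy _ (by omega))

end DividedPowers

/-! ### Functionals on a tensor product of bialgebras -/

section External

open WithConv

variable {k : Type*} [Field k] {C D : Type*} [AddCommGroup C] [Module k C] [Coalgebra k C]
  [AddCommGroup D] [Module k D] [Coalgebra k D] {A : Type*} [CommRing A] [Algebra k A]

/-- The functional `a ⊗ b ↦ f(a) ε(b)`. -/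
def extLeft (D : Type*) [AddCommGroup D] [Module k D] [Coalgebra k D] (f : C →ₗ[k] A) :
    C ⊗[k] D →ₗ[k] A :=
  (TensorProduct.rid k A).toLinearMap ∘ₗ TensorProduct.map f CoalgebraStruct.counit

/-- The functional `a ⊗ b ↦ ε(a) g(b)`. -/
def extRight (C : Type*) [AddCommGroup C] [Module k C] [Coalgebra k C] (g : D →ₗ[k] A) :
    C ⊗[k] D →ₗ[k] A :=
  (TensorProduct.lid k A).toLinearMap ∘ₗ TensorProduct.map CoalgebraStruct.counit g

omit [Coalgebra k C] in
@[simp]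
theorem extLeft_tmul (f : C →ₗ[k] A) (a : C) (b : D) :
    extLeft D f (a ⊗ₜ b) = CoalgebraStruct.counit (R := k) b • f a := by
  simp [extLeft]

omit [Coalgebra k D] in
@[simp]
theorem extRight_tmul (g : D →ₗ[k] A) (a : C) (b : D) :
    extRight C g (a ⊗ₜ b) = CoalgebraStruct.counit (R := k) a • g b := by
  simp [extRight]

theorem conv_tmul {a : C} {b : D} {ι κ : Type*} (R : Coalgebra.Repr k a ι)
    (R' : Coalgebra.Repr k b κ)
    (f g : WithConv (C ⊗[k] D →ₗ[k] A)) :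
    (f * g) (a ⊗ₜ b) = ∑ i ∈ R.index, ∑ j ∈ R'.index,
      f (R.left i ⊗ₜ R'.left j) * g (R.right i ⊗ₜ R'.right j) := by
  rw [LinearMap.convMul_apply, comul_tmul, ← R.eq, ← R'.eq, TensorProduct.sum_tmul]
  simp only [TensorProduct.tmul_sum, map_sum]
  rfl

theorem extLeft_conv {a : C} {ι : Type*} (R : Coalgebra.Repr k a ι) (b : D) (f : C →ₗ[k] A)
    (g : WithConv (C ⊗[k] D →ₗ[k] A)) :
    (toConv (extLeft D f) * g) (a ⊗ₜ b) = ∑ i ∈ R.index, f (R.left i) * g (R.right i ⊗ₜ b) := by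
  rw [conv_tmul R (Coalgebra.Repr.arbitrary k b)]
  refine Finset.sum_congr rfl fun i _ => ?_
  conv_rhs => rw [← Coalgebra.sum_counit_smul (Coalgebra.Repr.arbitrary k b)]
  rw [TensorProduct.tmul_sum, map_sum, Finset.mul_sum]
  refine Finset.sum_congr rfl fun j _ => ?_
  change extLeft D f _ * _ = _
  rw [extLeft_tmul, TensorProduct.tmul_smul, map_smul, smul_mul_assoc, mul_smul_comm]

theorem extRight_conv {b : D} {ι : Type*} (R : Coalgebra.Repr k b ι) (a : C) (f : D →ₗ[k] A)
    (g : WithConv (C ⊗[k] D →ₗ[k] A)) :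
    (toConv (extRight C f) * g) (a ⊗ₜ b) = ∑ i ∈ R.index, f (R.left i) * g (a ⊗ₜ R.right i) := by
  rw [conv_tmul (Coalgebra.Repr.arbitrary k a) R, Finset.sum_comm]
  refine Finset.sum_congr rfl fun i _ => ?_
  conv_rhs => rw [← Coalgebra.sum_counit_smul (Coalgebra.Repr.arbitrary k a)]
  rw [TensorProduct.sum_tmul, map_sum, Finset.mul_sum]
  refine Finset.sum_congr rfl fun j _ => ?_
  change extRight C f _ * _ = _
  rw [extRight_tmul, ← TensorProduct.smul_tmul', map_smul, smul_mul_assoc, mul_smul_comm]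

theorem extLeft_conv_extRight (a : C) (b : D) (f : C →ₗ[k] A) (g : D →ₗ[k] A) :
    (toConv (extLeft D f) * toConv (extRight C g)) (a ⊗ₜ b) = f a * g b := by
  rw [extLeft_conv (Coalgebra.Repr.arbitrary k a)]
  have h := congrArg (TensorProduct.rid k C)
    (Coalgebra.sum_tmul_counit_eq (Coalgebra.Repr.arbitrary k a))
  rw [map_sum, TensorProduct.rid_tmul, one_smul] at h
  change ∑ i ∈ _, f _ * extRight C g _ = _
  conv_rhs => rw [← h]
  rw [map_sum, Finset.sum_mul]
  refine Finset.sum_congr rfl fun i _ => ?_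
  rw [extRight_tmul, TensorProduct.rid_tmul, map_smul, smul_mul_assoc, mul_smul_comm]

end External

/-! ### The fields of the vertex algebra -/

section Fields

open WithConv

variable {k : Type*} [Field k] {τ : Type*}
  (r : LatticeV k ⊗[k] LatticeV k →ₗ[k] MvPowerSeries τ (KRing k (Fin 2)))

/-- The functional `r(a ⊗ b)(z, 0)`. -/
def valueAtZero : LatticeV k ⊗[k] LatticeV k →ₗ[k] MvPowerSeries τ (HahnSeries ℤ k) :=
  tMap τ (evalW k) ∘ₗ r

/-- Extension of scalars from `k((z))[[t]]` to `A((z))[[t]]`. -/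
def scalarSeries (k τ A : Type*) [Field k] [CommRing A] [Algebra k A] :
    MvPowerSeries τ (HahnSeries ℤ k) →ₐ[k] MvPowerSeries τ (HahnSeries ℤ A) :=
  tMapAlg τ (hMapAlg (Algebra.ofId k A))

/-- The inclusion `A → A((z))[[t]]` of the constants. -/
def constSeries (k τ A : Type*) [Field k] [CommRing A] [Algebra k A] :
    A →ₐ[k] MvPowerSeries τ (HahnSeries ℤ A) :=
  (tCAlg k τ (HahnSeries ℤ A)).comp (hC k A)

/-- The functional `r(a ⊗ b)(z, 0)` with values in `V((z))[[t]]`. -/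
def fieldFunctional :
    LatticeV k ⊗[k] LatticeV k →ₗ[k] MvPowerSeries τ (HahnSeries ℤ (LatticeV k)) :=
  (scalarSeries k τ (LatticeV k)).toLinearMap ∘ₗ valueAtZero r

/-- The part `X(a, z) b = Σ b' r(a ⊗ b'')(z, 0)` of the field `Y(a, z)`. -/
def annihilationPart :
    LatticeV k →ₗ[k] LatticeV k →ₗ[k] MvPowerSeries τ (HahnSeries ℤ (LatticeV k)) :=
  TensorProduct.curry (toConv (extRight (LatticeV k) (constSeries k τ (LatticeV k)).toLinearMap) *
    toConv (fieldFunctional r)).ofConv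

theorem annihilationPart_apply (a b : LatticeV k) {ι : Type*} (R : Coalgebra.Repr k b ι) :
    annihilationPart r a b =
      ∑ i ∈ R.index, constSeries k τ _ (R.left i) * fieldFunctional r (a ⊗ₜ R.right i) :=
  extRight_conv R a _ _

theorem expDMul_tmul (a b : LatticeV k) :
    expDMul k (a ⊗ₜ b) = expD k a * hC k (LatticeV k) b := by
  change hMap (LinearMap.mulRight k b) (expD k a) = _
  ext n
  rw [hC_apply, HahnSeries.coeff_mul_single_zero]
  rfl

/-- The fields as a convolution product: `Y(a, z) b` is the product of the functionals
`a ⊗ b ↦ (e^{zD} a) b` and `r(a ⊗ b)(z, 0)`. -/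
theorem bicharY_eq_conv : TensorProduct.uncurry (RingHom.id k) _ _ _ (bicharY r) =
    (toConv (tC k τ _ ∘ₗ expDMul k) * toConv (fieldFunctional r)).ofConv := by
  refine TensorProduct.ext' fun a b => ?_
  change TensorProduct.lift _ (comul₂ k (a ⊗ₜ b)) = LinearMap.mul' k _ (TensorProduct.map _ _
    (comul₂ k (a ⊗ₜ b)))
  induction comul₂ k (a ⊗ₜ b) with
  | zero => simp only [map_zero]
  | add u v hu hv => simp only [map_add, hu, hv]
  | tmul x y =>
    rw [TensorProduct.lift.tmul, LinearMap.mk₂_apply, TensorProduct.map_tmul, LinearMap.mul'_apply]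
    funext d
    rw [LinearMap.comp_apply, C_mul_apply]
    change seriesMul (LinearMap.lsmul k (LatticeV k)) (evalW k (r y d)) (expDMul k x) = _
    rw [seriesMul_lsmul, mul_comm]
    rfl

theorem tC_expDMul : toConv (tC k τ _ ∘ₗ expDMul k) =
    toConv (extLeft (LatticeV k) (tC k τ _ ∘ₗ expD k)) *
      toConv (extRight (LatticeV k) (constSeries k τ (LatticeV k)).toLinearMap) := by
  refine WithConv.ofConv_injective (TensorProduct.ext' fun a b => ?_)
  refine Eq.trans ?_ (extLeft_conv_extRight a b _ _).symm
  change tC k τ _ (expDMul k (a ⊗ₜ b)) = tC k τ _ (expD k a) * tC k τ _ (hC k (LatticeV k) b)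
  rw [expDMul_tmul]
  exact map_mul (tCAlg k τ _) _ _

/-- `Y(a, z) b = Σ (e^{zD} a') X(a'', z) b`. -/
theorem bicharY_apply (a b : LatticeV k) {ι : Type*} (R : Coalgebra.Repr k a ι) :
    bicharY r a b = ∑ i ∈ R.index, tC k τ _ (expD k (R.left i)) *
      annihilationPart r (R.right i) b := by
  refine (LinearMap.congr_fun (bicharY_eq_conv r) (a ⊗ₜ b)).trans ?_
  rw [tC_expDMul, mul_assoc]
  exact extLeft_conv R b _ _

end Fields

/-! ### Products of two fields -/

section ValueAtZero

variable {k : Type*} [Field k] {τ : Type*} {σ : MvPowerSeries τ (KRing k (Fin 2))}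
  {r : LatticeV k ⊗[k] LatticeV k →ₗ[k] MvPowerSeries τ (KRing k (Fin 2))}

/-- The values of `r` have no pole at `w = 0`. -/
def RegularAtZero (r : LatticeV k ⊗[k] LatticeV k →ₗ[k] MvPowerSeries τ (KRing k (Fin 2))) : Prop :=
  ∀ a b d, ∀ n < 0, (expand k (r (a ⊗ₜ b) d)).coeff n = 0

/-- Evaluation at `w = 0` is multiplicative on functions without a pole there. -/
theorem tMap_evalW_mul {x y : MvPowerSeries τ (KRing k (Fin 2))}
    (hx : ∀ d, ∀ n < 0, (expand k (x d)).coeff n = 0)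
    (hy : ∀ d, ∀ n < 0, (expand k (y d)).coeff n = 0) :
    tMap τ (evalW k) (x * y) = tMap τ (evalW k) x * tMap τ (evalW k) y := by
  classical
  funext d
  rw [tMap_apply, mul_apply_antidiagonal, mul_apply_antidiagonal, map_sum]
  refine Finset.sum_congr rfl fun p _ => ?_
  change (expand k (x p.1 * y p.2)).coeff 0 = _
  rw [map_mul]
  exact coeff_zero_mul (k := k) (hx _) (hy _)

theorem evalW_algebraMap (c : k) :
    evalW k (algebraMap k (KRing k (Fin 2)) c) = algebraMap k (HahnSeries ℤ k) c := by
  change (expand k (algebraMap k _ c)).coeff 0 = _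
  rw [AlgHom.commutes, Algebra.algebraMap_eq_smul_one, Algebra.algebraMap_eq_smul_one]
  change c • (1 : HahnSeries ℤ (HahnSeries ℤ k)).coeff 0 = c • 1
  rw [HahnSeries.coeff_one, if_pos rfl]

theorem tMap_evalW_algebraMap (c : k) : tMap τ (evalW k) (algebraMap k _ c) =
    algebraMap k (MvPowerSeries τ (HahnSeries ℤ k)) c := by
  classical
  funext d
  change evalW k (MvPowerSeries.coeff d (algebraMap k (MvPowerSeries τ (KRing k (Fin 2))) c)) =
    MvPowerSeries.coeff d (algebraMap k (MvPowerSeries τ (HahnSeries ℤ k)) c)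
  rw [MvPowerSeries.algebraMap_apply, MvPowerSeries.algebraMap_apply, MvPowerSeries.coeff_C,
    MvPowerSeries.coeff_C]
  split_ifs
  · exact evalW_algebraMap c
  · rw [map_zero]

theorem IsBicharacter.valueAtZero_one_left (hr : IsBicharacter σ r) (a : LatticeV k) :
    valueAtZero r (1 ⊗ₜ a) = algebraMap k _ (counit k a) := by
  change tMap τ (evalW k) (r (1 ⊗ₜ a)) = _
  rw [hr.one_left, tMap_evalW_algebraMap]

theorem IsBicharacter.valueAtZero_one_right (hr : IsBicharacter σ r) (a : LatticeV k) :
    valueAtZero r (a ⊗ₜ 1) = algebraMap k _ (counit k a) := by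
  change tMap τ (evalW k) (r (a ⊗ₜ 1)) = _
  rw [hr.one_right, tMap_evalW_algebraMap]

theorem IsBicharacter.valueAtZero_mul_right (hr : IsBicharacter σ r) (hreg : RegularAtZero r)
    (a b c : LatticeV k) {ι : Type*} (R : Coalgebra.Repr k a ι) :
    valueAtZero r (a ⊗ₜ (b * c)) = ∑ i ∈ R.index,
      valueAtZero r (R.left i ⊗ₜ b) * valueAtZero r (R.right i ⊗ₜ c) := by
  change tMap τ (evalW k) (r (a ⊗ₜ (b * c))) = _
  rw [hr.mul_right, ← comul_eq, ← R.eq, map_sum, map_sum, map_sum]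
  exact Finset.sum_congr rfl fun i _ => tMap_evalW_mul (hreg _ _) (hreg _ _)

theorem IsBicharacter.valueAtZero_mul_left (hr : IsBicharacter σ r) (hreg : RegularAtZero r)
    (a b c : LatticeV k) {ι : Type*} (R : Coalgebra.Repr k c ι) :
    valueAtZero r ((a * b) ⊗ₜ c) = ∑ i ∈ R.index,
      valueAtZero r (a ⊗ₜ R.left i) * valueAtZero r (b ⊗ₜ R.right i) := by
  change tMap τ (evalW k) (r ((a * b) ⊗ₜ c)) = _
  rw [hr.mul_left, ← comul_eq, ← R.eq, map_sum, map_sum, map_sum]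
  exact Finset.sum_congr rfl fun i _ => tMap_evalW_mul (hreg _ _) (hreg _ _)

theorem IsBicharacter.valueAtZero_latticeD (hr : IsBicharacter σ r) (a b : LatticeV k) :
    valueAtZero r (latticeD k a ⊗ₜ b) = tMap τ (hDeriv k k) (valueAtZero r (a ⊗ₜ b)) := by
  change tMap τ (evalW k) (r (latticeD k a ⊗ₜ b)) = _
  rw [hr.deriv_left]
  funext d
  change (expand k (KRing.partialD k 0 (r (a ⊗ₜ b) d))).coeff 0 = _
  rw [expand_partialD_zero]
  rfl

/-- Taylor expansion at `w = 0` of the values of a bicharacter. -/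
theorem IsBicharacter.expand_eq [CharZero k] (hr : IsBicharacter σ r) (hreg : RegularAtZero r)
    (a b : LatticeV k) (d : τ →₀ ℕ) : expand k (r (a ⊗ₜ b) d) =
      HahnSeries.ofPowerSeries ℤ (HahnSeries ℤ k)
        (PowerSeries.mk fun n => valueAtZero r (a ⊗ₜ dividedPow (latticeD k) n b) d) := by
  refine HahnSeries.ext (funext fun n => ?_)
  by_cases hn : 0 ≤ n
  · lift n to ℕ using hn
    rw [HahnSeries.ofPowerSeries_apply_coeff, PowerSeries.coeff_mk]
    rw [← coeff_zero_dividedPow_hDeriv (k := k)]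
    have h1 := map_dividedPow (f := r ∘ₗ TensorProduct.mk k _ _ a) (δ := latticeD k)
      (δ' := tMap τ (KRing.partialD k 1)) (fun x => hr.deriv_right a x) n b
    have h2 := map_dividedPow (f := (expand k).toLinearMap ∘ₗ tCoeff k d)
      (δ := tMap τ (KRing.partialD k 1)) (δ' := hDeriv k _)
      (fun x => expand_partialD_one (x d)) n (r (a ⊗ₜ b))
    change _ = (expand k (r (a ⊗ₜ dividedPow (latticeD k) n b) d)).coeff 0
    change r (a ⊗ₜ dividedPow (latticeD k) n b) = _ at h1
    rw [h1]
    exact (congrArg (fun x => HahnSeries.coeff x 0) h2).symm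
  · rw [coeff_ofPowerSeries_of_neg _ (not_le.mp hn)]
    exact hreg _ _ _ _ (not_le.mp hn)

end ValueAtZero

section Annihilation

open WithConv

variable {k : Type*} [Field k] {τ : Type*} {σ : MvPowerSeries τ (KRing k (Fin 2))}
  {r : LatticeV k ⊗[k] LatticeV k →ₗ[k] MvPowerSeries τ (KRing k (Fin 2))}

theorem fieldFunctional_apply (x : LatticeV k ⊗[k] LatticeV k) :
    fieldFunctional r x = scalarSeries k τ (LatticeV k) (valueAtZero r x) := rfl

theorem annihilationPart_eq (a b : LatticeV k) : annihilationPart r a b = LinearMap.mul' k _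
    (TensorProduct.map (constSeries k τ (LatticeV k)).toLinearMap
      (fieldFunctional r ∘ₗ TensorProduct.mk k _ _ a) (comul k b)) := by
  rw [annihilationPart_apply r a b (Coalgebra.Repr.arbitrary k b), ← comul_eq,
    ← (Coalgebra.Repr.arbitrary k b).eq, map_sum, map_sum]
  rfl

/-- The operators `X(a, z)` satisfy the Leibniz rule given by the coproduct of `a`.  Hence `X(a, z)`
is multiplicative for a grouplike `a` and a derivation for a primitive `a`. -/
theorem IsBicharacter.annihilationPart_mul (hr : IsBicharacter σ r) (hreg : RegularAtZero r)
    (a b c : LatticeV k) {ι : Type*} (R : Coalgebra.Repr k a ι) :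
    annihilationPart r a (b * c) = ∑ i ∈ R.index,
      annihilationPart r (R.left i) b * annihilationPart r (R.right i) c := by
  let T := fun (a : LatticeV k) => LinearMap.mul' k _ ∘ₗ
    TensorProduct.map (constSeries k τ (LatticeV k)).toLinearMap
      (fieldFunctional r ∘ₗ TensorProduct.mk k _ _ a)
  have hT : ∀ a b, annihilationPart r a b = T a (comul k b) := annihilationPart_eq
  simp only [hT, map_mul]
  induction comul k b with
  | zero => simp
  | add u v hu hv =>
    simp only [add_mul, map_add, hu, hv, Finset.sum_add_distrib]
  | tmul x x' =>
    induction comul k c with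
    | zero => simp
    | add u v hu hv =>
      simp only [mul_add, map_add, hu, hv, Finset.sum_add_distrib]
    | tmul y y' =>
      rw [Algebra.TensorProduct.tmul_mul_tmul]
      change constSeries k τ _ (x * y) * fieldFunctional r (a ⊗ₜ (x' * y')) = ∑ i ∈ R.index,
        (constSeries k τ _ x * fieldFunctional r (R.left i ⊗ₜ x')) *
          (constSeries k τ _ y * fieldFunctional r (R.right i ⊗ₜ y'))
      rw [map_mul, fieldFunctional_apply, hr.valueAtZero_mul_right hreg a x' y' R, map_sum,
        Finset.mul_sum]
      refine Finset.sum_congr rfl fun i _ => ?_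
      rw [map_mul, fieldFunctional_apply, fieldFunctional_apply]
      ring

/-- The expansion of `r(a ⊗ b)` in `V((z))((w))[[t]]`. -/
def expandFunctional
    (r : LatticeV k ⊗[k] LatticeV k →ₗ[k] MvPowerSeries τ (KRing k (Fin 2))) :
    LatticeV k ⊗[k] LatticeV k →ₗ[k]
      MvPowerSeries τ (HahnSeries ℤ (HahnSeries ℤ (LatticeV k))) :=
  (tMapAlg τ ((hMapAlg (hMapAlg (Algebra.ofId k (LatticeV k)))).comp (expand k))).toLinearMap ∘ₗ r

/-- The series `e^{wD} b`, viewed in `V((z))((w))[[t]]`. -/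
def outerExpD (k τ : Type*) [Field k] :
    LatticeV k →ₗ[k] MvPowerSeries τ (HahnSeries ℤ (HahnSeries ℤ (LatticeV k))) :=
  tC k τ _ ∘ₗ (hMapAlg (hC k (LatticeV k))).toLinearMap ∘ₗ expD k

/-- The series `e^{zD} a`, viewed in `V((z))((w))[[t]]`. -/
def innerExpD (k τ : Type*) [Field k] :
    LatticeV k →ₗ[k] MvPowerSeries τ (HahnSeries ℤ (HahnSeries ℤ (LatticeV k))) :=
  tC k τ _ ∘ₗ (hC k (HahnSeries ℤ (LatticeV k))).toLinearMap ∘ₗ expD k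

theorem hMapAlg_ofPowerSeries {A B : Type*} [CommRing A] [Algebra k A] [CommRing B] [Algebra k B]
    (f : A →ₐ[k] B) (x : PowerSeries A) :
    hMapAlg f (HahnSeries.ofPowerSeries ℤ A x) =
      HahnSeries.ofPowerSeries ℤ B (PowerSeries.map (f : A →+* B) x) := by
  ext n
  rw [coeff_hMapAlg]
  by_cases hn : 0 ≤ n
  · lift n to ℕ using hn
    rw [HahnSeries.ofPowerSeries_apply_coeff, HahnSeries.ofPowerSeries_apply_coeff,
      PowerSeries.coeff_map]
    rfl
  · rw [coeff_ofPowerSeries_of_neg _ (not_le.mp hn), coeff_ofPowerSeries_of_neg _ (not_le.mp hn),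
      map_zero]

/-- `X(a, z) e^{wD} b = Σ (e^{wD} b') r(a ⊗ b'')(z, w)`, expanded in the region `|z| > |w|`. -/
theorem IsBicharacter.hLift_annihilationPart_expD [CharZero k] (hr : IsBicharacter σ r)
    (hreg : RegularAtZero r) (a b : LatticeV k) :
    hLift (annihilationPart r a) (expD k b) =
      (toConv (extRight (LatticeV k) (outerExpD k τ)) * toConv (expandFunctional r)) (a ⊗ₜ b) := by
  refine Eq.trans ?_ (extRight_conv (Coalgebra.Repr.arbitrary k b) a _ _).symm
  set R := Coalgebra.Repr.arbitrary k b
  funext d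
  rw [seriesSum_apply]
  have h1 : ∀ i, (outerExpD k τ (R.left i) * expandFunctional r (a ⊗ₜ R.right i)) d =
      HahnSeries.ofPowerSeries ℤ _ ((PowerSeries.mk fun n =>
        hC k (LatticeV k) (dividedPow (latticeD k) n (R.left i))) * PowerSeries.mk fun n =>
          hMapAlg (Algebra.ofId k (LatticeV k))
            (valueAtZero r (a ⊗ₜ dividedPow (latticeD k) n (R.right i)) d)) := by
    intro i
    change (tC k τ _ (hMapAlg (hC k (LatticeV k)) (expD k (R.left i))) * _) d = _
    rw [C_mul_apply, map_mul]
    congr 1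
    · rw [expD_eq, hMapAlg_ofPowerSeries]
      refine congrArg _ (PowerSeries.ext fun n => ?_)
      rw [PowerSeries.coeff_map, PowerSeries.coeff_mk, PowerSeries.coeff_mk]
      rfl
    · change hMapAlg (hMapAlg (Algebra.ofId k (LatticeV k))) (expand k (r (a ⊗ₜ R.right i) d)) = _
      rw [hr.expand_eq hreg, hMapAlg_ofPowerSeries]
      refine congrArg _ (PowerSeries.ext fun n => ?_)
      rw [PowerSeries.coeff_map, PowerSeries.coeff_mk, PowerSeries.coeff_mk]
      rfl
  refine Eq.trans ?_ (Finset.sum_congr rfl fun i _ => (h1 i).symm)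
  rw [← map_sum]
  refine HahnSeries.ext (funext fun n => ?_)
  rw [hLift_apply]
  by_cases hn : 0 ≤ n
  · lift n to ℕ using hn
    rw [HahnSeries.ofPowerSeries_apply_coeff, map_sum, coeff_expD]
    have h2 : annihilationPart r a (dividedPow (latticeD k) n b) =
        ∑ p ∈ Finset.HasAntidiagonal.antidiagonal n, ∑ i ∈ R.index,
          constSeries k τ _ (dividedPow (latticeD k) p.1 (R.left i)) *
            fieldFunctional r (a ⊗ₜ dividedPow (latticeD k) p.2 (R.right i)) := by
      rw [annihilationPart_eq, comul_dividedPow, map_sum, map_sum]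
      refine Finset.sum_congr rfl fun p _ => ?_
      rw [← comul_eq, ← R.eq, map_sum, map_sum, map_sum]
      rfl
    rw [h2, seriesSum_apply]
    simp only [PowerSeries.coeff_mul, PowerSeries.coeff_mk]
    rw [Finset.sum_comm]
    refine Finset.sum_congr rfl fun p _ => ?_
    rw [seriesSum_apply]
    refine Finset.sum_congr rfl fun i _ => ?_
    exact C_mul_apply (k := k) _ _ _
  · rw [coeff_expD_of_neg _ (not_le.mp hn), coeff_ofPowerSeries_of_neg _ (not_le.mp hn), map_zero]
    rfl

/-- `X(a, z) X(b, w) c`. -/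
def annihilationProd (r : LatticeV k ⊗[k] LatticeV k →ₗ[k] MvPowerSeries τ (KRing k (Fin 2)))
    (c : LatticeV k) : LatticeV k ⊗[k] LatticeV k →ₗ[k]
      MvPowerSeries τ (HahnSeries ℤ (HahnSeries ℤ (LatticeV k))) :=
  prodFields (annihilationPart r) c

theorem tExt_hLift_bicharY (a : LatticeV k) (F : MvPowerSeries τ (HahnSeries ℤ (LatticeV k)))
    {ι : Type*} (R : Coalgebra.Repr k a ι) :
    tExt (hLift (bicharY r a)) F = ∑ i ∈ R.index,
      innerExpD k τ (R.left i) * tExt (hLift (annihilationPart r (R.right i))) F := by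
  have h : bicharY r a = ∑ i ∈ R.index,
      LinearMap.mulLeft k (tC k τ _ (expD k (R.left i))) ∘ₗ annihilationPart r (R.right i) := by
    refine LinearMap.ext fun b => ?_
    rw [bicharY_apply r a b R, LinearMap.sum_apply]
    rfl
  rw [h, tExt_hLift_sum]
  exact Finset.sum_congr rfl fun i _ => tExt_hLift_const_mul _ _ _

/-- The product of two fields,
`Y(a, z) Y(b, w) c = Σ (e^{zD} a') (e^{wD} b') X(a'', z) X(b'', w) c · r(a''' ⊗ b''')`,
with `r` expanded in the region `|z| > |w|`. -/
theorem IsBicharacter.prodFields_eq [CharZero k] (hr : IsBicharacter σ r)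
    (hreg : RegularAtZero r) (c : LatticeV k) :
    toConv (prodFields (bicharY r) c) =
      toConv (extLeft (LatticeV k) (innerExpD k τ)) *
        toConv (extRight (LatticeV k) (outerExpD k τ)) * toConv (annihilationProd r c) *
          toConv (expandFunctional r) := by
  -- `X(a, z) Y(b, w) c`, by the Leibniz rule for `X(a, z)`
  have key : ∀ a b, tExt (hLift (annihilationPart r a)) (bicharY r b c) =
      (toConv (extRight (LatticeV k) (outerExpD k τ)) * toConv (expandFunctional r) *
        toConv (annihilationProd r c)) (a ⊗ₜ b) := by
    intro a b
    let R := Coalgebra.Repr.arbitrary k a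
    let R' := Coalgebra.Repr.arbitrary k b
    rw [conv_tmul R R', bicharY_apply r b c R', map_sum, Finset.sum_comm]
    refine Finset.sum_congr rfl fun j _ => ?_
    rw [tExt_hLift_tC_mul R.index _ (fun i => annihilationPart r (R.left i))
      (fun i => annihilationPart r (R.right i)) (fun x y => hr.annihilationPart_mul hreg a x y R)]
    refine Finset.sum_congr rfl fun i _ => ?_
    rw [hr.hLift_annihilationPart_expD hreg]
    rfl
  have h1 : toConv (prodFields (bicharY r) c) = toConv (extLeft (LatticeV k) (innerExpD k τ)) *
      (toConv (extRight (LatticeV k) (outerExpD k τ)) * toConv (expandFunctional r) *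
        toConv (annihilationProd r c)) := by
    refine WithConv.ofConv_injective (TensorProduct.ext' fun a b => ?_)
    refine Eq.trans ?_ (extLeft_conv (Coalgebra.Repr.arbitrary k a) b _ _).symm
    refine (tExt_hLift_bicharY a _ (Coalgebra.Repr.arbitrary k a)).trans ?_
    exact Finset.sum_congr rfl fun i _ => congrArg _ (key _ _)
  rw [h1]
  ring

end Annihilation

/-! ### Locality -/

section TransposedSeriesPairs

variable {k : Type*} [Field k] {τ : Type*} {A : Type*} [CommRing A] [Algebra k A]

/-- The pairs of parameter-adic series whose coefficients, at the exponents of a lower set `Δ`, have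
the same expansions in the two regions. -/
def transposedSeries (k A : Type*) [Field k] [CommRing A] [Algebra k A] (Δ : LowerSet (τ →₀ ℕ)) :
    Subalgebra k (MvPowerSeries τ (HahnSeries ℤ (HahnSeries ℤ A)) ×
      MvPowerSeries τ (HahnSeries ℤ (HahnSeries ℤ A))) where
  carrier := {p | ∀ d ∈ Δ, (p.1 d, p.2 d) ∈ transposedPairs k A}
  mul_mem' := by
    classical
    intro x y hx hy d hd
    have h : ((x * y).1 d, (x * y).2 d) = ∑ p ∈ Finset.HasAntidiagonal.antidiagonal d,
        (x.1 p.1, x.2 p.1) * (y.1 p.2, y.2 p.2) := by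
      refine Prod.ext ?_ ?_
      · rw [Prod.fst_sum]
        exact mul_apply_antidiagonal _ _ _
      · rw [Prod.snd_sum]
        exact mul_apply_antidiagonal _ _ _
    rw [h]
    refine sum_mem fun p hp => ?_
    replace hp := Finset.HasAntidiagonal.mem_antidiagonal.mp hp
    exact mul_mem (hx _ (Δ.lower (by rw [← hp]; exact le_self_add) hd))
      (hy _ (Δ.lower (by rw [← hp]; exact le_add_self) hd))
  add_mem' := fun hx hy d hd => add_mem (hx d hd) (hy d hd)
  algebraMap_mem' := by
    classical
    intro c d hd
    change
      (MvPowerSeries.coeff d (algebraMap k (MvPowerSeries τ (HahnSeries ℤ (HahnSeries ℤ A))) c),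
      MvPowerSeries.coeff d (algebraMap k (MvPowerSeries τ (HahnSeries ℤ (HahnSeries ℤ A))) c)) ∈ _
    rw [IsScalarTower.algebraMap_apply k (HahnSeries ℤ (HahnSeries ℤ A))
      (MvPowerSeries τ (HahnSeries ℤ (HahnSeries ℤ A))), MvPowerSeries.algebraMap_apply,
      MvPowerSeries.coeff_C]
    split_ifs
    · exact (transposedPairs k A).algebraMap_mem c
    · exact zero_mem _

theorem mem_transposedSeries {Δ : LowerSet (τ →₀ ℕ)}
    {x y : MvPowerSeries τ (HahnSeries ℤ (HahnSeries ℤ A))} :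
    (x, y) ∈ transposedSeries k A Δ ↔ ∀ d ∈ Δ, (x d, y d) ∈ transposedPairs k A := Iff.rfl

theorem prod_mk_sum {ι M N : Type*} [AddCommMonoid M] [AddCommMonoid N] (s : Finset ι) (f : ι → M)
    (g : ι → N) : ∑ i ∈ s, (f i, g i) = (∑ i ∈ s, f i, ∑ i ∈ s, g i) :=
  Prod.ext Prod.fst_sum Prod.snd_sum

theorem tC_mem_transposedSeries (Δ : LowerSet (τ →₀ ℕ)) {x y : HahnSeries ℤ (HahnSeries ℤ A)}
    (h : (x, y) ∈ transposedPairs k A) :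
    (tC k τ _ x, tC k τ _ y) ∈ transposedSeries k A Δ := by
  intro d _
  change (tC k τ _ x d, tC k τ _ y d) ∈ _
  rw [tC_apply, tC_apply]
  split_ifs
  exacts [h, zero_mem (transposedPairs k A)]

end TransposedSeriesPairs

section ConvolutionPairs

open WithConv

variable {k : Type*} [Field k] {A : Type*} [CommRing A] [Algebra k A] {C : Type*}
  [AddCommGroup C] [Module k C] [Coalgebra k C]

theorem mem_of_eq_of_eq {S : Subalgebra k (A × A)} {x x' y y' : A} (h : x = x') (h' : y = y')
    (hS : (x', y') ∈ S) : (x, y) ∈ S := by rwa [h, h']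

theorem conv_apply_repr {c : C} {ι : Type*} (R : Coalgebra.Repr k c ι)
    (f g : WithConv (C →ₗ[k] A)) :
    (f * g) c = ∑ i ∈ R.index, f (R.left i) * g (R.right i) := R.convMul_apply f g

/-- If the two values of `f` and `f'` on transposed tensors are pairs in `S`, and so are the
multiples by `x` of those of `g` and `g'`, then the same holds for the convolution products. -/
theorem mul_conv_tmul_mem (S : Subalgebra k (A × A)) {f f' g g' : WithConv (C ⊗[k] C →ₗ[k] A)}
    (x : A) {a b : C} {ι κ : Type*} (R : Coalgebra.Repr k a ι) (R' : Coalgebra.Repr k b κ)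
    (hf : ∀ a b, (f (a ⊗ₜ b), f' (b ⊗ₜ a)) ∈ S)
    (hg : ∀ i ∈ R.index, ∀ j ∈ R'.index, (x * g (R.right i ⊗ₜ R'.right j),
      x * g' (R'.right j ⊗ₜ R.right i)) ∈ S) :
    (x * (f * g) (a ⊗ₜ b), x * (f' * g') (b ⊗ₜ a)) ∈ S := by
  rw [conv_tmul R R', conv_tmul R' R, Finset.sum_comm, Finset.mul_sum, Finset.mul_sum,
    ← prod_mk_sum]
  refine sum_mem fun j hj => ?_
  rw [Finset.mul_sum, Finset.mul_sum, ← prod_mk_sum]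
  refine sum_mem fun i hi => ?_
  rw [mul_left_comm, mul_left_comm x]
  exact mul_mem (hf _ _) (hg i hi j hj)

theorem conv_tmul_mem (S : Subalgebra k (A × A)) {f f' g g' : WithConv (C ⊗[k] C →ₗ[k] A)}
    (hf : ∀ a b, (f (a ⊗ₜ b), f' (b ⊗ₜ a)) ∈ S) (hg : ∀ a b, (g (a ⊗ₜ b), g' (b ⊗ₜ a)) ∈ S)
    (a b : C) : ((f * g) (a ⊗ₜ b), (f' * g') (b ⊗ₜ a)) ∈ S := by
  have h := mul_conv_tmul_mem S (f := f) (f' := f') (g := g) (g' := g') 1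
    (Coalgebra.Repr.arbitrary k a) (Coalgebra.Repr.arbitrary k b) hf
    (fun i _ j _ => by rw [one_mul, one_mul]; exact hg _ _)
  rwa [one_mul, one_mul] at h

end ConvolutionPairs

section Annihilation

open WithConv

variable {k : Type*} [Field k] {τ : Type*} {σ : MvPowerSeries τ (KRing k (Fin 2))}
  {r : LatticeV k ⊗[k] LatticeV k →ₗ[k] MvPowerSeries τ (KRing k (Fin 2))}

/-- The functional `r(a ⊗ ·)(z, 0)` in the inner variable. -/
def innerFunctional (r : LatticeV k ⊗[k] LatticeV k →ₗ[k] MvPowerSeries τ (KRing k (Fin 2)))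
    (a : LatticeV k) :
    LatticeV k →ₗ[k] MvPowerSeries τ (HahnSeries ℤ (HahnSeries ℤ (LatticeV k))) :=
  (tMapAlg τ (hC k (HahnSeries ℤ (LatticeV k)))).toLinearMap ∘ₗ fieldFunctional r ∘ₗ
    TensorProduct.mk k _ _ a

/-- The functional `r(a ⊗ ·)(w, 0)` in the outer variable. -/
def outerFunctional (r : LatticeV k ⊗[k] LatticeV k →ₗ[k] MvPowerSeries τ (KRing k (Fin 2)))
    (a : LatticeV k) :
    LatticeV k →ₗ[k] MvPowerSeries τ (HahnSeries ℤ (HahnSeries ℤ (LatticeV k))) :=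
  (tMapAlg τ (hMapAlg (Algebra.ofId k (HahnSeries ℤ (LatticeV k))))).toLinearMap ∘ₗ
    valueAtZero r ∘ₗ TensorProduct.mk k _ _ a

/-- The inclusion of `V` in `V((z))((w))[[t]]` as the constants. -/
def constDouble (k τ : Type*) [Field k] :
    LatticeV k →ₗ[k] MvPowerSeries τ (HahnSeries ℤ (HahnSeries ℤ (LatticeV k))) :=
  tC k τ _ ∘ₗ (hC k (HahnSeries ℤ (LatticeV k))).toLinearMap ∘ₗ (hC k (LatticeV k)).toLinearMap

theorem annihilationProd_tmul (a b c : LatticeV k) : annihilationProd r c (a ⊗ₜ b) =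
    (toConv (constDouble k τ) * toConv (innerFunctional r a) * toConv (outerFunctional r b)) c := by
  have h1 : ∀ l, tMapAlg τ (hC k (HahnSeries ℤ (LatticeV k))) (annihilationPart r a l) =
      (toConv (constDouble k τ) * toConv (innerFunctional r a)) l := by
    intro l
    let R := Coalgebra.Repr.arbitrary k l
    rw [annihilationPart_apply r a l R, map_sum]
    refine Eq.trans ?_ (conv_apply_repr R _ _).symm
    refine Finset.sum_congr rfl fun i _ => ?_
    rw [map_mul]
    refine congrArg₂ _ ?_ rfl
    exact tMap_tC (hC k (HahnSeries ℤ (LatticeV k))).toLinearMap (hC k (LatticeV k) (R.left i))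
  change tExt (hLift (annihilationPart r a)) (annihilationPart r b c) = _
  let R := Coalgebra.Repr.arbitrary k c
  rw [annihilationPart_apply r b c R, map_sum]
  refine Eq.trans ?_ (conv_apply_repr R _ _).symm
  refine Finset.sum_congr rfl fun i _ => ?_
  refine (tExt_hLift_scalar_mul (annihilationPart r a) (valueAtZero r (b ⊗ₜ R.right i))
    (R.left i)).trans ?_
  rw [h1]
  rfl

theorem inner_outer_mem (Δ : LowerSet (τ →₀ ℕ)) (a b : LatticeV k) :
    (innerFunctional r a b, outerFunctional r a b) ∈ transposedSeries k (LatticeV k) Δ := by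
  intro d _
  have h : hMapAlg (Algebra.ofId k (HahnSeries ℤ (LatticeV k))) (valueAtZero r (a ⊗ₜ b) d) =
      hMapAlg (hC k (LatticeV k)) (hMapAlg (Algebra.ofId k (LatticeV k))
        (valueAtZero r (a ⊗ₜ b) d)) := by
    ext n : 2
    exact ((hC k (LatticeV k)).commutes _).symm
  change (hC k _ (hMapAlg (Algebra.ofId k (LatticeV k)) (valueAtZero r (a ⊗ₜ b) d)),
    hMapAlg (Algebra.ofId k (HahnSeries ℤ (LatticeV k))) (valueAtZero r (a ⊗ₜ b) d)) ∈ _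
  rw [h]
  exact const_mem_transposedPairs _

theorem swap_mem_transposedSeries {Δ : LowerSet (τ →₀ ℕ)} {A : Type*} [CommRing A] [Algebra k A]
    {x y : MvPowerSeries τ (HahnSeries ℤ (HahnSeries ℤ A))} (h : (x, y) ∈ transposedSeries k A Δ) :
    (y, x) ∈ transposedSeries k A Δ := fun d hd => swap_mem_transposedPairs (h d hd)

/-- The operators `X(a, z)` and `X(b, w)` commute, by the cocommutativity of the lattice algebra. -/
theorem annihilationProd_mem (Δ : LowerSet (τ →₀ ℕ)) (a b c : LatticeV k) :
    (annihilationProd r c (a ⊗ₜ b), annihilationProd r c (b ⊗ₜ a)) ∈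
      transposedSeries k (LatticeV k) Δ := by
  rw [annihilationProd_tmul, annihilationProd_tmul]
  have h1 : ∀ x, (constDouble k τ x, constDouble k τ x) ∈ transposedSeries k (LatticeV k) Δ := by
    intro x
    have h := const_mem_transposedPairs (k := k) (hC k (LatticeV k) x)
    rw [show hMapAlg (hC k (LatticeV k)) (hC k (LatticeV k) x) =
      hC k _ (hC k (LatticeV k) x) from hMapAlg_single _ _ _] at h
    exact tC_mem_transposedSeries Δ h
  have h2 : ∀ x, ((toConv (constDouble k τ) * toConv (innerFunctional r a)) x,
      (toConv (constDouble k τ) * toConv (outerFunctional r a)) x) ∈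
        transposedSeries k (LatticeV k) Δ := by
    intro x
    have h := mul'_map_mem (transposedSeries k (LatticeV k) Δ)
      (f := (constDouble k τ).prod (constDouble k τ))
      (g := (innerFunctional r a).prod (outerFunctional r a)) h1
      (fun y => inner_outer_mem Δ a y) (comul k x)
    rwa [mul'_map_prod] at h
  have h3 := mul'_map_mem (transposedSeries k (LatticeV k) Δ)
    (f := (toConv (constDouble k τ) * toConv (innerFunctional r a)).ofConv.prod
      (toConv (constDouble k τ) * toConv (outerFunctional r a)).ofConv)
    (g := (outerFunctional r b).prod (innerFunctional r b)) h2
    (fun y => swap_mem_transposedSeries (inner_outer_mem Δ b y)) (comul k c)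
  rw [mul'_map_prod] at h3
  rw [mul_right_comm (toConv (constDouble k τ)) (toConv (innerFunctional r b))]
  exact h3

/-- The part `Σ (e^{zD} a') (e^{wD} b') X(a'', z) X(b'', w) c` of the product of two fields that is
symmetric under the interchange of the two fields. -/
def symmetricPart (r : LatticeV k ⊗[k] LatticeV k →ₗ[k] MvPowerSeries τ (KRing k (Fin 2)))
    (c : LatticeV k) : LatticeV k ⊗[k] LatticeV k →ₗ[k]
      MvPowerSeries τ (HahnSeries ℤ (HahnSeries ℤ (LatticeV k))) :=
  (toConv (extLeft (LatticeV k) (innerExpD k τ)) *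
        toConv (extRight (LatticeV k) (outerExpD k τ)) * toConv (annihilationProd r c)).ofConv

theorem symmetricPart_mem (Δ : LowerSet (τ →₀ ℕ)) (a b c : LatticeV k) :
    (symmetricPart r c (a ⊗ₜ b), symmetricPart r c (b ⊗ₜ a)) ∈
      transposedSeries k (LatticeV k) Δ := by
  refine conv_tmul_mem (transposedSeries k (LatticeV k) Δ) (fun a b => ?_)
    (fun a b => annihilationProd_mem Δ a b c) a b
  have h3 : ∀ y, (innerExpD k τ y, outerExpD k τ y) ∈ transposedSeries k (LatticeV k) Δ :=
    fun y => tC_mem_transposedSeries Δ (const_mem_transposedPairs (k := k) (expD k y))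
  have h := mul_mem (h3 a) (swap_mem_transposedSeries (h3 b))
  have h1 := extLeft_conv_extRight a b (innerExpD k τ) (outerExpD k τ)
  have h2 := extLeft_conv_extRight b a (innerExpD k τ) (outerExpD k τ)
  rw [mul_comm (innerExpD k τ b)] at h2
  exact mem_of_eq_of_eq h1 h2 h

theorem prodFieldsK_costrength (Y : LatticeV k →ₗ[k] LatticeV k →ₗ[k]
      MvPowerSeries τ (HahnSeries ℤ (LatticeV k))) (c : LatticeV k)
    (x : LatticeV k ⊗[k] LatticeV k) (s : MvPowerSeries τ (KRing k (Fin 2))) :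
    prodFieldsK Y c (costrength k τ _ _ (x ⊗ₜ s)) = prodFields Y c x *
      tMapAlg τ ((hMapAlg (hMapAlg (Algebra.ofId k (LatticeV k)))).comp (expand k)) s := by
  classical
  rw [mul_comm]
  funext d
  rw [mul_apply_antidiagonal, prodFieldsK, tExt_apply]
  refine Finset.sum_congr rfl fun p _ => ?_
  rw [costrength_tmul, TensorProduct.lift.tmul, LinearMap.mk₂_apply]
  exact seriesMul_seriesMul_lsmul _ _

/-- Composition of a product of fields with a diagonal operator is convolution with the expansion of
its functional. -/
theorem prodFieldsK_diagOp (Y : LatticeV k →ₗ[k] LatticeV k →ₗ[k]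
      MvPowerSeries τ (HahnSeries ℤ (LatticeV k))) (c : LatticeV k)
    (χ : LatticeV k ⊗[k] LatticeV k →ₗ[k] MvPowerSeries τ (KRing k (Fin 2)))
    (x : LatticeV k ⊗[k] LatticeV k) :
    prodFieldsK Y c (diagOp χ x) =
      (toConv (prodFields Y c) * toConv (expandFunctional χ)) x := by
  let R := Coalgebra.Repr.arbitrary k x
  refine Eq.trans ?_ (conv_apply_repr R _ _).symm
  change prodFieldsK Y c (costrength k τ _ _ (LinearMap.lTensor _ χ (CoalgebraStruct.comul x))) = _
  rw [← R.eq, map_sum, map_sum, map_sum]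
  exact Finset.sum_congr rfl fun i _ => prodFieldsK_costrength Y c (R.left i) (χ (R.right i))

theorem expandFunctional_conv
    (χ ψ : WithConv (LatticeV k ⊗[k] LatticeV k →ₗ[k] MvPowerSeries τ (KRing k (Fin 2)))) :
    toConv (expandFunctional χ.ofConv) * toConv (expandFunctional ψ.ofConv) =
      toConv (expandFunctional (χ * ψ).ofConv) :=
  WithConv.ofConv_injective (LinearMap.algHom_comp_convMul_distrib
    (tMapAlg τ ((hMapAlg (hMapAlg (Algebra.ofId k (LatticeV k)))).comp (expand k))) χ ψ).symm

/-- The product of the two fields in the opposite order is obtained from the symmetric part of the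
product by multiplication with the transposed bicharacter. -/
theorem IsBicharacter.prodFieldsK_eq [CharZero k] (hr : IsBicharacter σ r)
    (hreg : RegularAtZero r) (c : LatticeV k) (x : LatticeV k ⊗[k] LatticeV k) :
    prodFieldsK (bicharY r) c (bicharR r x) =
      (toConv (symmetricPart r c) * toConv (expandFunctional (transpose r))) x := by
  rw [bicharR_eq, prodFieldsK_diagOp, hr.prodFields_eq hreg]
  change (toConv (symmetricPart r c) * toConv (expandFunctional r) *
    toConv (expandFunctional (braidingFunctional r))) x = _
  rw [mul_assoc]
  have h := expandFunctional_conv (toConv r) (toConv (braidingFunctional r))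
  rw [mul_comm (toConv r), hr.braiding_mul] at h
  simp only at h
  rw [h]

/-- On a set of powers of the parameters, the poles of `r` at `z = w` are bounded. -/
def DiagonalPolesBounded
    (r : LatticeV k ⊗[k] LatticeV k →ₗ[k] MvPowerSeries τ (KRing k (Fin 2)))
    (Δ : LowerSet (τ →₀ ℕ)) : Prop :=
  ∀ x, ∃ N : ℕ, ∀ N' ≥ N, ∀ d ∈ Δ,
    (KRing.var k 0 - KRing.var k 1) ^ N' * r x d ∈ noDiagonalPole k

/-- The expansion of functions of two variables as double series over `LatticeV k`. -/
def expandV (k : Type*) [Field k] :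
    KRing k (Fin 2) →ₐ[k] HahnSeries ℤ (HahnSeries ℤ (LatticeV k)) :=
  (hMapAlg (hMapAlg (Algebra.ofId k (LatticeV k)))).comp (expand k)

theorem coeff_expandV (x : KRing k (Fin 2)) (m n : ℤ) : ((expandV k x).coeff n).coeff m =
    algebraMap k (LatticeV k) (((expand k x).coeff n).coeff m) := rfl

/-- A function without a pole at `z = w` has the same expansions in both regions. -/
theorem expandV_mem {x : KRing k (Fin 2)} (hx : x ∈ noDiagonalPole k) :
    (expandV k x, expandV k (swapK k x)) ∈ transposedPairs k (LatticeV k) := by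
  refine mem_transposedPairs.mpr fun m n => ?_
  have h := congrArg (algebraMap k (LatticeV k)) (mem_noDiagonalPole.mp hx m n)
  rwa [← coeff_expandV, ← coeff_expandV] at h

theorem mul_expandFunctional_apply
    (r : LatticeV k ⊗[k] LatticeV k →ₗ[k] MvPowerSeries τ (KRing k (Fin 2)))
    (e : KRing k (Fin 2)) (x : LatticeV k ⊗[k] LatticeV k) (d : τ →₀ ℕ) :
    (tC k τ _ (expandV k e) * expandFunctional r x) d = expandV k (e * r x d) :=
  (C_mul_apply (k := k) _ _ _).trans (map_mul (expandV k) _ _).symm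

theorem mul_expandFunctional_mem {Δ : LowerSet (τ →₀ ℕ)} (e : KRing k (Fin 2))
    (he : swapK k e = e) (a b : LatticeV k)
    (h : ∀ d ∈ Δ, e * r (a ⊗ₜ b) d ∈ noDiagonalPole k) :
    (tC k τ _ (expandV k e) * expandFunctional r (a ⊗ₜ b),
      tC k τ _ (expandV k e) * expandFunctional (transpose r) (b ⊗ₜ a)) ∈
        transposedSeries k (LatticeV k) Δ := by
  refine mem_transposedSeries.mpr fun d hd => ?_
  have h1 := mul_expandFunctional_apply r e (a ⊗ₜ b) d
  have h2 := mul_expandFunctional_apply (transpose r) e (b ⊗ₜ a) d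
  have h3 : e * transpose r (b ⊗ₜ a) d = swapK k (e * r (a ⊗ₜ b) d) := by
    rw [map_mul, he]; rfl
  rw [h3] at h2
  exact mem_of_eq_of_eq h1 h2 (expandV_mem (h d hd))

/-- Multiplication by a power of `z - w` makes the expansions of the bicharacter in the two regions
equal; the symmetric parts of the two products of fields agree already. -/
theorem IsBicharacter.exists_localAt [CharZero k] (hr : IsBicharacter σ r)
    (hreg : RegularAtZero r) {Δ : LowerSet (τ →₀ ℕ)} (hΔ : DiagonalPolesBounded r Δ)
    (a b : LatticeV k) :
    ∃ N : ℕ, ∀ (c : LatticeV k), ∀ d ∈ Δ, LocalAt (bicharY r) (bicharR r) a b c N d := by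
  let R := Coalgebra.Repr.arbitrary k a
  let R' := Coalgebra.Repr.arbitrary k b
  choose f hf using hΔ
  let g : (LatticeV k × LatticeV k) × (LatticeV k × LatticeV k) → ℕ :=
    fun p => f (R.right p.1 ⊗ₜ R'.right p.2)
  obtain ⟨N, hN⟩ : ∃ N, ∀ p ∈ R.index ×ˢ R'.index, g p ≤ N :=
    ⟨(R.index ×ˢ R'.index).sup g, fun p hp => Finset.le_sup hp⟩
  -- an even exponent, since the two sides contain `(z - w)^N` and `(w - z)^N`
  refine ⟨2 * N, fun c d hd m n => ?_⟩
  set e : KRing k (Fin 2) := (KRing.var k 0 - KRing.var k 1) ^ (2 * N) with he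
  have hswap : swapK k e = e := by
    rw [he, map_pow, map_sub, swapK_var_zero, swapK_var_one, pow_mul, pow_mul]
    congr 1
    ring
  have hmem : (tC k τ _ (expandV k e) * prodFields (bicharY r) c (a ⊗ₜ b),
      tC k τ _ (expandV k e) * prodFieldsK (bicharY r) c (bicharR r (b ⊗ₜ a))) ∈
        transposedSeries k (LatticeV k) Δ := by
    have h1 := LinearMap.congr_fun (congrArg ofConv (hr.prodFields_eq hreg c)) (a ⊗ₜ b)
    have h2 := hr.prodFieldsK_eq hreg c (b ⊗ₜ a)
    rw [h2]
    refine mem_of_eq_of_eq (congrArg _ h1) rfl ?_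
    refine mul_conv_tmul_mem (transposedSeries k (LatticeV k) Δ) _ R R'
      (fun a b => symmetricPart_mem Δ a b c) fun i hi j hj => ?_
    exact mul_expandFunctional_mem e hswap _ _ fun d hd => hf _ (2 * N)
      ((hN (i, j) (Finset.mem_product.mpr ⟨hi, hj⟩)).trans (by omega)) d hd
  have h := hmem d hd m n
  rw [seriesMul_seriesMul_lsmul, seriesMul_seriesMul_lsmul]
  have h1 := C_mul_apply (k := k) (expandV k e) (prodFields (bicharY r) c (a ⊗ₜ b)) d
  have h2 := C_mul_apply (k := k) (expandV k e) (prodFieldsK (bicharY r) c (bicharR r (b ⊗ₜ a))) d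
  exact (congrArg (fun x => (HahnSeries.coeff x n).coeff m) h1).symm.trans
    (h.trans (congrArg (fun x => (HahnSeries.coeff x m).coeff n) h2))

/-- Only finitely many monomials have degree less than `M`, so that modulo `(t)^M` the orders of the
poles at `z = w` are bounded. -/
theorem diagonalPolesBounded_degree_lt [Finite τ] (M : ℕ) :
    ∃ Δ : LowerSet (τ →₀ ℕ), (∀ d, d.degree < M → d ∈ Δ) ∧ DiagonalPolesBounded r Δ := by
  refine ⟨⟨{d | d.degree < M}, fun d d' h hd => ?_⟩, fun d hd => hd, ?_⟩
  · rw [Set.mem_ofPred_eq] at hd ⊢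
    exact (Finsupp.degree_mono h).trans_lt hd
  · intro x
    have hfin : {d : τ →₀ ℕ | d.degree < M}.Finite := by
      exact Finsupp.finite_of_degree_lt M
    choose f hf using fun d => exists_pow_mul_mem_noDiagonalPole (r x d)
    obtain ⟨N, hN⟩ := (hfin.image f).bddAbove
    exact ⟨N, fun N' hN' d hd => hf d N' ((hN ⟨d, hd, rfl⟩).trans hN')⟩

end Annihilation

/-! ### Poles at the diagonal that are bounded in the parameters -/

section BoundedDiagonalPoles

variable {k : Type*} [Field k] {τ : Type*}

theorem partialD_zero_mem_noDiagonalPole {x : KRing k (Fin 2)} (hx : x ∈ noDiagonalPole k) :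
    KRing.partialD k 0 x ∈ noDiagonalPole k := by
  rw [mem_noDiagonalPole] at hx ⊢
  intro m n
  rw [expand_partialD_zero, swapK_partialD_zero, expand_partialD_one, coeff_hMap, coeff_hDeriv,
    coeff_hDeriv, hx]
  rfl

theorem partialD_mem_noDiagonalPole (i : Fin 2) {x : KRing k (Fin 2)}
    (hx : x ∈ noDiagonalPole k) : KRing.partialD k i x ∈ noDiagonalPole k := by
  fin_cases i
  · exact partialD_zero_mem_noDiagonalPole hx
  · have h := swapK_mem_noDiagonalPole
      (partialD_zero_mem_noDiagonalPole (swapK_mem_noDiagonalPole hx))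
    rwa [swapK_partialD_zero, swapK_swapK] at h

theorem sub_mem_noDiagonalPole : KRing.var k 0 - KRing.var k 1 ∈ noDiagonalPole k :=
  sub_mem var_zero_mem_noDiagonalPole var_one_mem_noDiagonalPole

/-- The series whose coefficients have poles of bounded order at `z = w`. -/
def boundedDiagonalPoles (k τ : Type*) [Field k] :
    Subalgebra k (MvPowerSeries τ (KRing k (Fin 2))) where
  carrier := {x | ∃ N : ℕ, ∀ d,
    (KRing.var k 0 - KRing.var k 1) ^ N * x d ∈ noDiagonalPole k}
  mul_mem' := by
    classical
    rintro x y ⟨N, hN⟩ ⟨M, hM⟩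
    refine ⟨N + M, fun d => ?_⟩
    rw [mul_apply_antidiagonal, Finset.mul_sum]
    refine sum_mem fun p _ => ?_
    rw [pow_add, mul_mul_mul_comm]
    exact mul_mem (hN _) (hM _)
  add_mem' := by
    rintro x y ⟨N, hN⟩ ⟨M, hM⟩
    refine ⟨N + M, fun d => ?_⟩
    change _ * (x d + y d) ∈ _
    rw [mul_add]
    refine add_mem ?_ ?_
    · rw [pow_add, mul_right_comm]
      exact mul_mem (hN d) (pow_mem sub_mem_noDiagonalPole _)
    · rw [pow_add, mul_assoc]
      exact mul_mem (pow_mem sub_mem_noDiagonalPole _) (hM d)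
  algebraMap_mem' := by
    classical
    refine fun c => ⟨0, fun d => ?_⟩
    rw [pow_zero, one_mul]
    change MvPowerSeries.coeff d (algebraMap k (MvPowerSeries τ (KRing k (Fin 2))) c) ∈ _
    rw [IsScalarTower.algebraMap_apply k (KRing k (Fin 2)) (MvPowerSeries τ (KRing k (Fin 2))),
      MvPowerSeries.algebraMap_apply, MvPowerSeries.coeff_C]
    split_ifs
    exacts [Subalgebra.algebraMap_mem _ _, zero_mem _]

theorem mem_boundedDiagonalPoles {x : MvPowerSeries τ (KRing k (Fin 2))} :
    x ∈ boundedDiagonalPoles k τ ↔ ∃ N : ℕ, ∀ d,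
      (KRing.var k 0 - KRing.var k 1) ^ N * x d ∈ noDiagonalPole k := Iff.rfl

theorem tMap_partialD_mem_boundedDiagonalPoles (i : Fin 2)
    {x : MvPowerSeries τ (KRing k (Fin 2))} (hx : x ∈ boundedDiagonalPoles k τ) :
    tMap τ (KRing.partialD k i) x ∈ boundedDiagonalPoles k τ := by
  rw [mem_boundedDiagonalPoles] at hx ⊢
  obtain ⟨N, hN⟩ := hx
  refine ⟨N + 1, fun d => ?_⟩
  -- `e ∂x = ∂(e x) - (∂e) x` with `e = (z - w)^(N + 1)`; the factor `(z - w)^N` of `∂e` suffices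
  set u : KRing k (Fin 2) := KRing.var k 0 - KRing.var k 1
  have h1 : u ^ (N + 1) * x d ∈ noDiagonalPole k := by
    rw [pow_succ', mul_assoc]; exact mul_mem sub_mem_noDiagonalPole (hN d)
  have h2 := KRing.partialD_mul i u (u ^ N * x d)
  have h3 := KRing.partialD_mul i (u ^ (N + 1)) (x d)
  have hpow : ∀ n : ℕ, KRing.partialD k i (u ^ (n + 1)) =
      ((n : KRing k (Fin 2)) + 1) * KRing.partialD k i u * u ^ n := by
    intro n
    induction n with
    | zero => simp
    | succ n ih => rw [pow_succ, KRing.partialD_mul, ih]; push_cast; ring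
  rw [hpow] at h3
  have h4 : u ^ (N + 1) * KRing.partialD k i (x d) = KRing.partialD k i (u ^ (N + 1) * x d) -
      ((N : KRing k (Fin 2)) + 1) * KRing.partialD k i u * (u ^ N * x d) := by
    rw [h3]; ring
  rw [tMap_apply, h4]
  exact sub_mem (partialD_mem_noDiagonalPole i h1) (mul_mem (mul_mem
    (add_mem (natCast_mem _ N) (one_mem _))
    (partialD_mem_noDiagonalPole i sub_mem_noDiagonalPole)) (hN d))

theorem IsBicharacter.mem_boundedDiagonalPoles [CharZero k]
    {σ s : MvPowerSeries τ (KRing k (Fin 2))}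
    {r : LatticeV k ⊗[k] LatticeV k →ₗ[k] MvPowerSeries τ (KRing k (Fin 2))}
    (hr : IsBicharacter σ r) (hσ : σ ∈ boundedDiagonalPoles k τ)
    (hs : s ∈ boundedDiagonalPoles k τ) (hsσ : s * σ = 1) (x : LatticeV k ⊗[k] LatticeV k) :
    r x ∈ boundedDiagonalPoles k τ := by
  induction x with
  | zero => rw [map_zero]; exact zero_mem _
  | add u v hu hv => rw [map_add]; exact add_mem hu hv
  | tmul a b =>
    exact hr.mem _ (fun i x => tMap_partialD_mem_boundedDiagonalPoles i) hσ hs hsσ a b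

/-- If the orders of the poles of `σ` and `σ⁻¹` at `z = w` are bounded, then the exponent in the
locality axiom does not depend on the power of the parameters. -/
theorem IsBicharacter.stronglyLocal [CharZero k] {σ s : MvPowerSeries τ (KRing k (Fin 2))}
    {r : LatticeV k ⊗[k] LatticeV k →ₗ[k] MvPowerSeries τ (KRing k (Fin 2))}
    (hr : IsBicharacter σ r) (hreg : RegularAtZero r) (hσ : σ ∈ boundedDiagonalPoles k τ)
    (hs : s ∈ boundedDiagonalPoles k τ) (hsσ : s * σ = 1) :
    StronglyLocal (bicharY r) (bicharR r) := by
  intro a b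
  have hΔ : DiagonalPolesBounded r ⊤ := by
    intro x
    obtain ⟨N, hN⟩ := hr.mem_boundedDiagonalPoles hσ hs hsσ x
    refine ⟨N, fun N' hN' d _ => ?_⟩
    rw [← Nat.sub_add_cancel hN', pow_add, mul_assoc]
    exact mul_mem (pow_mem sub_mem_noDiagonalPole _) (hN d)
  obtain ⟨N, hN⟩ := hr.exists_localAt hreg hΔ a b
  exact ⟨N, fun c d => hN c d trivial⟩

end BoundedDiagonalPoles

/-! ### The axioms of a quantum vertex algebra -/

section Axioms

open WithConv

variable {k : Type*} [Field k] {τ : Type*} {σ : MvPowerSeries τ (KRing k (Fin 2))}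
  {r : LatticeV k ⊗[k] LatticeV k →ₗ[k] MvPowerSeries τ (KRing k (Fin 2))}

theorem IsSigma.regularAtZero [CharZero k] {F : Type*} [Field F] [Algebra k F]
    [Algebra (MvPowerSeries τ k) F] {v : ℕ+ → F} {c : ℕ+ → MvPowerSeries τ k} (hσ : IsSigma v c σ)
    (hr : IsBicharacter σ r) : RegularAtZero r := by
  intro a b d n hn
  obtain ⟨e, he⟩ := hσ.bicharacter_mem hr a b
  ext m
  by_contra h
  exact absurd (he d n m h).1 (not_le.mpr hn)

/-- The series in `A((z))[[t]]` with a pole of bounded order at `z = 0`. -/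
def boundedPoles (k τ A : Type*) [Field k] [CommRing A] [Algebra k A] :
    Subalgebra k (MvPowerSeries τ (HahnSeries ℤ A)) where
  carrier := {x | ∃ e : ℤ, ∀ d, ∀ n < e, (x d).coeff n = 0}
  mul_mem' := by
    classical
    rintro x y ⟨e, he⟩ ⟨e', he'⟩
    refine ⟨e + e', fun d n hn => ?_⟩
    rw [mul_apply_antidiagonal, HahnSeries.coeff_sum]
    refine Finset.sum_eq_zero fun p _ => ?_
    rw [coeff_mul_eq_sum _ _ n (s := ∅), Finset.sum_empty]
    intro i h1 h2
    by_contra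
    rcases lt_or_ge i e with h | h
    · exact h1 (he _ i h)
    · exact h2 (he' _ _ (by omega))
  add_mem' := by
    rintro x y ⟨e, he⟩ ⟨e', he'⟩
    refine ⟨min e e', fun d n hn => ?_⟩
    change (x d).coeff n + (y d).coeff n = 0
    rw [he d n (lt_of_lt_of_le hn (min_le_left _ _)),
      he' d n (lt_of_lt_of_le hn (min_le_right _ _)), add_zero]
  algebraMap_mem' := by
    classical
    refine fun c => ⟨0, fun d n hn => ?_⟩
    change (MvPowerSeries.coeff d (algebraMap k (MvPowerSeries τ (HahnSeries ℤ A)) c)).coeff n = 0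
    rw [IsScalarTower.algebraMap_apply k (HahnSeries ℤ A) (MvPowerSeries τ (HahnSeries ℤ A)),
      MvPowerSeries.algebraMap_apply, MvPowerSeries.coeff_C]
    split_ifs
    · rw [Algebra.algebraMap_self_apply, Algebra.algebraMap_eq_smul_one]
      change c • (1 : HahnSeries ℤ A).coeff n = 0
      rw [HahnSeries.coeff_one, if_neg hn.ne, smul_zero]
    · rfl

theorem conv_mem {A C : Type*} [CommRing A] [Algebra k A] [AddCommGroup C] [Module k C]
    [Coalgebra k C] (S : Subalgebra k A) {f g : WithConv (C →ₗ[k] A)} (hf : ∀ x, f x ∈ S)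
    (hg : ∀ x, g x ∈ S) (x : C) : (f * g) x ∈ S := by
  rw [conv_apply_repr (Coalgebra.Repr.arbitrary k x)]
  exact sum_mem fun i _ => mul_mem (hf _) (hg _)

theorem fieldFunctional_mem_boundedPoles
    (h : ∀ a b, tMapAlg τ (expand k) (r (a ⊗ₜ b)) ∈ boundedSeries k τ)
    (x : LatticeV k ⊗[k] LatticeV k) : fieldFunctional r x ∈ boundedPoles k τ (LatticeV k) := by
  induction x with
  | zero => rw [map_zero]; exact zero_mem _
  | add u v hu hv => rw [map_add]; exact add_mem hu hv
  | tmul a b =>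
    obtain ⟨e, he⟩ := h a b
    refine ⟨e, fun d n hn => ?_⟩
    change algebraMap k (LatticeV k) (((expand k (r (a ⊗ₜ b) d)).coeff 0).coeff n) = 0
    rw [show ((expand k (r (a ⊗ₜ b) d)).coeff 0).coeff n = 0 from ?_, map_zero]
    by_contra h
    exact absurd (he d 0 n h).2 (by omega)

theorem bicharY_mem_boundedPoles
    (h : ∀ a b, tMapAlg τ (expand k) (r (a ⊗ₜ b)) ∈ boundedSeries k τ) (a b : LatticeV k) :
    bicharY r a b ∈ boundedPoles k τ (LatticeV k) := by
  have h1 : ∀ x, tC k τ _ (expDMul k x) ∈ boundedPoles k τ (LatticeV k) := by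
    intro x
    induction x with
    | zero => rw [map_zero, map_zero]; exact zero_mem _
    | add u v hu hv => rw [map_add, map_add]; exact add_mem hu hv
    | tmul a b =>
      refine ⟨0, fun d n hn => ?_⟩
      rw [tC_apply, expDMul_tmul]
      split_ifs
      · rw [hC_apply, HahnSeries.coeff_mul_single_zero, coeff_expD_of_neg _ hn, zero_mul]
      · rfl
  have h2 := conv_mem (boundedPoles k τ (LatticeV k)) (f := toConv (tC k τ _ ∘ₗ expDMul k))
    (g := toConv (fieldFunctional r)) h1 (fieldFunctional_mem_boundedPoles h) (a ⊗ₜ b)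
  rwa [← bicharY_eq_conv] at h2

theorem IsSigma.exists_zCoeff_eq_zero [CharZero k] {F : Type*} [Field F] [Algebra k F]
    [Algebra (MvPowerSeries τ k) F] {v : ℕ+ → F} {c : ℕ+ → MvPowerSeries τ k} (hσ : IsSigma v c σ)
    (hr : IsBicharacter σ r) (a b : LatticeV k) :
    ∃ N : ℤ, ∀ n : ℤ, n < N → zCoeff n (bicharY r a b) = 0 := by
  obtain ⟨e, he⟩ := bicharY_mem_boundedPoles (hσ.bicharacter_mem hr) a b
  exact ⟨e, fun n hn => funext fun d => he d n hn⟩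

theorem expD_latticeD [CharZero k] (a : LatticeV k) :
    expD k (latticeD k a) = hDeriv k _ (expD k a) := by
  ext n
  rw [coeff_hDeriv]
  by_cases hn : 0 ≤ n
  · lift n to ℕ using hn
    have h : ((n : ℤ) + 1 : ℤ) = ((n + 1 : ℕ) : ℤ) := by push_cast; rfl
    rw [h, coeff_expD, coeff_expD]
    change ((n.factorial : k)⁻¹) • (latticeD k ^ n) (latticeD k a) =
      _ • (((n + 1).factorial : k)⁻¹) • (latticeD k ^ (n + 1)) a
    rw [smul_smul, pow_succ, Module.End.mul_apply, Nat.factorial_succ]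
    congr 1
    have : ((n : k) + 1) ≠ 0 := Nat.cast_add_one_ne_zero n
    have : (n.factorial : k) ≠ 0 := Nat.cast_ne_zero.mpr n.factorial_ne_zero
    push_cast
    field_simp
  · rw [coeff_expD_of_neg _ (not_le.mp hn)]
    rcases lt_or_eq_of_le (show n + 1 ≤ 0 by omega) with h | h
    · rw [coeff_expD_of_neg _ h, smul_zero]
    · rw [h, Int.cast_zero, zero_smul]

theorem hDeriv_hC {A : Type*} [CommRing A] [Algebra k A] (a : A) :
    hDeriv k A (hC k A a) = 0 := by
  rw [hC_apply, hDeriv_single, Int.cast_zero, zero_smul, map_zero]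

theorem expDMul_latticeD [CharZero k] (x : LatticeV k ⊗[k] LatticeV k) :
    expDMul k (LinearMap.rTensor _ (latticeD k) x) = hDeriv k _ (expDMul k x) := by
  induction x with
  | zero => simp only [map_zero]
  | add u v hu hv => simp only [map_add, hu, hv]
  | tmul a b =>
    rw [LinearMap.rTensor_tmul, expDMul_tmul, expDMul_tmul, hDeriv_mul, hDeriv_hC, mul_zero,
      zero_add, expD_latticeD]

theorem IsBicharacter.fieldFunctional_latticeD (hr : IsBicharacter σ r)
    (x : LatticeV k ⊗[k] LatticeV k) : fieldFunctional r (LinearMap.rTensor _ (latticeD k) x) =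
      tMap τ (hDeriv k _) (fieldFunctional r x) := by
  induction x with
  | zero => simp only [map_zero]
  | add u v hu hv => simp only [map_add, hu, hv]
  | tmul a b =>
    rw [LinearMap.rTensor_tmul, fieldFunctional_apply, hr.valueAtZero_latticeD]
    funext d
    refine HahnSeries.ext (funext fun n => ?_)
    change algebraMap k (LatticeV k) (_ • _) = _ • algebraMap k (LatticeV k) _
    rw [smul_eq_mul, map_mul, Algebra.smul_def]
    rfl

theorem IsBicharacter.bicharY_latticeD [CharZero k] (hr : IsBicharacter σ r) (a b : LatticeV k) :
    bicharY r (latticeD k a) b = tMap τ (hDeriv k _) (bicharY r a b) := by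
  have h := conv_coderivation (f := toConv (tC k τ _ ∘ₗ expDMul k))
    (g := toConv (fieldFunctional r)) (δ := tMap τ (hDeriv k (LatticeV k)))
    (comul_rTensor_coderivation (D := LatticeV k) (comul_latticeD' (k := k)))
    (tMap_leibniz hDeriv_mul)
    (fun x => ?_) (fun x => hr.fieldFunctional_latticeD x) (a ⊗ₜ b)
  · rwa [← bicharY_eq_conv] at h
  · change tC k τ _ (expDMul k _) = tMap τ _ (tC k τ _ (expDMul k x))
    rw [tMap_tC, expDMul_latticeD]

/-- The coproduct of a grouplike element. -/
def grouplikeRepr {g : LatticeV k} (hg : comul k g = g ⊗ₜ g) : Coalgebra.Repr k g Unit where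
  index := {()}
  left _ := g
  right _ := g
  eq := by rw [Finset.sum_singleton, comul_eq, hg]

theorem sum_mul_algebraMap_counit {A C : Type*} [CommRing A] [Algebra k A] [AddCommGroup C]
    [Module k C] [Coalgebra k C] {x : C} {ι : Type*} (R : Coalgebra.Repr k x ι) (f : C →ₗ[k] A) :
    ∑ i ∈ R.index, f (R.left i) * algebraMap k A (CoalgebraStruct.counit (R.right i)) = f x := by
  have h := congrArg (f ∘ₗ (TensorProduct.rid k C).toLinearMap) (Coalgebra.sum_tmul_counit_eq R)
  rw [map_sum] at h
  simp only [LinearMap.comp_apply, LinearEquiv.coe_coe, TensorProduct.rid_tmul, one_smul,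
    map_smul] at h
  rw [← h]
  exact Finset.sum_congr rfl fun i _ => by rw [mul_comm, ← Algebra.smul_def]

theorem IsBicharacter.annihilationPart_one_left (hr : IsBicharacter σ r) (b : LatticeV k) :
    annihilationPart r 1 b = constSeries k τ _ b := by
  let R := Coalgebra.Repr.arbitrary k b
  rw [annihilationPart_apply r 1 b R]
  refine Eq.trans (Finset.sum_congr rfl fun i _ => ?_)
    (sum_mul_algebraMap_counit R (constSeries k τ (LatticeV k)).toLinearMap)
  rw [fieldFunctional_apply, hr.valueAtZero_one_left, AlgHom.commutes]
  rfl

theorem IsBicharacter.annihilationPart_one_right (hr : IsBicharacter σ r) (a : LatticeV k) :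
    annihilationPart r a 1 = algebraMap k _ (counit k a) := by
  refine (annihilationPart_apply r a 1 (grouplikeRepr (map_one (comul k)))).trans ?_
  rw [grouplikeRepr, Finset.sum_singleton, map_one, one_mul, fieldFunctional_apply,
    hr.valueAtZero_one_right, AlgHom.commutes]

theorem expD_one : expD k 1 = 1 := by
  refine HahnSeries.ext (funext fun n => ?_)
  rw [HahnSeries.coeff_one]
  by_cases hn : 0 ≤ n
  · lift n to ℕ using hn
    rw [coeff_expD]
    cases n with
    | zero => rw [dividedPow_zero, Nat.cast_zero, if_pos rfl]
    | succ n =>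
      rw [dividedPow, LinearMap.smul_apply, pow_succ, Module.End.mul_apply, latticeD_one, map_zero,
        smul_zero, if_neg (by omega)]
  · rw [coeff_expD_of_neg _ (not_le.mp hn), if_neg (by omega)]

theorem IsBicharacter.bicharY_one_left (hr : IsBicharacter σ r) (b : LatticeV k) :
    bicharY r 1 b = constSeries k τ _ b := by
  refine (bicharY_apply r 1 b (grouplikeRepr (map_one (comul k)))).trans ?_
  rw [grouplikeRepr, Finset.sum_singleton, hr.annihilationPart_one_left, expD_one]
  exact (congrArg (· * _) (map_one (tCAlg k τ _))).trans (one_mul _)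

theorem IsBicharacter.bicharY_one_right (hr : IsBicharacter σ r) (a : LatticeV k) :
    bicharY r a 1 = tC k τ _ (expD k a) := by
  let R := Coalgebra.Repr.arbitrary k a
  rw [bicharY_apply r a 1 R]
  refine Eq.trans (Finset.sum_congr rfl fun i _ => ?_)
    (sum_mul_algebraMap_counit R (tC k τ _ ∘ₗ expD k))
  rw [hr.annihilationPart_one_right]
  rfl

theorem IsSigma.isHDQuantumVertexAlgebra [CharZero k] [Finite τ] {F : Type*} [Field F]
    [Algebra k F] [Algebra (MvPowerSeries τ k) F] {v : ℕ+ → F} {c : ℕ+ → MvPowerSeries τ k}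
    (hσ : IsSigma v c σ) (hr : IsBicharacter σ r) :
    IsHDQuantumVertexAlgebra (tC k τ (LatticeV k) 1) (tC k τ (LatticeV k) ∘ₗ latticeD k)
      (bicharY r) (bicharR r) where
  yang_baxter := bicharR_yang_baxter
  shift_left := hr.shift_left
  shift_right := hr.shift_right
  unitarity_left := hr.unitarity_left
  unitarity_right := hr.unitarity_right
  translation a b d n := by
    rw [LinearMap.comp_apply, tExt_tC, LinearMap.flip_apply, hr.bicharY_latticeD]
    rfl
  vacuum b := by
    rw [tExt_tC, LinearMap.flip_apply, hr.bicharY_one_left]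
    rfl
  creation a d := by
    rw [tExt_tC, hr.bicharY_one_right]
    refine ⟨fun n hn => ?_, ?_⟩
    · change (tC k τ _ (expD k a) d).coeff n = 0
      rw [tC_apply]
      split_ifs
      exacts [coeff_expD_of_neg _ hn, rfl]
    · change (tC k τ _ (expD k a) d).coeff 0 = tC k τ _ a d
      rw [tC_apply, tC_apply]
      split_ifs
      · exact (coeff_expD a 0).trans (dividedPow_zero _ a)
      · rfl
  locality a b M := by
    obtain ⟨Δ, h1, hΔ⟩ := diagonalPolesBounded_degree_lt (r := r) M
    obtain ⟨N, hN⟩ := hr.exists_localAt (hσ.regularAtZero hr) hΔ a b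
    exact ⟨N, fun c d hd => hN c d (h1 d hd)⟩

end Axioms

/-! ### Symmetric functions -/

section SymmetricFunctions

variable {F : Type*} [Field F] (v : ℕ+ → F)

/-- `z_λ v_λ = ⟨p_λ, p_λ⟩_v`. -/
def normSq (l : ℕ+ →₀ ℕ) : F :=
  l.prod fun n m => ((n : ℕ) : F) ^ m * (m.factorial : F) * v n ^ m

theorem scalarProduct_eq (f g : SymFun F) :
    scalarProduct v f g = ∑ l ∈ f.support, f.coeff l * g.coeff l * normSq v l := rfl

theorem normSq_add_single (l : ℕ+ →₀ ℕ) (n : ℕ+) : normSq v (l + Finsupp.single n 1) =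
    ((n : ℕ) : F) * v n * ((l n : F) + 1) * normSq v l := by
  have h : (l + Finsupp.single n 1).erase n = l.erase n := by
    rw [Finsupp.erase_add, Finsupp.erase_single, add_zero]
  rw [normSq, normSq, ← Finsupp.mul_prod_erase' l n _ (fun _ => by simp),
    ← Finsupp.mul_prod_erase' (l + Finsupp.single n 1) n _ (fun _ => by simp), h]
  rw [Finsupp.add_apply, Finsupp.single_eq_same, Nat.factorial_succ, pow_succ, pow_succ]
  push_cast
  ring

theorem normSq_ne_zero [CharZero F] (hv : ∀ n, v n ≠ 0) (l : ℕ+ →₀ ℕ) : normSq v l ≠ 0 :=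
  Finset.prod_ne_zero_iff.mpr fun n _ => mul_ne_zero (mul_ne_zero
    (pow_ne_zero _ (Nat.cast_ne_zero.mpr n.ne_zero))
    (Nat.cast_ne_zero.mpr (Nat.factorial_ne_zero _))) (pow_ne_zero _ (hv n))

/-- The operator `n v_n ∂/∂p_n`. -/
def perpOp (n : ℕ+) : Module.End F (SymFun F) :=
  (((n : ℕ) : F) * v n) • (MvPolynomial.pderiv n).toLinearMap

/-- The adjoint of multiplication by `p_n` is `n v_n ∂/∂p_n`, since
`z_λ v_λ = n v_n m z_μ v_μ` if `λ` is obtained from `μ` by adding an `m`-th part `n`. -/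
theorem isPerp_perpOp (n : ℕ+) : IsPerp v n (perpOp v n) := by
  classical
  intro f g
  rw [scalarProduct_eq, scalarProduct_eq]
  have hcoeff : ∀ l, (perpOp v n f).coeff l =
      ((n : ℕ) : F) * v n * (f.coeff (l + Finsupp.single n 1) * ((l n : F) + 1)) := by
    intro l
    change ((((n : ℕ) : F) * v n) • MvPolynomial.pderiv n f).coeff l = _
    rw [MvPolynomial.coeff_smul, MvPolynomial.coeff_pderiv, smul_eq_mul]
  refine Finset.sum_bij_ne_zero (fun l _ _ => l + Finsupp.single n 1) ?_ ?_ ?_ ?_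
  · intro l _ h
    rw [hcoeff] at h
    rw [MvPolynomial.mem_support_iff]
    intro h0
    simp [h0] at h
  · intro l _ _ l' _ _ h
    exact add_right_cancel h
  · intro l _ h
    rw [MvPolynomial.coeff_X_mul'] at h
    have hl : n ∈ l.support := by
      by_contra hn
      simp [hn] at h
    have hle : l - Finsupp.single n 1 + Finsupp.single n 1 = l :=
      tsub_add_cancel_of_le (Finsupp.single_le_iff.mpr
        (Nat.one_le_iff_ne_zero.mpr (Finsupp.mem_support_iff.mp hl)))
    rw [if_pos hl] at h
    have hterm : (perpOp v n f).coeff (l - Finsupp.single n 1) *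
        g.coeff (l - Finsupp.single n 1) * normSq v (l - Finsupp.single n 1) =
          f.coeff l * g.coeff (l - Finsupp.single n 1) * normSq v l := by
      rw [hcoeff, hle]
      conv_rhs => rw [← hle, normSq_add_single, hle]
      ring
    rw [← hterm] at h
    exact ⟨l - Finsupp.single n 1, MvPolynomial.mem_support_iff.mpr
      (left_ne_zero_of_mul (left_ne_zero_of_mul h)), h, hle⟩
  · intro l _ _
    rw [hcoeff, normSq_add_single, add_comm l, MvPolynomial.coeff_X_mul, add_comm _ l]
    ring

theorem scalarProduct_sub_left (f f' g : SymFun F) : scalarProduct v (f - f') g =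
    scalarProduct v f g - scalarProduct v f' g := by
  have h : ∀ f s, f.support ⊆ s → scalarProduct v f g =
      ∑ l ∈ s, f.coeff l * g.coeff l * normSq v l := fun f s hs =>
    Finset.sum_subset hs fun l _ hl => by
      rw [MvPolynomial.notMem_support_iff.mp hl, zero_mul, zero_mul]
  classical
  rw [h f (f.support ∪ f'.support) Finset.subset_union_left,
    h f' (f.support ∪ f'.support) Finset.subset_union_right,
    h (f - f') (f.support ∪ f'.support) (MvPolynomial.support_sub _ _ _), ← Finset.sum_sub_distrib]
  refine Finset.sum_congr rfl fun l _ => ?_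
  rw [MvPolynomial.coeff_sub]
  ring

theorem eq_zero_of_scalarProduct_eq_zero [CharZero F] (hv : ∀ n, v n ≠ 0) {f : SymFun F}
    (hf : ∀ g, scalarProduct v f g = 0) : f = 0 := by
  classical
  ext l
  by_contra hl
  have h := hf (MvPolynomial.monomial l 1)
  rw [scalarProduct_eq, Finset.sum_eq_single l] at h
  · rw [MvPolynomial.coeff_monomial, if_pos rfl, mul_one] at h
    exact mul_ne_zero hl (normSq_ne_zero v hv l) h
  · intro l' _ hl'
    rw [MvPolynomial.coeff_monomial, if_neg (Ne.symm hl'), mul_zero, zero_mul]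
  · intro hl
    rw [MvPolynomial.notMem_support_iff.mp hl, zero_mul, zero_mul]

theorem IsPerp.unique [CharZero F] (hv : ∀ n, v n ≠ 0) {n : ℕ+} {T T' : Module.End F (SymFun F)}
    (hT : IsPerp v n T) (hT' : IsPerp v n T') : T = T' := by
  refine LinearMap.ext fun f => sub_eq_zero.mp
    (eq_zero_of_scalarProduct_eq_zero v hv fun g => ?_)
  rw [scalarProduct_sub_left, hT, hT', sub_self]

theorem existsUnique_isPerp [CharZero F] (hv : ∀ n, v n ≠ 0) :
    ∃! pPerp : ℕ+ → Module.End F (SymFun F), ∀ n, IsPerp v n (pPerp n) :=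
  ⟨perpOp v, isPerp_perpOp v, fun _ h => funext fun n => (h n).unique v hv (isPerp_perpOp v n)⟩

end SymmetricFunctions

/-! ### The deformed Heisenberg algebra -/

section TensorOperators

variable {F A B : Type*} [CommRing F] [CommRing A] [Algebra F A] [CommRing B] [Algebra F B]

theorem rTensor_mulLeft_smul (c : F) (a : A) :
    c • LinearMap.rTensor B (LinearMap.mulLeft F a) =
      LinearMap.mulLeft F ((c • a) ⊗ₜ[F] (1 : B)) := by
  refine TensorProduct.ext' fun x y => ?_
  rw [LinearMap.smul_apply, LinearMap.rTensor_tmul, LinearMap.mulLeft_apply,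
    LinearMap.mulLeft_apply, Algebra.TensorProduct.tmul_mul_tmul, one_mul, smul_mul_assoc,
    TensorProduct.smul_tmul']

theorem rTensor_leibniz {δ : A →ₗ[F] A} (hδ : ∀ x y, δ (x * y) = x * δ y + δ x * y)
    (x y : A ⊗[F] B) : LinearMap.rTensor B δ (x * y) =
      x * LinearMap.rTensor B δ y + LinearMap.rTensor B δ x * y := by
  induction x with
  | zero => simp
  | add u v hu hv => rw [add_mul, map_add, hu, hv, map_add]; ring
  | tmul a b =>
    induction y with
    | zero => simp
    | add u v hu hv => rw [mul_add, map_add, hu, hv, map_add]; ring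
    | tmul a' b' =>
      simp only [Algebra.TensorProduct.tmul_mul_tmul, LinearMap.rTensor_tmul, hδ,
        TensorProduct.add_tmul]

theorem lTensor_leibniz {δ : B →ₗ[F] B} (hδ : ∀ x y, δ (x * y) = x * δ y + δ x * y)
    (x y : A ⊗[F] B) : LinearMap.lTensor A δ (x * y) =
      x * LinearMap.lTensor A δ y + LinearMap.lTensor A δ x * y := by
  induction x with
  | zero => simp
  | add u v hu hv => rw [add_mul, map_add, hu, hv, map_add]; ring
  | tmul a b =>
    induction y with
    | zero => simp
    | add u v hu hv => rw [mul_add, map_add, hu, hv, map_add]; ring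
    | tmul a' b' =>
      simp only [Algebra.TensorProduct.tmul_mul_tmul, LinearMap.lTensor_tmul, hδ,
        TensorProduct.tmul_add]

theorem commutator_mulLeft {A : Type*} [CommRing A] [Algebra F A] {δ : Module.End F A}
    (hδ : ∀ x y, δ (x * y) = x * δ y + δ x * y) (a : A) :
    δ * LinearMap.mulLeft F a - LinearMap.mulLeft F a * δ = LinearMap.mulLeft F (δ a) := by
  refine LinearMap.ext fun x => ?_
  change δ (a * x) - a * δ x = δ a * x
  rw [hδ]; ring

/-- The commutation relations for all pairs of modes follow from those for the pairs of modes of the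
same sign and those for a positive and a negative mode. -/
theorem commutator_of_pos {M : Type*} [AddCommGroup M] [Module F M] {H : ℤ → Module.End F M}
    {c : ℕ → F} (hzero : ∀ n, Commute (H 0) (H n))
    (hpos : ∀ m n : ℕ, Commute (H ((m : ℤ) + 1)) (H ((n : ℤ) + 1)))
    (hneg : ∀ m n : ℕ, Commute (H (Int.negSucc m)) (H (Int.negSucc n)))
    (hmix : ∀ m n : ℕ, H ((m : ℤ) + 1) * H (Int.negSucc n) - H (Int.negSucc n) * H ((m : ℤ) + 1) =
      if n = m then (((m : F) + 1) * c (m + 1)) • 1 else 0) (m n : ℤ) :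
    H m * H n - H n * H m = if m + n = 0 then ((m : F) * c m.natAbs) • 1 else 0 := by
  have hcomm : ∀ m n, Commute (H m) (H n) → (m + n = 0 → m = 0) →
      H m * H n - H n * H m = if m + n = 0 then ((m : F) * c m.natAbs) • 1 else 0 := by
    intro m n h h0
    rw [h.eq, sub_self]
    split_ifs with hmn
    · rw [h0 hmn, Int.cast_zero, zero_mul, zero_smul]
    · rfl
  have hofNat : ∀ m : ℕ, Int.ofNat (m + 1) = (m : ℤ) + 1 := fun m => rfl
  rcases m with (_ | m) | m
  · exact hcomm _ _ (hzero n) fun _ => rfl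
  · rcases n with (_ | n) | n
    · exact hcomm _ _ (hzero _).symm fun h => h
    · exact hcomm _ _ (hpos m n) fun h => by rw [hofNat, hofNat] at h; omega
    · rw [hofNat, hmix, Int.negSucc_eq]
      by_cases h : n = m
      · rw [if_pos h, if_pos (by rw [h]; ring), show ((m : ℤ) + 1).natAbs = m + 1 from rfl]
        push_cast
        rfl
      · rw [if_neg h, if_neg (by omega)]
  · rcases n with (_ | n) | n
    · exact hcomm _ _ (hzero _).symm fun h => h
    · rw [← neg_sub, hofNat, hmix, Int.negSucc_eq]
      by_cases h : m = n
      · rw [if_pos h, if_pos (by rw [h]; ring), ← neg_smul, ← h, Int.natAbs_neg,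
          show ((m : ℤ) + 1).natAbs = m + 1 from rfl]
        push_cast
        rw [neg_mul]
      · rw [if_neg h, if_neg (by omega), neg_zero]
    · exact hcomm _ _ (hneg m n) fun h => by omega

theorem pderiv_comm {ι : Type*} (i j : ι) (f : MvPolynomial ι F) :
    MvPolynomial.pderiv i (MvPolynomial.pderiv j f) =
      MvPolynomial.pderiv j (MvPolynomial.pderiv i f) := by
  classical
  by_cases h : i = j
  · rw [h]
  ext m
  simp only [MvPolynomial.coeff_pderiv, Finsupp.add_apply, Finsupp.single_apply, if_neg h,
    if_neg (Ne.symm h), add_zero]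
  rw [add_right_comm]
  ring

end TensorOperators

section HeisenbergOperators

variable {F : Type*} [Field F] (v : ℕ+ → F)

/-- The operator of multiplication by `v_n⁻¹ p_n`, as an element of the algebra. -/
def creationElt (n : ℕ+) : SymFunLattice F := ((v n)⁻¹ • MvPolynomial.X n) ⊗ₜ 1

theorem heis_negSucc (p : ℕ+ → Module.End F (SymFun F)) (n : ℕ) :
    heis v p (Int.negSucc n) = LinearMap.mulLeft F (creationElt v n.succPNat) := by
  refine Eq.trans ?_ (rTensor_mulLeft_smul _ _)
  rfl

theorem heis_zero (p : ℕ+ → Module.End F (SymFun F)) :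
    heis v p 0 = LinearMap.lTensor _ (chargeL F) := rfl

theorem heis_succ (hv : ∀ n, v n ≠ 0) (n : ℕ) : heis v (perpOp v) ((n : ℤ) + 1) =
    ((n : F) + 1) • LinearMap.rTensor _ (MvPolynomial.pderiv n.succPNat).toLinearMap := by
  change (v n.succPNat)⁻¹ • LinearMap.rTensor _ (perpOp v n.succPNat) = _
  rw [perpOp, LinearMap.rTensor_smul, smul_smul, mul_left_comm, inv_mul_cancel₀ (hv _), mul_one,
    Nat.succPNat_coe, Nat.cast_succ]

theorem heis_leibniz_zero (p : ℕ+ → Module.End F (SymFun F)) (x y : SymFunLattice F) :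
    heis v p 0 (x * y) = x * heis v p 0 y + heis v p 0 x * y :=
  lTensor_leibniz (fun x y => (chargeL_mul F x y).trans (add_comm _ _)) x y

theorem heis_leibniz_pos (hv : ∀ n, v n ≠ 0) (n : ℕ) (x y : SymFunLattice F) :
    heis v (perpOp v) ((n : ℤ) + 1) (x * y) =
      x * heis v (perpOp v) ((n : ℤ) + 1) y + heis v (perpOp v) ((n : ℤ) + 1) x * y := by
  rw [heis_succ v hv, LinearMap.smul_apply, LinearMap.smul_apply, LinearMap.smul_apply,
    mul_smul_comm, smul_mul_assoc, ← smul_add]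
  refine congrArg _ (rTensor_leibniz (fun x y => ?_) x y)
  exact (Derivation.leibniz _ x y).trans (congrArg _ (mul_comm _ _))

theorem heis_pos_creationElt (hv : ∀ n, v n ≠ 0) (m : ℕ) (n : ℕ+) :
    heis v (perpOp v) ((m : ℤ) + 1) (creationElt v n) =
      if (n : ℕ) = m + 1 then algebraMap F _ (((m : F) + 1) * (v n)⁻¹) else 0 := by
  rw [heis_succ v hv, creationElt, LinearMap.smul_apply, LinearMap.rTensor_tmul, map_smul]
  change _ • (_ • (MvPolynomial.pderiv m.succPNat) (MvPolynomial.X n)) ⊗ₜ[F] _ = _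
  split_ifs with h
  · have : n = m.succPNat := PNat.eq h
    subst this
    rw [MvPolynomial.pderiv_X_self, Algebra.algebraMap_eq_smul_one, mul_smul,
      TensorProduct.smul_tmul']
    rfl
  · rw [MvPolynomial.pderiv_X_of_ne (fun h' => h (by rw [h']; rfl)), smul_zero,
      TensorProduct.zero_tmul, smul_zero]

theorem heis_zero_creationElt (p : ℕ+ → Module.End F (SymFun F)) (n : ℕ+) :
    heis v p 0 (creationElt v n) = 0 := by
  rw [heis_zero, creationElt, LinearMap.lTensor_tmul, ← LaurentPolynomial.T_zero, chargeL_T,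
    Int.cast_zero, zero_smul, TensorProduct.tmul_zero]

theorem heis_zero_T (p : ℕ+ → Module.End F (SymFun F)) (m : ℤ) :
    heis v p 0 (1 ⊗ₜ LaurentPolynomial.T m) = (m : F) • (1 ⊗ₜ LaurentPolynomial.T m) := by
  rw [heis_zero, LinearMap.lTensor_tmul, chargeL_T, TensorProduct.tmul_smul]

theorem heis_pos_T (hv : ∀ n, v n ≠ 0) (n : ℕ) (m : ℤ) :
    heis v (perpOp v) ((n : ℤ) + 1) (1 ⊗ₜ LaurentPolynomial.T m) = 0 := by
  rw [heis_succ v hv, LinearMap.smul_apply, LinearMap.rTensor_tmul]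
  refine (congrArg _ (congrArg (· ⊗ₜ[F] _) ?_)).trans
    ((congrArg _ (TensorProduct.zero_tmul _ _)).trans (smul_zero _))
  exact MvPolynomial.pderiv_one

theorem heis_comm_pos (hv : ∀ n, v n ≠ 0) (m n : ℕ) :
    Commute (heis v (perpOp v) ((m : ℤ) + 1)) (heis v (perpOp v) ((n : ℤ) + 1)) := by
  rw [heis_succ v hv, heis_succ v hv]
  refine Commute.smul_left (Commute.smul_right ?_ _) _
  change LinearMap.rTensor _ _ * LinearMap.rTensor _ _ =
    LinearMap.rTensor _ _ * LinearMap.rTensor _ _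
  rw [← LinearMap.rTensor_mul, ← LinearMap.rTensor_mul]
  exact congrArg _ (LinearMap.ext fun x => pderiv_comm _ _ x)

/-- The commutation relations of the deformed Heisenberg algebra. -/
theorem heis_commutator (hv : ∀ n, v n ≠ 0) (m n : ℤ) :
    heis v (perpOp v) m * heis v (perpOp v) n - heis v (perpOp v) n * heis v (perpOp v) m =
      if m + n = 0 then ((m : F) * (v m.natAbs.toPNat')⁻¹) • 1 else 0 := by
  refine commutator_of_pos (H := heis v (perpOp v)) (c := fun n => (v n.toPNat')⁻¹)
    ?_ (heis_comm_pos v hv) (fun m n => ?_) (fun m n => ?_) m n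
  · rintro ((_ | n) | n)
    · exact Commute.refl _
    · rw [heis_zero]
      change Commute _ (heis v (perpOp v) ((n : ℤ) + 1))
      rw [heis_succ v hv]
      refine Commute.smul_right ?_ _
      exact (LinearMap.lTensor_comp_rTensor ..).trans (LinearMap.rTensor_comp_lTensor ..).symm
    · rw [heis_negSucc]
      refine sub_eq_zero.mp ((commutator_mulLeft (heis_leibniz_zero v _) _).trans ?_)
      rw [heis_zero_creationElt, LinearMap.mulLeft_zero_eq_zero]
  · rw [heis_negSucc, heis_negSucc]
    exact LinearMap.ext fun x => mul_left_comm _ _ _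
  · rw [heis_negSucc]
    refine (commutator_mulLeft (heis_leibniz_pos v hv m) _).trans ?_
    rw [heis_pos_creationElt v hv, Nat.succPNat_coe]
    by_cases h : n = m
    · subst h
      rw [if_pos rfl, if_pos rfl]
      exact LinearMap.ext fun x => (Algebra.smul_def _ _).symm
    · rw [if_neg (by omega), if_neg h, LinearMap.mulLeft_zero_eq_zero]

end HeisenbergOperators

/-! ### The common subspace of the two spaces -/

section CommonSubspace

variable {k : Type*} [Field k] {τ : Type*}

theorem integralToCompletion_tmul (a : MvPowerSeries τ k) (b : LatticeV k) (d : τ →₀ ℕ) :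
    integralToCompletion k τ (a ⊗ₜ b) d = a d • b := rfl

theorem integralToCompletion_injective :
    Function.Injective (integralToCompletion k τ) := by
  classical
  let B := Module.Basis.ofVectorSpace k (LatticeV k)
  -- the coordinates of the image with respect to a basis of `V` are those of the tensor
  have h : ∀ u i d, B.repr (integralToCompletion k τ u d) i =
      (TensorProduct.equivFinsuppOfBasisRight B u i) d := by
    intro u i d
    induction u with
    | zero => rw [map_zero, map_zero]; exact DFunLike.congr_fun (map_zero B.repr) i
    | add u v hu hv =>
      rw [map_add, map_add, Finsupp.add_apply]
      change B.repr (integralToCompletion k τ u d + integralToCompletion k τ v d) i = _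
      rw [map_add, Finsupp.add_apply, hu, hv]
      rfl
    | tmul a b =>
      rw [integralToCompletion_tmul, TensorProduct.equivFinsuppOfBasisRight_apply_tmul_apply,
        map_smul, Finsupp.smul_apply, smul_eq_mul, mul_comm]
      rfl
  rw [← LinearMap.ker_eq_bot, LinearMap.ker_eq_bot']
  intro u hu
  refine (TensorProduct.equivFinsuppOfBasisRight B).injective (Finsupp.ext fun i => ?_)
  funext d
  rw [← h, hu, map_zero]
  exact DFunLike.congr_fun (map_zero B.repr) i

/-- The inclusion of `k[[t]] ⊗ V` in `V[[t]]` as a homomorphism of algebras. -/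
def completionHom (k τ : Type*) [Field k] :
    MvPowerSeries τ k ⊗[k] LatticeV k →ₐ[k] MvPowerSeries τ (LatticeV k) :=
  Algebra.TensorProduct.productMap (tMapAlg τ (Algebra.ofId k (LatticeV k)))
    (tCAlg k τ (LatticeV k))

theorem completionHom_apply (u : MvPowerSeries τ k ⊗[k] LatticeV k) :
    completionHom k τ u = integralToCompletion k τ u := by
  refine LinearMap.congr_fun (f := (completionHom k τ).toLinearMap)
    (TensorProduct.ext' fun a b => ?_) u
  change completionHom k τ (a ⊗ₜ b) = _
  rw [completionHom, Algebra.TensorProduct.productMap_apply_tmul, mul_comm]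
  funext d
  refine (C_mul_apply (k := k) _ _ _).trans ?_
  rw [integralToCompletion_tmul, Algebra.smul_def, mul_comm]
  rfl

variable {F : Type*} [Field F] [Algebra k F] [Algebra (MvPowerSeries τ k) F]
  [IsScalarTower k (MvPowerSeries τ k) F] {v : ℕ+ → F}

/-- The `F`-linear homomorphism `Λ_F ⊗ F[ℤα] → F ⊗ V`, `p_n ↦ v_n h^{(n-1)}`. -/
def ofSymFun (k : Type*) [Field k] [Algebra k F] (v : ℕ+ → F) :
    SymFunLattice F →ₐ[F] F ⊗[k] LatticeV k :=
  Algebra.TensorProduct.productMap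
    (MvPolynomial.aeval fun n : ℕ+ => v n • ((1 : F) ⊗ₜ[k] hGen k n.natPred))
    (AddMonoidAlgebra.lift F _ ℤ
      { toFun := fun m => (1 : F) ⊗ₜ[k] eGen k m.toAdd
        map_one' := rfl
        map_mul' := fun m n => by
          rw [toAdd_mul, eGen_add, Algebra.TensorProduct.tmul_mul_tmul, one_mul] })

theorem toSymFun_hGen (n : ℕ) : toSymFun k v (hGen k n) = creationElt v n.succPNat :=
  latticeLift_hGen _ _ _

theorem toSymFun_eGen (m : ℤ) :
    toSymFun k v (eGen k m) = 1 ⊗ₜ LaurentPolynomial.T m :=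
  latticeLift_eGen _ _ _

theorem ofSymFun_creationElt (hv : ∀ n, v n ≠ 0) (n : ℕ+) :
    ofSymFun k v (creationElt v n) = 1 ⊗ₜ hGen k n.natPred := by
  rw [ofSymFun, creationElt, Algebra.TensorProduct.productMap_apply_tmul, map_one, mul_one,
    map_smul, MvPolynomial.aeval_X, smul_smul, inv_mul_cancel₀ (hv n), one_smul]

theorem ofSymFun_T (m : ℤ) :
    ofSymFun k v (1 ⊗ₜ LaurentPolynomial.T m) = 1 ⊗ₜ eGen k m := by
  rw [ofSymFun, Algebra.TensorProduct.productMap_apply_tmul, map_one, one_mul]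
  refine (AddMonoidAlgebra.lift_single _ _ _).trans ?_
  rw [one_smul]
  rfl

/-- `ofSymFun` is a left inverse of the embedding of `V`, up to extension of scalars. -/
theorem ofSymFun_toSymFun (hv : ∀ n, v n ≠ 0) (b : LatticeV k) :
    ofSymFun k v (toSymFun k v b) = 1 ⊗ₜ b := by
  have h : ((ofSymFun k v).restrictScalars k).comp (toSymFun k v) =
      Algebra.TensorProduct.includeRight := by
    refine lattice_algHom_ext (fun n => ?_) (fun m => ?_)
    · refine (congrArg _ (toSymFun_hGen n)).trans ?_
      refine (ofSymFun_creationElt hv _).trans ?_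
      rw [Nat.natPred_succPNat]
      rfl
    · refine (congrArg _ (toSymFun_eGen m)).trans ?_
      exact ofSymFun_T m
  exact DFunLike.congr_fun h b

theorem integralToSymFun_tmul (a : MvPowerSeries τ k) (b : LatticeV k) :
    integralToSymFun k τ v (a ⊗ₜ b) =
      algebraMap F _ (algebraMap (MvPowerSeries τ k) F a) * toSymFun k v b :=
  Algebra.TensorProduct.productMap_apply_tmul _ _ _ _

theorem integralToSymFun_injective [FaithfulSMul (MvPowerSeries τ k) F] (hv : ∀ n, v n ≠ 0) :
    Function.Injective (integralToSymFun k τ v) := by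
  have h : ∀ u, ofSymFun k v (integralToSymFun k τ v u) =
      LinearMap.rTensor _ (IsScalarTower.toAlgHom k (MvPowerSeries τ k) F).toLinearMap u := by
    intro u
    induction u with
    | zero => simp only [map_zero]
    | add u v hu hv => simp only [map_add, hu, hv]
    | tmul a b =>
      rw [integralToSymFun_tmul, map_mul, AlgHom.commutes, ofSymFun_toSymFun hv,
        LinearMap.rTensor_tmul, ← Algebra.smul_def, TensorProduct.smul_tmul', smul_eq_mul, mul_one]
      rfl
  have hinj := Module.Flat.rTensor_preserves_injective_linearMap (M := LatticeV k)
    (IsScalarTower.toAlgHom k (MvPowerSeries τ k) F).toLinearMap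
    (FaithfulSMul.algebraMap_injective (MvPowerSeries τ k) F)
  exact fun u u' hu => hinj (by rw [← h, ← h, hu])

theorem corresponds_iff {x : MvPowerSeries τ (LatticeV k)} {y : SymFunLattice F} :
    Corresponds v x y ↔ ∃ u, completionHom k τ u = x ∧ integralToSymFun k τ v u = y := by
  simp only [completionHom_apply]
  rfl

theorem Corresponds.mul {x x' : MvPowerSeries τ (LatticeV k)} {y y' : SymFunLattice F}
    (h : Corresponds v x y) (h' : Corresponds v x' y') : Corresponds v (x * x') (y * y') := by
  rw [corresponds_iff] at *
  obtain ⟨u, rfl, rfl⟩ := h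
  obtain ⟨u', rfl, rfl⟩ := h'
  exact ⟨u * u', map_mul _ _ _, map_mul _ _ _⟩

theorem Corresponds.add {x x' : MvPowerSeries τ (LatticeV k)} {y y' : SymFunLattice F}
    (h : Corresponds v x y) (h' : Corresponds v x' y') : Corresponds v (x + x') (y + y') := by
  obtain ⟨u, rfl, rfl⟩ := h
  obtain ⟨u', rfl, rfl⟩ := h'
  exact ⟨u + u', map_add _ _ _, map_add _ _ _⟩

theorem corresponds_zero : Corresponds v (0 : MvPowerSeries τ (LatticeV k)) 0 :=
  ⟨0, map_zero _, map_zero _⟩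

theorem corresponds_tC (b : LatticeV k) :
    Corresponds v (tC k τ (LatticeV k) b) (toSymFun k v b) := by
  refine corresponds_iff.mpr ⟨1 ⊗ₜ b, ?_, ?_⟩
  · rw [completionHom, Algebra.TensorProduct.productMap_apply_tmul, map_one, one_mul]
    rfl
  · rw [integralToSymFun_tmul, map_one, map_one, one_mul]

theorem corresponds_scalar (a : MvPowerSeries τ k) :
    Corresponds v (tMapAlg τ (Algebra.ofId k (LatticeV k)) a)
      (algebraMap F (SymFunLattice F) (algebraMap (MvPowerSeries τ k) F a)) := by
  refine corresponds_iff.mpr ⟨a ⊗ₜ 1, ?_, ?_⟩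
  · rw [completionHom, Algebra.TensorProduct.productMap_apply_tmul, map_one, mul_one]
  · rw [integralToSymFun_tmul, map_one, mul_one]

end CommonSubspace

/-! ### Recursion for exponential series -/

section ExpSeries

variable {S : Type*} [Field S] {A : Type*} [Ring A] [Algebra S A]

/-- The formal derivative of a power series. -/
def seriesDeriv (S : Type*) [Field S] {A : Type*} [Ring A] [Algebra S A] (x : PowerSeries A) :
    PowerSeries A :=
  PowerSeries.mk fun n => ((n : S) + 1) • PowerSeries.coeff (n + 1) x

theorem coeff_seriesDeriv (x : PowerSeries A) (n : ℕ) : PowerSeries.coeff n (seriesDeriv S x) =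
    ((n : S) + 1) • PowerSeries.coeff (n + 1) x := PowerSeries.coeff_mk _ _

theorem coeff_smul_series (c : S) (x : PowerSeries A) (n : ℕ) :
    PowerSeries.coeff n (c • x) = c • PowerSeries.coeff n x := rfl

theorem seriesDeriv_mul (x y : PowerSeries A) :
    seriesDeriv S (x * y) = x * seriesDeriv S y + seriesDeriv S x * y := by
  ext n
  rw [coeff_seriesDeriv]
  have h1 : ((n : S) + 1) • PowerSeries.coeff (n + 1) (x * y) =
      ∑ p ∈ Finset.HasAntidiagonal.antidiagonal (n + 1),
        (PowerSeries.coeff p.1 x * ((p.2 : S) • PowerSeries.coeff p.2 y) +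
          ((p.1 : S) • PowerSeries.coeff p.1 x) * PowerSeries.coeff p.2 y) := by
    rw [PowerSeries.coeff_mul, Finset.smul_sum]
    refine Finset.sum_congr rfl fun p hp => ?_
    rw [mul_smul_comm, smul_mul_assoc, ← add_smul, ← Nat.cast_add, add_comm p.2,
      Finset.HasAntidiagonal.mem_antidiagonal.mp hp, Nat.cast_succ]
  rw [h1, Finset.sum_add_distrib, map_add, PowerSeries.coeff_mul, PowerSeries.coeff_mul,
    Finset.Nat.sum_antidiagonal_succ',
    Finset.Nat.sum_antidiagonal_succ (f := fun p : ℕ × ℕ =>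
      ((p.1 : S) • PowerSeries.coeff p.1 x) * PowerSeries.coeff p.2 y)]
  simp [coeff_seriesDeriv]

theorem commute_of_coeff {x y : PowerSeries A}
    (h : ∀ i j, Commute (PowerSeries.coeff i x) (PowerSeries.coeff j y)) : Commute x y := by
  refine PowerSeries.ext fun n => ?_
  rw [PowerSeries.coeff_mul, PowerSeries.coeff_mul, ← Finset.Nat.sum_antidiagonal_swap]
  exact Finset.sum_congr rfl fun p _ => h p.2 p.1

theorem seriesDeriv_pow {G : PowerSeries A}
    (hG : ∀ i j, Commute (PowerSeries.coeff i G) (PowerSeries.coeff j G)) (n : ℕ) :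
    seriesDeriv S (G ^ (n + 1)) = ((n : S) + 1) • (G ^ n * seriesDeriv S G) := by
  have hcomm : Commute (seriesDeriv S G) G := commute_of_coeff fun i j => by
    rw [coeff_seriesDeriv]
    exact (hG _ _).smul_left _
  induction n with
  | zero => simp
  | succ n ih =>
    rw [pow_succ, seriesDeriv_mul, ih, smul_mul_assoc, mul_assoc, hcomm.eq, ← mul_assoc,
      ← pow_succ, Nat.cast_succ, add_smul ((n : S) + 1) 1, one_smul, add_comm]

theorem coeff_pow_eq_zero {G : PowerSeries A} (h0 : PowerSeries.coeff 0 G = 0) {n j : ℕ}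
    (h : n < j) : PowerSeries.coeff n (G ^ j) = 0 := by
  induction j generalizing n with
  | zero => omega
  | succ j ih =>
    rw [pow_succ, PowerSeries.coeff_mul]
    refine Finset.sum_eq_zero fun p hp => ?_
    have hp := Finset.HasAntidiagonal.mem_antidiagonal.mp hp
    rcases Nat.eq_zero_or_pos p.2 with h2 | h2
    · rw [h2, h0, mul_zero]
    · rw [ih (by omega), zero_mul]

/-- The definition of the exponential series, truncated at any sufficiently large exponent. -/
theorem coeff_expSeries {G : PowerSeries A} (h0 : PowerSeries.coeff 0 G = 0) {n N : ℕ}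
    (hN : n < N) : PowerSeries.coeff n (expSeries S G) =
      ∑ j ∈ Finset.range N, (j.factorial : S)⁻¹ • PowerSeries.coeff n (G ^ j) := by
  rw [expSeries, PowerSeries.coeff_mk]
  refine Finset.sum_subset (Finset.range_subset_range.mpr hN) fun j _ hj => ?_
  rw [coeff_pow_eq_zero h0 (by rw [Finset.mem_range] at hj; omega), smul_zero]

/-- The recursion expressing that the derivative of `exp G` is `exp G` times that of `G`. -/
theorem coeff_expSeries_succ [CharZero S] {G : PowerSeries A} (h0 : PowerSeries.coeff 0 G = 0)
    (hG : ∀ i j, Commute (PowerSeries.coeff i G) (PowerSeries.coeff j G)) (n : ℕ) :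
    ((n : S) + 1) • PowerSeries.coeff (n + 1) (expSeries S G) =
      ∑ p ∈ Finset.HasAntidiagonal.antidiagonal n, PowerSeries.coeff p.1 (expSeries S G) *
        (((p.2 : S) + 1) • PowerSeries.coeff (p.2 + 1) G) := by
  have h1 : ∀ p ∈ Finset.HasAntidiagonal.antidiagonal n,
      PowerSeries.coeff p.1 (expSeries S G) * (((p.2 : S) + 1) • PowerSeries.coeff (p.2 + 1) G) =
        ∑ j ∈ Finset.range (n + 1), (j.factorial : S)⁻¹ •
          (PowerSeries.coeff p.1 (G ^ j) * PowerSeries.coeff p.2 (seriesDeriv S G)) := by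
    intro p hp
    have hp := Finset.HasAntidiagonal.mem_antidiagonal.mp hp
    rw [coeff_expSeries h0 (show p.1 < n + 1 by omega), Finset.sum_mul]
    refine Finset.sum_congr rfl fun j _ => ?_
    rw [smul_mul_assoc, coeff_seriesDeriv]
  rw [Finset.sum_congr rfl h1, Finset.sum_comm, coeff_expSeries h0 (Nat.lt_succ_self (n + 1)),
    Finset.sum_range_succ', smul_add]
  have h2 : PowerSeries.coeff (n + 1) (G ^ 0) = 0 := by simp [PowerSeries.coeff_one]
  rw [h2, smul_zero, smul_zero, add_zero, Finset.smul_sum]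
  refine Finset.sum_congr rfl fun j _ => ?_
  rw [← Finset.smul_sum, ← PowerSeries.coeff_mul, smul_comm, ← coeff_seriesDeriv,
    seriesDeriv_pow hG, coeff_smul_series, smul_smul, Nat.factorial_succ]
  congr 1
  have : ((j : S) + 1) ≠ 0 := Nat.cast_add_one_ne_zero j
  have : (j.factorial : S) ≠ 0 := Nat.cast_ne_zero.mpr j.factorial_ne_zero
  push_cast
  field_simp

theorem coeff_zero_expSeries (G : PowerSeries A) :
    PowerSeries.coeff 0 (expSeries S G) = 1 := by
  simp [expSeries]

end ExpSeries

/-! ### The vertex operator `Ψ` -/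

section Translation

variable {F : Type*} [Field F]

/-- The substitution `p_n ↦ p_n - ζ^n` in symmetric functions. -/
def translatePoly (F : Type*) [Field F] : SymFun F →ₐ[F] Polynomial (SymFun F) :=
  MvPolynomial.aeval fun n : ℕ+ => Polynomial.C (MvPolynomial.X n) - Polynomial.X ^ (n : ℕ)

theorem translatePoly_X (n : ℕ+) : translatePoly F (MvPolynomial.X n) =
    Polynomial.C (MvPolynomial.X n) - Polynomial.X ^ (n : ℕ) :=
  MvPolynomial.aeval_X _ _

theorem coeff_zero_translatePoly (y : SymFun F) : (translatePoly F y).coeff 0 = y := by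
  have h : (Polynomial.constantCoeff).comp (translatePoly F).toRingHom =
      RingHom.id (SymFun F) := by
    refine MvPolynomial.ringHom_ext (fun c => ?_) (fun n => ?_)
    · simp [translatePoly, Polynomial.algebraMap_apply, MvPolynomial.algebraMap_eq]
    · simp [translatePoly, (PNat.ne_zero n).symm]
  exact RingHom.congr_fun h y

theorem dvd_ite_sub {R : Type*} [CommRing R] {x y : R} {p : Prop} [Decidable p]
    (h : ¬ p → x ∣ y) : x ∣ (if p then y else 0) - y := by
  split_ifs with hp
  · rw [sub_self]; exact dvd_zero _
  · rw [zero_sub, dvd_neg]; exact h hp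

/-- The derivative in `ζ` of `y(p_1 - ζ, p_2 - ζ^2, …)` is `- Σ_{i ≥ 1} i ζ^{i-1} ∂y/∂p_i`,
evaluated at the same point.  Modulo `ζ^N` the sum is finite. -/
theorem dvd_derivative_translatePoly (N : ℕ) (y : SymFun F) :
    Polynomial.X ^ N ∣ Polynomial.derivative (translatePoly F y) +
      ∑ i ∈ Finset.range N, ((i : Polynomial (SymFun F)) + 1) * Polynomial.X ^ i *
        translatePoly F (MvPolynomial.pderiv i.succPNat y) := by
  induction y using MvPolynomial.induction_on with
  | C c => simp [translatePoly]
  | add p q hp hq =>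
    simp only [map_add, mul_add, Finset.sum_add_distrib]
    rw [add_add_add_comm]
    exact dvd_add hp hq
  | mul_X p n hp =>
    have h1 : ∀ i : ℕ, ((i : Polynomial (SymFun F)) + 1) * Polynomial.X ^ i *
        translatePoly F (MvPolynomial.pderiv i.succPNat (p * MvPolynomial.X n)) =
        ((i : Polynomial (SymFun F)) + 1) * Polynomial.X ^ i *
          translatePoly F (MvPolynomial.pderiv i.succPNat p) * translatePoly F (MvPolynomial.X n) +
        translatePoly F p * if i = n.natPred then ((n : ℕ) : Polynomial (SymFun F)) *
          Polynomial.X ^ n.natPred else 0 := by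
      intro i
      rw [MvPolynomial.pderiv_mul, map_add, map_mul, map_mul]
      split_ifs with h
      · subst h
        rw [PNat.succPNat_natPred, MvPolynomial.pderiv_X_self, map_one]
        have : ((n.natPred : Polynomial (SymFun F)) + 1) = ((n : ℕ) : Polynomial (SymFun F)) := by
          rw [← Nat.cast_succ, Nat.succ_eq_add_one, PNat.natPred_add_one]
        rw [this]
        ring
      · rw [MvPolynomial.pderiv_X_of_ne (fun h' => h (by rw [h']; simp)), map_zero]
        ring
    simp only [h1]
    rw [Finset.sum_add_distrib, ← Finset.sum_mul, ← Finset.mul_sum, Finset.sum_ite_eq', map_mul,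
      Polynomial.derivative_mul]
    have h2 : Polynomial.derivative (translatePoly F (MvPolynomial.X n)) =
        - (((n : ℕ) : Polynomial (SymFun F)) * Polynomial.X ^ n.natPred) := by
      rw [translatePoly_X, Polynomial.derivative_sub, Polynomial.derivative_C, zero_sub,
        Polynomial.derivative_X_pow]
      simp [PNat.natPred]
    rw [h2]
    -- the truncation of the sum omits only multiples of `ζ^N`
    have h3 : Polynomial.X ^ N ∣ (if n.natPred ∈ Finset.range N then
        ((n : ℕ) : Polynomial (SymFun F)) * Polynomial.X ^ n.natPred else 0) -
          ((n : ℕ) : Polynomial (SymFun F)) * Polynomial.X ^ n.natPred :=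
      dvd_ite_sub fun h => Dvd.dvd.mul_left (pow_dvd_pow _ (by simpa using h)) _
    have h4 := dvd_add (hp.mul_right (translatePoly F (MvPolynomial.X n)))
      (h3.mul_left (translatePoly F p))
    refine (congrArg _ ?_).mp h4
    ring

/-- The recursion of `exp (- Σ_{i ≥ 1} ζ^i ∂/∂p_i)` for the coefficients of the substitution
`p_n ↦ p_n - ζ^n`. -/
theorem coeff_succ_translatePoly (n : ℕ) (y : SymFun F) :
    ((n : F) + 1) • (translatePoly F y).coeff (n + 1) =
      ∑ p ∈ Finset.HasAntidiagonal.antidiagonal n,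
        -(((p.2 : F) + 1) • (translatePoly F (MvPolynomial.pderiv p.2.succPNat y)).coeff p.1) := by
  have h := Polynomial.X_pow_dvd_iff.mp (dvd_derivative_translatePoly (n + 1) y) n
    (Nat.lt_succ_self n)
  rw [Polynomial.coeff_add, Polynomial.coeff_derivative, Polynomial.finsetSum_coeff] at h
  have h1 : ((n : F) + 1) • (translatePoly F y).coeff (n + 1) =
      (translatePoly F y).coeff (n + 1) * ((n : SymFun F) + 1) := by
    rw [Algebra.smul_def, map_add, map_natCast, map_one, mul_comm]
  rw [h1, eq_neg_of_add_eq_zero_left h, Finset.sum_neg_distrib,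
    ← Finset.Nat.sum_antidiagonal_swap, Finset.Nat.sum_antidiagonal_eq_sum_range_succ_mk]
  refine congrArg _ (Finset.sum_congr rfl fun i hi => ?_)
  rw [Finset.mem_range] at hi
  have h2 : ∀ (j : ℕ) (q : Polynomial (SymFun F)), ((j : Polynomial (SymFun F)) + 1) *
      Polynomial.X ^ j * q = Polynomial.C ((j : SymFun F) + 1) * (q * Polynomial.X ^ j) := by
    intro j q
    rw [map_add, map_natCast, map_one]; ring
  rw [h2, Polynomial.coeff_C_mul, Polynomial.coeff_mul_X_pow', if_pos (by omega),
    Algebra.smul_def, map_add, map_natCast, map_one]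
  rfl

end Translation

section TensorLift

variable {F A B C : Type*} [Field F] [CommRing A] [Algebra F A] [CommRing B] [Algebra F B]
  [CommRing C] [Algebra F C]

/-- The homomorphism `a ⊗ b ↦ f a * g b` to formal Laurent series over an algebra. -/
def tensorLift (f : A →ₐ[F] HahnSeries ℤ C) (g : B →ₐ[F] HahnSeries ℤ C) :
    A ⊗[F] B →ₐ[F] HahnSeries ℤ C :=
  Algebra.TensorProduct.productMap f g

theorem tensorLift_tmul (f : A →ₐ[F] HahnSeries ℤ C) (g : B →ₐ[F] HahnSeries ℤ C) (a : A) (b : B) :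
    tensorLift f g (a ⊗ₜ b) = f a * g b :=
  Algebra.TensorProduct.productMap_apply_tmul _ _ _ _

theorem tensorLift_left (f : A →ₐ[F] HahnSeries ℤ C) (g : B →ₐ[F] HahnSeries ℤ C) (a : A) :
    tensorLift f g (a ⊗ₜ 1) = f a := by
  rw [tensorLift_tmul, map_one, mul_one]

theorem tensorLift_right (f : A →ₐ[F] HahnSeries ℤ C) (g : B →ₐ[F] HahnSeries ℤ C) (b : B) :
    tensorLift f g (1 ⊗ₜ b) = g b := by
  rw [tensorLift_tmul, map_one, one_mul]

end TensorLift

section NormalOrdering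

variable {A : Type*} [CommRing A]

/-- The indices of the nonzero contributions to the coefficient of `z ^ m`, when the annihilation
part has degree at most `N` and the charge is `s`. -/
def modeIndices (N : ℕ) (m s : ℤ) : Finset (ℕ × ℕ × ℤ) :=
  ((Finset.range (N + 1)).filter fun j : ℕ => 0 ≤ m - s + j).image
    fun j : ℕ => ((m - s + j).toNat, j, s)

theorem mem_modeIndices {t : ℕ × ℕ × ℤ → A} {C : PowerSeries A} {f : ℕ → A} {N : ℕ} {s : ℤ}
    (ht : ∀ i j s', t (i, j, s') = if s' = s then PowerSeries.coeff i C * f j else 0)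
    (hf : ∀ j, N < j → f j = 0) {m : ℤ} {q : ℕ × ℕ × ℤ}
    (hq : (q.1 : ℤ) - (q.2.1 : ℤ) + q.2.2 = m) (h0 : t q ≠ 0) : q ∈ modeIndices N m s := by
  obtain ⟨i, j, s'⟩ := q
  rw [ht] at h0
  have hs : s' = s := by
    by_contra h
    exact h0 (if_neg h)
  subst hs
  rw [if_pos rfl] at h0
  have hj : j ≤ N := by
    by_contra h
    exact h0 (by rw [hf j (not_le.mp h), mul_zero])
  refine Finset.mem_image.mpr ⟨j, Finset.mem_filter.mpr ⟨Finset.mem_range.mpr (by omega), ?_⟩, ?_⟩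
  · simp only at hq; omega
  · simp only at hq
    refine Prod.ext ?_ rfl
    change (m - s' + j).toNat = i
    omega

theorem finite_modes {t : ℕ × ℕ × ℤ → A} {C : PowerSeries A} {f : ℕ → A} {N : ℕ} {s : ℤ}
    (ht : ∀ i j s', t (i, j, s') = if s' = s then PowerSeries.coeff i C * f j else 0)
    (hf : ∀ j, N < j → f j = 0) (m : ℤ) :
    {q : ℕ × ℕ × ℤ | (q.1 : ℤ) - (q.2.1 : ℤ) + q.2.2 = m ∧ t q ≠ 0}.Finite :=
  (Finset.finite_toSet (modeIndices N m s)).subset fun _ hq => mem_modeIndices ht hf hq.1 hq.2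

/-- The sum of the contributions to the coefficient of `z^m` is a coefficient of a product of
Laurent series. -/
theorem finsum_modes {t : ℕ × ℕ × ℤ → A} {C : PowerSeries A} {f : ℕ → A} {N : ℕ} {s : ℤ}
    (ht : ∀ i j s', t (i, j, s') = if s' = s then PowerSeries.coeff i C * f j else 0)
    (hf : ∀ j, N < j → f j = 0) (m : ℤ) :
    (∑ᶠ (q : ℕ × ℕ × ℤ) (_ : (q.1 : ℤ) - (q.2.1 : ℤ) + q.2.2 = m), t q) =
      (HahnSeries.ofPowerSeries ℤ A C *
        ∑ j ∈ Finset.range (N + 1), HahnSeries.single (s - j) (f j)).coeff m := by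
  have h1 : (∑ᶠ (q : ℕ × ℕ × ℤ) (_ : (q.1 : ℤ) - (q.2.1 : ℤ) + q.2.2 = m), t q) =
      ∑ q ∈ modeIndices N m s, t q := by
    refine finsum_mem_eq_sum_of_inter_support_eq t
      (s := {q : ℕ × ℕ × ℤ | (q.1 : ℤ) - (q.2.1 : ℤ) + q.2.2 = m}) (Set.ext fun q => ⟨?_, ?_⟩)
    · rintro ⟨hq, h0⟩
      exact ⟨mem_modeIndices ht hf hq h0, h0⟩
    · rintro ⟨hq, h0⟩
      obtain ⟨j, hj, rfl⟩ := Finset.mem_image.mp hq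
      have := (Finset.mem_filter.mp hj).2
      refine ⟨?_, h0⟩
      change ((m - s + j).toNat : ℤ) - (j : ℤ) + s = m
      omega
  rw [h1, modeIndices, Finset.sum_image (fun a _ b _ h => congrArg (fun q => q.2.1) h),
    Finset.sum_filter, Finset.mul_sum, HahnSeries.coeff_sum]
  refine Finset.sum_congr rfl fun j _ => ?_
  have h2 : m = (m - s + j) + (s - j) := by ring
  conv_rhs => rw [h2, HahnSeries.coeff_mul_single_add]
  split_ifs with h
  · rw [ht, if_pos rfl]
    congr 1
    conv_rhs => rw [← Int.toNat_of_nonneg h]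
    exact (HahnSeries.ofPowerSeries_apply_coeff _ _).symm
  · rw [coeff_ofPowerSeries_of_neg _ (not_le.mp h), zero_mul]

end NormalOrdering

section VertexOperator

variable {F : Type*} [Field F] (v : ℕ+ → F)

/-- The power series `exp (Σ_{n ≥ 1} v_n⁻¹ p_n z^n / n)`. -/
def creationSeries : PowerSeries (SymFunLattice F) :=
  expSeries F (PowerSeries.mk fun n => if n = 0 then 0 else (n : F)⁻¹ • creationElt v n.toPNat')

theorem creationSeries_zero : PowerSeries.coeff 0 (creationSeries v) = 1 :=
  coeff_zero_expSeries _

theorem creationSeries_succ [CharZero F] (n : ℕ) :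
    ((n : F) + 1) • PowerSeries.coeff (n + 1) (creationSeries v) =
      ∑ p ∈ Finset.HasAntidiagonal.antidiagonal n,
        PowerSeries.coeff p.1 (creationSeries v) * creationElt v p.2.succPNat := by
  rw [creationSeries, coeff_expSeries_succ (by simp) (fun _ _ => Commute.all _ _)]
  refine Finset.sum_congr rfl fun p _ => congrArg _ ?_
  rw [PowerSeries.coeff_mk, if_neg (Nat.succ_ne_zero _), smul_smul, Nat.cast_succ,
    mul_inv_cancel₀ (Nat.cast_add_one_ne_zero _), one_smul]
  rfl

theorem expSeries_zero_apply {M : Type*} [AddCommGroup M] [Module F M]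
    (G : PowerSeries (Module.End F M)) (x : M) :
    PowerSeries.coeff 0 (expSeries F G) x = x := by
  rw [coeff_zero_expSeries]
  rfl

theorem expSeries_succ_apply [CharZero F] {M : Type*} [AddCommGroup M] [Module F M]
    {G : PowerSeries (Module.End F M)} (H : ℕ → Module.End F M)
    (h0 : PowerSeries.coeff 0 G = 0)
    (hG : ∀ n : ℕ, PowerSeries.coeff (n + 1) G = ((n : F) + 1)⁻¹ • H n)
    (hH : ∀ m n, Commute (H m) (H n)) (n : ℕ) (x : M) :
    ((n : F) + 1) • PowerSeries.coeff (n + 1) (expSeries F G) x =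
      ∑ p ∈ Finset.HasAntidiagonal.antidiagonal n,
        PowerSeries.coeff p.1 (expSeries F G) (H p.2 x) := by
  have hcomm : ∀ i j, Commute (PowerSeries.coeff i G) (PowerSeries.coeff j G) := by
    rintro (_ | i) (_ | j)
    · exact Commute.refl _
    · rw [h0]; exact Commute.zero_left _
    · rw [h0]; exact Commute.zero_right _
    · rw [hG, hG]; exact ((hH i j).smul_left _).smul_right _
  have h := LinearMap.congr_fun (coeff_expSeries_succ (S := F) h0 hcomm n) x
  rw [LinearMap.smul_apply, LinearMap.sum_apply] at h
  rw [h]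
  refine Finset.sum_congr rfl fun p _ => ?_
  rw [hG, smul_smul, mul_inv_cancel₀ (Nat.cast_add_one_ne_zero _), one_smul]
  rfl

theorem expSeries_succ_apply_neg [CharZero F] {M : Type*} [AddCommGroup M] [Module F M]
    {G : PowerSeries (Module.End F M)} (H : ℕ → Module.End F M)
    (h0 : PowerSeries.coeff 0 G = 0)
    (hG : ∀ n : ℕ, PowerSeries.coeff (n + 1) G = -(((n : F) + 1)⁻¹ • H n))
    (hH : ∀ m n, Commute (H m) (H n)) (n : ℕ) (x : M) :
    ((n : F) + 1) • PowerSeries.coeff (n + 1) (expSeries F G) x =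
      ∑ p ∈ Finset.HasAntidiagonal.antidiagonal n,
        PowerSeries.coeff p.1 (expSeries F G) (-H p.2 x) :=
  expSeries_succ_apply (fun n => -H n) h0 (fun n => by rw [hG, smul_neg])
    (fun m n => (hH m n).neg_left.neg_right) n x

/-- The creation part of `Ψ(z)` acts by multiplication by `exp (Σ_{n ≥ 1} v_n⁻¹ p_n z^n / n)`. -/
theorem coeff_expMinus_apply [CharZero F] (p : ℕ+ → Module.End F (SymFun F)) (n : ℕ)
    (x : SymFunLattice F) : PowerSeries.coeff n (expMinus v p) x =
      PowerSeries.coeff n (creationSeries v) * x := by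
  induction n using Nat.strong_induction_on generalizing x with
  | _ n ih =>
    cases n with
    | zero =>
      rw [creationSeries_zero, one_mul]
      exact expSeries_zero_apply _ x
    | succ n =>
      have h := expSeries_succ_apply (F := F) (G := PowerSeries.mk fun n =>
          if n = 0 then 0 else (n : F)⁻¹ • heis v p (-(n : ℤ)))
        (fun n => LinearMap.mulLeft F (creationElt v n.succPNat)) (by simp)
        (fun n => ?_) (fun m n => LinearMap.ext fun x => mul_left_comm _ _ _) n x
      · refine smul_right_injective _ (Nat.cast_add_one_ne_zero (R := F) n) ?_
        refine h.trans ((Finset.sum_congr rfl fun q hq => ?_).trans (Finset.sum_mul _ _ _).symm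
          |>.trans ((congrArg (· * x) (creationSeries_succ v n).symm).trans
            (smul_mul_assoc _ _ _)))
        have hq := Finset.HasAntidiagonal.mem_antidiagonal.mp hq
        exact (ih q.1 (by omega) _).trans (mul_assoc _ _ _).symm
      · rw [PowerSeries.coeff_mk, if_neg (Nat.succ_ne_zero _), Nat.cast_succ]
        exact congrArg _ (heis_negSucc v p n)

/-- Taylor's formula: `exp (- Σ_{n ≥ 1} h_n ζ^n / n)` acts by the substitution `p_n ↦ p_n - ζ^n`,
since `h_n = n ∂/∂p_n`. -/
theorem coeff_expPlus_apply [CharZero F] (hv : ∀ n, v n ≠ 0) (j : ℕ) (y : SymFun F)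
    (g : F[T;T⁻¹]) : PowerSeries.coeff j (expPlus v (perpOp v)) (y ⊗ₜ g) =
      (translatePoly F y).coeff j ⊗ₜ g := by
  induction j using Nat.strong_induction_on generalizing y with
  | _ j ih =>
    cases j with
    | zero =>
      rw [coeff_zero_translatePoly]
      exact expSeries_zero_apply _ _
    | succ n =>
      have h := expSeries_succ_apply_neg (F := F) (G := PowerSeries.mk fun n =>
          if n = 0 then 0 else -((n : F)⁻¹ • heis v (perpOp v) n))
        (fun n => heis v (perpOp v) ((n : ℤ) + 1)) (by simp)
        (fun n => ?_) (heis_comm_pos v hv) n (y ⊗ₜ g)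
      · refine smul_right_injective _ (Nat.cast_add_one_ne_zero (R := F) n) ?_
        change _ = ((n : F) + 1) • ((translatePoly F y).coeff (n + 1) ⊗ₜ[F] g)
        rw [TensorProduct.smul_tmul', coeff_succ_translatePoly, TensorProduct.sum_tmul]
        refine h.trans (Finset.sum_congr rfl fun q hq => ?_)
        have hq := Finset.HasAntidiagonal.mem_antidiagonal.mp hq
        have h1 : -heis v (perpOp v) ((q.2 : ℤ) + 1) (y ⊗ₜ[F] g) =
            (-(((q.2 : F) + 1) • MvPolynomial.pderiv q.2.succPNat y)) ⊗ₜ[F] g := by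
          rw [heis_succ v hv, TensorProduct.neg_tmul, ← TensorProduct.smul_tmul']
          rfl
        refine (congrArg _ h1).trans ((ih q.1 (by omega) _).trans ?_)
        rw [map_neg, map_smul, Polynomial.coeff_neg, Polynomial.coeff_smul]
      · rw [PowerSeries.coeff_mk, if_neg (Nat.succ_ne_zero _), Nat.cast_succ]
        rfl

/-- The homomorphism `x ζ^j ↦ x z^{-j}`. -/
def evalInv (F : Type*) [Field F] : Polynomial (SymFun F) →ₐ[F] HahnSeries ℤ (SymFunLattice F) :=
  { Polynomial.eval₂RingHom ((hC F (SymFunLattice F)).comp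
      (Algebra.TensorProduct.includeLeft : SymFun F →ₐ[F] SymFunLattice F)).toRingHom
      (HahnSeries.single (-1) 1) with
    commutes' := fun c => (Polynomial.eval₂_C _ _).trans (AlgHom.commutes _ c) }

/-- The homomorphism `e^{mα} ↦ z^m e^{mα}`. -/
def chargeShift (F : Type*) [Field F] : F[T;T⁻¹] →ₐ[F] HahnSeries ℤ (SymFunLattice F) :=
  AddMonoidAlgebra.lift F (HahnSeries ℤ (SymFunLattice F)) ℤ
      { toFun := fun m => HahnSeries.single m.toAdd
          ((1 : SymFun F) ⊗ₜ[F] (LaurentPolynomial.T m.toAdd : F[T;T⁻¹]))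
        map_one' := rfl
        map_mul' := fun m n => by
          rw [HahnSeries.single_mul_single, Algebra.TensorProduct.tmul_mul_tmul, one_mul, toAdd_mul,
            LaurentPolynomial.T_add] }

/-- The algebra homomorphism `p_n ↦ p_n - z^{-n}`, `e^{mα} ↦ z^m e^{mα}`, by which
`exp (- Σ_{n ≥ 1} h_n z^{-n} / n) z^{∂_α}` acts. -/
def vertexShift (F : Type*) [Field F] : SymFunLattice F →ₐ[F] HahnSeries ℤ (SymFunLattice F) :=
  tensorLift ((evalInv F).comp (translatePoly F)) (chargeShift F)

theorem chargeShift_T (m : ℤ) : chargeShift F (LaurentPolynomial.T m : F[T;T⁻¹]) =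
    HahnSeries.single m (1 ⊗ₜ LaurentPolynomial.T m) := by
  refine (AddMonoidAlgebra.lift_single _ _ _).trans ?_
  rw [one_smul]
  rfl

theorem hahn_single_pow {A : Type*} [CommRing A] (n : ℕ) :
    (HahnSeries.single (-1) 1 : HahnSeries ℤ A) ^ n = HahnSeries.single (-(n : ℤ)) 1 := by
  rw [HahnSeries.single_pow, one_pow, nsmul_eq_mul, mul_neg, mul_one]

theorem vertexShift_T (m : ℤ) : vertexShift F (1 ⊗ₜ LaurentPolynomial.T m) =
    HahnSeries.single m (1 ⊗ₜ LaurentPolynomial.T m) := by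
  exact (tensorLift_right _ _ _).trans (chargeShift_T m)

theorem vertexShift_left (y : SymFun F) : vertexShift F (y ⊗ₜ 1) =
    ∑ j ∈ Finset.range ((translatePoly F y).natDegree + 1),
      HahnSeries.single (-(j : ℤ)) ((translatePoly F y).coeff j ⊗ₜ 1) := by
  refine (tensorLift_left _ _ _).trans ?_
  change evalInv F (translatePoly F y) = _
  refine (Polynomial.eval₂_eq_sum_range _ _).trans (Finset.sum_congr rfl fun j _ => ?_)
  rw [hahn_single_pow]
  refine (HahnSeries.single_mul_single).trans ?_
  rw [zero_add, mul_one]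
  rfl

theorem vertexShift_creationElt (n : ℕ+) : vertexShift F (creationElt v n) =
    hC F _ (creationElt v n) - HahnSeries.single (-(n : ℤ)) (algebraMap F _ (v n)⁻¹) := by
  have h : translatePoly F ((v n)⁻¹ • MvPolynomial.X n) =
      Polynomial.C ((v n)⁻¹ • MvPolynomial.X n) -
        Polynomial.C (MvPolynomial.C (v n)⁻¹) * Polynomial.X ^ (n : ℕ) := by
    rw [map_smul, translatePoly_X, Algebra.smul_def, Algebra.smul_def, mul_sub, map_mul]
    rfl
  refine (tensorLift_left _ _ _).trans ?_
  change evalInv F (translatePoly F _) = _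
  rw [h, map_sub]
  refine congrArg₂ _ (Polynomial.eval₂_C _ _) ?_
  refine (map_mul (evalInv F) _ _).trans ?_
  refine (congrArg₂ (· * ·) (Polynomial.eval₂_C _ _)
    ((Polynomial.eval₂_X_pow _ _).trans (hahn_single_pow _))).trans ?_
  refine (HahnSeries.single_mul_single).trans ?_
  rw [zero_add, mul_one]
  rfl

theorem psiTerm_add (p : ℕ+ → Module.End F (SymFun F)) (x y : SymFunLattice F) (q : ℕ × ℕ × ℤ) :
    psiTerm v p (x + y) q = psiTerm v p x q + psiTerm v p y q := by
  simp only [psiTerm, map_add, mul_add]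

theorem projL_T (s m : ℤ) : projL F s (LaurentPolynomial.T m : F[T;T⁻¹]) =
    if s = m then LaurentPolynomial.T m else 0 := by
  refine (congrArg (AddMonoidAlgebra.lsingle s) (Finsupp.single_apply (a := m) (a' := s)
    (b := (1 : F)))).trans ?_
  split_ifs with h1 h2 h2
  · rw [h2]; rfl
  · exact absurd h1.symm h2
  · exact absurd h2.symm h1
  · exact map_zero _

theorem psiTerm_tmul [CharZero F] (hv : ∀ n, v n ≠ 0) (y : SymFun F) (m : ℤ)
    (i j : ℕ) (s : ℤ) :
    psiTerm v (perpOp v) (y ⊗ₜ LaurentPolynomial.T m) (i, j, s) =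
      if s = m then PowerSeries.coeff i (creationSeries v) *
        ((translatePoly F y).coeff j ⊗ₜ LaurentPolynomial.T (m + 1)) else 0 := by
  rw [psiTerm]
  change PowerSeries.coeff i (expMinus v (perpOp v)) (PowerSeries.coeff j (expPlus v (perpOp v))
    ((1 ⊗ₜ LaurentPolynomial.T 1) * (y ⊗ₜ projL F s (LaurentPolynomial.T m)))) = _
  rw [projL_T]
  split_ifs
  · rw [Algebra.TensorProduct.tmul_mul_tmul, one_mul, coeff_expPlus_apply v hv,
      coeff_expMinus_apply, ← LaurentPolynomial.T_add, add_comm 1 m]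
  · rw [TensorProduct.tmul_zero, mul_zero, map_zero, map_zero]

theorem induction_monomials (P : SymFunLattice F → Prop)
    (h : ∀ y m, P (y ⊗ₜ LaurentPolynomial.T m))
    (hadd : ∀ x y, P x → P y → P (x + y)) (x : SymFunLattice F) : P x := by
  refine TensorProduct.induction_on x ?_ (fun y g => ?_) hadd
  · exact (congrArg P (TensorProduct.zero_tmul _ _)).mp (h 0 0)
  · induction g using LaurentPolynomial.induction_on' with
    | add p q hp hq => rw [TensorProduct.tmul_add]; exact hadd _ _ hp hq
    | C_mul_T n a =>
      rw [← LaurentPolynomial.smul_eq_C_mul, ← TensorProduct.smul_tmul]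
      exact h _ _

theorem translatePoly_coeff_tmul_eq_zero {y : SymFun F} {j : ℕ}
    (h : (translatePoly F y).natDegree < j) (g : F[T;T⁻¹]) :
    (translatePoly F y).coeff j ⊗ₜ[F] g = 0 := by
  rw [Polynomial.coeff_eq_zero_of_natDegree_lt h, TensorProduct.zero_tmul]

/-- Only finitely many products of modes contribute to a coefficient of `Ψ(z) x`. -/
theorem finite_psiTerm [CharZero F] (hv : ∀ n, v n ≠ 0) (m : ℤ) (x : SymFunLattice F) :
    {q : ℕ × ℕ × ℤ | (q.1 : ℤ) - (q.2.1 : ℤ) + q.2.2 = m ∧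
      psiTerm v (perpOp v) x q ≠ 0}.Finite := by
  refine induction_monomials (fun x => {q : ℕ × ℕ × ℤ | (q.1 : ℤ) - (q.2.1 : ℤ) + q.2.2 = m ∧
    psiTerm v (perpOp v) x q ≠ 0}.Finite) (fun y s => ?_) (fun x y hx hy => ?_) x
  · exact finite_modes (psiTerm_tmul v hv y s)
      (fun j hj => translatePoly_coeff_tmul_eq_zero hj _) m
  · refine (hx.union hy).subset fun q hq => ?_
    by_cases h : psiTerm v (perpOp v) x q = 0
    · refine Or.inr ⟨hq.1, fun h' => hq.2 ?_⟩
      rw [psiTerm_add, h, h', add_zero]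
    · exact Or.inl ⟨hq.1, h⟩

theorem hC_mul_sum_single_mul_single {A : Type*} [CommRing A] [Algebra F A] (g e : A) (N : ℕ)
    (f : ℕ → A) (s : ℤ) : hC F A g * ((∑ j ∈ Finset.range N,
      HahnSeries.single (-(j : ℤ)) (f j)) * HahnSeries.single s e) =
    ∑ j ∈ Finset.range N, HahnSeries.single (s - j) (g * (f j * e)) := by
  rw [Finset.sum_mul, Finset.mul_sum]
  refine Finset.sum_congr rfl fun j _ => ?_
  rw [hC_apply, HahnSeries.single_mul_single, HahnSeries.single_mul_single, zero_add,
    neg_add_eq_sub]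

theorem vertexShift_tmul_T (y : SymFun F) (s : ℤ) :
    hC F (SymFunLattice F) (1 ⊗ₜ LaurentPolynomial.T 1) *
      vertexShift F (y ⊗ₜ LaurentPolynomial.T s) =
    ∑ j ∈ Finset.range ((translatePoly F y).natDegree + 1), HahnSeries.single (s - j)
      ((translatePoly F y).coeff j ⊗ₜ LaurentPolynomial.T (s + 1)) := by
  have h : vertexShift F (y ⊗ₜ LaurentPolynomial.T s) =
      (∑ j ∈ Finset.range ((translatePoly F y).natDegree + 1),
        HahnSeries.single (-(j : ℤ)) ((translatePoly F y).coeff j ⊗ₜ 1)) *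
      HahnSeries.single s (1 ⊗ₜ LaurentPolynomial.T s) := by
    rw [← vertexShift_left, ← vertexShift_T]
    refine (congrArg (vertexShift F) ?_).trans (map_mul (vertexShift F) _ _)
    rw [Algebra.TensorProduct.tmul_mul_tmul, one_mul, mul_one]
  rw [h]
  refine (hC_mul_sum_single_mul_single _ _ _ _ _).trans (Finset.sum_congr rfl fun j _ => ?_)
  rw [Algebra.TensorProduct.tmul_mul_tmul, Algebra.TensorProduct.tmul_mul_tmul, one_mul, mul_one,
    one_mul, ← LaurentPolynomial.T_add, add_comm 1 s]

/-- The normally ordered exponential `Ψ(z)` as a product in the ring of Laurent series. -/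
theorem psiCoeff_eq [CharZero F] (hv : ∀ n, v n ≠ 0) (m : ℤ) (x : SymFunLattice F) :
    psiCoeff v (perpOp v) m x = (HahnSeries.ofPowerSeries ℤ _ (creationSeries v) *
      (hC F (SymFunLattice F) (1 ⊗ₜ LaurentPolynomial.T 1) * vertexShift F x)).coeff m := by
  refine induction_monomials (fun x => psiCoeff v (perpOp v) m x =
    (HahnSeries.ofPowerSeries ℤ _ (creationSeries v) *
      (hC F (SymFunLattice F) (1 ⊗ₜ LaurentPolynomial.T 1) * vertexShift F x)).coeff m)
    (fun y s => ?_) (fun x y hx hy => ?_) x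
  · refine (finsum_modes (psiTerm_tmul v hv y s)
      (fun j hj => translatePoly_coeff_tmul_eq_zero hj _) m).trans ?_
    rw [vertexShift_tmul_T]
  · have h : psiCoeff v (perpOp v) m (x + y) =
        psiCoeff v (perpOp v) m x + psiCoeff v (perpOp v) m y := by
      simp only [psiCoeff, psiTerm_add]
      exact finsum_mem_add_distrib' (finite_psiTerm v hv m x) (finite_psiTerm v hv m y)
    have h2 : vertexShift F (x + y) = vertexShift F x + vertexShift F y := map_add _ _ _
    refine h.trans ((congrArg₂ _ hx hy).trans ?_)
    rw [h2, mul_add, mul_add]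
    rfl

end VertexOperator

/-! ### Values of the bicharacter at `w = 0` -/

section Monomials

variable {k : Type*} [Field k] {τ : Type*} {A B : Type*} [CommRing A] [Algebra k A] [CommRing B]
  [Algebra k B]

/-- The map `a ↦ a z^n`. -/
def zMono (k : Type*) [Field k] {τ A : Type*} [CommRing A] [Algebra k A] (n : ℤ) :
    MvPowerSeries τ A →ₗ[k] MvPowerSeries τ (HahnSeries ℤ A) :=
  tMap τ
    { toFun := HahnSeries.single n
      map_add' := (HahnSeries.single.addMonoidHom n).map_add
      map_smul' := fun c a => by
        ext m
        by_cases h : m = n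
        · subst h; simp
        · simp [HahnSeries.coeff_single_of_ne h] }

theorem zMono_apply (n : ℤ) (a : MvPowerSeries τ A) (d : τ →₀ ℕ) :
    zMono k n a d = HahnSeries.single n (a d) := rfl

theorem zMono_mul (m n : ℤ) (a b : MvPowerSeries τ A) :
    zMono k m a * zMono k n b = zMono k (m + n) (a * b) := by
  classical
  funext d
  rw [mul_apply_antidiagonal, zMono_apply, mul_apply_antidiagonal]
  refine (Finset.sum_congr rfl fun p _ => ?_).trans
    (map_sum (HahnSeries.single.addMonoidHom (m + n)) _ _).symm
  rw [zMono_apply, zMono_apply, HahnSeries.single_mul_single]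
  rfl

theorem zMono_zero_one : zMono k 0 (1 : MvPowerSeries τ A) = 1 := by
  classical
  funext d
  rw [zMono_apply]
  change HahnSeries.single 0 (MvPowerSeries.coeff d 1) = MvPowerSeries.coeff d 1
  rw [MvPowerSeries.coeff_one, MvPowerSeries.coeff_one]
  split_ifs
  · rfl
  · exact map_zero _

theorem tMap_hDeriv_zMono (n : ℤ) (a : MvPowerSeries τ A) :
    tMap τ (hDeriv k A) (zMono k n a) = zMono k (n - 1) ((n : k) • a) := by
  funext d
  exact hDeriv_single _ _

theorem zCoeff_zMono (n m : ℤ) (a : MvPowerSeries τ A) :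
    zCoeff m (zMono k n a) = if m = n then a else 0 := by
  funext d
  refine (HahnSeries.coeff_single (a := n) (b := m)).trans ?_
  split_ifs <;> rfl

theorem zCoeff_mul_zMono (n m : ℤ) (x : MvPowerSeries τ (HahnSeries ℤ A))
    (a : MvPowerSeries τ A) : zCoeff m (x * zMono k n a) = zCoeff (m - n) x * a := by
  classical
  funext d
  rw [zCoeff, mul_apply_antidiagonal, mul_apply_antidiagonal, HahnSeries.coeff_sum]
  refine Finset.sum_congr rfl fun p _ => ?_
  rw [zMono_apply]
  conv_lhs => rw [← sub_add_cancel m n]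
  exact HahnSeries.coeff_mul_single_add

theorem tMapAlg_hMapAlg_zMono (f : A →ₐ[k] B) (n : ℤ) (a : MvPowerSeries τ A) :
    tMapAlg τ (hMapAlg f) (zMono k n a) = zMono k n (tMapAlg τ f a) := by
  funext d
  exact hMapAlg_single f n (a d)

theorem constSeries_eq_zMono (a : A) : constSeries k τ A a = zMono k 0 (tC k τ A a) := by
  funext d
  change tC k τ _ (hC k A a) d = _
  rw [zMono_apply, tC_apply, tC_apply, hC_apply]
  split_ifs
  · rfl
  · exact (map_zero _).symm

theorem zCoeff_tC_expD (m : ℤ) (a : LatticeV k) :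
    zCoeff m (tC k τ _ (expD k a)) = tC k τ _ ((expD k a).coeff m) := by
  funext d
  rw [zCoeff, tC_apply, tC_apply]
  split_ifs <;> rfl

theorem scalarSeries_zMono (n : ℤ) (a : MvPowerSeries τ k) :
    scalarSeries k τ A (zMono k n a) = zMono k n (tMapAlg τ (Algebra.ofId k A) a) :=
  tMapAlg_hMapAlg_zMono _ _ _

end Monomials

/-- A sequence is determined by its convolution with a sequence whose first term is a unit. -/
theorem eq_of_sum_antidiagonal_eq {A : Type*} [CommRing A] {f x y : ℕ → A} (hf : IsUnit (f 0))
    (h : ∀ n, ∑ p ∈ Finset.HasAntidiagonal.antidiagonal n, f p.1 * x p.2 =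
      ∑ p ∈ Finset.HasAntidiagonal.antidiagonal n, f p.1 * y p.2) : x = y := by
  have hu : IsUnit (PowerSeries.mk f) := by
    rw [PowerSeries.isUnit_iff_constantCoeff, ← PowerSeries.coeff_zero_eq_constantCoeff_apply,
      PowerSeries.coeff_mk]
    exact hf
  have h1 : PowerSeries.mk f * PowerSeries.mk x = PowerSeries.mk f * PowerSeries.mk y := by
    ext n
    simpa only [PowerSeries.coeff_mul, PowerSeries.coeff_mk] using h n
  funext n
  simpa only [PowerSeries.coeff_mk] using congrArg (PowerSeries.coeff n) (hu.mul_left_cancel h1)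

section Generators

variable {k : Type*} [Field k]

/-- The coproduct of a primitive element. -/
def primitiveRepr {a : LatticeV k} (ha : comul k a = a ⊗ₜ 1 + 1 ⊗ₜ a) :
    Coalgebra.Repr k a Bool where
  index := Finset.univ
  left i := if i then a else 1
  right i := if i then 1 else a
  eq := by rw [comul_eq, ha, Fintype.sum_bool]; simp

theorem sum_primitiveRepr {a : LatticeV k} (ha : comul k a = a ⊗ₜ 1 + 1 ⊗ₜ a) {M : Type*}
    [AddCommMonoid M] (f : LatticeV k → LatticeV k → M) :
    ∑ i ∈ (primitiveRepr ha).index, f ((primitiveRepr ha).left i) ((primitiveRepr ha).right i) =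
      f a 1 + f 1 a := by
  refine (Fintype.sum_bool _).trans ?_
  simp [primitiveRepr]

variable [CharZero k]

theorem dividedPow_hGen_zero (n : ℕ) : dividedPow (latticeD k) n (hGen k 0) = hGen k n := by
  induction n with
  | zero => exact dividedPow_zero _ _
  | succ n ih =>
    refine smul_right_injective _ (Nat.cast_add_one_ne_zero (R := k) n) ?_
    change _ = ((n : k) + 1) • hGen k (n + 1)
    rw [← latticeD_hGen, ← ih, apply_dividedPow]

/-- The Taylor coefficients of `e^{zD} e^α` satisfy the recursion of the exponential of
`Σ h^{(n-1)} z^n / n`. -/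
theorem dividedPow_eGen_succ (n : ℕ) :
    ((n : k) + 1) • dividedPow (latticeD k) (n + 1) (eGen k 1) =
      ∑ p ∈ Finset.HasAntidiagonal.antidiagonal n,
        dividedPow (latticeD k) p.1 (eGen k 1) * hGen k p.2 := by
  rw [← apply_dividedPow, dividedPow_comm (fun _ => rfl), latticeD_eGen, Int.cast_one, one_smul,
    mul_comm, dividedPow_mul]
  simp only [dividedPow_hGen_zero]

end Generators

section Values

variable {k : Type*} [Field k] [CharZero k] {τ : Type*} {F : Type*} [Field F]
  [Algebra (MvPowerSeries τ k) F] {v : ℕ+ → F} {c : ℕ+ → MvPowerSeries τ k}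
  {σ : MvPowerSeries τ (KRing k (Fin 2))}
  {r : LatticeV k ⊗[k] LatticeV k →ₗ[k] MvPowerSeries τ (KRing k (Fin 2))}

omit [CharZero k] in
theorem coeff_zero_fSeries : PowerSeries.coeff 0 (fSeries c) = 1 := coeff_zero_expSeries _

theorem coeff_fSeries_succ (n : ℕ) : ((n : k) + 1) • PowerSeries.coeff (n + 1) (fSeries c) =
    ∑ p ∈ Finset.HasAntidiagonal.antidiagonal n,
      PowerSeries.coeff p.1 (fSeries c) * -c p.2.succPNat := by
  rw [fSeries, coeff_expSeries_succ (by simp) (fun _ _ => Commute.all _ _)]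
  refine Finset.sum_congr rfl fun p _ => congrArg _ ?_
  rw [PowerSeries.coeff_mk, dif_pos (Nat.succ_pos _), smul_neg, smul_smul, Nat.cast_succ,
    mul_inv_cancel₀ (Nat.cast_add_one_ne_zero _), one_smul]
  rfl

omit [CharZero k] in
theorem IsBicharacter.valueAtZero_eGen_mul (hr : IsBicharacter σ r) (hreg : RegularAtZero r)
    (m : ℤ) (a b : LatticeV k) : valueAtZero r (eGen k m ⊗ₜ (a * b)) =
      valueAtZero r (eGen k m ⊗ₜ a) * valueAtZero r (eGen k m ⊗ₜ b) := by
  refine (hr.valueAtZero_mul_right hreg _ _ _ (grouplikeRepr (comul_eGen m))).trans ?_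
  exact Finset.sum_singleton _ _

/-- The Taylor coefficients of `σ = z f(w / z)` at `w = 0` are the values
`r(e^α ⊗ D^{(n)} e^α)(z, 0)`. -/
theorem IsSigma.valueAtZero_dividedPow (hσ : IsSigma v c σ) (hr : IsBicharacter σ r)
    (hreg : RegularAtZero r) (n : ℕ) :
    valueAtZero r (eGen k 1 ⊗ₜ dividedPow (latticeD k) n (eGen k 1)) =
      zMono k (1 - n) (PowerSeries.coeff n (fSeries c)) := by
  funext d
  ext m
  have h := congrArg (fun x => (HahnSeries.coeff x (n : ℤ)).coeff m)
    (hr.expand_eq hreg (eGen k 1) (eGen k 1) d)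
  simp only [HahnSeries.ofPowerSeries_apply_coeff, PowerSeries.coeff_mk] at h
  rw [hr.lattice] at h
  rw [← h, zMono_apply, HahnSeries.coeff_single]
  refine (hσ.expansion d m n).trans ?_
  simp only [Nat.cast_nonneg, true_and, Int.toNat_natCast]
  split_ifs <;> rfl

theorem IsSigma.valueAtZero_eGen_one (hσ : IsSigma v c σ) (hr : IsBicharacter σ r)
    (hreg : RegularAtZero r) : valueAtZero r (eGen k 1 ⊗ₜ eGen k 1) = zMono k 1 1 := by
  have h := hσ.valueAtZero_dividedPow hr hreg 0
  rwa [dividedPow_zero, coeff_zero_fSeries, Nat.cast_zero, sub_zero] at h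

omit [CharZero k] in
theorem isUnit_zMono (n : ℤ) : IsUnit (zMono k n (1 : MvPowerSeries τ k)) :=
  IsUnit.of_mul_eq_one (zMono k (-n) 1) (by
    rw [zMono_mul, add_neg_cancel, one_mul, zMono_zero_one])

/-- The functional `r(e^α ⊗ ·)(z, 0)` is multiplicative, so that the recursions for `D^{(n)} e^α`
and for the coefficients of `f` determine its values on the `h^{(n)}`. -/
theorem IsSigma.valueAtZero_eGen_hGen (hσ : IsSigma v c σ) (hr : IsBicharacter σ r)
    (hreg : RegularAtZero r) (n : ℕ) :
    valueAtZero r (eGen k 1 ⊗ₜ hGen k n) = zMono k (-n - 1) (-c n.succPNat) := by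
  refine congrFun (eq_of_sum_antidiagonal_eq
    (f := fun n => valueAtZero r (eGen k 1 ⊗ₜ dividedPow (latticeD k) n (eGen k 1)))
    (x := fun n => valueAtZero r (eGen k 1 ⊗ₜ hGen k n))
    (y := fun n : ℕ => zMono k (-n - 1) (-c n.succPNat)) ?_ fun n => ?_) n
  · simp only [dividedPow_zero]
    rw [hσ.valueAtZero_eGen_one hr hreg]
    exact isUnit_zMono 1
  · have h1 := congrArg (fun x => valueAtZero r (eGen k 1 ⊗ₜ[k] x))
      (dividedPow_eGen_succ (k := k) n)
    simp only [TensorProduct.tmul_smul, TensorProduct.tmul_sum, map_smul, map_sum,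
      hr.valueAtZero_eGen_mul hreg] at h1
    rw [← h1, hσ.valueAtZero_dividedPow hr hreg, ← map_smul, coeff_fSeries_succ, map_sum]
    refine Finset.sum_congr rfl fun p hp => ?_
    have hp := Finset.HasAntidiagonal.mem_antidiagonal.mp hp
    rw [hσ.valueAtZero_dividedPow hr hreg, zMono_mul]
    refine congrArg (fun i => zMono k i _) ?_
    rw [← hp]
    push_cast
    ring

theorem IsSigma.valueAtZero_eGen_eGen (hσ : IsSigma v c σ) (hr : IsBicharacter σ r)
    (hreg : RegularAtZero r) (m : ℤ) : valueAtZero r (eGen k 1 ⊗ₜ eGen k m) = zMono k m 1 := by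
  have hs : ∀ m : ℤ, valueAtZero r (eGen k 1 ⊗ₜ eGen k (m + 1)) =
      valueAtZero r (eGen k 1 ⊗ₜ eGen k m) * zMono k 1 1 := fun m => by
    rw [eGen_add, hr.valueAtZero_eGen_mul hreg, hσ.valueAtZero_eGen_one hr hreg]
  induction m using Int.induction_on with
  | zero =>
    rw [eGen_zero, hr.valueAtZero_one_right, counit_eGen, map_one, zMono_zero_one]
  | succ m ih => rw [hs, ih, zMono_mul, one_mul]
  | pred m ih =>
    refine (isUnit_zMono (k := k) (τ := τ) 1).mul_right_cancel ?_
    rw [← hs, sub_add_cancel, ih, zMono_mul, one_mul, sub_add_cancel]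

omit [CharZero k] in
/-- `∂_z r(e^α ⊗ b)(z, 0) = Σ r(h ⊗ b')(z, 0) r(e^α ⊗ b'')(z, 0)`, by which the values of
`r(h ⊗ b)(z, 0)` are obtained from those of `r(e^α ⊗ b)(z, 0)`. -/
theorem IsBicharacter.valueAtZero_latticeD_eGen (hr : IsBicharacter σ r) (hreg : RegularAtZero r)
    (b : LatticeV k) {ι : Type*} (R : Coalgebra.Repr k b ι) :
    tMap τ (hDeriv k k) (valueAtZero r (eGen k 1 ⊗ₜ b)) = ∑ i ∈ R.index,
      valueAtZero r (hGen k 0 ⊗ₜ R.left i) * valueAtZero r (eGen k 1 ⊗ₜ R.right i) := by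
  rw [← hr.valueAtZero_latticeD, latticeD_eGen, Int.cast_one, one_smul,
    hr.valueAtZero_mul_left hreg _ _ _ R]

theorem IsSigma.valueAtZero_hGen_hGen (hσ : IsSigma v c σ) (hr : IsBicharacter σ r)
    (hreg : RegularAtZero r) (n : ℕ) : valueAtZero r (hGen k 0 ⊗ₜ hGen k n) =
      zMono k (-n - 2) (((n : k) + 1) • c n.succPNat) := by
  have h := hr.valueAtZero_latticeD_eGen hreg _ (primitiveRepr (comul_hGen (k := k) n))
  rw [sum_primitiveRepr (comul_hGen (k := k) n) (fun x y =>
    valueAtZero r (hGen k 0 ⊗ₜ x) * valueAtZero r (eGen k 1 ⊗ₜ y)), hr.valueAtZero_one_right,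
    hr.valueAtZero_one_right, counit_eGen, counit_hGen, map_one, map_zero, mul_one, zero_mul,
    add_zero, hσ.valueAtZero_eGen_hGen hr hreg, tMap_hDeriv_zMono] at h
  rw [← h, smul_neg, ← neg_smul]
  congr 2
  · ring
  · push_cast; ring

theorem IsSigma.valueAtZero_hGen_eGen (hσ : IsSigma v c σ) (hr : IsBicharacter σ r)
    (hreg : RegularAtZero r) (m : ℤ) : valueAtZero r (hGen k 0 ⊗ₜ eGen k m) =
      zMono k (-1) ((m : k) • 1) := by
  have h := hr.valueAtZero_latticeD_eGen hreg _ (grouplikeRepr (comul_eGen (k := k) m))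
  replace h := h.trans (Finset.sum_singleton _ _)
  change _ = valueAtZero r (hGen k 0 ⊗ₜ eGen k m) * valueAtZero r (eGen k 1 ⊗ₜ eGen k m) at h
  rw [hσ.valueAtZero_eGen_eGen hr hreg, tMap_hDeriv_zMono] at h
  refine (isUnit_zMono (k := k) (τ := τ) m).mul_right_cancel ?_
  rw [← h, zMono_mul, mul_one, neg_add_eq_sub]

omit [CharZero k] in
theorem annihilationPart_hGen (a : LatticeV k) (n : ℕ) : annihilationPart r a (hGen k n) =
    constSeries k τ _ (hGen k n) * fieldFunctional r (a ⊗ₜ 1) +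
      fieldFunctional r (a ⊗ₜ hGen k n) := by
  rw [annihilationPart_apply r a _ (primitiveRepr (comul_hGen (k := k) n)),
    sum_primitiveRepr (comul_hGen (k := k) n) (fun x y => constSeries k τ _ x *
      fieldFunctional r (a ⊗ₜ y)), map_one, one_mul]

omit [CharZero k] in
theorem annihilationPart_eGen (a : LatticeV k) (m : ℤ) : annihilationPart r a (eGen k m) =
    constSeries k τ _ (eGen k m) * fieldFunctional r (a ⊗ₜ eGen k m) := by
  rw [annihilationPart_apply r a _ (grouplikeRepr (comul_eGen (k := k) m))]
  exact Finset.sum_singleton _ _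

theorem IsSigma.annihilationPart_eGen_hGen (hσ : IsSigma v c σ) (hr : IsBicharacter σ r)
    (hreg : RegularAtZero r) (n : ℕ) : annihilationPart r (eGen k 1) (hGen k n) =
      zMono k 0 (tC k τ _ (hGen k n)) +
        zMono k (-n - 1) (tMapAlg τ (Algebra.ofId k (LatticeV k)) (-c n.succPNat)) := by
  rw [annihilationPart_hGen, fieldFunctional_apply, fieldFunctional_apply,
    hr.valueAtZero_one_right, counit_eGen, map_one, map_one, mul_one,
    hσ.valueAtZero_eGen_hGen hr hreg, scalarSeries_zMono, constSeries_eq_zMono]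

theorem IsSigma.annihilationPart_eGen_eGen (hσ : IsSigma v c σ) (hr : IsBicharacter σ r)
    (hreg : RegularAtZero r) (m : ℤ) : annihilationPart r (eGen k 1) (eGen k m) =
      zMono k m (tC k τ _ (eGen k m)) := by
  rw [annihilationPart_eGen, fieldFunctional_apply, hσ.valueAtZero_eGen_eGen hr hreg,
    scalarSeries_zMono, constSeries_eq_zMono, zMono_mul, map_one, mul_one, zero_add]

omit [CharZero k] in
theorem IsBicharacter.annihilationPart_eGen_mul (hr : IsBicharacter σ r) (hreg : RegularAtZero r)
    (m : ℤ) (a b : LatticeV k) : annihilationPart r (eGen k m) (a * b) =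
      annihilationPart r (eGen k m) a * annihilationPart r (eGen k m) b := by
  rw [hr.annihilationPart_mul hreg _ _ _ (grouplikeRepr (comul_eGen (k := k) m))]
  exact Finset.sum_singleton _ _

theorem IsSigma.annihilationPart_hGen_hGen (hσ : IsSigma v c σ) (hr : IsBicharacter σ r)
    (hreg : RegularAtZero r) (n : ℕ) : annihilationPart r (hGen k 0) (hGen k n) =
      zMono k (-n - 2) (tMapAlg τ (Algebra.ofId k (LatticeV k))
        (((n : k) + 1) • c n.succPNat)) := by
  rw [annihilationPart_hGen, fieldFunctional_apply, fieldFunctional_apply,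
    hr.valueAtZero_one_right, counit_hGen, map_zero, map_zero, mul_zero, zero_add,
    hσ.valueAtZero_hGen_hGen hr hreg, scalarSeries_zMono]

theorem IsSigma.annihilationPart_hGen_eGen (hσ : IsSigma v c σ) (hr : IsBicharacter σ r)
    (hreg : RegularAtZero r) (m : ℤ) : annihilationPart r (hGen k 0) (eGen k m) =
      zMono k (-1) ((m : k) • tC k τ _ (eGen k m)) := by
  rw [annihilationPart_eGen, fieldFunctional_apply, hσ.valueAtZero_hGen_eGen hr hreg,
    scalarSeries_zMono, constSeries_eq_zMono, zMono_mul, map_smul, map_one, mul_smul_comm, mul_one,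
    zero_add]

omit [CharZero k] in
theorem IsBicharacter.annihilationPart_hGen_mul (hr : IsBicharacter σ r) (hreg : RegularAtZero r)
    (n : ℕ) (a b : LatticeV k) : annihilationPart r (hGen k n) (a * b) =
      annihilationPart r (hGen k n) a * zMono k 0 (tC k τ _ b) +
        annihilationPart r (hGen k n) b * zMono k 0 (tC k τ _ a) := by
  rw [hr.annihilationPart_mul hreg _ _ _ (primitiveRepr (comul_hGen (k := k) n)),
    sum_primitiveRepr (comul_hGen (k := k) n) (fun x y => annihilationPart r x a *
      annihilationPart r y b), hr.annihilationPart_one_left, hr.annihilationPart_one_left,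
    constSeries_eq_zMono, constSeries_eq_zMono, mul_comm (zMono k 0 _)]

end Values

/-! ### Comparison of the vertex operators -/

section SeriesCorrespondence

variable {k : Type*} [Field k] {τ : Type*} {F : Type*} [Field F] [Algebra k F]
  [Algebra (MvPowerSeries τ k) F] [IsScalarTower k (MvPowerSeries τ k) F] {v : ℕ+ → F}

theorem Corresponds.smul {x : MvPowerSeries τ (LatticeV k)} {y : SymFunLattice F}
    (h : Corresponds v x y) (a : k) : Corresponds v (a • x) (a • y) := by
  obtain ⟨u, rfl, rfl⟩ := h
  exact ⟨a • u, map_smul _ _ _, map_smul _ _ _⟩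

theorem Corresponds.neg {x : MvPowerSeries τ (LatticeV k)} {y : SymFunLattice F}
    (h : Corresponds v x y) : Corresponds v (-x) (-y) := by
  obtain ⟨u, rfl, rfl⟩ := h
  exact ⟨-u, map_neg _ _, map_neg _ _⟩

/-- The coefficients of `x ∈ V((z))[[t]]` and of `y ∈ (Λ_F ⊗ F[ℤα])((z))` correspond. -/
def SeriesCorresponds (v : ℕ+ → F) (x : MvPowerSeries τ (HahnSeries ℤ (LatticeV k)))
    (y : HahnSeries ℤ (SymFunLattice F)) : Prop :=
  ∀ m, Corresponds v (zCoeff m x) (y.coeff m)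

/-- Multiplication by `x` corresponds to multiplication by `y`.  This holds for corresponding
Laurent polynomials in `z`, but not for corresponding series, since the correspondence of
coefficients is not compatible with infinite sums. -/
def MulCorresponds (v : ℕ+ → F) (x : MvPowerSeries τ (HahnSeries ℤ (LatticeV k)))
    (y : HahnSeries ℤ (SymFunLattice F)) : Prop :=
  ∀ x' y', SeriesCorresponds v x' y' → SeriesCorresponds v (x' * x) (y' * y)

variable {x x' : MvPowerSeries τ (HahnSeries ℤ (LatticeV k))}
  {y y' : HahnSeries ℤ (SymFunLattice F)}

theorem MulCorresponds.mul (h : MulCorresponds v x y) (h' : MulCorresponds v x' y') :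
    MulCorresponds v (x * x') (y * y') := fun a b hab => by
  refine (congrArg₂ (SeriesCorresponds v) (mul_assoc a x x') (mul_assoc b y y')).mp ?_
  exact h' _ _ (h _ _ hab)

theorem coeff_mul_add {A : Type*} [CommRing A] (x y z : HahnSeries ℤ A) (m : ℤ) :
    (x * (y + z)).coeff m = (x * y).coeff m + (x * z).coeff m := by
  rw [mul_add, HahnSeries.coeff_add]

theorem MulCorresponds.add (h : MulCorresponds v x y) (h' : MulCorresponds v x' y') :
    MulCorresponds v (x + x') (y + y') := fun a b hab m => by
  refine (congrArg₂ (fun x y => Corresponds v (zCoeff m x) y)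
    (mul_add a x x') (coeff_mul_add b y y' m)).mpr ?_
  exact (h _ _ hab m).add (h' _ _ hab m)

theorem coeff_mul_single_sub {A : Type*} [CommRing A] (y : HahnSeries ℤ A) (n m : ℤ) (a : A) :
    (y * HahnSeries.single n a).coeff m = y.coeff (m - n) * a := by
  conv_lhs => rw [← sub_add_cancel m n]
  exact HahnSeries.coeff_mul_single_add

theorem mulCorresponds_zMono (n : ℤ) {w : MvPowerSeries τ (LatticeV k)} {w' : SymFunLattice F}
    (h : Corresponds v w w') : MulCorresponds v (zMono k n w) (HahnSeries.single n w') :=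
  fun a b hab m => by
    rw [zCoeff_mul_zMono, coeff_mul_single_sub]
    exact (hab (m - n)).mul h

end SeriesCorrespondence

theorem natCast_add_one_smul {F A : Type*} [Field F] [CommRing A] [Algebra F A] (n : ℕ) (x : A) :
    ((n : F) + 1) • x = ((n : A) + 1) * x := by
  rw [Algebra.smul_def, map_add, map_natCast, map_one]

theorem intCast_smul_eq {k F A : Type*} [Field k] [Field F] [AddCommGroup A] [Module k A]
    [Module F A] (n : ℤ) (x : A) : (n : k) • x = (n : F) • x := by
  rw [Int.cast_smul_eq_zsmul, Int.cast_smul_eq_zsmul]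

section CreationPart

variable {k : Type*} [Field k] [CharZero k] {τ : Type*} {F : Type*} [Field F] [CharZero F]
  [Algebra k F] {v : ℕ+ → F}

/-- The embedding identifies `e^{zD} e^α` with `exp (Σ_{n ≥ 1} h_{-n} z^n / n) e^α`. -/
theorem toSymFun_dividedPow_eGen (n : ℕ) :
    toSymFun k v (dividedPow (latticeD k) n (eGen k 1)) =
      PowerSeries.coeff n (creationSeries v) * (1 ⊗ₜ LaurentPolynomial.T 1) := by
  induction n using Nat.strong_induction_on with
  | _ n ih =>
    cases n with
    | zero => rw [dividedPow_zero, creationSeries_zero, one_mul, toSymFun_eGen]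
    | succ n =>
      refine smul_right_injective _ (Nat.cast_add_one_ne_zero (R := F) n) ?_
      have h := dividedPow_eGen_succ (k := k) n
      rw [Algebra.smul_def, map_add, map_natCast, map_one] at h
      replace h := congrArg (toSymFun k v) h
      rw [map_mul, map_sum, map_add, map_natCast, map_one] at h
      refine (natCast_add_one_smul (F := F) (A := SymFunLattice F) n _).trans ?_
      change _ = ((n : F) + 1) • _
      rw [h, ← smul_mul_assoc, creationSeries_succ, Finset.sum_mul]
      refine Finset.sum_congr rfl fun p hp => ?_
      have hp := Finset.HasAntidiagonal.mem_antidiagonal.mp hp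
      rw [map_mul, ih p.1 (by omega), toSymFun_hGen, mul_right_comm]

variable [Algebra (MvPowerSeries τ k) F] [IsScalarTower k (MvPowerSeries τ k) F]

/-- The creation parts of `Y(e^α, z)` and of `Ψ(z)` correspond. -/
theorem seriesCorresponds_expD : SeriesCorresponds v (tC k τ _ (expD k (eGen k 1)))
    (HahnSeries.ofPowerSeries ℤ _ (creationSeries v) *
      hC F (SymFunLattice F) (1 ⊗ₜ LaurentPolynomial.T 1)) := by
  intro m
  rw [zCoeff_tC_expD, hC_apply, coeff_mul_single_sub, sub_zero]
  by_cases hm : 0 ≤ m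
  · lift m to ℕ using hm
    rw [coeff_expD, HahnSeries.ofPowerSeries_apply_coeff, ← toSymFun_dividedPow_eGen (k := k)]
    exact corresponds_tC _
  · rw [coeff_expD_of_neg _ (not_le.mp hm), coeff_ofPowerSeries_of_neg _ (not_le.mp hm), map_zero,
      zero_mul]
    exact corresponds_zero

end CreationPart

section Fields

variable {k : Type*} [Field k] [CharZero k] {τ : Type*} {F : Type*} [Field F]
  [Algebra k F] [Algebra (MvPowerSeries τ k) F] [IsScalarTower k (MvPowerSeries τ k) F]
  {v : ℕ+ → F} {c : ℕ+ → MvPowerSeries τ k} {σ : MvPowerSeries τ (KRing k (Fin 2))}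
  {r : LatticeV k ⊗[k] LatticeV k →ₗ[k] MvPowerSeries τ (KRing k (Fin 2))}

omit [CharZero k] in
theorem IsSigma.corresponds_scalar (hσ : IsSigma v c σ) (n : ℕ+) :
    Corresponds v (tMapAlg τ (Algebra.ofId k (LatticeV k)) (c n))
      (algebraMap F (SymFunLattice F) (v n)⁻¹) := by
  rw [hσ.v_inv]
  exact HDQVA.corresponds_scalar _

/-- The annihilation part of `Y(e^α, z)` corresponds to
`exp (- Σ_{n ≥ 1} h_n z^{-n} / n) z^{∂_α}`: both are multiplicative, and they agree on
generators. -/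
theorem IsSigma.mulCorresponds_annihilationPart (hσ : IsSigma v c σ) (hr : IsBicharacter σ r)
    (hreg : RegularAtZero r) (b : LatticeV k) :
    MulCorresponds v (annihilationPart r (eGen k 1) b) (vertexShift F (toSymFun k v b)) := by
  induction b using lattice_induction with
  | hh n =>
    rw [hσ.annihilationPart_eGen_hGen hr hreg, toSymFun_hGen, vertexShift_creationElt]
    refine (congrArg (MulCorresponds v _) (sub_eq_add_neg _ _)).mpr ?_
    refine MulCorresponds.add (mulCorresponds_zMono 0 ?_) ?_
    · rw [← toSymFun_hGen (k := k)]
      exact corresponds_tC _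
    · rw [← HahnSeries.single_neg, map_neg]
      have := mulCorresponds_zMono (v := v) (-(n : ℤ) - 1) (hσ.corresponds_scalar n.succPNat).neg
      have h1 : (-(n : ℤ) - 1) = -((n.succPNat : ℕ) : ℤ) := by
        rw [Nat.succPNat_coe]; push_cast; ring
      rw [h1] at this ⊢
      exact this
  | he m =>
    rw [hσ.annihilationPart_eGen_eGen hr hreg, toSymFun_eGen, vertexShift_T]
    refine mulCorresponds_zMono m ?_
    rw [← toSymFun_eGen (k := k) (v := v)]
    exact corresponds_tC _
  | algebraMap a =>
    have h1 : annihilationPart r (eGen k 1) (algebraMap k _ a) =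
        zMono k 0 (tC k τ _ (algebraMap k _ a)) := by
      rw [← constSeries_eq_zMono, AlgHom.commutes, Algebra.algebraMap_eq_smul_one, map_smul,
        hr.annihilationPart_one_right, counit_eGen, map_one, Algebra.algebraMap_eq_smul_one]
    have h2 : vertexShift F (toSymFun k v (algebraMap k _ a)) =
        HahnSeries.single 0 (toSymFun k v (algebraMap k _ a)) := by
      rw [AlgHom.commutes, IsScalarTower.algebraMap_apply k F (SymFunLattice F)]
      exact ((vertexShift F).commutes _).trans ((hC F (SymFunLattice F)).commutes _).symm
    rw [h1, h2]
    exact mulCorresponds_zMono 0 (corresponds_tC _)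
  | add a b ha hb =>
    rw [map_add, map_add]
    exact (congrArg (MulCorresponds v _) (map_add (vertexShift F) _ _)).mpr (ha.add hb)
  | mul a b ha hb =>
    rw [hr.annihilationPart_eGen_mul hreg, map_mul]
    exact (congrArg (MulCorresponds v _) (map_mul (vertexShift F) _ _)).mpr (ha.mul hb)

/-- `Y(e^α, z) = Ψ(z)`. -/
theorem IsSigma.corresponds_psiCoeff [CharZero F] (hσ : IsSigma v c σ) (hr : IsBicharacter σ r)
    (hreg : RegularAtZero r) (m : ℤ) (b : LatticeV k) :
    Corresponds v (zCoeff m (bicharY r (eGen k 1) b))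
      (psiCoeff v (perpOp v) m (toSymFun k v b)) := by
  rw [psiCoeff_eq v hσ.v_ne_zero, bicharY_apply r _ _ (grouplikeRepr (comul_eGen (k := k) 1))]
  -- `Y(e^α, z) b = (e^{zD} e^α) X(e^α, z) b`, since `e^α` is grouplike
  have h := hσ.mulCorresponds_annihilationPart hr hreg b _ _ seriesCorresponds_expD m
  refine (congrArg₂ (fun x y => Corresponds v (zCoeff m x) (HahnSeries.coeff y m)) ?_
    (mul_assoc _ _ _)).mp h
  exact (Finset.sum_singleton _ _).symm

omit [CharZero k] in
/-- The annihilation part of `Y(h, z)` and the operators `h_n`, `n ≥ 0`, are derivations which agree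
on generators. -/
theorem corresponds_mode_of_leibniz (hr : IsBicharacter σ r) (hreg : RegularAtZero r)
    (m : ℤ) (δ : SymFunLattice F →ₗ[F] SymFunLattice F)
    (hδ : ∀ x y, δ (x * y) = x * δ y + δ x * y)
    (hh : ∀ n, Corresponds v (zCoeff m (annihilationPart r (hGen k 0) (hGen k n)))
      (δ (toSymFun k v (hGen k n))))
    (he : ∀ n, Corresponds v (zCoeff m (annihilationPart r (hGen k 0) (eGen k n)))
      (δ (toSymFun k v (eGen k n)))) (b : LatticeV k) :
    Corresponds v (zCoeff m (annihilationPart r (hGen k 0) b)) (δ (toSymFun k v b)) := by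
  induction b using lattice_induction with
  | hh n => exact hh n
  | he n => exact he n
  | algebraMap a =>
    have h0 : δ 1 = 0 := by
      have := hδ 1 1
      rw [mul_one, one_mul, mul_one] at this
      exact left_eq_add.mp this
    have h1 : annihilationPart r (hGen k 0) (algebraMap k _ a) = 0 := by
      rw [Algebra.algebraMap_eq_smul_one, map_smul, hr.annihilationPart_one_right, counit_hGen,
        map_zero, smul_zero]
    have h2 : δ (toSymFun k v (algebraMap k _ a)) = 0 := by
      rw [AlgHom.commutes, IsScalarTower.algebraMap_apply k F (SymFunLattice F),
        Algebra.algebraMap_eq_smul_one, map_smul, h0, smul_zero]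
    rw [h1, h2]
    exact corresponds_zero
  | add a b ha hb =>
    rw [map_add, map_add, map_add]
    exact ha.add hb
  | mul a b ha hb =>
    rw [hr.annihilationPart_hGen_mul hreg, map_mul, hδ, add_comm (toSymFun k v a * _),
      mul_comm (toSymFun k v a)]
    have h := (ha.mul (corresponds_tC b)).add (hb.mul (corresponds_tC a))
    refine (congrArg (fun x => Corresponds v x _) ?_).mp h
    conv_lhs => rw [← sub_zero m]
    exact congrArg₂ (· + ·) (zCoeff_mul_zMono (k := k) 0 m _ _).symm
      (zCoeff_mul_zMono (k := k) 0 m _ _).symm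

omit [CharZero k] in
theorem IsBicharacter.bicharY_hGen_zero (hr : IsBicharacter σ r) (m : ℤ) (b : LatticeV k) :
    zCoeff m (bicharY r (hGen k 0) b) = tC k τ _ ((expD k (hGen k 0)).coeff m * b) +
      zCoeff m (annihilationPart r (hGen k 0) b) := by
  rw [bicharY_apply r _ _ (primitiveRepr (comul_hGen (k := k) 0)),
    sum_primitiveRepr (comul_hGen (k := k) 0) (fun x y => tC k τ _ (expD k x) *
      annihilationPart r y b), hr.annihilationPart_one_left, expD_one, constSeries_eq_zMono,
    ← tCAlg_apply (k := k) (τ := τ) (1 : HahnSeries ℤ (LatticeV k)), map_one, one_mul]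
  refine (congrArg (· + zCoeff m (annihilationPart r (hGen k 0) b))
    (zCoeff_mul_zMono (k := k) 0 m _ _)).trans ?_
  rw [sub_zero, zCoeff_tC_expD]
  exact congrArg (· + _) (map_mul (tCAlg k τ (LatticeV k)) _ _).symm

/-- The coefficients of `Y(Dα, z) = Σ h_n z^{-n-1}` are the operators `h_n`. -/
theorem IsSigma.corresponds_heis [CharZero F] (hσ : IsSigma v c σ) (hr : IsBicharacter σ r)
    (hreg : RegularAtZero r) (n : ℤ) (b : LatticeV k) :
    Corresponds v (zCoeff (-n - 1) (bicharY r (hGen k 0) b))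
      (heis v (perpOp v) n (toSymFun k v b)) := by
  rw [hr.bicharY_hGen_zero]
  obtain ((_ | n) | n) := n
  · rw [coeff_expD_of_neg _ (by simp), zero_mul, map_zero, zero_add]
    refine corresponds_mode_of_leibniz hr hreg _ _ (heis_leibniz_zero v _) (fun j => ?_)
      (fun j => ?_) b
    · rw [hσ.annihilationPart_hGen_hGen hr hreg, zCoeff_zMono, if_neg (by simp; omega),
        toSymFun_hGen]
      exact (congrArg (Corresponds v 0) (heis_zero_creationElt v _ _)).mpr corresponds_zero
    · rw [hσ.annihilationPart_hGen_eGen hr hreg, zCoeff_zMono, if_pos (by simp), toSymFun_eGen]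
      refine (congrArg (Corresponds v _) (heis_zero_T v _ _)).mpr ?_
      have h := (corresponds_tC (τ := τ) (v := v) (eGen k j)).smul (j : k)
      rw [toSymFun_eGen] at h
      refine (congrArg (Corresponds v _) ?_).mp h
      exact intCast_smul_eq (k := k) (F := F) (A := SymFunLattice F) _ _
  · rw [coeff_expD_of_neg _ (by simp; omega), zero_mul, map_zero, zero_add]
    refine corresponds_mode_of_leibniz hr hreg _ _ (heis_leibniz_pos v hσ.v_ne_zero n) (fun j => ?_)
      (fun j => ?_) b
    · rw [hσ.annihilationPart_hGen_hGen hr hreg, zCoeff_zMono, toSymFun_hGen]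
      refine (congrArg (Corresponds v _) (heis_pos_creationElt v hσ.v_ne_zero _ _)).mpr ?_
      by_cases h : j = n
      · subst h
        rw [if_pos (by simp; ring), if_pos (by simp)]
        have h := HDQVA.corresponds_scalar (v := v) (((j : k) + 1) • c j.succPNat)
        refine (congrArg (Corresponds v _) (congrArg (algebraMap F _) ?_)).mp h
        rw [hσ.v_inv, Algebra.smul_def, map_mul, map_add, map_add, map_natCast, map_natCast,
          map_one, map_one]
      · rw [if_neg (by simp; omega), if_neg (by simp; omega)]
        exact corresponds_zero
    · rw [hσ.annihilationPart_hGen_eGen hr hreg, zCoeff_zMono, if_neg (by simp; omega),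
        toSymFun_eGen]
      exact (congrArg (Corresponds v 0) (heis_pos_T v hσ.v_ne_zero _ _)).mpr corresponds_zero
  · have hm : -Int.negSucc n - 1 = (n : ℤ) := by omega
    rw [hm, heis_negSucc, coeff_expD, dividedPow_hGen_zero]
    have h0 : Corresponds v (zCoeff (n : ℤ) (annihilationPart r (hGen k 0) b)) 0 := by
      refine corresponds_mode_of_leibniz hr hreg _ (0 : SymFunLattice F →ₗ[F] SymFunLattice F)
        (fun x y => ?_) (fun j => ?_) (fun j => ?_) b
      · simp
      · rw [hσ.annihilationPart_hGen_hGen hr hreg, zCoeff_zMono, if_neg (by omega)]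
        exact corresponds_zero
      · rw [hσ.annihilationPart_hGen_eGen hr hreg, zCoeff_zMono, if_neg (by omega)]
        exact corresponds_zero
    have h := (corresponds_tC (τ := τ) (v := v) (hGen k n * b)).add h0
    rw [add_zero, map_mul (toSymFun k v), toSymFun_hGen] at h
    exact h

end Fields

/-! ### Families `(v_n)` close to `1` -/

section LinearODE

/-- A linear differential equation of order one has at most one power series solution with a given
constant term. -/
theorem eq_of_derivative_eq_mul (S : Type*) {A : Type*} [Field S] [CharZero S] [CommRing A]
    [Algebra S A] {F G H : PowerSeries A}
    (h0 : PowerSeries.coeff 0 F = PowerSeries.coeff 0 G)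
    (hF : PowerSeries.derivative A F = F * H) (hG : PowerSeries.derivative A G = G * H) :
    F = G := by
  ext n
  induction n using Nat.strong_induction_on with
  | _ n ih =>
    cases n with
    | zero => exact h0
    | succ n =>
      have h : PowerSeries.coeff n (F * H) = PowerSeries.coeff n (G * H) := by
        rw [PowerSeries.coeff_mul, PowerSeries.coeff_mul]
        refine Finset.sum_congr rfl fun p hp => ?_
        have hp := Finset.HasAntidiagonal.mem_antidiagonal.mp hp
        rw [ih p.1 (by omega)]
      rw [← hF, ← hG, PowerSeries.coeff_derivative, PowerSeries.coeff_derivative] at h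
      have hu : IsUnit ((n : A) + 1) := by
        have := (IsUnit.mk0 ((n : S) + 1) (Nat.cast_add_one_ne_zero n)).map (algebraMap S A)
        rwa [map_add, map_natCast, map_one] at this
      exact hu.mul_right_cancel h

variable {S A : Type*} [Field S] [CharZero S] [CommRing A] [Algebra S A]

theorem derivative_expSeries {G : PowerSeries A} (h0 : PowerSeries.coeff 0 G = 0) :
    PowerSeries.derivative A (expSeries S G) = expSeries S G * PowerSeries.derivative A G := by
  ext n
  rw [PowerSeries.coeff_derivative, mul_comm, ← natCast_add_one_smul (F := S),
    coeff_expSeries_succ h0 (fun _ _ => Commute.all _ _), PowerSeries.coeff_mul]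
  refine Finset.sum_congr rfl fun p _ => ?_
  rw [PowerSeries.coeff_derivative, natCast_add_one_smul, mul_comm (_ + 1)]

/-- `exp G` and `exp (-G)` are inverse to each other: their product satisfies the same differential
equation as `1`. -/
theorem expSeries_mul_expSeries_neg {G : PowerSeries A} (h0 : PowerSeries.coeff 0 G = 0) :
    expSeries S G * expSeries S (-G) = 1 := by
  have h0' : PowerSeries.coeff 0 (-G) = 0 := by rw [map_neg, h0, neg_zero]
  refine eq_of_derivative_eq_mul S (H := 0) ?_ ?_ ?_
  · rw [PowerSeries.coeff_mul, Finset.Nat.antidiagonal_zero, Finset.sum_singleton,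
      coeff_zero_expSeries, coeff_zero_expSeries, PowerSeries.coeff_zero_one, mul_one]
  · rw [Derivation.leibniz, derivative_expSeries h0, derivative_expSeries h0', map_neg, smul_eq_mul,
      smul_eq_mul]
    ring
  · rw [Derivation.map_one_eq_zero, mul_zero]

/-- `exp (- Σ c_n x^n / n) = (1 - x) exp (- Σ (c_n - 1) x^n / n)`. -/
theorem expSeries_eq_one_sub_X_mul {G G' : PowerSeries A} (h0 : PowerSeries.coeff 0 G = 0)
    (h0' : PowerSeries.coeff 0 G' = 0)
    (h : ∀ n : ℕ, PowerSeries.coeff (n + 1) G' * ((n : A) + 1) =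
      PowerSeries.coeff (n + 1) G * ((n : A) + 1) + 1) :
    expSeries S G = (1 - PowerSeries.X) * expSeries S G' := by
  have h1 : PowerSeries.derivative A G' = PowerSeries.derivative A G + PowerSeries.mk 1 := by
    ext n
    rw [map_add, PowerSeries.coeff_derivative, PowerSeries.coeff_derivative, h,
      PowerSeries.coeff_mk]
    rfl
  refine eq_of_derivative_eq_mul S ?_ (derivative_expSeries h0) ?_
  · rw [PowerSeries.coeff_mul, Finset.Nat.antidiagonal_zero, Finset.sum_singleton,
      coeff_zero_expSeries, coeff_zero_expSeries]
    simp
  · rw [Derivation.leibniz, derivative_expSeries h0', h1, map_sub, Derivation.map_one_eq_zero,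
      PowerSeries.derivative_X, smul_eq_mul, smul_eq_mul]
    have h2 := PowerSeries.mk_one_mul_one_sub_eq_one A
    linear_combination expSeries S G' * h2

end LinearODE

section OrderFiltration

variable {k : Type*} [Field k] {τ : Type*}

/-- The series `Σ F_n x^n ∈ k[[t]][[x]]` for which `F_n` has order at least `n` in `t`, so that the
coefficient of `t^d` is a polynomial in `x` of degree at most `|d|`. -/
def orderFiltered (k τ : Type*) [Field k] : Subalgebra k (PowerSeries (MvPowerSeries τ k)) where
  carrier := {F | ∀ (n : ℕ) (d : τ →₀ ℕ), d.degree < n →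
    MvPowerSeries.coeff d (PowerSeries.coeff n F) = 0}
  mul_mem' := by
    classical
    intro F G hF hG n d hd
    rw [PowerSeries.coeff_mul, map_sum]
    refine Finset.sum_eq_zero fun p hp => ?_
    rw [MvPowerSeries.coeff_mul]
    refine Finset.sum_eq_zero fun q hq => ?_
    have hp := Finset.HasAntidiagonal.mem_antidiagonal.mp hp
    have hq := congrArg Finsupp.degree (Finset.HasAntidiagonal.mem_antidiagonal.mp hq)
    rw [map_add] at hq
    by_cases h : q.1.degree < p.1
    · rw [hF _ _ h, zero_mul]
    · rw [hG _ _ (by omega), mul_zero]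
  add_mem' := by
    intro F G hF hG n d hd
    rw [map_add, map_add, hF n d hd, hG n d hd, add_zero]
  algebraMap_mem' := by
    intro c n d hd
    rw [IsScalarTower.algebraMap_apply k (MvPowerSeries τ k) (PowerSeries (MvPowerSeries τ k)),
      PowerSeries.algebraMap_apply, Algebra.algebraMap_self_apply, PowerSeries.coeff_C,
      if_neg (by omega), map_zero]

theorem expSeries_mem_orderFiltered {G : PowerSeries (MvPowerSeries τ k)}
    (hG : G ∈ orderFiltered k τ) : expSeries k G ∈ orderFiltered k τ := by
  intro n d hd
  rw [expSeries, PowerSeries.coeff_mk, map_sum]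
  refine Finset.sum_eq_zero fun j _ => ?_
  rw [map_smul, pow_mem hG j n d hd, smul_zero]

/-- The coefficient of `t^d` in `F`, truncated after `x^{|d| + 1}`. -/
def polyCoeff (F : PowerSeries (MvPowerSeries τ k)) (d : τ →₀ ℕ) : Polynomial k :=
  PowerSeries.trunc (d.degree + 2)
    (PowerSeries.mk fun n => MvPowerSeries.coeff d (PowerSeries.coeff n F))

/-- The coefficient of `t^d` in `F` is a polynomial in `x` of degree at most `|d| + 1`. -/
def HasPolyCoeff (F : PowerSeries (MvPowerSeries τ k)) : Prop :=
  ∀ (n : ℕ) (d : τ →₀ ℕ), d.degree + 1 < n →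
    MvPowerSeries.coeff d (PowerSeries.coeff n F) = 0

theorem HasPolyCoeff.coeff_polyCoeff {F : PowerSeries (MvPowerSeries τ k)} (hF : HasPolyCoeff F)
    (d : τ →₀ ℕ) (n : ℕ) :
    (polyCoeff F d).coeff n = MvPowerSeries.coeff d (PowerSeries.coeff n F) := by
  rw [polyCoeff, PowerSeries.coeff_trunc, PowerSeries.coeff_mk]
  split_ifs with h
  · rfl
  · exact (hF n d (by omega)).symm

theorem hasPolyCoeff_of_mem {F : PowerSeries (MvPowerSeries τ k)} (hF : F ∈ orderFiltered k τ) :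
    HasPolyCoeff F := fun n d h => hF n d (by omega)

theorem hasPolyCoeff_one_sub_X_mul {F : PowerSeries (MvPowerSeries τ k)}
    (hF : F ∈ orderFiltered k τ) : HasPolyCoeff ((1 - PowerSeries.X) * F) := by
  intro n d h
  obtain _ | n := n
  · omega
  · rw [sub_mul, one_mul, map_sub, PowerSeries.coeff_succ_X_mul, map_sub, hF _ _ (by omega),
      hF _ _ (by omega), sub_zero]

theorem polyCoeff_mul {F G : PowerSeries (MvPowerSeries τ k)} (hF : HasPolyCoeff F)
    (hG : HasPolyCoeff G) (hFG : HasPolyCoeff (F * G)) (d : τ →₀ ℕ) :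
    letI := Classical.decEq τ
    polyCoeff (F * G) d = ∑ p ∈ Finset.HasAntidiagonal.antidiagonal d,
      polyCoeff F p.1 * polyCoeff G p.2 := by
  classical
  ext n
  rw [hFG.coeff_polyCoeff, Polynomial.finsetSum_coeff, PowerSeries.coeff_mul, map_sum]
  simp only [Polynomial.coeff_mul, hF.coeff_polyCoeff, hG.coeff_polyCoeff, MvPowerSeries.coeff_mul]
  rw [Finset.sum_comm]

end OrderFiltration

section Ratio

variable {k : Type*} [Field k] {τ : Type*}

/-- The function `w / z`. -/
def KRing.ratio (k : Type*) [Field k] : KRing k (Fin 2) :=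
  (KRing.var k 1 : KRing k (Fin 2)) *
    ((KRing.isUnit_var (k := k) (0 : Fin 2)).unit⁻¹ : (KRing k (Fin 2))ˣ)

theorem KRing.var_mul_ratio : KRing.var k 0 * KRing.ratio k = KRing.var k 1 := by
  rw [KRing.ratio, mul_left_comm, IsUnit.mul_val_inv, mul_one]

theorem expand_ratio :
    expand k (KRing.ratio k) = HahnSeries.single 1 (HahnSeries.single (-1) 1) := by
  have h := congrArg (expand k) (KRing.var_mul_ratio (k := k))
  rw [map_mul, expand_var_zero, expand_var_one] at h
  have hu : IsUnit (HahnSeries.single 0 (HahnSeries.single 1 1) :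
      LaurentSeries (LaurentSeries k)) := by
    rw [← expand_var_zero]
    exact (KRing.isUnit_var 0).map _
  refine hu.mul_left_cancel (h.trans ?_)
  rw [HahnSeries.single_mul_single, HahnSeries.single_mul_single, zero_add, mul_one, add_neg_cancel]
  rfl

theorem coeff_expand_aeval_ratio (P : Polynomial k) (n m : ℤ) :
    ((expand k (Polynomial.aeval (KRing.ratio k) P)).coeff n).coeff m =
      if 0 ≤ n ∧ m = -n then P.coeff n.toNat else 0 := by
  classical
  induction P using Polynomial.induction_on' with
  | add P Q hP hQ =>
    rw [map_add, map_add]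
    refine (congrArg₂ (· + ·) hP hQ).trans ?_
    rw [Polynomial.coeff_add]
    split_ifs
    · rfl
    · exact add_zero _
  | monomial j a =>
    rw [Polynomial.aeval_monomial, map_mul, map_pow, expand_ratio, HahnSeries.single_pow,
      HahnSeries.single_pow, AlgHom.commutes, ← Algebra.smul_def, Polynomial.coeff_monomial]
    change a • ((HahnSeries.single (j • (1 : ℤ)) (HahnSeries.single (j • (-1 : ℤ))
      ((1 : k) ^ j))).coeff n).coeff m = _
    rw [HahnSeries.coeff_single, one_pow]
    by_cases hn : n = j
    · subst hn
      simp [HahnSeries.coeff_single]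
    · rw [if_neg (by simpa using hn), HahnSeries.coeff_zero, smul_zero]
      split_ifs <;> first | rfl | omega

/-- The function `F(w / z)` of `z` and `w`. -/
def ratioFunction (F : PowerSeries (MvPowerSeries τ k)) : MvPowerSeries τ (KRing k (Fin 2)) :=
  fun d => Polynomial.aeval (KRing.ratio k) (polyCoeff F d)

theorem ratioFunction_mul {F G : PowerSeries (MvPowerSeries τ k)} (hF : HasPolyCoeff F)
    (hG : HasPolyCoeff G) (hFG : HasPolyCoeff (F * G)) :
    ratioFunction (F * G) = ratioFunction F * ratioFunction G := by
  classical
  funext d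
  rw [mul_apply_antidiagonal, ratioFunction, polyCoeff_mul hF hG hFG, map_sum]
  exact Finset.sum_congr (by congr!) fun p _ => map_mul _ _ _

theorem hasPolyCoeff_of_const {F : PowerSeries (MvPowerSeries τ k)} {P : Polynomial k}
    (hP : P.natDegree ≤ 1) (h : ∀ n, PowerSeries.coeff n F = MvPowerSeries.C (P.coeff n)) :
    HasPolyCoeff F := fun n d hd => by
  rw [h, Polynomial.coeff_eq_zero_of_natDegree_lt (by omega), map_zero, map_zero]

theorem ratioFunction_of_const {F : PowerSeries (MvPowerSeries τ k)} {P : Polynomial k}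
    (hP : P.natDegree ≤ 1) (h : ∀ n, PowerSeries.coeff n F = MvPowerSeries.C (P.coeff n)) :
    ratioFunction F = tC k τ _ (Polynomial.aeval (KRing.ratio k) P) := by
  classical
  funext d
  have h1 : polyCoeff F d = if d = 0 then P else 0 := by
    ext n
    rw [(hasPolyCoeff_of_const hP h).coeff_polyCoeff, h, MvPowerSeries.coeff_C]
    split_ifs <;> rfl
  rw [ratioFunction, h1, tC_apply]
  split_ifs
  · rfl
  · exact map_zero _

theorem ratioFunction_one :
    ratioFunction (1 : PowerSeries (MvPowerSeries τ k)) = tC k τ _ 1 := by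
  refine (ratioFunction_of_const (P := 1) (by simp) fun n => ?_).trans (by rw [map_one])
  rw [PowerSeries.coeff_one, Polynomial.coeff_one]
  split_ifs
  · rw [map_one]
  · rw [map_zero]

theorem coeff_one_sub_X (n : ℕ) :
    PowerSeries.coeff n (1 - PowerSeries.X : PowerSeries (MvPowerSeries τ k)) =
      MvPowerSeries.C ((1 - Polynomial.X : Polynomial k).coeff n) := by
  rw [map_sub, Polynomial.coeff_sub, map_sub, PowerSeries.coeff_one, Polynomial.coeff_one,
    PowerSeries.coeff_X, Polynomial.coeff_X]
  simp only [apply_ite (MvPowerSeries.C (σ := τ) (R := k)), map_one, map_zero, eq_comm (a := n)]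

theorem natDegree_one_sub_X_le : (1 - Polynomial.X : Polynomial k).natDegree ≤ 1 :=
  (Polynomial.natDegree_sub_le _ _).trans (by simp)

theorem ratioFunction_one_sub_X :
    ratioFunction (1 - PowerSeries.X : PowerSeries (MvPowerSeries τ k)) =
      tC k τ _ (1 - KRing.ratio k) := by
  refine (ratioFunction_of_const natDegree_one_sub_X_le coeff_one_sub_X).trans ?_
  rw [map_sub, map_one, Polynomial.aeval_X]

end Ratio

section Sigma

variable {k : Type*} [Field k] [CharZero k] {τ : Type*}

/-- The logarithm `- Σ_{n ≥ 1} c_n x^n / n` of `f`. -/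
def logSeries (c : ℕ+ → MvPowerSeries τ k) : PowerSeries (MvPowerSeries τ k) :=
  PowerSeries.mk fun n => if h : 0 < n then -((n : k)⁻¹ • c ⟨n, h⟩) else 0

omit [CharZero k] in
theorem coeff_zero_logSeries (c : ℕ+ → MvPowerSeries τ k) :
    PowerSeries.coeff 0 (logSeries c) = 0 := by simp [logSeries]

theorem coeff_logSeries_succ_mul (c : ℕ+ → MvPowerSeries τ k) (n : ℕ) :
    PowerSeries.coeff (n + 1) (logSeries c) * ((n : MvPowerSeries τ k) + 1) = -c n.succPNat := by
  rw [logSeries, PowerSeries.coeff_mk, dif_pos (Nat.succ_pos n), mul_comm,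
    ← natCast_add_one_smul (F := k), smul_neg, smul_smul, Nat.cast_succ,
    mul_inv_cancel₀ (Nat.cast_add_one_ne_zero _), one_smul]
  rfl

/-- If `c_n - 1` has order at least `n` in `t`, then `f(x) = (1 - x) g(x)`, where the
`t`-coefficients of `g` and of `g⁻¹` are polynomials in `x`. -/
theorem exists_fSeries_eq {c : ℕ+ → MvPowerSeries τ k}
    (hc : ∀ (n : ℕ+) (d : τ →₀ ℕ), d.degree < n → MvPowerSeries.coeff d (c n - 1) = 0) :
    ∃ g ∈ orderFiltered k τ, ∃ g' ∈ orderFiltered k τ, g' * g = 1 ∧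
      fSeries c = (1 - PowerSeries.X) * g := by
  -- `g = exp (- Σ (c_n - 1) x^n / n)`, as `exp (- Σ x^n / n) = 1 - x`
  have hmem : logSeries (fun n => c n - 1) ∈ orderFiltered k τ := by
    intro n d hd
    rw [logSeries, PowerSeries.coeff_mk]
    split_ifs with h
    · rw [map_neg, map_smul, hc ⟨n, h⟩ d hd, smul_zero, neg_zero]
    · exact map_zero _
  refine ⟨_, expSeries_mem_orderFiltered hmem, _,
    expSeries_mem_orderFiltered (neg_mem hmem), ?_, ?_⟩
  · exact (mul_comm _ _).trans (expSeries_mul_expSeries_neg (S := k) (A := MvPowerSeries τ k)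
      (coeff_zero_logSeries _))
  · refine expSeries_eq_one_sub_X_mul (coeff_zero_logSeries c) (coeff_zero_logSeries _) fun n => ?_
    rw [coeff_logSeries_succ_mul]
    refine Eq.trans ?_ (congrArg (· + 1) (coeff_logSeries_succ_mul c n).symm)
    ring

omit [CharZero k] in
/-- The coefficients of `F(w / z)` are polynomials in `w / z`, hence have no poles at `z = w`. -/
theorem ratioFunction_mem_boundedDiagonalPoles (G : PowerSeries (MvPowerSeries τ k)) :
    ratioFunction G ∈ boundedDiagonalPoles k τ := by
  refine ⟨0, fun d => ?_⟩
  rw [pow_zero, one_mul, ratioFunction]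
  have h : KRing.ratio k ∈ noDiagonalPole k :=
    mul_mem var_one_mem_noDiagonalPole (inv_var_zero_mem_noDiagonalPole (IsUnit.mul_val_inv _))
  exact Algebra.adjoin_le (Set.singleton_subset_iff.mpr h)
    (Polynomial.aeval_mem_adjoin_singleton _ _)

omit [CharZero k] in
theorem tC_mem_boundedDiagonalPoles {x : KRing k (Fin 2)} {N : ℕ}
    (hx : (KRing.var k 0 - KRing.var k 1) ^ N * x ∈ noDiagonalPole k) :
    tC k τ (KRing k (Fin 2)) x ∈ boundedDiagonalPoles k τ := by
  classical
  refine ⟨N, fun d => ?_⟩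
  rw [tC_apply]
  split_ifs
  · exact hx
  · rw [mul_zero]; exact zero_mem _

omit [CharZero k] in
theorem tC_mul_tC (x y : KRing k (Fin 2)) :
    tC k τ (KRing k (Fin 2)) x * tC k τ (KRing k (Fin 2)) y =
      tC k τ (KRing k (Fin 2)) (x * y) :=
  (map_mul (tCAlg k τ (KRing k (Fin 2))) x y).symm

omit [CharZero k] in
theorem tC_var_zero_mul_ratioFunction {g : PowerSeries (MvPowerSeries τ k)}
    (hg : g ∈ orderFiltered k τ) :
    tC k τ (KRing k (Fin 2)) (KRing.var k 0) * ratioFunction ((1 - PowerSeries.X) * g) =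
      tC k τ (KRing k (Fin 2)) (KRing.var k 0 - KRing.var k 1) * ratioFunction g := by
  rw [ratioFunction_mul (hasPolyCoeff_of_const natDegree_one_sub_X_le coeff_one_sub_X)
      (hasPolyCoeff_of_mem hg) (hasPolyCoeff_one_sub_X_mul hg), ratioFunction_one_sub_X,
    ← mul_assoc,
    tC_mul_tC, mul_sub, mul_one, KRing.var_mul_ratio]

omit [CharZero k] in
theorem tC_mul_ratioFunction_mul {x y : KRing k (Fin 2)} {g g' : PowerSeries (MvPowerSeries τ k)}
    (hg : g ∈ orderFiltered k τ) (hg' : g' ∈ orderFiltered k τ) (hxy : x * y = 1)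
    (hgg' : g' * g = 1) :
    (tC k τ (KRing k (Fin 2)) x * ratioFunction g') *
      (tC k τ (KRing k (Fin 2)) y * ratioFunction g) = 1 := by
  have h : ratioFunction g' * ratioFunction g = tC k τ (KRing k (Fin 2)) 1 := by
    rw [← ratioFunction_mul (hasPolyCoeff_of_mem hg') (hasPolyCoeff_of_mem hg)
      (hasPolyCoeff_of_mem (mul_mem hg' hg)), hgg', ratioFunction_one]
  rw [mul_mul_mul_comm, h, tC_mul_tC, tC_mul_tC, hxy, one_mul]
  exact map_one (tCAlg k τ (KRing k (Fin 2)))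

omit [CharZero k] in
theorem coeff_expand_var_zero_mul_ratioFunction {f : PowerSeries (MvPowerSeries τ k)}
    (hf : HasPolyCoeff f) (d : τ →₀ ℕ) (m n : ℤ) :
    ((expand k ((tC k τ (KRing k (Fin 2)) (KRing.var k 0) * ratioFunction f :
      MvPowerSeries τ (KRing k (Fin 2))) d)).coeff n).coeff m =
      if 0 ≤ n ∧ m = 1 - n then MvPowerSeries.coeff d (PowerSeries.coeff n.toNat f) else 0 := by
  have h : m = (m - 1) + 1 := by ring
  rw [C_mul_apply, map_mul, expand_var_zero, HahnSeries.coeff_single_zero_mul, h,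
    HahnSeries.coeff_single_mul_add, one_mul, ratioFunction, coeff_expand_aeval_ratio,
    hf.coeff_polyCoeff]
  refine if_congr ?_ rfl rfl
  omega

/-- A family `(v_n)` for which `v_n⁻¹ - 1` has order at least `n` in `t` defines an invertible
`σ`, and the orders of the poles of `σ` and `σ⁻¹` at `z = w` are bounded. -/
theorem exists_isSigma {F : Type*} [Field F] [Algebra (MvPowerSeries τ k) F] {v : ℕ+ → F}
    {c : ℕ+ → MvPowerSeries τ k} (hv : ∀ n, v n ≠ 0)
    (hvc : ∀ n, (v n)⁻¹ = algebraMap (MvPowerSeries τ k) F (c n))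
    (hc : ∀ (n : ℕ+) (d : τ →₀ ℕ), d.degree < n → MvPowerSeries.coeff d (c n - 1) = 0) :
    ∃ σ ∈ boundedDiagonalPoles k τ, ∃ s ∈ boundedDiagonalPoles k τ, s * σ = 1 ∧ IsSigma v c σ := by
  obtain ⟨g, hg, g', hg', hgg', hf⟩ := exists_fSeries_eq hc
  have hne : (0 : Fin 2) ≠ 1 := by decide
  obtain ⟨u, hu⟩ := (KRing.isUnit_var_sub (k := k) hne).exists_left_inv
  have hσ := tC_var_zero_mul_ratioFunction hg
  rw [← hf] at hσ
  have hs : (tC k τ (KRing k (Fin 2)) u * ratioFunction g') *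
      (tC k τ (KRing k (Fin 2)) (KRing.var k 0) * ratioFunction (fSeries c)) = 1 :=
    (congrArg _ hσ).trans (tC_mul_ratioFunction_mul hg hg' hu hgg')
  have hu' : tC k τ (KRing k (Fin 2)) u ∈ boundedDiagonalPoles k τ :=
    tC_mem_boundedDiagonalPoles (N := 1) (by rw [pow_one, mul_comm, hu]; exact one_mem _)
  have hz : tC k τ (KRing k (Fin 2)) (KRing.var k 0) ∈ boundedDiagonalPoles k τ :=
    tC_mem_boundedDiagonalPoles (N := 0) (by
      rw [pow_zero, one_mul]; exact var_zero_mem_noDiagonalPole)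
  refine ⟨tC k τ (KRing k (Fin 2)) (KRing.var k 0) * ratioFunction (fSeries c),
    mul_mem hz (ratioFunction_mem_boundedDiagonalPoles _),
    tC k τ (KRing k (Fin 2)) u * ratioFunction g',
    mul_mem hu' (ratioFunction_mem_boundedDiagonalPoles _), hs, hv, hvc, fun d m n => ?_,
    IsUnit.of_mul_eq_one_right _ hs⟩
  exact coeff_expand_var_zero_mul_ratioFunction (hf ▸ hasPolyCoeff_one_sub_X_mul hg) d m n

end Sigma

/-! ### The Hall-Littlewood and Macdonald families -/

section Families

variable {k : Type*} [Field k] {τ : Type*}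

theorem coeff_X_pow_mul_eq_zero (i : τ) (y : MvPowerSeries τ k) {n : ℕ} {d : τ →₀ ℕ}
    (hd : d.degree < n) : MvPowerSeries.coeff d (MvPowerSeries.X i ^ n * y) = 0 := by
  classical
  rw [MvPowerSeries.X_pow_eq, MvPowerSeries.coeff_monomial_mul, if_neg]
  intro h
  have h1 := Finsupp.single_le_iff.mp h
  have h2 := Finsupp.le_degree i d
  omega

theorem constantCoeff_one_sub_X_pow (i : τ) (n : ℕ+) :
    MvPowerSeries.constantCoeff (1 - MvPowerSeries.X i ^ (n : ℕ) : MvPowerSeries τ k) = 1 := by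
  rw [map_sub, map_one, map_pow, MvPowerSeries.constantCoeff_X, zero_pow n.ne_zero, sub_zero]

variable {F : Type*} [Field F] [Algebra (MvPowerSeries τ k) F] [FaithfulSMul (MvPowerSeries τ k) F]

theorem one_sub_pow_ne_zero {t : F} {i : τ}
    (ht : t = algebraMap (MvPowerSeries τ k) F (MvPowerSeries.X i)) (n : ℕ+) :
    1 - t ^ (n : ℕ) ≠ 0 := by
  intro h
  rw [ht, ← map_pow, ← map_one (algebraMap (MvPowerSeries τ k) F), ← map_sub] at h
  have h1 := FaithfulSMul.algebraMap_injective (MvPowerSeries τ k) F (h.trans (map_zero _).symm)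
  have h2 := constantCoeff_one_sub_X_pow (k := k) i n
  rw [h1, map_zero] at h2
  exact zero_ne_one h2

/-- Here `v_n⁻¹ = 1 - t^n`. -/
theorem exists_isSigma_hallLittlewood [CharZero k] {t : F} {i : τ}
    (ht : t = algebraMap (MvPowerSeries τ k) F (MvPowerSeries.X i)) :
    ∃ c, ∃ σ ∈ boundedDiagonalPoles k τ, ∃ s ∈ boundedDiagonalPoles k τ,
      s * σ = 1 ∧ IsSigma (fun n : ℕ+ => 1 / (1 - t ^ (n : ℕ))) c σ := by
  refine ⟨fun n => 1 - MvPowerSeries.X i ^ (n : ℕ), exists_isSigma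
    (fun n => div_ne_zero one_ne_zero (one_sub_pow_ne_zero ht n)) (fun n => ?_) fun n d hd => ?_⟩
  · rw [one_div, inv_inv, map_sub, map_one, map_pow, ht]
  · have h : (1 - MvPowerSeries.X i ^ (n : ℕ) - 1 : MvPowerSeries τ k) =
        MvPowerSeries.X i ^ (n : ℕ) * (-1) := by ring
    rw [h, coeff_X_pow_mul_eq_zero i _ hd]

/-- Here `v_n⁻¹ = (1 - t^n) (1 - q^n)⁻¹`, where the inverse is taken in the ring of power series. -/
theorem exists_isSigma_macdonald [CharZero k] {t q : F} {i j : τ}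
    (ht : t = algebraMap (MvPowerSeries τ k) F (MvPowerSeries.X i))
    (hq : q = algebraMap (MvPowerSeries τ k) F (MvPowerSeries.X j)) :
    ∃ c, ∃ σ ∈ boundedDiagonalPoles k τ, ∃ s ∈ boundedDiagonalPoles k τ,
      s * σ = 1 ∧ IsSigma (fun n : ℕ+ => (1 - q ^ (n : ℕ)) / (1 - t ^ (n : ℕ))) c σ := by
  have hinv : ∀ n : ℕ+, (1 - MvPowerSeries.X j ^ (n : ℕ) : MvPowerSeries τ k) *
      (1 - MvPowerSeries.X j ^ (n : ℕ))⁻¹ = 1 := fun n =>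
    MvPowerSeries.mul_inv_cancel _ (by rw [constantCoeff_one_sub_X_pow]; exact one_ne_zero)
  refine ⟨fun n => (1 - MvPowerSeries.X i ^ (n : ℕ)) * (1 - MvPowerSeries.X j ^ (n : ℕ))⁻¹,
    exists_isSigma
      (fun n => div_ne_zero (one_sub_pow_ne_zero hq n) (one_sub_pow_ne_zero ht n))
      (fun n => ?_) fun n d hd => ?_⟩
  · have h := congrArg (algebraMap (MvPowerSeries τ k) F) (hinv n)
    rw [map_mul, map_one, map_sub, map_one, map_pow, ← hq] at h
    rw [inv_div, map_mul, map_sub, map_one, map_pow, ← ht, div_eq_mul_inv,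
      eq_inv_of_mul_eq_one_right h]
  · have h : (1 - MvPowerSeries.X i ^ (n : ℕ) : MvPowerSeries τ k) *
          (1 - MvPowerSeries.X j ^ (n : ℕ))⁻¹ - 1 =
        MvPowerSeries.X j ^ (n : ℕ) * (1 - MvPowerSeries.X j ^ (n : ℕ))⁻¹ +
        MvPowerSeries.X i ^ (n : ℕ) * -(1 - MvPowerSeries.X j ^ (n : ℕ))⁻¹ := by
      linear_combination hinv n
    rw [h, map_add, coeff_X_pow_mul_eq_zero j _ hd, coeff_X_pow_mul_eq_zero i _ hd, add_zero]

end Families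

end HDQVA
end

theorem mainTheorem1 (k : Type*) [Field k] [CharZero k] :
    -- the general family `(v_n)`
    (∀ (τ : Type*) [Finite τ] (F : Type*) [Field F] [Algebra k F]
      [Algebra (MvPowerSeries τ k) F] [IsScalarTower k (MvPowerSeries τ k) F]
      [FaithfulSMul (MvPowerSeries τ k) F]
      (v : ℕ+ → F) (c : ℕ+ → MvPowerSeries τ k) (σ : MvPowerSeries τ (KRing k (Fin 2))),
      IsSigma v c σ →
        -- the adjoint operators `p_n^⊥` and the bicharacter exist and are unique
        (∃! pPerp : ℕ+ → Module.End F (SymFun F), ∀ n, IsPerp v n (pPerp n)) ∧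
        (∃! r : LatticeV k ⊗[k] LatticeV k →ₗ[k] MvPowerSeries τ (KRing k (Fin 2)),
          IsBicharacter σ r) ∧
        -- `k[[t]] ⊗ V` is contained in `V[[t]]` and in `Λ_F ⊗ F[ℤα]`
        Function.Injective (integralToCompletion k τ) ∧
        Function.Injective (integralToSymFun k τ v) ∧
        ∀ (pPerp : ℕ+ → Module.End F (SymFun F))
          (r : LatticeV k ⊗[k] LatticeV k →ₗ[k] MvPowerSeries τ (KRing k (Fin 2))),
          (∀ n, IsPerp v n (pPerp n)) → IsBicharacter σ r →
            -- the values of `r` have no pole at `w = 0`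
            (∀ (a b : LatticeV k) (d : τ →₀ ℕ) (n : ℤ), n < 0 →
              (expand k (tCoeff k d (r (a ⊗ₜ b)))).coeff n = 0) ∧
            -- `Y(a, z) b` has a pole of finite order at `z = 0`
            (∀ a b : LatticeV k, ∃ N : ℤ, ∀ n : ℤ, n < N →
              zCoeff n (bicharY r a b) = 0) ∧
            -- the `h_n` form a deformed Heisenberg algebra and are the modes of `Y(Dα, z)`
            (∀ m n : ℤ, heis v pPerp m * heis v pPerp n - heis v pPerp n * heis v pPerp m =
              if m + n = 0 then ((m : F) * (v m.natAbs.toPNat')⁻¹) • 1 else 0) ∧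
            (∀ (n : ℤ) (b : LatticeV k),
              Corresponds v (zCoeff (-n - 1) (bicharY r (hGen k 0) b))
                (heis v pPerp n (toSymFun k v b))) ∧
            -- `Y(e^α, z) = Ψ(z)`
            (∀ (m : ℤ) (x : SymFunLattice F),
              {q : ℕ × ℕ × ℤ | (q.1 : ℤ) - (q.2.1 : ℤ) + q.2.2 = m ∧
                psiTerm v pPerp x q ≠ 0}.Finite) ∧
            (∀ (m : ℤ) (b : LatticeV k),
              Corresponds v (zCoeff m (bicharY r (eGen k 1) b))
                (psiCoeff v pPerp m (toSymFun k v b))) ∧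
            -- the `H_D`-quantum vertex algebra
            IsHDQuantumVertexAlgebra (tC k τ (LatticeV k) 1)
              (tC k τ (LatticeV k) ∘ₗ latticeD k) (bicharY r) (bicharR r)) ∧
    -- the Hall-Littlewood case `v_n = 1 / (1 - t^n)`
    (∀ (F : Type*) [Field F] [Algebra k F]
      [Algebra (MvPowerSeries Unit k) F] [IsScalarTower k (MvPowerSeries Unit k) F]
      [FaithfulSMul (MvPowerSeries Unit k) F] (t : F),
      t = algebraMap (MvPowerSeries Unit k) F (MvPowerSeries.X ()) →
      ∃ (c : ℕ+ → MvPowerSeries Unit k) (σ : MvPowerSeries Unit (KRing k (Fin 2))),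
        IsSigma (fun n : ℕ+ => 1 / (1 - t ^ (n : ℕ))) c σ ∧
        ∀ r, IsBicharacter σ r → StronglyLocal (bicharY r) (bicharR r)) ∧
    -- the Macdonald case `v_n = (1 - q^n) / (1 - t^n)`
    (∀ (F : Type*) [Field F] [Algebra k F]
      [Algebra (MvPowerSeries (Fin 2) k) F] [IsScalarTower k (MvPowerSeries (Fin 2) k) F]
      [FaithfulSMul (MvPowerSeries (Fin 2) k) F] (t q : F),
      t = algebraMap (MvPowerSeries (Fin 2) k) F (MvPowerSeries.X 0) →
      q = algebraMap (MvPowerSeries (Fin 2) k) F (MvPowerSeries.X 1) →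
      ∃ (c : ℕ+ → MvPowerSeries (Fin 2) k) (σ : MvPowerSeries (Fin 2) (KRing k (Fin 2))),
        IsSigma (fun n : ℕ+ => (1 - q ^ (n : ℕ)) / (1 - t ^ (n : ℕ))) c σ ∧
        ∀ r, IsBicharacter σ r → StronglyLocal (bicharY r) (bicharR r)) := by
  refine ⟨?_, ?_, ?_⟩
  · intro τ _ F _ _ _ _ _ v c σ hσ
    -- `F` contains `k`
    have : CharZero F := charZero_of_injective_algebraMap (algebraMap k F).injective
    refine ⟨existsUnique_isPerp v hσ.v_ne_zero, ?_, integralToCompletion_injective,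
      integralToSymFun_injective hσ.v_ne_zero, ?_⟩
    · obtain ⟨r, hr⟩ := exists_isBicharacter hσ.isUnit
      exact ⟨r, hr, fun r' hr' => hr'.unique hr⟩
    · intro pPerp r hp hr
      -- by uniqueness the adjoint operators are `n v_n ∂/∂p_n`
      obtain rfl : pPerp = perpOp v :=
        funext fun n => IsPerp.unique v hσ.v_ne_zero (hp n) (isPerp_perpOp v n)
      have hreg := hσ.regularAtZero hr
      exact ⟨hreg, hσ.exists_zCoeff_eq_zero hr, heis_commutator v hσ.v_ne_zero,
        hσ.corresponds_heis hr hreg, finite_psiTerm v hσ.v_ne_zero,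
        hσ.corresponds_psiCoeff hr hreg, hσ.isHDQuantumVertexAlgebra hr⟩
  · intro F _ _ _ _ _ t ht
    obtain ⟨c, σ, hσ, s, hs, hsσ, h⟩ := exists_isSigma_hallLittlewood ht
    exact ⟨c, σ, h, fun r hr => hr.stronglyLocal (h.regularAtZero hr) hσ hs hsσ⟩
  · intro F _ _ _ _ _ t q ht hq
    obtain ⟨c, σ, hσ, s, hs, hsσ, h⟩ := exists_isSigma_macdonald ht hq
    exact ⟨c, σ, h, fun r hr => hr.stronglyLocal (h.regularAtZero hr) hσ hs hsσ⟩
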